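/- Let $\Sigma$ be a compact connected Riemann surface with canonical bundle $\mathcal K$, let $A_1,\dots,A_s\in\Sigma$ be distinct points, and let $r\ge 1$ and $q_1,\dots,q_s$ be positive integers with $\gcd(q_j,r)=1$. Let $p_j$ be integers with $0<p_j<q_j$ and $p_j\equiv -r \pmod{q_j}$ (so $q_j\ge 2$), and put $n_j=\frac{p_j+r}{q_j}\in\mathbb Z$. Let $\overline\Sigma$ be the orbifold Riemann surface with underlying surface $\Sigma$ in which $A_j$ is an orbifold point of order $q_j$. Let $\mathcal K_{orb}$ be its orbifold canonical line bundle (the canonical bundle of each orbifold chart), and let $\overline M=\mathbb P(\mathcal O\oplus\mathcal K_{orb}^r)$ be the corresponding orbifold ruled surface over $\overline\Sigma$. Its singular points are cyclic quotient singularities of type $A_{p,q}$, that is, $\mathbb C^2/\Gamma_{p,q}$, where $0<p<q$ are coprime and $\Gamma_{p,q}$ is generated by $(z,w)\mapsto(e^{2\pi i/q}z,e^{2\pi i p/q}w)$. The minimal (Hirzebruch–Jung) resolution $\widetilde M\to\overline M$ is the map from a smooth complex surface which is biholomorphic over the complement of the singular points and which, near each singular point, in the linear orbifold coordinates given by an orbifold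 chart of $\overline\Sigma$ and the fibre coordinate, is the Hirzebruch–Jung resolution of $\mathbb C^2/\Gamma_{p,q}$. The exceptional curves of the latter form a chain of projective lines with self-intersections $-e_1,\dots,-e_k$, where $$\frac pq=\cfrac{1}{e_1-\cfrac{1}{e_2-\cdots-\cfrac1{e_k}}},\qquad e_i\ge 2 .$$ Let $\check M=\mathbb P\big(\mathcal O\oplus(\mathcal K^r\otimes\bigotimes_j[A_j]^{r-n_j})\big)\to\Sigma$, where $[A_j]$ is the line bundle of the divisor $A_j$. Let $\mathcal P$ be the parabolic structure on $\check M$ which consists of the points $A_j$, the points $B_j$ over $A_j$ on the infinity section (the section where the $\mathcal O$-component vanishes), and the weights $p_j/q_j$. Let $Bl(\check M,\mathcal P)\to\check M$ be the associated iterated blow-up. It is obtained by performing the following process for each $j$. Blow up $B_j$; then repeatedly blow up one of the points in which the last exceptional divisor meets the neighbouring curves of the total transform of the fibre $F_j$ over $A_j$; stop when this total transform is a chain of rational curves with self-intersections $$-e_1,\dots,-e_k,-1,-e'_l,\dots,-e'_1 ,$$ in which the first curve is the proper transform of $F_j$, and $(e_i)$ and $(e'_i)$, with all $e_i,e'_i\ge2$,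 are the expansions as above of $\frac{p_j}{q_j}$ and $\frac{q_j-p_j}{q_j}$. Then the minimal (Hirzebruch–Jung) resolution $\widetilde M$ of $\overline M$ and the iterated blow-up $Bl(\check M,\mathcal P)$ both exist, and every such $\widetilde M$ is biholomorphic to every such $Bl(\check M,\mathcal P)$. -/

import Mathlib

open scoped Manifold ContDiff Topology

universe u

noncomputable section

namespace OrbiRuled

/-! ## Spaces with holomorphic functions -/

/-- A (reduced) complex space, given by its sheaf of holomorphic functions: `HolAt f x` says that
the function `f` is holomorphic near the point `x`. It only depends on the germ of `f` at `x`. -/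
class HolSpace (X : Type u) [TopologicalSpace X] where
  HolAt : (X → ℂ) → X → Prop
  congr : ∀ {f g : X → ℂ} {x : X}, f =ᶠ[𝓝 x] g → HolAt f x → HolAt g x

/-- A complex manifold of dimension two, with its holomorphic functions. -/
instance instHolSpaceManifold (X : Type u) [TopologicalSpace X] [ChartedSpace (ℂ × ℂ) X] :
    HolSpace X where
  HolAt f x := ContMDiffAt 𝓘(ℂ, ℂ × ℂ) 𝓘(ℂ) ω f x
  congr h hf := hf.congr_of_eventuallyEq h.symm

section HolSpace

variable {X Y : Type u} [TopologicalSpace X] [HolSpace X] [TopologicalSpace Y] [HolSpace Y]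

/-- `f` restricts to a biholomorphism from `f ⁻¹' V` onto the open set `V`. -/
def IsBiholOver (f : X → Y) (V : Set Y) : Prop :=
  ∃ e : OpenPartialHomeomorph X Y, e.source = f ⁻¹' V ∧ e.target = V ∧
    Set.EqOn f e e.source ∧
    ∀ x ∈ e.source, ∀ g : Y → ℂ, HolSpace.HolAt g (e x) ↔ HolSpace.HolAt (g ∘ e) x

/-- `e` is a holomorphic coordinate chart with values in `ℂ²`. -/
def IsHolChart (e : OpenPartialHomeomorph X (ℂ × ℂ)) : Prop :=
  ∀ x ∈ e.source, ∀ f : X → ℂ, HolSpace.HolAt f x ↔ AnalyticAt ℂ (f ∘ e.symm) (e x)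

/-- `b : X → Y` is the blow-up of the surface `Y` at the point `c`: it is biholomorphic over the
complement of `c`, and in suitable coordinates of `Y` centred at `c` it is the map
`{(v, l) | v ∈ l ∈ ℙ¹} → ℂ²`. The two affine charts of the latter are `(s, t) ↦ (s, s t)`
(on the line `l = [1 : t]`) and `(s, t) ↦ (s t, t)` (on the line `l = [s : 1]`). -/
def IsPointBlowup (b : X → Y) (c : Y) : Prop :=
  Continuous b ∧ IsBiholOver b {c}ᶜ ∧
  ∃ (e : OpenPartialHomeomorph Y (ℂ × ℂ)) (c₁ c₂ : OpenPartialHomeomorph X (ℂ × ℂ)),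
    IsHolChart e ∧ IsHolChart c₁ ∧ IsHolChart c₂ ∧ c ∈ e.source ∧ e c = 0 ∧
    b ⁻¹' e.source = c₁.source ∪ c₂.source ∧
    c₁.target = {y | (y.1, y.1 * y.2) ∈ e.target} ∧
    c₂.target = {y | (y.1 * y.2, y.2) ∈ e.target} ∧
    (∀ y ∈ c₁.target, b (c₁.symm y) = e.symm (y.1, y.1 * y.2)) ∧
    (∀ y ∈ c₂.target, b (c₂.symm y) = e.symm (y.1 * y.2, y.2)) ∧
    (∀ y ∈ c₁.target, ∀ y' ∈ c₂.target,
      c₁.symm y = c₂.symm y' ↔ y.2 ≠ 0 ∧ y' = (y.2⁻¹, y.1 * y.2))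

/-- The proper transform of a curve `C` under the blow-up `b` of the point `c`. -/
def properTransform (b : X → Y) (c : Y) (C : Set Y) : Set X :=
  closure (b ⁻¹' (C \ {c}))

end HolSpace

/-! ## Hirzebruch-Jung continued fractions -/

/-- `hjFrac [e₁, …, e_k] = 1 / (e₁ - 1 / (e₂ - … - 1 / e_k))`. -/
def hjFrac : List ℤ → ℚ
  | [] => 0
  | e :: l => 1 / ((e : ℚ) - hjFrac l)

/-- `e = [e₁, …, e_k]` is the Hirzebruch-Jung expansion of `α`, with all `e_i ≥ 2`. -/
def IsHJExpansion (e : List ℤ) (α : ℚ) : Prop :=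
  (∀ x ∈ e, 2 ≤ x) ∧ hjFrac e = α

/-- The sequence with `x_0 = a`, `x_1 = b` and `x_{i+1} = e_i x_i - x_{i-1}`. -/
def hjSeq (e : List ℤ) (a b : ℤ) : ℕ → ℤ
  | 0 => a
  | 1 => b
  | i + 2 => e.getD i 0 * hjSeq e a b (i + 1) - hjSeq e a b i

/-! ## The iterated blow-up of a parabolic ruled surface -/

/-- A parabolic structure on a ruled surface `pr : M → S`: distinct marked points of `S`, a point
in the fibre over each of them, and rational weights in `(0, 1)`. -/
structure ParabolicStructure {M S : Type u} (pr : M → S) (s : ℕ) where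
  /-- the marked points of the base -/
  A : Fin s → S
  A_injective : Function.Injective A
  /-- the marked points in the fibres -/
  B : Fin s → M
  pr_B : ∀ j, pr (B j) = A j
  /-- the weights -/
  weight : Fin s → ℚ
  weight_pos : ∀ j, 0 < weight j
  weight_lt_one : ∀ j, weight j < 1

/-- `ChainBlowup F B Z Φ l E r`: the surface `Z` with `Φ : Z → M` is obtained from `M` by blowing
up the point `B` of the fibre `F` and then, repeatedly, one of the two points in which the
last exceptional divisor meets the neighbouring curves of the chain `Φ ⁻¹' F`.
`E` is the last exceptional divisor (of self-intersection `-1`). The lists `l` and `r` hold the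
curves of the chain `Φ ⁻¹' F` on the two sides of `E`, in each list starting with
the neighbour of `E`, each curve with its self-intersection number; the last curve of
`l` is the proper transform of `F`. The fibre `F` has self-intersection `0`, an exceptional divisor
has self-intersection `-1`, and the proper transform of a smooth curve under the blow-up of one
of its points has self-intersection one less than the curve. -/
inductive ChainBlowup {M : Type u} [TopologicalSpace M] [HolSpace M] (F : Set M) (B : M) :
    (Z : Type u) → [TopologicalSpace Z] → [HolSpace Z] → (Z → M) →
      List (Set Z × ℤ) → Set Z → List (Set Z × ℤ) → Prop
  | first (Z : Type u) [TopologicalSpace Z] [HolSpace Z] (b : Z → M) :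
      IsPointBlowup b B →
      ChainBlowup F B Z b [(properTransform b B F, -1)] (b ⁻¹' {B}) []
  | left (Z Z' : Type u) [TopologicalSpace Z] [HolSpace Z] [TopologicalSpace Z'] [HolSpace Z']
      (Φ : Z → M) (C : Set Z) (n : ℤ) (l : List (Set Z × ℤ)) (E : Set Z) (r : List (Set Z × ℤ))
      (c : Z) (b : Z' → Z) :
      ChainBlowup F B Z Φ ((C, n) :: l) E r → C ∩ E = {c} → IsPointBlowup b c →
      ChainBlowup F B Z' (Φ ∘ b)
        ((properTransform b c C, n - 1) :: l.map (fun D => (properTransform b c D.1, D.2)))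
        (b ⁻¹' {c})
        ((properTransform b c E, -2) :: r.map (fun D => (properTransform b c D.1, D.2)))
  | right (Z Z' : Type u) [TopologicalSpace Z] [HolSpace Z] [TopologicalSpace Z'] [HolSpace Z']
      (Φ : Z → M) (C : Set Z) (n : ℤ) (l : List (Set Z × ℤ)) (E : Set Z) (r : List (Set Z × ℤ))
      (c : Z) (b : Z' → Z) :
      ChainBlowup F B Z Φ l E ((C, n) :: r) → C ∩ E = {c} → IsPointBlowup b c →
      ChainBlowup F B Z' (Φ ∘ b)
        ((properTransform b c E, -2) :: l.map (fun D => (properTransform b c D.1, D.2)))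
        (b ⁻¹' {c})
        ((properTransform b c C, n - 1) :: r.map (fun D => (properTransform b c D.1, D.2)))

/-- `Φ : Z → M` is the iterated blow-up determined by the point `B` of the fibre `F` and
the weight `α`: the preimage of `F` is the chain of curves with self-intersection numbers
`-e₁, …, -e_k, -1, -e'_l, …, -e'₁`, which starts with the proper transform of `F`; here
`e` and `e'` are the Hirzebruch-Jung expansions of `α` and `1 - α`. -/
def IsWeightedBlowupAt {M Z : Type u} [TopologicalSpace M] [HolSpace M] [TopologicalSpace Z]
    [HolSpace Z] (F : Set M) (B : M) (α : ℚ) (Φ : Z → M) : Prop :=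
  ∃ (e e' : List ℤ) (l r : List (Set Z × ℤ)) (E : Set Z),
    IsHJExpansion e α ∧ IsHJExpansion e' (1 - α) ∧ ChainBlowup F B Z Φ l E r ∧
    l.map Prod.snd = (e.map (fun x => -x)).reverse ∧
    r.map Prod.snd = (e'.map (fun x => -x)).reverse

/-- The iterated blow-up for a list of fibres `F`, points `B ∈ F` and weights `α`, one
fibre after the other. -/
inductive IsIteratedBlowup {M : Type u} [TopologicalSpace M] [HolSpace M] :
    List (Set M × M × ℚ) → (Y : Type u) → [TopologicalSpace Y] → [HolSpace Y] → (Y → M) → Prop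
  | nil (Y : Type u) [TopologicalSpace Y] [HolSpace Y] (Φ : Y → M) :
      IsBiholOver Φ Set.univ → IsIteratedBlowup [] Y Φ
  | cons (Z Y : Type u) [TopologicalSpace Z] [HolSpace Z] [TopologicalSpace Y] [HolSpace Y]
      (F : Set M) (B : M) (α : ℚ) (L : List (Set M × M × ℚ)) (Φ : Z → M) (B' : Z) (b : Y → Z) :
      IsIteratedBlowup L Z Φ → Φ B' = B → IsWeightedBlowupAt (Φ ⁻¹' F) B' α b →
      IsIteratedBlowup ((F, B, α) :: L) Y (Φ ∘ b)

/-- `β : Y → M` is the iterated blow-up `Bl(M, P)` of the ruled surface `pr : M → S` with the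
parabolic structure `P`. -/
def IsParabolicBlowup {M S Y : Type u} [TopologicalSpace M] [HolSpace M] [TopologicalSpace Y]
    [HolSpace Y] {pr : M → S} {s : ℕ} (P : ParabolicStructure pr s) (β : Y → M) : Prop :=
  IsIteratedBlowup (List.ofFn fun j => (pr ⁻¹' {P.A j}, P.B j, P.weight j)) Y β

/-! ## Ruled surfaces over orbifold Riemann surfaces -/

section Ruled

variable (S : Type u) [TopologicalSpace S] [ChartedSpace ℂ S]

/-- Let `S` be a Riemann surface, `m x` the order of the orbifold point `x` (`1` at a regular
point), and `d` a divisor. An orbifold chart is a holomorphic map `φ` from a disc to `S` which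
identifies an open subset of `S` with the quotient of the disc by the rotations of order `m (φ 0)`.
Only the centre of the disc may be an orbifold point or a point of the divisor. -/
structure OrbChart (m : S → ℕ) (d : S → ℤ) where
  toFun : ℂ → S
  radius : ℝ
  radius_pos : 0 < radius
  holo : ContMDiffOn 𝓘(ℂ) 𝓘(ℂ) ω toFun (Metric.ball 0 radius)
  fibres : ∀ z ∈ Metric.ball (0 : ℂ) radius, ∀ w ∈ Metric.ball (0 : ℂ) radius,
    toFun z = toFun w ↔ z ^ m (toFun 0) = w ^ m (toFun 0)
  regular : ∀ z ∈ Metric.ball (0 : ℂ) radius, z ≠ 0 → m (toFun z) = 1 ∧ d (toFun z) = 0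

variable {S} {m : S → ℕ} {d : S → ℤ}

/-- The germ of `h` at `z` is a change of orbifold charts from `φ` to `φ'`, and `a` is the value
at `z` of the transition function of the line bundle `K_orb^r ⊗ [d]`. In the chart `φ`, with
coordinate `z`, this bundle has the frame `(dz)^r ⊗ z ^ (-d (φ 0))`, and for `z' = h z` the new
frame is `a` times the old one: `a = (dz' / dz)^r * (z ^ d (φ 0) / z' ^ d (φ' 0))`,
where `g` denotes the second factor. -/
def IsTransition (r : ℕ) (φ φ' : OrbChart S m d) (z : ℂ) (h : ℂ → ℂ) (a : ℂ) : Prop :=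
  AnalyticAt ℂ h z ∧ deriv h z ≠ 0 ∧ h z ∈ Metric.ball (0 : ℂ) φ'.radius ∧
  (∀ᶠ w in 𝓝 z, φ'.toFun (h w) = φ.toFun w) ∧
  ∃ g : ℂ → ℂ, AnalyticAt ℂ g z ∧
    (∀ᶠ w in 𝓝[≠] z, g w * h w ^ d (φ'.toFun 0) = w ^ d (φ.toFun 0)) ∧
    a = deriv h z ^ r * g z

/-- Homogeneous coordinates: an orbifold chart `φ`, a point `z` of its disc, and `(u, v) ≠ 0`. -/
abbrev Rep (m : S → ℕ) (d : S → ℤ) : Type u :=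
  Σ φ : OrbChart S m d, {y : ℂ × ℂ × ℂ // y.1 ∈ Metric.ball (0 : ℂ) φ.radius ∧ y.2 ≠ 0}

/-- Two homogeneous coordinates represent the same point of `ℙ(O ⊕ K_orb^r ⊗ [d])`: a change of
orbifold charts takes the line spanned by `u + v (dz)^r z^(-d)` to that spanned by
`u' + v' (dz')^r z'^(-d')`. -/
def Rel (r : ℕ) (x x' : Rep m d) : Prop :=
  ∃ (h : ℂ → ℂ) (a lam : ℂ), IsTransition r x.1 x'.1 x.2.1.1 h a ∧ x'.2.1.1 = h x.2.1.1 ∧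
    lam ≠ 0 ∧ x'.2.1.2.1 = lam * x.2.1.2.1 ∧ a * x'.2.1.2.2 = lam * x.2.1.2.2

/-- The ruled surface `ℙ(O ⊕ K_orb^r ⊗ [d])` over the orbifold Riemann surface `(S, m)`. For
`m = 1` this is the ruled surface `ℙ(O ⊕ K^r ⊗ [d])` over `S`; for `d = 0` it is `ℙ(O ⊕ K_orb^r)`
(more precisely, the complex space underlying this orbifold). -/
def RuledSurface (m : S → ℕ) (d : S → ℤ) (r : ℕ) : Type u := Quot (Rel (m := m) (d := d) r)

instance (r : ℕ) : TopologicalSpace (RuledSurface m d r) :=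
  inferInstanceAs (TopologicalSpace (Quot (Rel (m := m) (d := d) r)))

namespace RuledSurface

/-- The point with the homogeneous coordinates `x`. -/
def mk (r : ℕ) (x : Rep m d) : RuledSurface m d r := Quot.mk _ x

/-- The point with homogeneous coordinates `[u : v]` over the point `z` of the chart `φ` (and a
meaningless value if `z` is outside the disc or `u = v = 0`). -/
def pt (r : ℕ) (φ : OrbChart S m d) (z u v : ℂ) : RuledSurface m d r :=
  open Classical in
  if h : z ∈ Metric.ball (0 : ℂ) φ.radius ∧ (u, v) ≠ (0 : ℂ × ℂ) then
    mk r ⟨φ, ⟨(z, u, v), h⟩⟩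
  else
    mk r ⟨φ, ⟨(0, 1, 0), Metric.mem_ball_self φ.radius_pos, by simp⟩⟩

lemma pt_eq (r : ℕ) (φ : OrbChart S m d) {z u v : ℂ}
    (h : z ∈ Metric.ball (0 : ℂ) φ.radius ∧ (u, v) ≠ (0 : ℂ × ℂ)) :
    pt r φ z u v = mk r ⟨φ, ⟨(z, u, v), h⟩⟩ :=
  dif_pos h

lemma continuousAt_pt (r : ℕ) (φ : OrbChart S m d) {z u v : ℂ}
    (hz : z ∈ Metric.ball (0 : ℂ) φ.radius) (huv : (u, v) ≠ (0 : ℂ × ℂ)) :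
    ContinuousAt (fun y : ℂ × ℂ × ℂ => pt r φ y.1 y.2.1 y.2.2) (z, u, v) := by
  let V : Set (ℂ × ℂ × ℂ) := {y | y.1 ∈ Metric.ball (0 : ℂ) φ.radius ∧ y.2 ≠ 0}
  have hV : IsOpen V :=
    (Metric.isOpen_ball.preimage continuous_fst).inter
      (isOpen_compl_singleton.preimage continuous_snd)
  have hc : Continuous (fun y : V => mk (m := m) (d := d) r ⟨φ, y⟩) :=
    continuous_quot_mk.comp continuous_sigmaMk
  have hc' : ContinuousOn (fun y : ℂ × ℂ × ℂ => pt r φ y.1 y.2.1 y.2.2) V := by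
    rw [continuousOn_iff_continuous_domRestrict]
    exact hc.congr fun y => (pt_eq r φ y.2).symm
  exact hc'.continuousAt (hV.mem_nhds ⟨hz, huv⟩)

/-- A function on `ℙ(O ⊕ K_orb^r ⊗ [d])` is holomorphic if it is holomorphic in the orbifold
charts and the homogeneous coordinates. -/
instance (r : ℕ) : HolSpace (RuledSurface m d r) where
  HolAt f x := ∀ (φ : OrbChart S m d) (z u v : ℂ), z ∈ Metric.ball (0 : ℂ) φ.radius →
    (u, v) ≠ (0 : ℂ × ℂ) → pt r φ z u v = x →
    AnalyticAt ℂ (fun y : ℂ × ℂ × ℂ => f (pt r φ y.1 y.2.1 y.2.2)) (z, u, v)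
  congr := by
    rintro f g x hfg hf φ z u v hz huv rfl
    exact (hf φ z u v hz huv rfl).congr ((continuousAt_pt r φ hz huv).eventually hfg)

/-- The ruling `ℙ(O ⊕ K_orb^r ⊗ [d]) → S`. -/
def proj (r : ℕ) : RuledSurface m d r → S :=
  Quot.lift (fun x : Rep m d => x.1.toFun x.2.1.1) (by
    rintro x x' ⟨h, a, lam, ht, hz, -⟩
    have := ht.2.2.2.1.self_of_nhds
    simp only [hz, this])

/-- The infinity section, where the component `u` in `O` vanishes. -/
def infinitySection (r : ℕ) : Set (RuledSurface m d r) :=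
  {x | ∃ (φ : OrbChart S m d) (z v : ℂ), z ∈ Metric.ball (0 : ℂ) φ.radius ∧ v ≠ 0 ∧
    x = pt r φ z 0 v}

/-- The singular points of the orbifold: the points with non-trivial isotropy. -/
def singularSet (r : ℕ) : Set (RuledSurface m d r) :=
  {x | ∃ (φ : OrbChart S m d) (z u v : ℂ) (h : ℂ → ℂ) (a lam : ℂ),
    z ∈ Metric.ball (0 : ℂ) φ.radius ∧ (u, v) ≠ (0 : ℂ × ℂ) ∧ x = pt r φ z u v ∧
    IsTransition r φ φ z h a ∧ h z = z ∧ lam ≠ 0 ∧ u = lam * u ∧ a * v = lam * v ∧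
    ¬ h =ᶠ[𝓝 z] id}

/-- The affine coordinates of the orbifold over the chart `φ`: `(z, ξ) ↦ [1 : ξ]` around the zero
section (`b = false`) and `(z, η) ↦ [η : 1]` around the infinity section (`b = true`). -/
def affineChart (r : ℕ) (φ : OrbChart S m d) (b : Bool) (y : ℂ × ℂ) : RuledSurface m d r :=
  if b then pt r φ y.1 y.2 1 else pt r φ y.1 1 y.2

end RuledSurface

end Ruled

/-! ## The Hirzebruch-Jung resolution -/

/-- The polydisc of radius `ρ` in `ℂ²`. -/
def polydisc (ρ : ℝ) : Set (ℂ × ℂ) := {v | ‖v.1‖ < ρ ∧ ‖v.2‖ < ρ}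

/-- `ψ` identifies the quotient of the polydisc by the group `Γ_{p,q}`, generated by
`(z, w) ↦ (ζ z, ζ ^ p w)` with `ζ = exp (2 π i / q)`, with a subset of `T`. -/
def IsQuotientChart {T : Type u} (ψ : ℂ × ℂ → T) (ρ : ℝ) (p q : ℕ) : Prop :=
  0 < p ∧ p < q ∧ p.Coprime q ∧
  ∀ v ∈ polydisc ρ, ∀ v' ∈ polydisc ρ,
    ψ v = ψ v' ↔ ∃ ζ : ℂ, ζ ^ q = 1 ∧ v' = (ζ * v.1, ζ ^ p * v.2)

/-- Let `e = [e₁, …, e_k]` be the expansion of `p / q`. The Hirzebruch-Jung resolution of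
`ℂ² / Γ_{p,q}` is covered by affine charts `0, …, k`. With the vectors `v_i = (a_i, b_i) / q`,
`v_0 = (0, 1)`, `v_1 = (1, p) / q`, `v_{i+1} = e_i v_i - v_{i-1}`, the `i`-th chart maps `(s, t)`
to the class of `(z, w) = s^{v_i} t^{v_{i+1}}`. This class is pinned down by
the invariant monomials `z ^ q`, `w ^ q` and `z ^ (q - p) w`. -/
def HJOver (e : List ℤ) (p q : ℕ) (i : ℕ) (y v : ℂ × ℂ) : Prop :=
  v.1 ^ q = y.1 ^ hjSeq e 0 1 i * y.2 ^ hjSeq e 0 1 (i + 1) ∧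
  v.2 ^ q = y.1 ^ hjSeq e q p i * y.2 ^ hjSeq e q p (i + 1) ∧
  v.1 ^ (q - p) * v.2 = y.1 ^ hjSeq e 1 1 i * y.2 ^ hjSeq e 1 1 (i + 1)

/-- Over the image of the quotient chart `ψ` of the polydisc by `Γ_{p,q}`, the map `π : X → T` is
the Hirzebruch-Jung resolution of `ℂ² / Γ_{p,q}`. The charts `i` and `i + 1` are glued by
`(s, t) ↦ (t s ^ e_{i+1}, s⁻¹)`; the exceptional curve `t = 0` that they share is a
projective line with self-intersection `-e_{i+1} ≤ -2`. -/
def IsHJModel {X T : Type u} [TopologicalSpace X] [HolSpace X] (π : X → T) (ψ : ℂ × ℂ → T)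
    (ρ : ℝ) (p q : ℕ) : Prop :=
  ∃ (e : List ℤ) (c : ℕ → OpenPartialHomeomorph X (ℂ × ℂ)),
    IsHJExpansion e (p / q) ∧
    (∀ i ≤ e.length, IsHolChart (c i)) ∧
    π ⁻¹' (ψ '' polydisc ρ) = ⋃ i ≤ e.length, (c i).source ∧
    (∀ i ≤ e.length, (c i).target = {y | ∃ v ∈ polydisc ρ, HJOver e p q i y v}) ∧
    (∀ i ≤ e.length, ∀ y ∈ (c i).target, ∀ v ∈ polydisc ρ, HJOver e p q i y v →
      π ((c i).symm y) = ψ v) ∧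
    (∀ i < e.length, ∀ y ∈ (c i).target, ∀ y' ∈ (c (i + 1)).target,
      (c i).symm y = (c (i + 1)).symm y' ↔
        y.1 ≠ 0 ∧ y' = (y.2 * y.1 ^ e.getD i 0, y.1⁻¹))

/-- `π : X → ℙ(O ⊕ K_orb^r ⊗ [d])` is the minimal resolution, obtained with the Hirzebruch-Jung
strings: it is biholomorphic over the complement of the singular points, each singular point is of
type `A_{p,q}` for suitable `p` and `q`, and over a neighbourhood of it, in affine coordinates of
the orbifold centred at the point, `π` is the Hirzebruch-Jung resolution of `ℂ² / Γ_{p,q}`. -/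
def IsHJResolution {S : Type u} [TopologicalSpace S] [ChartedSpace ℂ S] {m : S → ℕ} {d : S → ℤ}
    {r : ℕ} {X : Type u} [TopologicalSpace X] [HolSpace X] (π : X → RuledSurface m d r) : Prop :=
  Continuous π ∧ IsBiholOver π (RuledSurface.singularSet r)ᶜ ∧
  ∀ x ∈ RuledSurface.singularSet r, ∃ (φ : OrbChart S m d) (b : Bool) (ρ : ℝ) (p q : ℕ),
    0 < ρ ∧ ρ ≤ φ.radius ∧ RuledSurface.affineChart r φ b 0 = x ∧
    IsQuotientChart (RuledSurface.affineChart r φ b) ρ p q ∧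
    IsHJModel π (RuledSurface.affineChart r φ b) ρ p q

/-! ## Marked points -/

/-- The orbifold with points `A j` of order `q j`. -/
def orbOrder {S : Type u} {s : ℕ} (A : Fin s → S) (q : Fin s → ℕ) (x : S) : ℕ :=
  open Classical in ∏ j, if A j = x then q j else 1

/-- The divisor `∑ j, k j • A j`. -/
def divisorOf {S : Type u} {s : ℕ} (A : Fin s → S) (k : Fin s → ℤ) (x : S) : ℤ :=
  open Classical in ∑ j, if A j = x then k j else 0

end OrbiRuled

end

open OrbiRuled

open OrbiRuled

/-!
The proof compares all surfaces through *generic coordinates*. Write `𝒜` for the set of points `A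
j`. Over the complement of `𝒜` the two ruled surfaces coincide, and a point there which is off the
zero and infinity sections is determined by its base point together with the quotient of its
homogeneous coordinates with respect to the preferred coordinate of the base there
(`RuledSurface.gen`). A surface carrying a map to `S × ℂ` of this kind is known as soon as one
knows which local charts it has: two surfaces with the same germs of charts, in the sense of
`LocMatch`, are biholomorphic, because the local identifications agree on the dense set of generic
points and glue (`exists_openPartialHomeomorph_of_locMatch`).

Near a fibre over `A j` all surfaces involved are toric: with respect to a reference chart `(s, t)`
they have the charts `(z, w)` with `s`, `t` monomials in `z`, `w`, one for each unimodular cone of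
a fan (`Realizes`). Thus `Realizes.nonempty_diffeomorph` reduces the theorem to the claim that the
resolution and the iterated blow-up have the same fan over each `A j`, namely the one built from
the Hirzebruch-Jung strings of `p / q` and `(q - p) / q` (`hjFanOf`).

* For the blow-up: blowing up the origin of a toric chart subdivides its cone (`Realizes.blowup`).
  In a chain of torus-invariant curves the self-intersection numbers give the linear relations
  between neighbouring rays, so that the chain `-e₁, …, -e_k, -1, -e'_l, …, -e'₁` determines the
  fan (`IsWeightedBlowupAt.realizes`, `IsIteratedBlowup.isBlowupModel`).
* For the resolution: in an orbifold chart `z ↦ z ^ q` of the base, with `w` the fibre coordinate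
  of `ℙ(𝒪 ⊕ 𝒦_orb^r)`, the frame `(dz)^r` differs from that of `𝒦^r ⊗ [A]^(r - n)` by a power of
  `z`, up to units, and `q (r - n) = r q - p - r` makes `z ^ q` and `w z ^ (-p)` the reference
  coordinates `s`, `t` up to units as well. The Hirzebruch-Jung charts of the two quotient
  singularities on the fibre, of types `A_{p,q}` and `A_{q-p,q}`, therefore are the toric charts
  for the cones on the two sides of the ray of the proper transform of the fibre of `ℙ(𝒪 ⊕
  𝒦_orb^r)`, which is the `-1`-curve (`toric_sideCone`, `IsHJResolution.realizes`).

Both surfaces exist. A blow-up of a point is constructed by gluing (`exists_isPointBlowup`), and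
the Euclidean algorithm for `p / q` chooses the corners to be blown up (`Tracked.exists_chain`,
`exists_isIteratedBlowup`). The surface so obtained also carries the resolution: the map to the
orbifold ruled surface is the extension by continuity of the identification of generic points
(`IsGenLimit`, `IsToricModel.exists_isHJResolution`).
-/

noncomputable section

namespace OrbiRuled

/-! ### Biholomorphic partial homeomorphisms and generic coordinates -/

section Bihol

universe v w t

variable {X : Type u} {Y : Type v} {Z : Type w} {S : Type t}
  [TopologicalSpace X] [HolSpace X] [TopologicalSpace Y] [HolSpace Y]
  [TopologicalSpace Z] [HolSpace Z]

/-- A partial homeomorphism which identifies the sheaves of holomorphic functions. -/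
def IsBihol (e : OpenPartialHomeomorph X Y) : Prop :=
  ∀ x ∈ e.source, ∀ g : Y → ℂ, HolSpace.HolAt g (e x) ↔ HolSpace.HolAt (g ∘ e) x

lemma holAt_congr {f g : X → ℂ} {x : X} (h : f =ᶠ[𝓝 x] g) :
    HolSpace.HolAt f x ↔ HolSpace.HolAt g x :=
  ⟨HolSpace.congr h, HolSpace.congr h.symm⟩

lemma IsBihol.symm {e : OpenPartialHomeomorph X Y} (he : IsBihol e) : IsBihol e.symm := by
  intro y hy g
  have hx := e.map_target hy
  have h := he (e.symm y) hx (g ∘ e.symm)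
  rw [e.right_inv hy] at h
  refine Iff.trans (holAt_congr ?_) h.symm
  filter_upwards [e.open_source.mem_nhds hx] with x' hx'
  simp [e.left_inv hx']

lemma IsBihol.trans {e : OpenPartialHomeomorph X Y} {e' : OpenPartialHomeomorph Y Z}
    (he : IsBihol e) (he' : IsBihol e') : IsBihol (e.trans e') := by
  intro x hx g
  rw [OpenPartialHomeomorph.trans_source] at hx
  exact (he' (e x) hx.2 g).trans (he x hx.1 (g ∘ e'))

lemma IsBihol.restr {e : OpenPartialHomeomorph X Y} (he : IsBihol e) {s : Set X}
    (hs : IsOpen s) : IsBihol (e.restrOpen s hs) :=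
  fun x hx g => he x hx.1 g

lemma isBihol_refl : IsBihol (OpenPartialHomeomorph.refl X) := fun _ _ _ => Iff.rfl

lemma holAt_iff_analyticAt {f : ℂ × ℂ → ℂ} {x : ℂ × ℂ} :
    HolSpace.HolAt f x ↔ AnalyticAt ℂ f x := by
  change ContMDiffAt 𝓘(ℂ, ℂ × ℂ) 𝓘(ℂ) ω f x ↔ _
  rw [contMDiffAt_iff_contDiffAt, ← contDiffWithinAt_univ,
    contDiffWithinAt_omega_iff_analyticWithinAt, analyticWithinAt_univ]

lemma isBihol_iff_isHolChart {e : OpenPartialHomeomorph X (ℂ × ℂ)} :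
    IsBihol e ↔ IsHolChart e := by
  constructor
  · intro h x hx f
    have h' := h.symm (e x) (e.map_source hx) f
    rw [e.left_inv hx] at h'
    exact h'.trans holAt_iff_analyticAt
  · intro h x hx g
    rw [h x hx, holAt_iff_analyticAt]
    refine analyticAt_congr ?_
    filter_upwards [e.open_target.mem_nhds (e.map_source hx)] with y hy
    simp [e.right_inv hy]

/-- Mutually inverse germs of holomorphic maps define a biholomorphic partial homeomorphism. -/
lemma exists_isBihol_of_germs {F G : ℂ × ℂ → ℂ × ℂ} {y : ℂ × ℂ} (hF : AnalyticAt ℂ F y)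
    (hG : AnalyticAt ℂ G (F y)) (h₁ : ∀ᶠ y' in 𝓝 y, G (F y') = y')
    (h₂ : ∀ᶠ y' in 𝓝 (F y), F (G y') = y') :
    ∃ e : OpenPartialHomeomorph (ℂ × ℂ) (ℂ × ℂ), IsBihol e ∧ y ∈ e.source ∧
      ∀ x ∈ e.source, e x = F x := by
  obtain ⟨U, hU, hUo, hyU⟩ := eventually_nhds_iff.1 (hF.eventually_analyticAt.and h₁)
  obtain ⟨V, hV, hVo, hyV⟩ := eventually_nhds_iff.1 (hG.eventually_analyticAt.and h₂)
  have hFc : ContinuousOn F U := fun x hx => (hU x hx).1.continuousAt.continuousWithinAt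
  have hGc : ContinuousOn G V := fun x hx => (hV x hx).1.continuousAt.continuousWithinAt
  let e : OpenPartialHomeomorph (ℂ × ℂ) (ℂ × ℂ) :=
    { toFun := F
      invFun := G
      source := U ∩ F ⁻¹' V
      target := V ∩ G ⁻¹' U
      map_source' := fun x hx => ⟨hx.2, by simpa [(hU x hx.1).2] using hx.1⟩
      map_target' := fun x hx => ⟨hx.2, by simpa [(hV x hx.1).2] using hx.1⟩
      left_inv' := fun x hx => (hU x hx.1).2
      right_inv' := fun x hx => (hV x hx.1).2
      open_source := hFc.isOpen_inter_preimage hUo hVo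
      open_target := hGc.isOpen_inter_preimage hVo hUo
      continuousOn_toFun := hFc.mono Set.inter_subset_left
      continuousOn_invFun := hGc.mono Set.inter_subset_left }
  refine ⟨e, ?_, ⟨hyU, hyV⟩, fun x _ => rfl⟩
  intro x hx g
  rw [holAt_iff_analyticAt, holAt_iff_analyticAt]
  constructor
  · intro hg
    exact hg.comp (hU x hx.1).1
  · intro hg
    have hgx : AnalyticAt ℂ G (F x) := (hV _ hx.2).1
    have hg' : AnalyticAt ℂ (g ∘ e) (G (F x)) := by rwa [(hU x hx.1).2]
    refine (hg'.comp hgx).congr ?_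
    filter_upwards [hVo.mem_nhds hx.2] with z hz
    exact congrArg g (hV z hz).2

/-- Let `f` and `g` be generic coordinates: maps to `S × ℂ` for which the points with non-zero
second component are generic. `LocMatch f g x y` says that a biholomorphism from a
neighbourhood of `x` to one of `y`, compatible with the generic coordinates, takes `x` to `y`, and
that the generic points are dense near `x`. -/
def LocMatch (f : X → S × ℂ) (g : Y → S × ℂ) (x : X) (y : Y) : Prop :=
  ∃ e : OpenPartialHomeomorph X Y, IsBihol e ∧ x ∈ e.source ∧ e x = y ∧
    (∀ x' ∈ e.source, g (e x') = f x') ∧ ∀ x' ∈ e.source, x' ∈ closure {x'' | (f x'').2 ≠ 0}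

/-- The generic coordinates are injective on the set of generic points. -/
def GenInj (f : X → S × ℂ) : Prop := Set.InjOn f {x | (f x).2 ≠ 0}

variable {f : X → S × ℂ} {g : Y → S × ℂ} {k : Z → S × ℂ} {x x' : X} {y y' : Y} {z : Z}

lemma LocMatch.eq (h : LocMatch f g x y) : g y = f x := by
  obtain ⟨e, -, hx, rfl, h, -⟩ := h
  exact h x hx

lemma LocMatch.symm (h : LocMatch f g x y) : LocMatch g f y x := by
  obtain ⟨e, he, hx, rfl, hfg, hd⟩ := h
  refine ⟨e.symm, he.symm, e.map_source hx, e.left_inv hx, fun y' hy' => ?_, fun y' hy' => ?_⟩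
  · rw [← hfg _ (e.map_target hy'), e.right_inv hy']
  · have hx' := e.map_target hy'
    have h1 := mem_closure_iff_frequently.1 (hd _ hx')
    have h2 := h1.and_eventually (e.open_source.mem_nhds hx')
    have h3 := (e.continuousAt hx').tendsto.frequently
      (p := fun y'' => (g y'').2 ≠ 0) (h2.mono fun x'' h => by rw [hfg _ h.2]; exact h.1)
    rw [e.right_inv hy'] at h3
    exact mem_closure_iff_frequently.2 h3

lemma LocMatch.trans (h : LocMatch f g x y) (h' : LocMatch g k y z) : LocMatch f k x z := by
  obtain ⟨e, he, hx, rfl, hfg, hd⟩ := h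
  obtain ⟨e', he', hx', rfl, hfg', -⟩ := h'
  refine ⟨e.trans e', he.trans he', ⟨hx, hx'⟩, rfl, ?_, fun x' hx' => hd _ hx'.1⟩
  rintro x'' ⟨h1, h2⟩
  exact (hfg' _ h2).trans (hfg _ h1)

/-- The matching survives in a neighbourhood of the two points. -/
lemma LocMatch.exists_chart (h : LocMatch f g x y) {s : Set X} (hs : s ∈ 𝓝 x) :
    ∃ e : OpenPartialHomeomorph X Y, IsBihol e ∧ x ∈ e.source ∧ e x = y ∧ e.source ⊆ s ∧
      ∀ x' ∈ e.source, LocMatch f g x' (e x') ∧ g (e x') = f x' := by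
  obtain ⟨e, he, hx, rfl, hfg, hd⟩ := h
  refine ⟨e.restrOpen (interior s) isOpen_interior, he.restr _, ⟨hx, mem_interior_iff_mem_nhds.2 hs⟩,
    rfl, fun x' hx' => interior_subset hx'.2, fun x' hx' =>
      ⟨⟨e, he, hx'.1, rfl, hfg, hd⟩, hfg _ hx'.1⟩⟩

lemma LocMatch.frequently_generic (h : LocMatch f g x y) : ∃ᶠ x' in 𝓝 x, (f x').2 ≠ 0 := by
  obtain ⟨e, -, hx, -, -, hd⟩ := h
  exact mem_closure_iff_frequently.1 (hd x hx)

/-- In a Hausdorff space, a point is matched to at most one point. -/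
lemma LocMatch.unique [T2Space Y] (hg : GenInj g) (h : LocMatch f g x y)
    (h' : LocMatch f g x y') : y = y' := by
  have hd := h.frequently_generic
  obtain ⟨e, he, hx, rfl, hfg, -⟩ := h
  obtain ⟨e', he', hx', rfl, hfg', -⟩ := h'
  by_contra hne
  obtain ⟨U, V, hU, hV, hxU, hxV, hUV⟩ := t2_separation hne
  have h1 := (e.continuousAt hx).eventually (hU.mem_nhds hxU)
  have h2 := (e'.continuousAt hx').eventually (hV.mem_nhds hxV)
  obtain ⟨x'', h3, h4, h5, h6, h7⟩ := (hd.and_eventually (h1.and (h2.and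
    ((e.open_source.eventually_mem hx).and (e'.open_source.eventually_mem hx'))))).exists
  have : e x'' = e' x'' := by
    refine hg ?_ ?_ ?_
    · simpa [hfg _ h6] using h3
    · simpa [hfg' _ h7] using h3
    · rw [hfg _ h6, hfg' _ h7]
  exact Set.disjoint_left.1 hUV h4 (this ▸ h5)

lemma LocMatch.unique_left [T2Space X] (hf : GenInj f) (h : LocMatch f g x y)
    (h' : LocMatch f g x' y) : x = x' :=
  h.symm.unique hf h'.symm

/-- If every point of the open set `D` is matched to some point, then the local matchings are
the restrictions of a single biholomorphism defined on `D`. -/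
lemma exists_openPartialHomeomorph_of_locMatch [T2Space X] [T2Space Y] (hf : GenInj f)
    (hg : GenInj g) {D : Set X} (hD : IsOpen D) (hne : D.Nonempty)
    (h : ∀ x ∈ D, ∃ y, LocMatch f g x y) :
    ∃ e : OpenPartialHomeomorph X Y, IsBihol e ∧ e.source = D ∧
      ∀ x ∈ D, LocMatch f g x (e x) := by
  classical
  obtain ⟨x₀, hx₀⟩ := hne
  have : Nonempty X := ⟨x₀⟩
  have : Nonempty Y := ⟨(h x₀ hx₀).choose⟩
  choose! φ hφ using h
  have hinj : Set.InjOn φ D := fun a ha b hb hab =>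
    (hφ a ha).unique_left hf (hab ▸ hφ b hb)
  have hloc : ∀ x ∈ D, ∃ e : OpenPartialHomeomorph X Y, IsBihol e ∧ x ∈ e.source ∧
      e.source ⊆ D ∧ ∀ x' ∈ e.source, φ x' = e x' := by
    intro x hx
    obtain ⟨e, he, hxe, -, hsub, hm⟩ := (hφ x hx).exists_chart (hD.mem_nhds hx)
    exact ⟨e, he, hxe, hsub, fun x' hx' => (hφ x' (hsub hx')).unique hg (hm x' hx').1⟩
  have hleft : ∀ x ∈ D, Function.invFunOn φ D (φ x) = x := fun x hx =>
    hinj.leftInvOn_invFunOn hx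
  have himg : ∀ e : OpenPartialHomeomorph X Y, e.source ⊆ D → (∀ x' ∈ e.source, φ x' = e x') →
      ∀ y ∈ e.target, Function.invFunOn φ D y = e.symm y ∧ y ∈ φ '' D := by
    intro e hsub hφe y hy
    have h1 := e.map_target hy
    have h2 : φ (e.symm y) = y := by rw [hφe _ h1, e.right_inv hy]
    refine ⟨?_, _, hsub h1, h2⟩
    conv_lhs => rw [← h2]
    exact hleft _ (hsub h1)
  let E : OpenPartialHomeomorph X Y :=
    { toFun := φ
      invFun := Function.invFunOn φ D
      source := D
      target := φ '' D
      map_source' := fun x hx => Set.mem_image_of_mem φ hx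
      map_target' := by
        rintro _ ⟨x, hx, rfl⟩
        rwa [hleft x hx]
      left_inv' := hleft
      right_inv' := by
        rintro _ ⟨x, hx, rfl⟩
        rw [hleft x hx]
      open_source := hD
      open_target := by
        rw [isOpen_iff_mem_nhds]
        rintro _ ⟨x, hx, rfl⟩
        obtain ⟨e, -, hxe, hsub, hφe⟩ := hloc x hx
        refine Filter.mem_of_superset (e.open_target.mem_nhds ?_)
          fun y hy => (himg e hsub hφe y hy).2
        rw [hφe x hxe]
        exact e.map_source hxe
      continuousOn_toFun := by
        intro x hx
        obtain ⟨e, -, hxe, -, hφe⟩ := hloc x hx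
        exact ((e.continuousAt hxe).congr
          (Filter.eventually_of_mem (e.open_source.mem_nhds hxe)
            fun x' hx' => (hφe x' hx').symm)).continuousWithinAt
      continuousOn_invFun := by
        rintro _ ⟨x, hx, rfl⟩
        obtain ⟨e, -, hxe, hsub, hφe⟩ := hloc x hx
        have hy : φ x ∈ e.target := by
          rw [hφe x hxe]
          exact e.map_source hxe
        exact ((e.continuousAt_symm hy).congr
          (Filter.eventually_of_mem (e.open_target.mem_nhds hy)
            fun y hy => (himg e hsub hφe y hy).1.symm)).continuousWithinAt }
  refine ⟨E, ?_, rfl, hφ⟩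
  intro x hx k
  obtain ⟨e, he, hxe, -, hφe⟩ := hloc x hx
  have h1 : E x = e x := hφe x hxe
  rw [h1, he x hxe k]
  refine holAt_congr ?_
  filter_upwards [e.open_source.mem_nhds hxe] with x' hx'
  exact congrArg k (hφe x' hx').symm

/-- Mutually inverse germs of holomorphic maps of `ℂ²`, compatible with the generic coordinates,
give a matching. That the germs are inverse to each other only has to be known at generic points,
where it is automatic. -/
lemma LocMatch.of_germs {μ ν : ℂ × ℂ → S × ℂ} (hμ : GenInj μ) (hν : GenInj ν)
    {F G : ℂ × ℂ → ℂ × ℂ} {y : ℂ × ℂ} (hF : AnalyticAt ℂ F y) (hG : AnalyticAt ℂ G (F y))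
    (hμν : ∀ᶠ y' in 𝓝 y, ν (F y') = μ y') (hνμ : ∀ᶠ y' in 𝓝 (F y), μ (G y') = ν y')
    (hdμ : ∀ᶠ y' in 𝓝 y, y' ∈ closure {y'' | (μ y'').2 ≠ 0})
    (hdν : ∀ᶠ y' in 𝓝 (F y), y' ∈ closure {y'' | (ν y'').2 ≠ 0}) :
    LocMatch μ ν y (F y) := by
  -- two continuous germs which agree at the generic points agree
  have key : ∀ {P Q : ℂ × ℂ → ℂ × ℂ} {ρ σ : ℂ × ℂ → S × ℂ} {x : ℂ × ℂ}, GenInj ρ →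
      AnalyticAt ℂ P x → AnalyticAt ℂ Q (P x) → (∀ᶠ x' in 𝓝 x, σ (P x') = ρ x') →
      (∀ᶠ x' in 𝓝 (P x), ρ (Q x') = σ x') →
      (∀ᶠ x' in 𝓝 x, x' ∈ closure {x'' | (ρ x'').2 ≠ 0}) → ∀ᶠ x' in 𝓝 x, Q (P x') = x' := by
    intro P Q ρ σ x hρ hP hQ h1 h2 h3
    have h4 := hP.continuousAt.eventually h2
    have h5 := (hQ.comp hP).eventually_analyticAt
    filter_upwards [(h1.and h4).eventually_nhds, h5, h3] with x' h6 h7 h8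
    by_contra hne
    obtain ⟨U, V, hU, hV, hxU, hxV, hUV⟩ := t2_separation hne
    obtain ⟨x'', h9, ⟨h10, h11⟩, h12, h13⟩ := ((mem_closure_iff_frequently.1 h8).and_eventually
      (h6.and ((h7.continuousAt.eventually (hU.eventually_mem hxU)).and
        (hV.eventually_mem hxV)))).exists
    have h14 : ρ (Q (P x'')) = ρ x'' := h11.trans h10
    have h9' : (ρ x'').2 ≠ 0 := h9
    have : Q (P x'') = x'' := hρ (by simpa [h14] using h9') h9 h14
    have h12' : Q (P x'') ∈ U := h12
    rw [this] at h12'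
    exact Set.disjoint_left.1 hUV h12' h13
  have h1 := key hμ hF hG hμν hνμ hdμ
  have hGy : G (F y) = y := h1.self_of_nhds
  have h2 : ∀ᶠ y' in 𝓝 (F y), F (G y') = y' :=
    key (σ := μ) hν hG (by rwa [hGy]) hνμ (by rwa [hGy]) hdν
  obtain ⟨e, he, hye, heF⟩ := exists_isBihol_of_germs hF hG h1 h2
  obtain ⟨s, hs, hso, hys⟩ := eventually_nhds_iff.1 (hμν.and hdμ)
  exact ⟨e.restrOpen s hso, he.restr hso, ⟨hye, hys⟩, heF y hye,
    fun x' hx' => by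
      rw [← (hs x' hx'.2).1, ← heF x' hx'.1]
      rfl, fun x' hx' => (hs x' hx'.2).2⟩

end Bihol

/-! ### Blow-ups of points -/

/-- The two standard affine charts of the blow-up of `ℂ²` at the origin: `(s, t) ↦ (s, s t)` and
`(s, t) ↦ (s t, t)`. -/
def blowMap (b : Bool) (y : ℂ × ℂ) : ℂ × ℂ :=
  if b then (y.1 * y.2, y.2) else (y.1, y.1 * y.2)

lemma blowMap_false (y : ℂ × ℂ) : blowMap false y = (y.1, y.1 * y.2) := rfl

lemma blowMap_true (y : ℂ × ℂ) : blowMap true y = (y.1 * y.2, y.2) := rfl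

lemma analyticAt_blowMap (b : Bool) (y : ℂ × ℂ) : AnalyticAt ℂ (blowMap b) y := by
  cases b
  · exact analyticAt_fst.prod (analyticAt_fst.mul analyticAt_snd)
  · exact (analyticAt_fst.mul analyticAt_snd).prod analyticAt_snd

lemma blowMap_not_swap (b : Bool) (y : ℂ × ℂ) : blowMap (!b) y.swap = (blowMap b y).swap := by
  cases b <;> simp [blowMap, mul_comm]

/-- The exchange of the coordinates of `ℂ²`. -/
def swapPH : OpenPartialHomeomorph (ℂ × ℂ) (ℂ × ℂ) :=
  (Homeomorph.prodComm ℂ ℂ).toOpenPartialHomeomorph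

lemma swapPH_apply (y : ℂ × ℂ) : swapPH y = y.swap := rfl

lemma analyticAt_swap (y : ℂ × ℂ) : AnalyticAt ℂ (Prod.swap : ℂ × ℂ → ℂ × ℂ) y :=
  analyticAt_snd.prod analyticAt_fst

lemma isBihol_swapPH : IsBihol swapPH := by
  intro x _ g
  rw [holAt_iff_analyticAt, holAt_iff_analyticAt]
  constructor
  · intro h
    exact AnalyticAt.comp (g := g) (f := Prod.swap) h (analyticAt_swap x)
  · intro h
    have h' : AnalyticAt ℂ (g ∘ swapPH) (Prod.swap (swapPH x)) := by simpa [swapPH_apply] using h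
    exact AnalyticAt.comp (g := g ∘ swapPH) h' (analyticAt_swap (swapPH x))

/-- Analytic functions on a normed space are divisible by the coordinates, in the sense that
`H x = L x x` for an analytic family of linear maps, if `H 0 = 0`. -/
lemma exists_analyticAt_apply_self {E F : Type*} [NormedAddCommGroup E] [NormedSpace ℂ E]
    [NormedAddCommGroup F] [NormedSpace ℂ F] [CompleteSpace F] {H : E → F}
    (hH : AnalyticAt ℂ H 0) (h0 : H 0 = 0) :
    ∃ L : E → E →L[ℂ] F, AnalyticAt ℂ L 0 ∧ ∀ᶠ x in 𝓝 0, H x = L x x := by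
  obtain ⟨p, r, hp⟩ := hH
  have hr : 0 < p.shift.radius := by
    rw [FormalMultilinearSeries.radius_shift]
    exact hp.r_pos.trans_le hp.r_le
  have hs := p.shift.hasFPowerSeriesOnBall hr
  refine ⟨p.shift.sum, hs.analyticAt, ?_⟩
  have hball : Metric.eball (0 : E) (min r p.shift.radius) ∈ 𝓝 (0 : E) :=
    Metric.eball_mem_nhds _ (lt_min hp.r_pos hr)
  filter_upwards [hball] with x hx
  have h1 := hp.hasSum (y := x) (Metric.eball_subset_eball (min_le_left _ _) hx)
  have h2 := hs.hasSum (y := x) (Metric.eball_subset_eball (min_le_right _ _) hx)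
  rw [zero_add] at h1 h2
  have h3 := h2.mapL (ContinuousLinearMap.apply ℂ F x)
  have h4 : HasSum (fun n => p (n + 1) fun _ => x) (p.shift.sum x x) := by
    have h3' : HasSum (fun n => p.shift n (fun _ => x) x) (p.shift.sum x x) := h3
    convert h3' using 2 with n
    simp only [FormalMultilinearSeries.shift, ContinuousMultilinearMap.curryRight_apply]
    congr 1
    ext i
    refine Fin.lastCases ?_ (fun i => ?_) i <;> simp
  have h5 := (hasSum_nat_add_iff (f := fun n => p n fun _ => x) 1).1 h4
  have h6 : (p 0 fun _ => x) = 0 := by rw [hp.coeff_zero, h0]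
  simp only [Finset.range_one, Finset.sum_singleton, h6, add_zero] at h5
  exact h1.unique h5

/-- Analytic germs which agree off the line `s = 0` agree. -/
lemma eventually_eq_of_fst_ne {E : Type*} [NormedAddCommGroup E] [NormedSpace ℂ E] [CompleteSpace E]
    {A B : ℂ × ℂ → E} {y : ℂ × ℂ} (hA : AnalyticAt ℂ A y)
    (hB : AnalyticAt ℂ B y) (h : ∀ᶠ y' in 𝓝 y, y'.1 ≠ 0 → A y' = B y') :
    ∀ᶠ y' in 𝓝 y, A y' = B y' := by
  have hd : Dense {y : ℂ × ℂ | y.1 ≠ 0} :=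
    (dense_compl_singleton (0 : ℂ)).preimage isOpenMap_fst
  filter_upwards [h.eventually_nhds, hA.eventually_analyticAt, hB.eventually_analyticAt]
    with x h1 h2 h3
  by_contra hne
  obtain ⟨U, V, hU, hV, hxU, hxV, hUV⟩ := t2_separation hne
  obtain ⟨z, h4, h5, h6, h7⟩ := ((mem_closure_iff_frequently.1 (hd x)).and_eventually
    (h1.and ((h2.continuousAt.eventually (hU.eventually_mem hxU)).and
      (h3.continuousAt.eventually (hV.eventually_mem hxV))))).exists
  exact Set.disjoint_left.1 hUV h6 (h5 h4 ▸ h7)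

lemma exists_blowMap_factor {H : ℂ × ℂ → ℂ × ℂ} (hH : AnalyticAt ℂ H 0) (h0 : H 0 = 0) :
    ∃ P : ℂ × ℂ → ℂ × ℂ, (∀ t, AnalyticAt ℂ P (0, t)) ∧
      ∀ t, ∀ᶠ y in 𝓝 ((0 : ℂ), t), H (blowMap false y) = y.1 • P y := by
  obtain ⟨L, hL, hHL⟩ := exists_analyticAt_apply_self hH h0
  have hb : ∀ t : ℂ, blowMap false (0, t) = 0 := fun t => by simp [blowMap]
  refine ⟨fun y => L (blowMap false y) (1, y.2), fun t => ?_, fun t => ?_⟩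
  · have h1 : AnalyticAt ℂ (fun y => L (blowMap false y)) ((0 : ℂ), t) :=
      AnalyticAt.comp (g := L) (by rwa [hb]) (analyticAt_blowMap false _)
    have h2 : AnalyticAt ℂ (fun y : ℂ × ℂ => ((1 : ℂ), y.2)) ((0 : ℂ), t) :=
      analyticAt_const.prod analyticAt_snd
    exact ((ContinuousLinearMap.id ℂ (ℂ × ℂ →L[ℂ] ℂ × ℂ)).analyticAt_bilinear _).comp
      (h1.prod h2)
  · have h2 : ∀ᶠ y in 𝓝 ((0 : ℂ), t), H (blowMap false y) = L (blowMap false y) (blowMap false y) :=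
      (analyticAt_blowMap false (0, t)).continuousAt.eventually (p := fun x => H x = L x x)
        (by rwa [hb])
    filter_upwards [h2] with y hy
    rw [hy, ← map_smul]
    simp [blowMap]

lemma blowMap_eq_zero {y : ℂ × ℂ} : blowMap false y = 0 ↔ y.1 = 0 := by
  rw [blowMap_false, Prod.mk_eq_zero]
  exact ⟨fun h => h.1, fun h => ⟨h, by simp [h]⟩⟩

/-- Let `H` and `K` be mutually inverse germs at the origin, and write `H(s, s t) = s P(s, t)`,
`K(s, s t) = s Q(s, t)`. Where `P₁ ≠ 0`, the germ `(s P₁, P₂ / P₁)` lifts `H` to the blow-up, and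
the lift of `K` is a left inverse of it. -/
lemma blowMap_lift_left_inverse {H K P Q : ℂ × ℂ → ℂ × ℂ}
    (hKH : ∀ᶠ x in 𝓝 0, K (H x) = x) {t : ℂ} (hP : AnalyticAt ℂ P (0, t))
    (hHP : ∀ᶠ y in 𝓝 ((0 : ℂ), t), H (blowMap false y) = y.1 • P y)
    (hQ : ∀ t, AnalyticAt ℂ Q (0, t))
    (hKQ : ∀ t, ∀ᶠ y in 𝓝 ((0 : ℂ), t), K (blowMap false y) = y.1 • Q y)
    (hne : (P (0, t)).1 ≠ 0) :
    (Q (0, (P (0, t)).2 / (P (0, t)).1)).1 ≠ 0 ∧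
    (Q (0, (P (0, t)).2 / (P (0, t)).1)).2 / (Q (0, (P (0, t)).2 / (P (0, t)).1)).1 = t ∧
    AnalyticAt ℂ (fun y : ℂ × ℂ => (y.1 * (P y).1, (P y).2 / (P y).1)) (0, t) ∧
    (∀ᶠ y in 𝓝 ((0 : ℂ), t),
      blowMap false (y.1 * (P y).1, (P y).2 / (P y).1) = H (blowMap false y)) ∧
    ∀ᶠ y in 𝓝 ((0 : ℂ), t), ∀ z, z = (y.1 * (P y).1, (P y).2 / (P y).1) →
      (z.1 * (Q z).1, (Q z).2 / (Q z).1) = y := by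
  set F : ℂ × ℂ → ℂ × ℂ := fun y => (y.1 * (P y).1, (P y).2 / (P y).1) with hF
  have hP1 : AnalyticAt ℂ (fun y => (P y).1) ((0 : ℂ), t) := analyticAt_fst.comp hP
  have hP2 : AnalyticAt ℂ (fun y => (P y).2) ((0 : ℂ), t) := analyticAt_snd.comp hP
  have hFa : AnalyticAt ℂ F (0, t) := (analyticAt_fst.mul hP1).prod (hP2.div hP1 hne)
  have hF0 : F (0, t) = (0, (P (0, t)).2 / (P (0, t)).1) := by simp [hF]
  have hQF : AnalyticAt ℂ (fun y => Q (F y)) ((0 : ℂ), t) :=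
    AnalyticAt.comp (g := Q) (by rw [hF0]; exact hQ _) hFa
  have hQ1 : AnalyticAt ℂ (fun y => (Q (F y)).1) ((0 : ℂ), t) := analyticAt_fst.comp hQF
  have hQ2 : AnalyticAt ℂ (fun y => (Q (F y)).2) ((0 : ℂ), t) := analyticAt_snd.comp hQF
  have hPne : ∀ᶠ y in 𝓝 ((0 : ℂ), t), (P y).1 ≠ 0 := hP1.continuousAt.eventually_ne hne
  have hbF : ∀ᶠ y in 𝓝 ((0 : ℂ), t), blowMap false (F y) = H (blowMap false y) := by
    filter_upwards [hHP, hPne] with y h1 h2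
    rw [h1, blowMap_false]
    ext
    · simp [hF]
    · simp only [hF, Prod.smul_snd, smul_eq_mul]
      field_simp
  have hKQF : ∀ᶠ y in 𝓝 ((0 : ℂ), t), K (blowMap false (F y)) = (F y).1 • Q (F y) :=
    hFa.continuousAt.eventually (by rw [hF0]; exact hKQ _)
  have hb0 : blowMap false ((0 : ℂ), t) = 0 := blowMap_eq_zero.2 rfl
  have hKHb : ∀ᶠ y in 𝓝 ((0 : ℂ), t), K (H (blowMap false y)) = blowMap false y :=
    (analyticAt_blowMap false (0, t)).continuousAt.eventually (p := fun x => K (H x) = x)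
      (by rwa [hb0])
  have hmain : ∀ᶠ y in 𝓝 ((0 : ℂ), t),
      ((P y).1 * (Q (F y)).1, (P y).1 * (Q (F y)).2) = ((1 : ℂ), y.2) := by
    refine eventually_eq_of_fst_ne ((hP1.mul hQ1).prod (hP1.mul hQ2))
      (analyticAt_const.prod analyticAt_snd) ?_
    filter_upwards [hbF, hKQF, hKHb] with y h1 h2 h3 h4
    rw [h1, h3, blowMap_false] at h2
    have h5 := congrArg Prod.fst h2
    have h6 := congrArg Prod.snd h2
    simp only [hF, Prod.smul_fst, Prod.smul_snd, smul_eq_mul] at h5 h6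
    ext
    · refine mul_left_cancel₀ h4 ?_
      rw [mul_one]
      conv_rhs => rw [h5]
      ring
    · refine mul_left_cancel₀ h4 ?_
      rw [h6]
      ring
  have hm0 := hmain.self_of_nhds
  rw [Prod.mk.injEq, hF0] at hm0
  have hQne : (Q (0, (P (0, t)).2 / (P (0, t)).1)).1 ≠ 0 := right_ne_zero_of_mul_eq_one hm0.1
  refine ⟨hQne, ?_, hFa, hbF, ?_⟩
  · rw [div_eq_iff hQne]
    refine mul_left_cancel₀ hne ?_
    rw [hm0.2, mul_left_comm, hm0.1, mul_one]
  · filter_upwards [hmain] with y h1 z hz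
    rw [Prod.mk.injEq] at h1
    have hz' : z = F y := hz
    rw [← hz'] at h1
    have h2 := right_ne_zero_of_mul_eq_one h1.1
    have h3 := left_ne_zero_of_mul_eq_one h1.1
    ext
    · simp only [hz, mul_assoc]
      rw [← hz, h1.1, mul_one]
    · simp only
      rw [div_eq_iff h2]
      refine mul_left_cancel₀ h3 ?_
      rw [h1.2, mul_left_comm, h1.1, mul_one]

/-- The factor `P` in `H(s, s t) = s P(s, t)` does not vanish at `s = 0`. -/
lemma blowMap_factor_ne_zero {H K P : ℂ × ℂ → ℂ × ℂ} (h0 : H 0 = 0)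
    (hK : AnalyticAt ℂ K 0) (hKH : ∀ᶠ x in 𝓝 0, K (H x) = x) {t : ℂ} (hP : AnalyticAt ℂ P (0, t))
    (hHP : ∀ᶠ y in 𝓝 ((0 : ℂ), t), H (blowMap false y) = y.1 • P y) : P (0, t) ≠ 0 := by
  have hK0 : K 0 = 0 := by simpa [h0] using hKH.self_of_nhds
  obtain ⟨L, hL, hKL⟩ := exists_analyticAt_apply_self hK hK0
  have hsP : AnalyticAt ℂ (fun y : ℂ × ℂ => y.1 • P y) ((0 : ℂ), t) := analyticAt_fst.smul hP
  have hLP : AnalyticAt ℂ (fun y : ℂ × ℂ => L (y.1 • P y) (P y)) ((0 : ℂ), t) := by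
    have h1 : AnalyticAt ℂ (fun y : ℂ × ℂ => L (y.1 • P y)) ((0 : ℂ), t) :=
      AnalyticAt.comp (g := L) (by simpa using hL) hsP
    exact ((ContinuousLinearMap.id ℂ (ℂ × ℂ →L[ℂ] ℂ × ℂ)).analyticAt_bilinear _).comp
      (h1.prod hP)
  have hb0 : blowMap false ((0 : ℂ), t) = 0 := blowMap_eq_zero.2 rfl
  have hKHb : ∀ᶠ y in 𝓝 ((0 : ℂ), t), K (H (blowMap false y)) = blowMap false y :=
    (analyticAt_blowMap false (0, t)).continuousAt.eventually (p := fun x => K (H x) = x)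
      (by rwa [hb0])
  have hKLs : ∀ᶠ y in 𝓝 ((0 : ℂ), t), K (y.1 • P y) = L (y.1 • P y) (y.1 • P y) :=
    hsP.continuousAt.eventually (p := fun x => K x = L x x) (by simpa using hKL)
  have hmain : ∀ᶠ y in 𝓝 ((0 : ℂ), t), L (y.1 • P y) (P y) = ((1 : ℂ), y.2) := by
    refine eventually_eq_of_fst_ne hLP (analyticAt_const.prod analyticAt_snd) ?_
    filter_upwards [hHP, hKHb, hKLs] with y h1 h2 h3 h4
    rw [← h1, h2, h1, map_smul] at h3
    refine smul_right_injective _ h4 ?_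
    simp only
    rw [← h3]
    simp [blowMap]
  intro h
  have := hmain.self_of_nhds
  rw [h] at this
  simp only [map_zero] at this
  exact one_ne_zero (congrArg Prod.fst this).symm

/-- A biholomorphic germ `H` of `(ℂ², 0)` lifts to the blow-up of the origin. -/
lemma exists_blowMap_lift {H K : ℂ × ℂ → ℂ × ℂ} (hH : AnalyticAt ℂ H 0) (hK : AnalyticAt ℂ K 0)
    (h0 : H 0 = 0) (hKH : ∀ᶠ x in 𝓝 0, K (H x) = x) (hHK : ∀ᶠ x in 𝓝 0, H (K x) = x)
    (i : Bool) (y : ℂ × ℂ) (hy : blowMap i y = 0) :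
    ∃ (j : Bool) (E : OpenPartialHomeomorph (ℂ × ℂ) (ℂ × ℂ)), IsBihol E ∧ y ∈ E.source ∧
      blowMap j (E y) = 0 ∧ ∀ y' ∈ E.source, blowMap j (E y') = H (blowMap i y') := by
  have hK0 : K 0 = 0 := by simpa [h0] using hKH.self_of_nhds
  -- the case of the first chart on both sides
  have key : ∀ {H K P Q : ℂ × ℂ → ℂ × ℂ}, AnalyticAt ℂ H 0 → AnalyticAt ℂ K 0 → H 0 = 0 →
      K 0 = 0 → (∀ᶠ x in 𝓝 0, K (H x) = x) → (∀ᶠ x in 𝓝 0, H (K x) = x) →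
      (∀ t, AnalyticAt ℂ P (0, t)) →
      (∀ t, ∀ᶠ y in 𝓝 ((0 : ℂ), t), H (blowMap false y) = y.1 • P y) →
      (∀ t, AnalyticAt ℂ Q (0, t)) →
      (∀ t, ∀ᶠ y in 𝓝 ((0 : ℂ), t), K (blowMap false y) = y.1 • Q y) →
      ∀ t : ℂ, (P (0, t)).1 ≠ 0 → ∃ E : OpenPartialHomeomorph (ℂ × ℂ) (ℂ × ℂ), IsBihol E ∧
        ((0 : ℂ), t) ∈ E.source ∧ blowMap false (E (0, t)) = 0 ∧
        ∀ y' ∈ E.source, blowMap false (E y') = H (blowMap false y') := by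
    intro H K P Q hH hK h0 hK0 hKH hHK hP hHP hQ hKQ t hne
    obtain ⟨h1, h2, h3, h4, h5⟩ :=
      blowMap_lift_left_inverse hKH (hP t) (hHP t) hQ hKQ hne
    obtain ⟨-, -, h3', -, h5'⟩ :=
      blowMap_lift_left_inverse hHK (hQ _) (hKQ _) hP hHP h1
    have hF0 : ((0 : ℂ) * (P (0, t)).1, (P (0, t)).2 / (P (0, t)).1) =
        (0, (P (0, t)).2 / (P (0, t)).1) := by rw [zero_mul]
    obtain ⟨E, hE, hyE, hEF⟩ := exists_isBihol_of_germs h3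
      (G := fun z => (z.1 * (Q z).1, (Q z).2 / (Q z).1)) (by simpa only [hF0] using h3')
      (h5.mono fun y hy => hy _ rfl) (by simpa only [hF0] using h5'.mono fun y hy => hy _ rfl)
    obtain ⟨s, hs, hso, hys⟩ := eventually_nhds_iff.1 h4
    refine ⟨E.restrOpen s hso, hE.restr hso, ⟨hyE, hys⟩, ?_, fun y' hy' => ?_⟩
    · change blowMap false (E (0, t)) = 0
      rw [hEF _ hyE, blowMap_eq_zero]
      simp
    · change blowMap false (E y') = _
      rw [hEF _ hy'.1, hs _ hy'.2]
  have key2 : ∀ {H K : ℂ × ℂ → ℂ × ℂ}, AnalyticAt ℂ H 0 → AnalyticAt ℂ K 0 → H 0 = 0 →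
      K 0 = 0 → (∀ᶠ x in 𝓝 0, K (H x) = x) → (∀ᶠ x in 𝓝 0, H (K x) = x) → ∀ t : ℂ,
      ∃ (j : Bool) (E : OpenPartialHomeomorph (ℂ × ℂ) (ℂ × ℂ)), IsBihol E ∧
        ((0 : ℂ), t) ∈ E.source ∧ blowMap j (E (0, t)) = 0 ∧
        ∀ y' ∈ E.source, blowMap j (E y') = H (blowMap false y') := by
    intro H K hH hK h0 hK0 hKH hHK t
    obtain ⟨P, hP, hHP⟩ := exists_blowMap_factor hH h0
    have hPne := blowMap_factor_ne_zero h0 hK hKH (hP t) (hHP t)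
    by_cases h1 : (P (0, t)).1 = 0
    · have h2 : (P (0, t)).2 ≠ 0 := fun h2 => hPne (Prod.ext h1 h2)
      have hK' : AnalyticAt ℂ (K ∘ Prod.swap) 0 :=
        AnalyticAt.comp (g := K) (f := Prod.swap) hK (analyticAt_swap 0)
      obtain ⟨Q, hQ, hKQ⟩ := exists_blowMap_factor hK' (by simpa using hK0)
      have hsw : Filter.Tendsto (Prod.swap : ℂ × ℂ → ℂ × ℂ) (𝓝 0) (𝓝 0) :=
        (analyticAt_swap 0).continuousAt
      obtain ⟨E, hE, hyE, hE0, hEH⟩ := key (H := Prod.swap ∘ H) (K := K ∘ Prod.swap)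
        (P := Prod.swap ∘ P) ((analyticAt_swap _).comp hH) hK' (by simp [h0]) (by simpa using hK0)
        (by filter_upwards [hKH] with x hx; simpa using hx)
        (by filter_upwards [hsw.eventually hHK] with x hx; simp [hx])
        (fun t => (analyticAt_swap _).comp (hP t))
        (fun t => by filter_upwards [hHP t] with y hy; simp [hy]) hQ hKQ t h2
      refine ⟨true, E.trans swapPH, hE.trans isBihol_swapPH, ⟨hyE, trivial⟩, ?_, fun y' hy' => ?_⟩
      · change blowMap (!false) (E (0, t)).swap = 0
        rw [blowMap_not_swap, hE0]
        rfl
      · change blowMap (!false) (E y').swap = _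
        rw [blowMap_not_swap, hEH _ hy'.1]
        simp
    · obtain ⟨Q, hQ, hKQ⟩ := exists_blowMap_factor hK hK0
      exact ⟨false, key hH hK h0 hK0 hKH hHK hP hHP hQ hKQ t h1⟩
  cases i
  · obtain ⟨s, t⟩ := y
    obtain rfl : s = 0 := blowMap_eq_zero.1 hy
    exact key2 hH hK h0 hK0 hKH hHK t
  · obtain ⟨s, t⟩ := y
    obtain rfl : t = 0 := by
      have := congrArg Prod.snd hy
      simpa [blowMap] using this
    have hsw : Filter.Tendsto (Prod.swap : ℂ × ℂ → ℂ × ℂ) (𝓝 0) (𝓝 0) :=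
      (analyticAt_swap 0).continuousAt
    obtain ⟨j, E, hE, hyE, hE0, hEH⟩ := key2 (H := H ∘ Prod.swap) (K := Prod.swap ∘ K)
      (AnalyticAt.comp (g := H) (f := Prod.swap) hH (analyticAt_swap 0))
      ((analyticAt_swap _).comp hK) (by simpa using h0) (by simp [hK0])
      (by filter_upwards [hsw.eventually hKH] with x hx; simp [hx])
      (by filter_upwards [hHK] with x hx; simpa using hx) s
    refine ⟨j, swapPH.trans E, isBihol_swapPH.trans hE, ⟨trivial, hyE⟩, hE0, fun y' hy' => ?_⟩
    change blowMap j (E y'.swap) = _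
    have h1 := hEH _ hy'.2
    have h2 := blowMap_not_swap true y'
    rw [Bool.not_true] at h2
    change blowMap j (E y'.swap) = H (blowMap false y'.swap).swap at h1
    rw [h1, h2, Prod.swap_swap]

section BlowupCharts

variable {X Y : Type u} [TopologicalSpace X] [HolSpace X] [TopologicalSpace Y] [HolSpace Y]

lemma IsBihol.analyticAt {e : OpenPartialHomeomorph (ℂ × ℂ) (ℂ × ℂ)} (he : IsBihol e)
    {x : ℂ × ℂ} (hx : x ∈ e.source) : AnalyticAt ℂ e x :=
  ((holAt_iff_analyticAt.1 ((he x hx Prod.fst).1 (holAt_iff_analyticAt.2 analyticAt_fst)))).prod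
    (holAt_iff_analyticAt.1 ((he x hx Prod.snd).1 (holAt_iff_analyticAt.2 analyticAt_snd)))

/-- The two standard charts of a point blow-up, indexed by a Boolean. -/
lemma IsPointBlowup.exists_charts {b : X → Y} {c : Y} (hb : IsPointBlowup b c) :
    ∃ (e : OpenPartialHomeomorph Y (ℂ × ℂ)) (k : Bool → OpenPartialHomeomorph X (ℂ × ℂ)),
      IsBihol e ∧ (∀ i, IsBihol (k i)) ∧ c ∈ e.source ∧ e c = 0 ∧
      (∀ x, b x ∈ e.source ↔ ∃ i, x ∈ (k i).source) ∧
      (∀ i y, y ∈ (k i).target ↔ blowMap i y ∈ e.target) ∧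
      (∀ i, ∀ y ∈ (k i).target, b ((k i).symm y) = e.symm (blowMap i y)) ∧
      (∀ y ∈ (k false).target, ∀ y' ∈ (k true).target,
        (k false).symm y = (k true).symm y' ↔ y.2 ≠ 0 ∧ y' = (y.2⁻¹, y.1 * y.2)) := by
  obtain ⟨-, -, e, c₁, c₂, he, h1, h2, hc, hc0, hs, ht1, ht2, hb1, hb2, hg⟩ := hb
  refine ⟨e, fun i => if i then c₂ else c₁, isBihol_iff_isHolChart.2 he, ?_, hc, hc0, ?_, ?_, ?_,
    hg⟩
  · rintro (_ | _)
    exacts [isBihol_iff_isHolChart.2 h1, isBihol_iff_isHolChart.2 h2]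
  · intro x
    have : x ∈ b ⁻¹' e.source ↔ x ∈ c₁.source ∪ c₂.source := by rw [hs]
    simpa using this
  · rintro (_ | _) y
    exacts [by simp [ht1, blowMap], by simp [ht2, blowMap]]
  · rintro (_ | _) y hy
    exacts [hb1 y hy, hb2 y hy]

lemma IsPointBlowup.injOn {b : X → Y} {c : Y} (hb : IsPointBlowup b c) {x x' : X}
    (hx : b x ≠ c) (h : b x = b x') : x = x' := by
  obtain ⟨-, ⟨e, hes, -, heq, -⟩, -⟩ := hb
  have h1 : x ∈ e.source := by rw [hes]; exact hx
  have h2 : x' ∈ e.source := by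
    rw [hes]
    change b x' ≠ c
    rwa [← h]
  exact e.injOn h1 h2 (by rw [← heq h1, ← heq h2, h])

lemma IsPointBlowup.exists_preimage {b : X → Y} {c y : Y} (hb : IsPointBlowup b c)
    (hy : y ≠ c) : ∃ x, b x = y := by
  obtain ⟨-, ⟨e, hes, het, heq, -⟩, -⟩ := hb
  have h1 : y ∈ e.target := by rw [het]; exact hy
  exact ⟨e.symm y, by rw [heq (e.map_target h1), e.right_inv h1]⟩

/-- Away from the exceptional curve a blow-up is locally biholomorphic. -/
lemma IsPointBlowup.exists_bihol {b : X → Y} {c : Y} (hb : IsPointBlowup b c) {x : X}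
    (hx : b x ≠ c) : ∃ e : OpenPartialHomeomorph X Y, IsBihol e ∧ x ∈ e.source ∧
      ∀ x' ∈ e.source, e x' = b x' := by
  obtain ⟨-, ⟨e, hes, -, heq, hol⟩, -⟩ := hb
  exact ⟨e, hol, by rw [hes]; exact hx, fun x' hx' => (heq hx').symm⟩

/-- The blow-up of a point of a Hausdorff surface is Hausdorff. -/
lemma IsPointBlowup.t2Space [T2Space Y] {b : X → Y} {c : Y} (hb : IsPointBlowup b c) :
    T2Space X := by
  have hcont := hb.1
  obtain ⟨e, k, -, -, hc, hc0, hs, ht, hbk, hg⟩ := hb.exists_charts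
  -- two points of one chart can be separated in it
  have hchart : ∀ i x x', x ∈ (k i).source → x' ∈ (k i).source → x ≠ x' →
      ∃ U V : Set X, IsOpen U ∧ IsOpen V ∧ x ∈ U ∧ x' ∈ V ∧ Disjoint U V := by
    intro i x x' hx hx' hne
    obtain ⟨U, V, hU, hV, hxU, hxV, hUV⟩ :=
      t2_separation (fun h => hne ((k i).injOn hx hx' h) : k i x ≠ k i x')
    refine ⟨_, _, (k i).isOpen_inter_preimage hU, (k i).isOpen_inter_preimage hV, ⟨hx, hxU⟩,
      ⟨hx', hxV⟩, ?_⟩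
    exact (hUV.preimage (k i)).mono Set.inter_subset_right Set.inter_subset_right
  -- a point of the exceptional curve outside one chart is the origin of the other one
  have hor1 : ∀ x, b x = c → x ∈ (k false).source → x ∉ (k true).source → k false x = 0 := by
    intro x hxc hx hx'
    have hy := (k false).map_source hx
    have hx0 : (k false).symm (k false x) = x := (k false).left_inv hx
    have h1 := hbk false _ hy
    rw [hx0, hxc] at h1
    have h2 := (ht false _).1 hy
    have h3 : blowMap false (k false x) = 0 := by rw [← hc0, h1, e.right_inv h2]
    have h4 := blowMap_eq_zero.1 h3
    by_contra h5
    have h6 : (k false x).2 ≠ 0 := fun h6 => h5 (Prod.ext h4 h6)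
    have h7 : (((k false x).2)⁻¹, (k false x).1 * (k false x).2) ∈ (k true).target := by
      rw [ht, blowMap_true]
      rw [blowMap_false] at h2
      convert h2 using 2
      field_simp
    have h8 := (hg _ hy _ h7).2 ⟨h6, rfl⟩
    rw [hx0] at h8
    exact hx' (h8 ▸ (k true).map_target h7)
  have hor2 : ∀ x, b x = c → x ∈ (k true).source → x ∉ (k false).source → k true x = 0 := by
    intro x hxc hx hx'
    have hy := (k true).map_source hx
    have hx0 : (k true).symm (k true x) = x := (k true).left_inv hx
    have h1 := hbk true _ hy
    rw [hx0, hxc] at h1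
    have h2 := (ht true _).1 hy
    have h3 : blowMap true (k true x) = 0 := by rw [← hc0, h1, e.right_inv h2]
    have h4 : (k true x).2 = 0 := congrArg Prod.snd h3
    by_contra h5
    have h6 : (k true x).1 ≠ 0 := fun h6 => h5 (Prod.ext h6 h4)
    have h7 : (((k true x).1 * (k true x).2), ((k true x).1)⁻¹) ∈ (k false).target := by
      rw [ht, blowMap_false]
      rw [blowMap_true] at h2
      convert h2 using 2
      field_simp
    have h8 := (hg _ h7 _ hy).2 ⟨inv_ne_zero h6, by ext <;> field_simp⟩
    rw [hx0] at h8
    exact hx' (h8 ▸ (k false).map_target h7)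
  have hmixed : ∀ x x', b x = c → b x' = c → x ∈ (k false).source → x ∉ (k true).source →
      x' ∈ (k true).source → x' ∉ (k false).source →
      ∃ U V : Set X, IsOpen U ∧ IsOpen V ∧ x ∈ U ∧ x' ∈ V ∧ Disjoint U V := by
    intro x x' hxc hxc' h1 h2 h3 h4
    have hx0 := hor1 x hxc h1 h2
    have hx0' := hor2 x' hxc' h3 h4
    have ho1 : IsOpen {y : ℂ × ℂ | ‖y.2‖ < 1} := isOpen_lt (by fun_prop) (by fun_prop)
    have ho2 : IsOpen {y : ℂ × ℂ | ‖y.1‖ < 1} := isOpen_lt (by fun_prop) (by fun_prop)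
    refine ⟨_, _, (k false).isOpen_inter_preimage ho1, (k true).isOpen_inter_preimage ho2,
      ⟨h1, by simp [hx0]⟩, ⟨h3, by simp [hx0']⟩, ?_⟩
    rw [Set.disjoint_left]
    rintro z ⟨hz1, hz2⟩ ⟨hz3, hz4⟩
    obtain ⟨h5, h6⟩ := (hg _ ((k false).map_source hz1) _ ((k true).map_source hz3)).1
      (by rw [(k false).left_inv hz1, (k true).left_inv hz3])
    have hz2' : ‖(k false z).2‖ < 1 := hz2
    have hz4' : ‖(k true z).1‖ < 1 := hz4
    rw [h6, norm_inv] at hz4'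
    have := norm_pos_iff.2 h5
    exact absurd hz4' (not_lt.2 (one_le_inv_iff₀.2 ⟨this, hz2'.le⟩))
  refine ⟨fun x x' hne => ?_⟩
  by_cases hbb : b x = b x'
  · by_cases hxc : b x = c
    · have hxc' : b x' = c := hbb ▸ hxc
      obtain ⟨i, hi⟩ := (hs x).1 (by rwa [hxc])
      obtain ⟨j, hj⟩ := (hs x').1 (by rwa [hxc'])
      by_cases h1 : x' ∈ (k i).source
      · exact hchart i x x' hi h1 hne
      by_cases h2 : x ∈ (k j).source
      · exact hchart j x x' h2 hj hne
      cases i <;> cases j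
      · exact absurd hj h1
      · exact hmixed x x' hxc hxc' hi h2 hj h1
      · obtain ⟨U, V, hU, hV, h3, h4, h5⟩ := hmixed x' x hxc' hxc hj h1 hi h2
        exact ⟨V, U, hV, hU, h4, h3, h5.symm⟩
      · exact absurd hj h1
    · exact absurd (hb.injOn hxc hbb) hne
  · obtain ⟨U, V, hU, hV, h1, h2, h3⟩ := t2_separation hbb
    exact ⟨_, _, hU.preimage hcont, hV.preimage hcont, h1, h2, h3.preimage b⟩

/-- In the definition of a blow-up, the coordinates centred at `c` may be chosen freely: near the
points of the exceptional curve there are coordinates in which the blow-up has the standard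
form with respect to the given chart, and all points of the standard charts occur. -/
lemma IsPointBlowup.charts {b : X → Y} {c : Y} (hb : IsPointBlowup b c)
    {κ : OpenPartialHomeomorph Y (ℂ × ℂ)} (hκ : IsBihol κ) (hc : c ∈ κ.source) (h0 : κ c = 0) :
    (∀ x, b x = c → ∃ (j : Bool) (κ' : OpenPartialHomeomorph X (ℂ × ℂ)), IsBihol κ' ∧
      x ∈ κ'.source ∧ blowMap j (κ' x) = 0 ∧
      ∀ x' ∈ κ'.source, b x' ∈ κ.source ∧ κ (b x') = blowMap j (κ' x')) ∧
    (∀ j y, blowMap j y = 0 → ∃ x, b x = c ∧ ∃ κ' : OpenPartialHomeomorph X (ℂ × ℂ),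
      IsBihol κ' ∧ x ∈ κ'.source ∧ κ' x = y ∧
      ∀ x' ∈ κ'.source, b x' ∈ κ.source ∧ κ (b x') = blowMap j (κ' x')) := by
  have hcont := hb.1
  obtain ⟨e, k, he, hk, hce, he0, hs, ht, hbk, -⟩ := hb.exists_charts
  have hH : IsBihol (e.symm.trans κ) := he.symm.trans hκ
  have hK : IsBihol (κ.symm.trans e) := hκ.symm.trans he
  have hes : e.symm 0 = c := by rw [← he0, e.left_inv hce]
  have hκs : κ.symm 0 = c := by rw [← h0, κ.left_inv hc]
  have h0H : (0 : ℂ × ℂ) ∈ (e.symm.trans κ).source := by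
    refine ⟨by simpa [he0] using e.map_source hce, ?_⟩
    change e.symm 0 ∈ κ.source
    rwa [hes]
  have h0K : (0 : ℂ × ℂ) ∈ (κ.symm.trans e).source := by
    refine ⟨by simpa [h0] using κ.map_source hc, ?_⟩
    change κ.symm 0 ∈ e.source
    rwa [hκs]
  have hHa := hH.analyticAt h0H
  have hKa := hK.analyticAt h0K
  have hH0 : (e.symm.trans κ) 0 = 0 := by
    change κ (e.symm 0) = 0
    rw [hes, h0]
  have hK0 : (κ.symm.trans e) 0 = 0 := by
    change e (κ.symm 0) = 0
    rw [hκs, he0]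
  have hKH : ∀ᶠ x in 𝓝 0, (κ.symm.trans e) ((e.symm.trans κ) x) = x := by
    filter_upwards [(e.symm.trans κ).open_source.mem_nhds h0H] with x hx
    have h1 : x ∈ e.target := hx.1
    have h2 : e.symm x ∈ κ.source := hx.2
    change e (κ.symm (κ (e.symm x))) = x
    rw [κ.left_inv h2, e.right_inv h1]
  have hHK : ∀ᶠ x in 𝓝 0, (e.symm.trans κ) ((κ.symm.trans e) x) = x := by
    filter_upwards [(κ.symm.trans e).open_source.mem_nhds h0K] with x hx
    have h1 : x ∈ κ.target := hx.1
    have h2 : κ.symm x ∈ e.source := hx.2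
    change κ (e.symm (e (κ.symm x))) = x
    rw [e.left_inv h2, κ.right_inv h1]
  have hko : IsOpen (b ⁻¹' κ.source) := κ.open_source.preimage hcont
  refine ⟨fun x hx => ?_, fun j y hy => ?_⟩
  · obtain ⟨i, hi⟩ := (hs x).1 (by rwa [hx])
    have hy := (k i).map_source hi
    have hb0 : blowMap i (k i x) = 0 := by
      have h1 := hbk i _ hy
      rw [(k i).left_inv hi, hx] at h1
      rw [← he0, h1, e.right_inv ((ht i _).1 hy)]
    obtain ⟨j, E, hE, hyE, hE0, hEH⟩ := exists_blowMap_lift hHa hKa hH0 hKH hHK i _ hb0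
    refine ⟨j, ((k i).trans E).restrOpen _ hko, ((hk i).trans hE).restr hko, ⟨⟨hi, hyE⟩, ?_⟩, hE0,
      fun x' hx' => ⟨hx'.2, ?_⟩⟩
    · change b x ∈ κ.source
      rwa [hx]
    · have h1 := hEH _ hx'.1.2
      have h2 := hbk i _ ((k i).map_source hx'.1.1)
      rw [(k i).left_inv hx'.1.1] at h2
      rw [h2]
      exact h1.symm
  · obtain ⟨i, E, hE, hyE, hE0, hEH⟩ := exists_blowMap_lift hKa hHa hK0 hHK hKH j y hy
    have hyt : E y ∈ (k i).target := by
      rw [ht, hE0, ← he0]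
      exact e.map_source hce
    have hbx : b ((k i).symm (E y)) = c := by rw [hbk i _ hyt, hE0, hes]
    have hV : IsOpen {x' | x' ∈ (κ.symm.trans e).source} := (κ.symm.trans e).open_source
    have hbc : Continuous (blowMap j) :=
      continuous_iff_continuousAt.2 fun y => (analyticAt_blowMap j y).continuousAt
    let κ' := (k i).trans E.symm
    have hx0 : (k i).symm (E y) ∈ κ'.source := ⟨(k i).map_target hyt, by
      change k i ((k i).symm (E y)) ∈ E.target
      rw [(k i).right_inv hyt]
      exact E.map_source hyE⟩
    have hκx : κ' ((k i).symm (E y)) = y := by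
      change E.symm (k i ((k i).symm (E y))) = y
      rw [(k i).right_inv hyt, E.left_inv hyE]
    have hW := κ'.isOpen_inter_preimage (hV.preimage hbc)
    refine ⟨(k i).symm (E y), hbx, κ'.restrOpen _ hW,
      ((hk i).trans hE.symm).restr hW, ⟨hx0, hx0, ?_⟩, hκx, ?_⟩
    · change blowMap j (κ' _) ∈ (κ.symm.trans e).source
      rw [hκx, hy]
      exact h0K
    · rintro x' ⟨⟨h1, h2⟩, -, h3⟩
      replace h1 : x' ∈ (k i).source := h1
      replace h2 : k i x' ∈ E.target := h2
      have h4 : b x' = e.symm (blowMap i (k i x')) := by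
        rw [← hbk i _ ((k i).map_source h1), (k i).left_inv h1]
      have h5 := hEH _ (E.map_target h2)
      rw [E.right_inv h2] at h5
      have h6 : blowMap j (κ' x') ∈ (κ.symm.trans e).source := h3
      have h7 : b x' = κ.symm (blowMap j (κ' x')) := by
        rw [h4]
        change _ = e (κ.symm (blowMap j (κ' x'))) at h5
        have h8 : κ.symm (blowMap j (κ' x')) ∈ e.source := h6.2
        rw [h5, e.left_inv h8]
      rw [h7]
      exact ⟨κ.map_target h6.1, κ.right_inv h6.1⟩

end BlowupCharts

section BlowupExistence

variable {W : Type u} [TopologicalSpace W]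

/-- The blow-up of `W` at the centre `c` of the chart `κ`, as a set. The point `x ≠ c` of `W` is
`inl x`, and the exceptional curve consists of the points `inr t = [1 : t]` and `inl c = [0 : 1]`. -/
def Blowup (_κ : OpenPartialHomeomorph W (ℂ × ℂ)) (_c : W) : Type u := W ⊕ ULift.{u} ℂ

namespace Blowup

variable (κ : OpenPartialHomeomorph W (ℂ × ℂ)) (c : W)

/-- The points of the blow-up which lie over a point `x ≠ c`, and the point `[0 : 1]` over `c`. -/
def inl (x : W) : Blowup κ c := Sum.inl x

/-- The point `[1 : t]` of the exceptional curve. -/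
def inr (t : ℂ) : Blowup κ c := Sum.inr ⟨t⟩

/-- The blow-up map. -/
def proj : Blowup κ c → W := Sum.elim id fun _ => c

/-- The parametrization `(s, t) ↦ (s, s t)` of the blow-up. -/
def par₁ (y : ℂ × ℂ) : Blowup κ c :=
  open Classical in if y.1 = 0 then inr κ c y.2 else inl κ c (κ.symm (y.1, y.1 * y.2))

/-- The parametrization `(s, t) ↦ (s t, t)` of the blow-up. -/
def par₂ (y : ℂ × ℂ) : Blowup κ c :=
  open Classical in
  if y.2 = 0 ∧ y.1 ≠ 0 then inr κ c y.1⁻¹ else inl κ c (κ.symm (y.1 * y.2, y.2))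

/-- The inverse of `par₁`. -/
def coord₁ : Blowup κ c → ℂ × ℂ :=
  Sum.elim (fun x => ((κ x).1, (κ x).2 / (κ x).1)) fun t => (0, t.down)

/-- The inverse of `par₂`. -/
def coord₂ : Blowup κ c → ℂ × ℂ :=
  Sum.elim (fun x => ((κ x).1 / (κ x).2, (κ x).2)) fun t => (t.down⁻¹, 0)

/-- The domain of definition of `par₁`. -/
def dom₁ : Set (ℂ × ℂ) := {y | (y.1, y.1 * y.2) ∈ κ.target}

/-- The domain of definition of `par₂`. -/
def dom₂ : Set (ℂ × ℂ) := {y | (y.1 * y.2, y.2) ∈ κ.target}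

lemma isOpen_dom₁ : IsOpen (dom₁ κ) := κ.open_target.preimage (by fun_prop)

lemma isOpen_dom₂ : IsOpen (dom₂ κ) := κ.open_target.preimage (by fun_prop)

/-- A set is open if it is so in the complement of `c` and in the two parametrizations. -/
instance : TopologicalSpace (Blowup κ c) where
  IsOpen U := (∀ x, x ≠ c → inl κ c x ∈ U → ∀ᶠ x' in 𝓝 x, inl κ c x' ∈ U) ∧
    (∀ y ∈ dom₁ κ, par₁ κ c y ∈ U → ∀ᶠ y' in 𝓝 y, par₁ κ c y' ∈ U) ∧
    ∀ y ∈ dom₂ κ, par₂ κ c y ∈ U → ∀ᶠ y' in 𝓝 y, par₂ κ c y' ∈ U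
  isOpen_univ := by simp
  isOpen_inter := by
    rintro U V ⟨h1, h2, h3⟩ ⟨h1', h2', h3'⟩
    exact ⟨fun x hx hU => (h1 x hx hU.1).and (h1' x hx hU.2),
      fun y hy hU => (h2 y hy hU.1).and (h2' y hy hU.2),
      fun y hy hU => (h3 y hy hU.1).and (h3' y hy hU.2)⟩
  isOpen_sUnion := by
    rintro s hs
    refine ⟨fun x hx => ?_, fun y hy => ?_, fun y hy => ?_⟩
    · rintro ⟨t, ht, hxt⟩
      exact ((hs t ht).1 x hx hxt).mono fun _ h => ⟨t, ht, h⟩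
    · rintro ⟨t, ht, hxt⟩
      exact ((hs t ht).2.1 y hy hxt).mono fun _ h => ⟨t, ht, h⟩
    · rintro ⟨t, ht, hxt⟩
      exact ((hs t ht).2.2 y hy hxt).mono fun _ h => ⟨t, ht, h⟩

lemma isOpen_def {U : Set (Blowup κ c)} : IsOpen U ↔
    (∀ x, x ≠ c → inl κ c x ∈ U → ∀ᶠ x' in 𝓝 x, inl κ c x' ∈ U) ∧
    (∀ y ∈ dom₁ κ, par₁ κ c y ∈ U → ∀ᶠ y' in 𝓝 y, par₁ κ c y' ∈ U) ∧
    ∀ y ∈ dom₂ κ, par₂ κ c y ∈ U → ∀ᶠ y' in 𝓝 y, par₂ κ c y' ∈ U := Iff.rfl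

lemma continuousAt_inl {x : W} (hx : x ≠ c) : ContinuousAt (inl κ c) x := by
  intro s hs
  obtain ⟨U, hUs, hU, hxU⟩ := mem_nhds_iff.1 hs
  exact (hU.1 x hx hxU).mono fun _ h => hUs h

lemma continuousAt_par₁ {y : ℂ × ℂ} (hy : y ∈ dom₁ κ) : ContinuousAt (par₁ κ c) y := by
  intro s hs
  obtain ⟨U, hUs, hU, hxU⟩ := mem_nhds_iff.1 hs
  exact (hU.2.1 y hy hxU).mono fun _ h => hUs h

lemma continuousAt_par₂ {y : ℂ × ℂ} (hy : y ∈ dom₂ κ) : ContinuousAt (par₂ κ c) y := by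
  intro s hs
  obtain ⟨U, hUs, hU, hxU⟩ := mem_nhds_iff.1 hs
  exact (hU.2.2 y hy hxU).mono fun _ h => hUs h

/-- A function is holomorphic if it is so in the complement of `c` and in the two
parametrizations. -/
instance [HolSpace W] : HolSpace (Blowup κ c) where
  HolAt f z := (∀ x, x ≠ c → inl κ c x = z → HolSpace.HolAt (f ∘ inl κ c) x) ∧
    (∀ y ∈ dom₁ κ, par₁ κ c y = z → AnalyticAt ℂ (f ∘ par₁ κ c) y) ∧
    ∀ y ∈ dom₂ κ, par₂ κ c y = z → AnalyticAt ℂ (f ∘ par₂ κ c) y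
  congr := by
    rintro f g z hfg ⟨h1, h2, h3⟩
    refine ⟨?_, ?_, ?_⟩
    · rintro x hx rfl
      exact HolSpace.congr ((continuousAt_inl κ c hx).eventually hfg) (h1 x hx rfl)
    · rintro y hy rfl
      exact (h2 y hy rfl).congr ((continuousAt_par₁ κ c hy).eventually hfg)
    · rintro y hy rfl
      exact (h3 y hy rfl).congr ((continuousAt_par₂ κ c hy).eventually hfg)

lemma holAt_def [HolSpace W] {f : Blowup κ c → ℂ} {z : Blowup κ c} : HolSpace.HolAt f z ↔
    (∀ x, x ≠ c → inl κ c x = z → HolSpace.HolAt (f ∘ inl κ c) x) ∧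
    (∀ y ∈ dom₁ κ, par₁ κ c y = z → AnalyticAt ℂ (f ∘ par₁ κ c) y) ∧
    ∀ y ∈ dom₂ κ, par₂ κ c y = z → AnalyticAt ℂ (f ∘ par₂ κ c) y := Iff.rfl

lemma inl_injective : Function.Injective (inl κ c) := Sum.inl_injective

lemma inl_ne_inr (x : W) (t : ℂ) : inl κ c x ≠ inr κ c t := Sum.inl_ne_inr

lemma inr_inj {t t' : ℂ} : inr κ c t = inr κ c t' ↔ t = t' :=
  ⟨fun h => congrArg ULift.down (Sum.inr_injective h), fun h => h ▸ rfl⟩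

lemma par₁_of_ne {y : ℂ × ℂ} (hy : y.1 ≠ 0) :
    par₁ κ c y = inl κ c (κ.symm (y.1, y.1 * y.2)) := if_neg hy

lemma par₁_zero (t : ℂ) : par₁ κ c (0, t) = inr κ c t := if_pos rfl

lemma par₂_of_ne {y : ℂ × ℂ} (hy : y.2 ≠ 0) :
    par₂ κ c y = inl κ c (κ.symm (y.1 * y.2, y.2)) := if_neg fun h => hy h.1

lemma par₂_zero {s : ℂ} (hs : s ≠ 0) : par₂ κ c (s, 0) = inr κ c s⁻¹ := if_pos ⟨rfl, hs⟩

lemma par₂_zero_zero : par₂ κ c (0, 0) = inl κ c (κ.symm 0) := by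
  simp [par₂]
  rfl

variable {κ c}

lemma symm_zero (hc : c ∈ κ.source) (h0 : κ c = 0) : κ.symm 0 = c := by
  rw [← h0, κ.left_inv hc]

lemma symm_eq_center (hc : c ∈ κ.source) (h0 : κ c = 0) {y : ℂ × ℂ} (hy : y ∈ κ.target) :
    κ.symm y = c ↔ y = 0 := by
  constructor
  · intro h
    rw [← κ.right_inv hy, h, h0]
  · rintro rfl
    exact symm_zero hc h0

lemma par₁_eq_par₂ (hc : c ∈ κ.source) (h0 : κ c = 0) {y y' : ℂ × ℂ} (hy : y ∈ dom₁ κ)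
    (hy' : y' ∈ dom₂ κ) :
    par₁ κ c y = par₂ κ c y' ↔ y.2 ≠ 0 ∧ y' = (y.2⁻¹, y.1 * y.2) := by
  obtain ⟨s, t⟩ := y
  obtain ⟨s', t'⟩ := y'
  rcases eq_or_ne s 0 with rfl | hs
  · rw [par₁_zero]
    rcases eq_or_ne t' 0 with rfl | ht
    · rcases eq_or_ne s' 0 with rfl | hs'
      · rw [par₂_zero_zero]
        simp only [(inl_ne_inr κ c _ _).symm, Prod.mk.injEq, zero_mul, and_true, false_iff, not_and]
        intro h h'
        exact h (inv_eq_zero.1 h'.symm)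
      · rw [par₂_zero κ c hs', inr_inj]
        simp only [Prod.mk.injEq, zero_mul, and_true]
        constructor
        · rintro rfl
          exact ⟨inv_ne_zero hs', by simp⟩
        · rintro ⟨-, rfl⟩
          simp
    · rw [par₂_of_ne κ c ht]
      simp [(inl_ne_inr κ c _ _).symm, ht]
  · rw [par₁_of_ne κ c hs]
    rcases eq_or_ne t' 0 with rfl | ht
    · have h1 : ∀ t : ℂ, t ≠ 0 → (0 : ℂ) ≠ s * t := fun t ht => (mul_ne_zero hs ht).symm
      rcases eq_or_ne s' 0 with rfl | hs'
      · rw [par₂_zero_zero, (inl_injective κ c).eq_iff, symm_zero hc h0, symm_eq_center hc h0 hy]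
        simp only [Prod.mk_eq_zero, hs, false_and, Prod.mk.injEq, false_iff, not_and]
        exact fun h _ => h1 t h
      · rw [par₂_zero κ c hs']
        simp only [inl_ne_inr, Prod.mk.injEq, false_iff, not_and]
        exact fun h _ => h1 t h
    · rw [par₂_of_ne κ c ht, (inl_injective κ c).eq_iff, κ.symm.injOn.eq_iff hy hy']
      simp only [Prod.mk.injEq]
      constructor
      · rintro ⟨rfl, h⟩
        have h2 : t ≠ 0 := by
          rintro rfl
          simp at h
          exact ht h.symm
        refine ⟨h2, ?_, h.symm⟩
        refine eq_inv_of_mul_eq_one_left ?_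
        refine mul_left_cancel₀ ht ?_
        linear_combination h
      · rintro ⟨h2, rfl, rfl⟩
        exact ⟨by field_simp, rfl⟩

lemma coord₁_par₁ {y : ℂ × ℂ} (hy : y ∈ dom₁ κ) : coord₁ κ c (par₁ κ c y) = y := by
  obtain ⟨s, t⟩ := y
  rcases eq_or_ne s 0 with rfl | hs
  · rw [par₁_zero]
    rfl
  · rw [par₁_of_ne κ c hs]
    change ((κ (κ.symm (s, s * t))).1, (κ (κ.symm (s, s * t))).2 / (κ (κ.symm (s, s * t))).1) = _
    rw [κ.right_inv hy]
    ext
    · rfl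
    · field_simp

lemma coord₂_par₂ {y : ℂ × ℂ} (hy : y ∈ dom₂ κ) : coord₂ κ c (par₂ κ c y) = y := by
  obtain ⟨s, t⟩ := y
  rcases eq_or_ne t 0 with rfl | ht
  · rcases eq_or_ne s 0 with rfl | hs
    · have hy' : (0 : ℂ × ℂ) ∈ κ.target := by
        have h1 : ((0 : ℂ) * 0, (0 : ℂ)) ∈ κ.target := hy
        rwa [mul_zero] at h1
      rw [par₂_zero_zero]
      change ((κ (κ.symm 0)).1 / (κ (κ.symm 0)).2, (κ (κ.symm 0)).2) = _
      rw [κ.right_inv hy']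
      simp
    · rw [par₂_zero κ c hs]
      change ((s⁻¹)⁻¹, (0 : ℂ)) = _
      rw [inv_inv]
  · rw [par₂_of_ne κ c ht]
    change ((κ (κ.symm (s * t, t))).1 / (κ (κ.symm (s * t, t))).2, (κ (κ.symm (s * t, t))).2) = _
    rw [κ.right_inv hy]
    ext
    · field_simp
    · rfl

lemma inl_eq_par₁ {x : W} (hx : x ∈ κ.source) (h : (κ x).1 ≠ 0) :
    inl κ c x = par₁ κ c ((κ x).1, (κ x).2 / (κ x).1) := by
  rw [par₁_of_ne κ c (y := ((κ x).1, (κ x).2 / (κ x).1)) h]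
  have h1 : ((κ x).1, (κ x).1 * ((κ x).2 / (κ x).1)) = κ x := by
    ext
    · rfl
    · field_simp
  rw [h1, κ.left_inv hx]

lemma inl_eq_par₂ {x : W} (hx : x ∈ κ.source) (h : (κ x).2 ≠ 0) :
    inl κ c x = par₂ κ c ((κ x).1 / (κ x).2, (κ x).2) := by
  rw [par₂_of_ne κ c (y := ((κ x).1 / (κ x).2, (κ x).2)) h]
  have h1 : ((κ x).1 / (κ x).2 * (κ x).2, (κ x).2) = κ x := by
    ext
    · field_simp
    · rfl
  rw [h1, κ.left_inv hx]

lemma of_par₁_eq_inl {x : W} {y : ℂ × ℂ} (hy : y ∈ dom₁ κ) (h : par₁ κ c y = inl κ c x) :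
    y.1 ≠ 0 ∧ x = κ.symm (blowMap false y) ∧ x ∈ κ.source ∧ κ x = blowMap false y := by
  have h1 : y.1 ≠ 0 := fun h1 => by
    obtain ⟨s, t⟩ := y
    obtain rfl : s = 0 := h1
    rw [par₁_zero] at h
    exact inl_ne_inr κ c _ _ h.symm
  rw [par₁_of_ne κ c h1, (inl_injective κ c).eq_iff] at h
  refine ⟨h1, h.symm, ?_, ?_⟩
  · rw [← h]
    exact κ.map_target hy
  · rw [← h]
    exact κ.right_inv hy

lemma of_par₂_eq_inl (hc : c ∈ κ.source) (h0 : κ c = 0) {x : W} (hx : x ≠ c) {y : ℂ × ℂ}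
    (hy : y ∈ dom₂ κ) (h : par₂ κ c y = inl κ c x) :
    y.2 ≠ 0 ∧ x = κ.symm (blowMap true y) ∧ x ∈ κ.source ∧ κ x = blowMap true y := by
  have h1 : y.2 ≠ 0 := fun h1 => by
    obtain ⟨s, t⟩ := y
    obtain rfl : t = 0 := h1
    rcases eq_or_ne s 0 with rfl | hs
    · rw [par₂_zero_zero, (inl_injective κ c).eq_iff, symm_zero hc h0] at h
      exact hx h.symm
    · rw [par₂_zero κ c hs] at h
      exact inl_ne_inr κ c _ _ h.symm
  rw [par₂_of_ne κ c h1, (inl_injective κ c).eq_iff] at h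
  refine ⟨h1, h.symm, ?_, ?_⟩
  · rw [← h]
    exact κ.map_target hy
  · rw [← h]
    exact κ.right_inv hy

lemma continuousAt_div₁ {x : W} (hx : x ∈ κ.source) (h : (κ x).1 ≠ 0) :
    ContinuousAt (fun x => ((κ x).1, (κ x).2 / (κ x).1)) x := by
  have h1 := κ.continuousAt hx
  exact (continuous_fst.continuousAt.comp h1).prodMk
    ((continuous_snd.continuousAt.comp h1).div (continuous_fst.continuousAt.comp h1) h)

lemma continuousAt_div₂ {x : W} (hx : x ∈ κ.source) (h : (κ x).2 ≠ 0) :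
    ContinuousAt (fun x => ((κ x).1 / (κ x).2, (κ x).2)) x := by
  have h1 := κ.continuousAt hx
  exact ((continuous_fst.continuousAt.comp h1).div (continuous_snd.continuousAt.comp h1) h).prodMk
    (continuous_snd.continuousAt.comp h1)

/-- The change of parametrizations from `par₁` to `par₂`. -/
lemma par₁_eq {y : ℂ × ℂ} (hc : c ∈ κ.source) (h0 : κ c = 0) (hy : y ∈ dom₁ κ) (h : y.2 ≠ 0) :
    (y.2⁻¹, y.1 * y.2) ∈ dom₂ κ ∧ par₁ κ c y = par₂ κ c (y.2⁻¹, y.1 * y.2) := by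
  have h1 : (y.2⁻¹, y.1 * y.2) ∈ dom₂ κ := by
    have h2 : ((y.2⁻¹ * (y.1 * y.2), y.1 * y.2) : ℂ × ℂ) = (y.1, y.1 * y.2) := by
      ext
      · field_simp
      · rfl
    rw [dom₂, Set.mem_ofPred_eq, h2]
    exact hy
  exact ⟨h1, (par₁_eq_par₂ hc h0 hy h1).2 ⟨h, rfl⟩⟩

/-- The change of parametrizations from `par₂` to `par₁`. -/
lemma par₂_eq {y : ℂ × ℂ} (hc : c ∈ κ.source) (h0 : κ c = 0) (hy : y ∈ dom₂ κ) (h : y.1 ≠ 0) :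
    (y.1 * y.2, y.1⁻¹) ∈ dom₁ κ ∧ par₂ κ c y = par₁ κ c (y.1 * y.2, y.1⁻¹) := by
  have h1 : (y.1 * y.2, y.1⁻¹) ∈ dom₁ κ := by
    have h2 : ((y.1 * y.2, y.1 * y.2 * y.1⁻¹) : ℂ × ℂ) = (y.1 * y.2, y.2) := by
      ext
      · rfl
      · field_simp
    rw [dom₁, Set.mem_ofPred_eq, h2]
    exact hy
  refine ⟨h1, ((par₁_eq_par₂ hc h0 h1 hy).2 ⟨inv_ne_zero h, ?_⟩).symm⟩
  ext
  · simp
  · field_simp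

lemma isOpen_image_par₁ (hc : c ∈ κ.source) (h0 : κ c = 0) {O : Set (ℂ × ℂ)} (hO : IsOpen O)
    (hOd : O ⊆ dom₁ κ) : IsOpen (par₁ κ c '' O) := by
  refine (isOpen_def κ c).2 ⟨fun x _ => ?_, fun y hy => ?_, fun y hy => ?_⟩
  · rintro ⟨y, hy, hyx⟩
    obtain ⟨h1, -, h2, h3⟩ := of_par₁_eq_inl (hOd hy) hyx
    have h4 : (κ x).1 ≠ 0 := by rwa [h3]
    have h5 : ((κ x).1, (κ x).2 / (κ x).1) = y := by
      rw [h3]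
      ext
      · rfl
      · simp only [blowMap_false]
        field_simp
    have h6 : ∀ᶠ x' in 𝓝 x, (κ x').1 ≠ 0 :=
      (continuous_fst.continuousAt.comp (κ.continuousAt h2)).eventually_ne h4
    have h7 := (continuousAt_div₁ h2 h4).eventually
      (hO.eventually_mem (by simpa only [h5] using hy))
    filter_upwards [κ.open_source.mem_nhds h2, h6, h7] with x' h8 h9 h10
    exact ⟨_, h10, (inl_eq_par₁ h8 h9).symm⟩
  · rintro ⟨y', hy', h⟩
    have : y = y' := by rw [← coord₁_par₁ (c := c) hy, ← h, coord₁_par₁ (hOd hy')]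
    rw [this]
    exact (hO.eventually_mem hy').mono fun y'' h => ⟨y'', h, rfl⟩
  · rintro ⟨y', hy', h⟩
    obtain ⟨h1, h2⟩ := (par₁_eq_par₂ hc h0 (hOd hy') hy).1 h
    have h3 : y.1 ≠ 0 := by
      rw [h2]
      exact inv_ne_zero h1
    have h4 : ((y.1 * y.2, y.1⁻¹) : ℂ × ℂ) = y' := by
      rw [h2]
      ext
      · simp only
        field_simp
      · simp
    have h5 : ContinuousAt (fun y : ℂ × ℂ => (y.1 * y.2, y.1⁻¹)) y :=
      (continuous_fst.mul continuous_snd).continuousAt.prodMk (continuous_fst.continuousAt.inv₀ h3)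
    have h6 := h5.eventually (hO.eventually_mem (by simpa only [h4] using hy'))
    filter_upwards [continuous_fst.continuousAt.eventually_ne h3, h6,
      (isOpen_dom₂ κ).mem_nhds hy] with y'' h7 h8 h9
    exact ⟨_, h8, (par₂_eq hc h0 h9 h7).2.symm⟩

lemma isOpen_image_par₂ (hc : c ∈ κ.source) (h0 : κ c = 0) {O : Set (ℂ × ℂ)} (hO : IsOpen O)
    (hOd : O ⊆ dom₂ κ) : IsOpen (par₂ κ c '' O) := by
  refine (isOpen_def κ c).2 ⟨fun x hx => ?_, fun y hy => ?_, fun y hy => ?_⟩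
  · rintro ⟨y, hy, hyx⟩
    obtain ⟨h1, -, h2, h3⟩ := of_par₂_eq_inl hc h0 hx (hOd hy) hyx
    have h4 : (κ x).2 ≠ 0 := by rwa [h3]
    have h5 : ((κ x).1 / (κ x).2, (κ x).2) = y := by
      rw [h3]
      ext
      · simp only [blowMap_true]
        field_simp
      · rfl
    have h6 : ∀ᶠ x' in 𝓝 x, (κ x').2 ≠ 0 :=
      (continuous_snd.continuousAt.comp (κ.continuousAt h2)).eventually_ne h4
    have h7 := (continuousAt_div₂ h2 h4).eventually
      (hO.eventually_mem (by simpa only [h5] using hy))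
    filter_upwards [κ.open_source.mem_nhds h2, h6, h7] with x' h8 h9 h10
    exact ⟨_, h10, (inl_eq_par₂ h8 h9).symm⟩
  · rintro ⟨y', hy', h⟩
    obtain ⟨h1, h2⟩ := (par₁_eq_par₂ hc h0 hy (hOd hy')).1 h.symm
    have h5 : ContinuousAt (fun y : ℂ × ℂ => (y.2⁻¹, y.1 * y.2)) y :=
      (continuous_snd.continuousAt.inv₀ h1).prodMk (continuous_fst.mul continuous_snd).continuousAt
    have h6 := h5.eventually (hO.eventually_mem (by simpa only [← h2] using hy'))
    filter_upwards [continuous_snd.continuousAt.eventually_ne h1, h6,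
      (isOpen_dom₁ κ).mem_nhds hy] with y'' h7 h8 h9
    exact ⟨_, h8, (par₁_eq hc h0 h9 h7).2.symm⟩
  · rintro ⟨y', hy', h⟩
    have : y = y' := by rw [← coord₂_par₂ (c := c) hy, ← h, coord₂_par₂ (hOd hy')]
    rw [this]
    exact (hO.eventually_mem hy').mono fun y'' h => ⟨y'', h, rfl⟩

/-- The chart of the blow-up which is inverse to `par₁`. -/
def chart₁ (hc : c ∈ κ.source) (h0 : κ c = 0) :
    OpenPartialHomeomorph (Blowup κ c) (ℂ × ℂ) where
  toFun := coord₁ κ c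
  invFun := par₁ κ c
  source := par₁ κ c '' dom₁ κ
  target := dom₁ κ
  map_source' := by
    rintro _ ⟨y, hy, rfl⟩
    rwa [coord₁_par₁ hy]
  map_target' := fun y hy => ⟨y, hy, rfl⟩
  left_inv' := by
    rintro _ ⟨y, hy, rfl⟩
    rw [coord₁_par₁ hy]
  right_inv' := fun y hy => coord₁_par₁ hy
  open_source := isOpen_image_par₁ hc h0 (isOpen_dom₁ κ) subset_rfl
  open_target := isOpen_dom₁ κ
  continuousOn_toFun := by
    rintro _ ⟨y, hy, rfl⟩
    refine ContinuousAt.continuousWithinAt fun s hs => ?_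
    rw [coord₁_par₁ hy] at hs
    have h1 : interior s ∩ dom₁ κ ∈ 𝓝 y :=
      Filter.inter_mem (interior_mem_nhds.2 hs) ((isOpen_dom₁ κ).mem_nhds hy)
    have h2 := isOpen_image_par₁ hc h0 (isOpen_interior.inter (isOpen_dom₁ κ))
      (Set.inter_subset_right (s := interior s))
    refine Filter.mem_map.2 (Filter.mem_of_superset (h2.mem_nhds ⟨y, mem_of_mem_nhds h1, rfl⟩) ?_)
    rintro _ ⟨y', hy', rfl⟩
    change coord₁ κ c _ ∈ s
    rw [coord₁_par₁ hy'.2]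
    exact interior_subset hy'.1
  continuousOn_invFun := fun y hy => (continuousAt_par₁ κ c hy).continuousWithinAt

/-- The chart of the blow-up which is inverse to `par₂`. -/
def chart₂ (hc : c ∈ κ.source) (h0 : κ c = 0) :
    OpenPartialHomeomorph (Blowup κ c) (ℂ × ℂ) where
  toFun := coord₂ κ c
  invFun := par₂ κ c
  source := par₂ κ c '' dom₂ κ
  target := dom₂ κ
  map_source' := by
    rintro _ ⟨y, hy, rfl⟩
    rwa [coord₂_par₂ hy]
  map_target' := fun y hy => ⟨y, hy, rfl⟩
  left_inv' := by
    rintro _ ⟨y, hy, rfl⟩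
    rw [coord₂_par₂ hy]
  right_inv' := fun y hy => coord₂_par₂ hy
  open_source := isOpen_image_par₂ hc h0 (isOpen_dom₂ κ) subset_rfl
  open_target := isOpen_dom₂ κ
  continuousOn_toFun := by
    rintro _ ⟨y, hy, rfl⟩
    refine ContinuousAt.continuousWithinAt fun s hs => ?_
    rw [coord₂_par₂ hy] at hs
    have h1 : interior s ∩ dom₂ κ ∈ 𝓝 y :=
      Filter.inter_mem (interior_mem_nhds.2 hs) ((isOpen_dom₂ κ).mem_nhds hy)
    have h2 := isOpen_image_par₂ hc h0 (isOpen_interior.inter (isOpen_dom₂ κ))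
      (Set.inter_subset_right (s := interior s))
    refine Filter.mem_map.2 (Filter.mem_of_superset (h2.mem_nhds ⟨y, mem_of_mem_nhds h1, rfl⟩) ?_)
    rintro _ ⟨y', hy', rfl⟩
    change coord₂ κ c _ ∈ s
    rw [coord₂_par₂ hy'.2]
    exact interior_subset hy'.1
  continuousOn_invFun := fun y hy => (continuousAt_par₂ κ c hy).continuousWithinAt


lemma isHolChart_chart₁ [HolSpace W] (hκ : IsHolChart κ) (hc : c ∈ κ.source) (h0 : κ c = 0) :
    IsHolChart (chart₁ hc h0) := by
  rintro _ ⟨y, hy, rfl⟩ f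
  change _ ↔ AnalyticAt ℂ (f ∘ par₁ κ c) (coord₁ κ c (par₁ κ c y))
  rw [coord₁_par₁ hy]
  refine ⟨fun h => h.2.1 y hy rfl, fun h => (holAt_def κ c).2 ⟨fun x hx hxy => ?_,
    fun y' hy' hyy => ?_, fun y' hy' hyy => ?_⟩⟩
  · obtain ⟨h1, h2, h3, h4⟩ := of_par₁_eq_inl hy hxy.symm
    have h5 : AnalyticAt ℂ (fun z : ℂ × ℂ => (z.1, z.2 / z.1)) (κ x) :=
      analyticAt_fst.prod (analyticAt_snd.div analyticAt_fst (by rwa [h4]))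
    have h6 : ((κ x).1, (κ x).2 / (κ x).1) = y := by
      rw [h4]
      ext
      · rfl
      · simp only [blowMap_false]
        field_simp
    have h7 := AnalyticAt.comp (g := f ∘ par₁ κ c) (f := fun z : ℂ × ℂ => (z.1, z.2 / z.1))
      (x := κ x) (by simpa only [h6] using h) h5
    rw [hκ x h3]
    refine h7.congr ?_
    have h8 : ∀ᶠ z in 𝓝 (κ x), z.1 ≠ 0 := continuous_fst.continuousAt.eventually_ne (by rwa [h4])
    filter_upwards [κ.open_target.mem_nhds (κ.map_source h3), h8] with z h9 h10
    have h11 := inl_eq_par₁ (c := c) (κ.map_target h9) (by rwa [κ.right_inv h9])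
    rw [κ.right_inv h9] at h11
    exact congrArg f h11.symm
  · have : y' = y := by rw [← coord₁_par₁ (c := c) hy', hyy, coord₁_par₁ hy]
    rwa [this]
  · obtain ⟨h1, h2⟩ := (par₁_eq_par₂ hc h0 hy hy').1 hyy.symm
    have h3 : y'.1 ≠ 0 := by
      rw [h2]
      exact inv_ne_zero h1
    have h4 : ((y'.1 * y'.2, y'.1⁻¹) : ℂ × ℂ) = y := by
      rw [h2]
      ext
      · simp only
        field_simp
      · simp
    have h5 : AnalyticAt ℂ (fun y : ℂ × ℂ => (y.1 * y.2, y.1⁻¹)) y' :=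
      (analyticAt_fst.mul analyticAt_snd).prod (analyticAt_fst.inv h3)
    have h6 := AnalyticAt.comp (g := f ∘ par₁ κ c) (f := fun y : ℂ × ℂ => (y.1 * y.2, y.1⁻¹))
      (x := y') (by simpa only [h4] using h) h5
    refine h6.congr ?_
    filter_upwards [continuous_fst.continuousAt.eventually_ne h3,
      (isOpen_dom₂ κ).mem_nhds hy'] with z h7 h8
    exact congrArg f (par₂_eq hc h0 h8 h7).2.symm

lemma isHolChart_chart₂ [HolSpace W] (hκ : IsHolChart κ) (hc : c ∈ κ.source) (h0 : κ c = 0) :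
    IsHolChart (chart₂ hc h0) := by
  rintro _ ⟨y, hy, rfl⟩ f
  change _ ↔ AnalyticAt ℂ (f ∘ par₂ κ c) (coord₂ κ c (par₂ κ c y))
  rw [coord₂_par₂ hy]
  refine ⟨fun h => h.2.2 y hy rfl, fun h => (holAt_def κ c).2 ⟨fun x hx hxy => ?_,
    fun y' hy' hyy => ?_, fun y' hy' hyy => ?_⟩⟩
  · obtain ⟨h1, h2, h3, h4⟩ := of_par₂_eq_inl hc h0 hx hy hxy.symm
    have h5 : AnalyticAt ℂ (fun z : ℂ × ℂ => (z.1 / z.2, z.2)) (κ x) :=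
      (analyticAt_fst.div analyticAt_snd (by rwa [h4])).prod analyticAt_snd
    have h6 : ((κ x).1 / (κ x).2, (κ x).2) = y := by
      rw [h4]
      ext
      · simp only [blowMap_true]
        field_simp
      · rfl
    have h7 := AnalyticAt.comp (g := f ∘ par₂ κ c) (f := fun z : ℂ × ℂ => (z.1 / z.2, z.2))
      (x := κ x) (by simpa only [h6] using h) h5
    rw [hκ x h3]
    refine h7.congr ?_
    have h8 : ∀ᶠ z in 𝓝 (κ x), z.2 ≠ 0 := continuous_snd.continuousAt.eventually_ne (by rwa [h4])
    filter_upwards [κ.open_target.mem_nhds (κ.map_source h3), h8] with z h9 h10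
    have h11 := inl_eq_par₂ (c := c) (κ.map_target h9) (by rwa [κ.right_inv h9])
    rw [κ.right_inv h9] at h11
    exact congrArg f h11.symm
  · obtain ⟨h1, h2⟩ := (par₁_eq_par₂ hc h0 hy' hy).1 hyy
    have h5 : AnalyticAt ℂ (fun y : ℂ × ℂ => (y.2⁻¹, y.1 * y.2)) y' :=
      (analyticAt_snd.inv h1).prod (analyticAt_fst.mul analyticAt_snd)
    have h6 := AnalyticAt.comp (g := f ∘ par₂ κ c) (f := fun y : ℂ × ℂ => (y.2⁻¹, y.1 * y.2))
      (x := y') (by simpa only [← h2] using h) h5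
    refine h6.congr ?_
    filter_upwards [continuous_snd.continuousAt.eventually_ne h1,
      (isOpen_dom₁ κ).mem_nhds hy'] with z h7 h8
    exact congrArg f (par₁_eq hc h0 h8 h7).2.symm
  · have : y' = y := by rw [← coord₂_par₂ (c := c) hy', hyy, coord₂_par₂ hy]
    rwa [this]

lemma proj_par₁ (hc : c ∈ κ.source) (h0 : κ c = 0) {y : ℂ × ℂ} :
    proj κ c (par₁ κ c y) = κ.symm (blowMap false y) := by
  obtain ⟨s, t⟩ := y
  rcases eq_or_ne s 0 with rfl | hs
  · rw [par₁_zero, blowMap_eq_zero.2 rfl, symm_zero hc h0]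
    rfl
  · rw [par₁_of_ne κ c hs]
    rfl

lemma proj_par₂ (hc : c ∈ κ.source) (h0 : κ c = 0) {y : ℂ × ℂ} :
    proj κ c (par₂ κ c y) = κ.symm (blowMap true y) := by
  obtain ⟨s, t⟩ := y
  rcases eq_or_ne t 0 with rfl | ht
  · have h1 : blowMap true (s, 0) = 0 := by simp [blowMap]
    rw [h1, symm_zero hc h0]
    rcases eq_or_ne s 0 with rfl | hs
    · rw [par₂_zero_zero]
      exact symm_zero hc h0
    · rw [par₂_zero κ c hs]
      rfl
  · rw [par₂_of_ne κ c ht]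
    rfl

lemma continuous_proj (hc : c ∈ κ.source) (h0 : κ c = 0) : Continuous (proj κ c) := by
  refine ⟨fun U hU => (isOpen_def κ c).2 ⟨fun x _ hx => hU.eventually_mem hx, fun y hy hyU => ?_,
    fun y hy hyU => ?_⟩⟩
  · have h1 : ContinuousAt (fun y => κ.symm (blowMap false y)) y :=
      ContinuousAt.comp (g := κ.symm) (κ.continuousAt_symm hy)
        (analyticAt_blowMap false y).continuousAt
    have hyU' : proj κ c (par₁ κ c y) ∈ U := hyU
    rw [proj_par₁ hc h0] at hyU'
    refine (h1.eventually (hU.eventually_mem hyU')).mono fun y' hy' => ?_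
    change proj κ c (par₁ κ c y') ∈ U
    rwa [proj_par₁ hc h0]
  · have h1 : ContinuousAt (fun y => κ.symm (blowMap true y)) y :=
      ContinuousAt.comp (g := κ.symm) (κ.continuousAt_symm hy)
        (analyticAt_blowMap true y).continuousAt
    have hyU' : proj κ c (par₂ κ c y) ∈ U := hyU
    rw [proj_par₂ hc h0] at hyU'
    refine (h1.eventually (hU.eventually_mem hyU')).mono fun y' hy' => ?_
    change proj κ c (par₂ κ c y') ∈ U
    rwa [proj_par₂ hc h0]

/-- The complement of the exceptional curve. -/
def offCenter [T1Space W] (hc : c ∈ κ.source) (h0 : κ c = 0) :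
    OpenPartialHomeomorph (Blowup κ c) W where
  toFun := proj κ c
  invFun := inl κ c
  source := proj κ c ⁻¹' {c}ᶜ
  target := {c}ᶜ
  map_source' := fun x hx => hx
  map_target' := fun x hx => hx
  left_inv' := by
    rintro (x | t) hx
    · rfl
    · exact (hx rfl).elim
  right_inv' := fun x _ => rfl
  open_source := isOpen_compl_singleton.preimage (continuous_proj hc h0)
  open_target := isOpen_compl_singleton
  continuousOn_toFun := (continuous_proj hc h0).continuousOn
  continuousOn_invFun := fun _ hx => (continuousAt_inl κ c hx).continuousWithinAt

lemma isBihol_offCenter [HolSpace W] [T1Space W] (hκ : IsHolChart κ) (hc : c ∈ κ.source)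
    (h0 : κ c = 0) : IsBihol (offCenter hc h0).symm := by
  intro x hx f
  have hx : x ≠ c := hx
  change HolSpace.HolAt f (inl κ c x) ↔ HolSpace.HolAt (f ∘ inl κ c) x
  refine ⟨fun h => h.1 x hx rfl, fun h => (holAt_def κ c).2 ⟨fun x' _ hxx => ?_,
    fun y hy hyx => ?_, fun y hy hyx => ?_⟩⟩
  · rwa [inl_injective κ c hxx]
  · obtain ⟨h1, h2, h3, h4⟩ := of_par₁_eq_inl hy hyx
    have h5 := AnalyticAt.comp (f := blowMap false) (x := y) (h4 ▸ (hκ x h3 _).1 h)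
      (analyticAt_blowMap false y)
    refine h5.congr ?_
    filter_upwards [continuous_fst.continuousAt.eventually_ne h1] with y' hy'
    exact congrArg f (par₁_of_ne κ c hy').symm
  · obtain ⟨h1, h2, h3, h4⟩ := of_par₂_eq_inl hc h0 hx hy hyx
    have h5 := AnalyticAt.comp (f := blowMap true) (x := y) (h4 ▸ (hκ x h3 _).1 h)
      (analyticAt_blowMap true y)
    refine h5.congr ?_
    filter_upwards [continuous_snd.continuousAt.eventually_ne h1] with y' hy'
    exact congrArg f (par₂_of_ne κ c hy').symm

lemma isPointBlowup_proj [HolSpace W] [T1Space W] (hκ : IsHolChart κ) (hc : c ∈ κ.source)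
    (h0 : κ c = 0) : IsPointBlowup (proj κ c) c := by
  refine ⟨continuous_proj hc h0, ⟨offCenter hc h0, rfl, rfl, fun _ _ => rfl,
    (isBihol_offCenter hκ hc h0).symm⟩, κ, chart₁ hc h0, chart₂ hc h0, hκ,
    isHolChart_chart₁ hκ hc h0, isHolChart_chart₂ hκ hc h0, hc, h0, ?_, rfl, rfl,
    fun y _ => proj_par₁ hc h0, fun y _ => proj_par₂ hc h0,
    fun y hy y' hy' => par₁_eq_par₂ hc h0 hy hy'⟩
  ext z
  constructor
  · intro hz
    rcases z with x | t
    · have hx : x ∈ κ.source := hz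
      by_cases h1 : (κ x).1 = 0
      · right
        by_cases h2 : (κ x).2 = 0
        · have h3 : x = c := κ.injOn hx hc (by rw [h0]; exact Prod.ext h1 h2)
          refine ⟨(0, 0), ?_, ?_⟩
          · change ((0 : ℂ) * 0, (0 : ℂ)) ∈ κ.target
            rw [mul_zero, ← Prod.zero_eq_mk, ← h0]
            exact κ.map_source hc
          · rw [par₂_zero_zero, symm_zero hc h0, h3]
            rfl
        · refine ⟨_, ?_, (inl_eq_par₂ hx h2).symm⟩
          change ((κ x).1 / (κ x).2 * (κ x).2, (κ x).2) ∈ κ.target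
          rw [div_mul_cancel₀ _ h2]
          exact κ.map_source hx
      · left
        refine ⟨_, ?_, (inl_eq_par₁ hx h1).symm⟩
        change ((κ x).1, (κ x).1 * ((κ x).2 / (κ x).1)) ∈ κ.target
        rw [mul_div_cancel₀ _ h1]
        exact κ.map_source hx
    · left
      refine ⟨(0, t.down), ?_, par₁_zero κ c t.down⟩
      change ((0 : ℂ), (0 : ℂ) * t.down) ∈ κ.target
      rw [zero_mul, ← Prod.zero_eq_mk, ← h0]
      exact κ.map_source hc
  · rintro (⟨y, hy, rfl⟩ | ⟨y, hy, rfl⟩)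
    · change proj κ c _ ∈ κ.source
      rw [proj_par₁ hc h0]
      exact κ.map_target hy
    · change proj κ c _ ∈ κ.source
      rw [proj_par₂ hc h0]
      exact κ.map_target hy

end Blowup

/-- Points of Hausdorff surfaces can be blown up. -/
lemma exists_isPointBlowup [HolSpace W] [T2Space W] {κ : OpenPartialHomeomorph W (ℂ × ℂ)} {c : W}
    (hκ : IsBihol κ) (hc : c ∈ κ.source) (h0 : κ c = 0) :
    ∃ (X : Type u) (_ : TopologicalSpace X) (_ : HolSpace X) (b : X → W), IsPointBlowup b c :=
  ⟨Blowup κ c, inferInstance, inferInstance, Blowup.proj κ c,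
    Blowup.isPointBlowup_proj (isBihol_iff_isHolChart.1 hκ) hc h0⟩

end BlowupExistence

/-! ### Holomorphic germs in one variable -/

section OneVariable

lemma exists_analyticAt_pow_eq {E : Type*} [NormedAddCommGroup E] [NormedSpace ℂ E] {g : E → ℂ}
    {z : E} (hg : AnalyticAt ℂ g z) (h0 : g z ≠ 0) {n : ℕ} (hn : n ≠ 0) {c : ℂ} (hc : c ^ n = g z) :
    ∃ k : E → ℂ, AnalyticAt ℂ k z ∧ k z = c ∧ ∀ w, k w ^ n = g w := by
  refine ⟨fun w => c * (g w / g z) ^ ((n : ℂ)⁻¹), ?_, ?_, fun w => ?_⟩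
  · refine analyticAt_const.mul (AnalyticAt.cpow (hg.div analyticAt_const h0) analyticAt_const ?_)
    rw [div_self h0]
    exact Complex.one_mem_slitPlane
  · simp [div_self h0]
  · rw [mul_pow, Complex.cpow_nat_inv_pow _ hn, hc, mul_div_cancel₀ _ h0]

/-- An injective holomorphic germ has a non-zero derivative. -/
lemma deriv_ne_zero_of_injOn {f : ℂ → ℂ} {z : ℂ} (hf : AnalyticAt ℂ f z) {U : Set ℂ}
    (hU : U ∈ 𝓝 z) (hinj : Set.InjOn f U) : deriv f z ≠ 0 := by
  have hF : AnalyticAt ℂ (fun w => f w - f z) z := hf.sub analyticAt_const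
  have hnt : analyticOrderAt (fun w => f w - f z) z ≠ ⊤ := by
    rw [Ne, analyticOrderAt_eq_top]
    intro h
    have h1 : ∀ᶠ w in 𝓝[≠] z, w ∈ U ∧ f w - f z = 0 :=
      (Filter.eventually_of_mem hU (fun _ h => h)).and h |>.filter_mono nhdsWithin_le_nhds
    obtain ⟨w, ⟨h2, h3⟩, h4⟩ := (h1.and self_mem_nhdsWithin).exists
    exact h4 (hinj h2 (mem_of_mem_nhds hU) (sub_eq_zero.1 h3))
  obtain ⟨n, hn⟩ := ENat.ne_top_iff_exists.1 hnt
  obtain ⟨g, hg, hgz, hfg⟩ := (hF.analyticOrderAt_eq_natCast).1 hn.symm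
  have hn0 : n ≠ 0 := by
    rintro rfl
    have := hfg.self_of_nhds
    simp at this
    exact hgz this.symm
  obtain ⟨c, hc⟩ := IsAlgClosed.exists_pow_nat_eq (g z) (Nat.pos_of_ne_zero hn0)
  obtain ⟨k, hk, hkz, hkg⟩ := exists_analyticAt_pow_eq hg hgz hn0 hc
  have hc0 : c ≠ 0 := by
    rintro rfl
    rw [zero_pow hn0] at hc
    exact hgz hc.symm
  have hu : AnalyticAt ℂ (fun w => (w - z) * k w) z :=
    (analyticAt_id.sub analyticAt_const).mul hk
  have hud : deriv (fun w => (w - z) * k w) z = c := by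
    have h1 := ((hasDerivAt_id z).sub_const z).mul hk.differentiableAt.hasDerivAt
    have h2 := h1.deriv
    simp only [id_eq, one_mul, sub_self, zero_mul, add_zero, hkz] at h2
    exact h2
  have hud0 : deriv (fun w => (w - z) * k w) z ≠ 0 := by rwa [hud]
  have hfu : ∀ᶠ w in 𝓝 z, f w = f z + ((w - z) * k w) ^ n := by
    filter_upwards [hfg] with w hw
    rw [mul_pow, hkg, ← smul_eq_mul, ← hw]
    ring
  have hn1 : n = 1 := by
    by_contra hn1
    -- otherwise two points with the same value are obtained from a root of unity
    have hr := hu.hasStrictDerivAt.eventually_right_inverse hud0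
    set ρ := hu.hasStrictDerivAt.localInverse (fun w => (w - z) * k w) _ z hud0 with hρ
    have hρa : AnalyticAt ℂ ρ ((z - z) * k z) := hu.analyticAt_localInverse hud0
    have hu0 : (z - z) * k z = 0 := by simp
    rw [hu0] at hρa hr
    have hρ0 : ρ 0 = z := by
      have := HasStrictFDerivAt.localInverse_apply_image
        (hu.hasStrictDerivAt.hasStrictFDerivAt_equiv hud0)
      simpa only [hu0] using this
    have hζ := Complex.isPrimitiveRoot_exp n hn0
    set ζ := Complex.exp (2 * Real.pi * Complex.I / n)
    have hζ1 : ζ ≠ 1 := hζ.ne_one (by omega)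
    have hall : ∀ᶠ y in 𝓝 (0 : ℂ), ρ y ∈ U ∧ f (ρ y) = f z + y ^ n := by
      have h1 := hρa.continuousAt.eventually (p := fun w => w ∈ U ∧ f w = f z + ((w - z) * k w) ^ n)
        (by rw [hρ0]; exact (Filter.eventually_of_mem hU fun _ h => h).and hfu)
      filter_upwards [h1, hr] with y h2 h3
      refine ⟨h2.1, ?_⟩
      rw [h2.2]
      exact congrArg (fun x => f z + x ^ n) h3
    have hmul : Filter.Tendsto (fun y => ζ * y) (𝓝 0) (𝓝 0) := by
      have : ContinuousAt (fun y => ζ * y) 0 := by fun_prop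
      simpa [ContinuousAt] using this
    have hr' : ∀ᶠ y in 𝓝 (0 : ℂ), (ρ y - z) * k (ρ y) = y := hr
    obtain ⟨y, ⟨h1, h2, h3, h4⟩, h5⟩ := (((hall.and ((hmul.eventually hall).and
      (hr'.and (hmul.eventually hr')))).filter_mono nhdsWithin_le_nhds).and
      (self_mem_nhdsWithin (s := {(0 : ℂ)}ᶜ))).exists
    have h6 : ρ y = ρ (ζ * y) := hinj h1.1 h2.1 (by rw [h1.2, h2.2, mul_pow, hζ.pow_eq_one, one_mul])
    rw [← h6, h3] at h4
    have h7 : (ζ - 1) * y = 0 := by linear_combination -h4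
    rcases mul_eq_zero.1 h7 with h8 | h8
    · exact hζ1 (sub_eq_zero.1 h8)
    · exact h5 h8
  subst hn1
  have h1 : deriv f z = deriv (fun w => f z + ((w - z) * k w) ^ 1) z :=
    Filter.EventuallyEq.deriv_eq hfu
  rw [h1]
  simp only [pow_one, deriv_const_add]
  exact hud0

/-- A holomorphic germ at the origin which only depends on the `N`-th power of the variable is a
holomorphic function of it. -/
lemma analyticAt_comp_root {f : ℂ → ℂ} (hf : AnalyticAt ℂ f 0) {N : ℕ} (hN : N ≠ 0)
    (hinv : ∀ᶠ y in 𝓝 (0 : ℂ), ∀ z, z ^ N = y → f z = f (y ^ ((N : ℂ)⁻¹))) :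
    AnalyticAt ℂ (fun y => f (y ^ ((N : ℂ)⁻¹))) 0 := by
  have hcont : ContinuousAt (fun y : ℂ => y ^ ((N : ℂ)⁻¹)) 0 := by
    have h1 : (0 : ℝ) < ((N : ℂ)⁻¹).re := by
      rw [← Complex.ofReal_natCast, ← Complex.ofReal_inv, Complex.ofReal_re]
      positivity
    exact Complex.continuousAt_cpow_const_of_re_pos (Or.inl le_rfl) h1
  have h0 : (0 : ℂ) ^ ((N : ℂ)⁻¹) = 0 := Complex.zero_cpow (by simpa using hN)
  refine Complex.analyticAt_of_differentiable_on_punctured_nhds_of_continuousAt ?_ ?_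
  · have h1 := hcont.eventually (p := fun w => AnalyticAt ℂ f w)
      (by simpa only [h0] using hf.eventually_analyticAt)
    filter_upwards [self_mem_nhdsWithin, h1.filter_mono nhdsWithin_le_nhds,
      hinv.eventually_nhds.filter_mono nhdsWithin_le_nhds] with y hy h2 h3
    obtain ⟨k, hk, hky, hkp⟩ := exists_analyticAt_pow_eq (g := fun y => y) (z := y) analyticAt_id hy hN
      (c := y ^ ((N : ℂ)⁻¹)) (Complex.cpow_nat_inv_pow _ hN)
    have h4 : AnalyticAt ℂ (f ∘ k) y := AnalyticAt.comp (by rwa [hky]) hk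
    refine (h4.congr ?_).differentiableAt
    filter_upwards [h3] with y' h5
    exact h5 _ (hkp y')
  · exact ContinuousAt.comp (g := f) (by rw [h0]; exact hf.continuousAt) hcont

end OneVariable

/-! ### Holomorphic curves in a Riemann surface -/

section Jac

variable {S : Type u} [TopologicalSpace S] [ChartedSpace ℂ S]

/-- The derivative of a holomorphic map `g : ℂ → S` at `z`, in the preferred coordinate of `S`
at `g z`. -/
def jac (g : ℂ → S) (z : ℂ) : ℂ := deriv (fun w => chartAt ℂ (g z) (g w)) z

lemma contMDiffAt_of_analyticAt_chart_comp {g : ℂ → S} {z : ℂ} (hc : ContinuousAt g z)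
    (h : AnalyticAt ℂ (fun w => chartAt ℂ (g z) (g w)) z) : ContMDiffAt 𝓘(ℂ) 𝓘(ℂ) ω g z := by
  rw [contMDiffAt_iff_target]
  refine ⟨hc, ?_⟩
  rw [contMDiffAt_iff_contDiffAt]
  exact h.contDiffAt

variable [IsManifold 𝓘(ℂ) ω S]

lemma analyticAt_chart_comp {g : ℂ → S} {z : ℂ} (hg : ContMDiffAt 𝓘(ℂ) 𝓘(ℂ) ω g z) {x : S}
    (hx : g z ∈ (chartAt ℂ x).source) : AnalyticAt ℂ (fun w => chartAt ℂ x (g w)) z := by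
  have h1 : ContMDiffAt 𝓘(ℂ) 𝓘(ℂ) ω (chartAt ℂ x) (g z) :=
    contMDiffAt_of_mem_maximalAtlas (IsManifold.chart_mem_maximalAtlas x) hx
  have h2 : ContMDiffAt 𝓘(ℂ) 𝓘(ℂ) ω (chartAt ℂ x ∘ g) z := h1.comp z hg
  rw [contMDiffAt_iff_contDiffAt, ← contDiffWithinAt_univ,
    contDiffWithinAt_omega_iff_analyticWithinAt, analyticWithinAt_univ] at h2
  exact h2

lemma jac_comp {g g' : ℂ → S} {h : ℂ → ℂ} {z : ℂ} (hh : AnalyticAt ℂ h z)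
    (hg' : ContMDiffAt 𝓘(ℂ) 𝓘(ℂ) ω g' (h z)) (hgg : ∀ᶠ w in 𝓝 z, g' (h w) = g w) :
    jac g z = jac g' (h z) * deriv h z := by
  have h1 := analyticAt_chart_comp hg' (mem_chart_source ℂ (g' (h z)))
  have h2 : deriv (fun w => chartAt ℂ (g z) (g w)) z =
      deriv ((fun w => chartAt ℂ (g' (h z)) (g' w)) ∘ h) z := by
    refine Filter.EventuallyEq.deriv_eq ?_
    filter_upwards [hgg] with w hw
    simp only [Function.comp, hw, hgg.self_of_nhds]
  rw [jac, h2, deriv_comp _ h1.differentiableAt hh.differentiableAt]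
  rfl

lemma jac_ne_zero {g : ℂ → S} {z : ℂ} (hg : ContMDiffAt 𝓘(ℂ) 𝓘(ℂ) ω g z) {U : Set ℂ}
    (hU : U ∈ 𝓝 z) (hinj : Set.InjOn g U) : jac g z ≠ 0 := by
  have h1 : g ⁻¹' (chartAt ℂ (g z)).source ∈ 𝓝 z :=
    hg.continuousAt ((chartAt ℂ (g z)).open_source.mem_nhds (mem_chart_source ℂ (g z)))
  refine deriv_ne_zero_of_injOn (analyticAt_chart_comp hg (mem_chart_source ℂ (g z)))
    (Filter.inter_mem hU h1) fun a ha b hb hab => ?_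
  exact hinj ha.1 hb.1 ((chartAt ℂ (g z)).injOn ha.2 hb.2 hab)

/-- A local coordinate `g'` of `S` may be used to lift a holomorphic curve `g`. -/
lemma exists_lift {g g' : ℂ → S} {z z' : ℂ} (hg : ContMDiffAt 𝓘(ℂ) 𝓘(ℂ) ω g z)
    (hg' : ContMDiffAt 𝓘(ℂ) 𝓘(ℂ) ω g' z') (hj : jac g' z' ≠ 0) (heq : g' z' = g z) :
    ∃ h : ℂ → ℂ, AnalyticAt ℂ h z ∧ h z = z' ∧ ∀ᶠ w in 𝓝 z, g' (h w) = g w := by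
  have ha := analyticAt_chart_comp hg (mem_chart_source ℂ (g z))
  have ha' := analyticAt_chart_comp hg' (x := g z) (by rw [heq]; exact mem_chart_source ℂ (g z))
  have hj' : deriv (fun w => chartAt ℂ (g z) (g' w)) z' ≠ 0 := by rwa [← heq]
  have hr := ha'.hasStrictDerivAt.eventually_right_inverse hj'
  set ρ := ha'.hasStrictDerivAt.localInverse (fun w => chartAt ℂ (g z) (g' w)) _ z' hj' with hρ
  have hρa : AnalyticAt ℂ ρ (chartAt ℂ (g z) (g' z')) := ha'.analyticAt_localInverse hj'
  have hρ0 : ρ (chartAt ℂ (g z) (g' z')) = z' := HasStrictFDerivAt.localInverse_apply_image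
        (ha'.hasStrictDerivAt.hasStrictFDerivAt_equiv hj')
  rw [heq] at hρa hρ0 hr
  have hh : AnalyticAt ℂ (fun w => ρ (chartAt ℂ (g z) (g w))) z :=
    AnalyticAt.comp (g := ρ) (f := fun w => chartAt ℂ (g z) (g w)) hρa ha
  refine ⟨_, hh, hρ0, ?_⟩
  have h1 : ∀ᶠ w in 𝓝 z, g w ∈ (chartAt ℂ (g z)).source := hg.continuousAt
    ((chartAt ℂ (g z)).open_source.mem_nhds (mem_chart_source ℂ (g z)))
  have h2 : ∀ᶠ w in 𝓝 z, g' (ρ (chartAt ℂ (g z) (g w))) ∈ (chartAt ℂ (g z)).source := by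
    have h3 : ContinuousAt (fun w => g' (ρ (chartAt ℂ (g z) (g w)))) z :=
      ContinuousAt.comp (g := g') (by rw [hρ0]; exact hg'.continuousAt) hh.continuousAt
    refine h3 ((chartAt ℂ (g z)).open_source.mem_nhds ?_)
    simp only [hρ0, heq]
    exact mem_chart_source ℂ (g z)
  filter_upwards [h1, h2, ha.continuousAt.eventually hr] with w h3 h4 h5
  exact (chartAt ℂ (g z)).injOn h4 h3 h5

end Jac

lemma exists_injOn_of_deriv_ne_zero {f : ℂ → ℂ} {z : ℂ} (hf : AnalyticAt ℂ f z)
    (h : deriv f z ≠ 0) : ∃ U ∈ 𝓝 z, Set.InjOn f U := by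
  have h1 := hf.hasStrictDerivAt.eventually_left_inverse h
  refine ⟨_, h1, fun a ha b hb hab => ?_⟩
  rw [← (show _ = a from ha), ← (show _ = b from hb), hab]

lemma exists_eq_mul_of_map_zero {h : ℂ → ℂ} (hh : AnalyticAt ℂ h 0) (h0 : h 0 = 0) :
    ∃ α : ℂ → ℂ, AnalyticAt ℂ α 0 ∧ α 0 = deriv h 0 ∧ ∀ᶠ y in 𝓝 0, h y = y * α y := by
  obtain ⟨L, hL, hhL⟩ := exists_analyticAt_apply_self hh h0
  have hα : AnalyticAt ℂ (fun y => L y 1) 0 :=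
    ((ContinuousLinearMap.id ℂ (ℂ →L[ℂ] ℂ)).analyticAt_bilinear _).comp (hL.prod analyticAt_const)
  have hmul : ∀ᶠ y in 𝓝 0, h y = y * L y 1 := by
    filter_upwards [hhL] with y hy
    rw [hy, ← smul_eq_mul, ← map_smul, smul_eq_mul, mul_one]
  refine ⟨_, hα, ?_, hmul⟩
  rw [Filter.EventuallyEq.deriv_eq hmul]
  have h1 := ((hasDerivAt_id (0 : ℂ)).mul hα.differentiableAt.hasDerivAt).deriv
  simp only [id_eq, one_mul, zero_mul, add_zero] at h1
  exact h1.symm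

section Disc

variable (S : Type u) [TopologicalSpace S] [ChartedSpace ℂ S]

/-- A holomorphic coordinate disc of the Riemann surface `S`. -/
structure Disc where
  toFun : ℂ → S
  radius : ℝ
  radius_pos : 0 < radius
  holo : ContMDiffOn 𝓘(ℂ) 𝓘(ℂ) ω toFun (Metric.ball 0 radius)
  inj : Set.InjOn toFun (Metric.ball 0 radius)

variable {S}

/-- Only the centre of the disc may be a point of `𝒜`. -/
def Disc.Avoids (φ : Disc S) (𝒜 : Set S) : Prop :=
  ∀ z ∈ Metric.ball (0 : ℂ) φ.radius, z ≠ 0 → φ.toFun z ∉ 𝒜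

namespace Disc

lemma contMDiffAt (φ : Disc S) {z : ℂ} (hz : z ∈ Metric.ball (0 : ℂ) φ.radius) :
    ContMDiffAt 𝓘(ℂ) 𝓘(ℂ) ω φ.toFun z :=
  φ.holo.contMDiffAt (Metric.isOpen_ball.mem_nhds hz)

lemma zero_mem (φ : Disc S) : (0 : ℂ) ∈ Metric.ball (0 : ℂ) φ.radius :=
  Metric.mem_ball_self φ.radius_pos

variable [IsManifold 𝓘(ℂ) ω S]

lemma jac_ne_zero (φ : Disc S) {z : ℂ} (hz : z ∈ Metric.ball (0 : ℂ) φ.radius) :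
    jac φ.toFun z ≠ 0 :=
  OrbiRuled.jac_ne_zero (φ.contMDiffAt hz) (Metric.isOpen_ball.mem_nhds hz) φ.inj

lemma exists_transition (φ φ' : Disc S) {z z' : ℂ} (hz : z ∈ Metric.ball (0 : ℂ) φ.radius)
    (hz' : z' ∈ Metric.ball (0 : ℂ) φ'.radius) (h : φ'.toFun z' = φ.toFun z) :
    ∃ k : ℂ → ℂ, AnalyticAt ℂ k z ∧ k z = z' ∧ deriv k z ≠ 0 ∧
      ∀ᶠ w in 𝓝 z, φ'.toFun (k w) = φ.toFun w := by
  obtain ⟨k, hk, hkz, hkw⟩ :=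
    exists_lift (φ.contMDiffAt hz) (φ'.contMDiffAt hz') (φ'.jac_ne_zero hz') h
  refine ⟨k, hk, hkz, fun h0 => ?_, hkw⟩
  have := jac_comp hk (by rw [hkz]; exact φ'.contMDiffAt hz') hkw
  rw [h0, mul_zero] at this
  exact φ.jac_ne_zero hz this

end Disc

/-- There are arbitrarily small coordinate discs at every point. -/
lemma exists_disc [IsManifold 𝓘(ℂ) ω S] [T1Space S] (x : S) {𝒜 : Set S} (h𝒜 : 𝒜.Finite) :
    ∃ φ : Disc S, φ.toFun 0 = x ∧ φ.Avoids 𝒜 := by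
  set e := chartAt ℂ x with he
  have hx : x ∈ e.source := mem_chart_source ℂ x
  have hfin : (𝒜 \ {x}).Finite := h𝒜.subset Set.sdiff_subset
  have hopen : IsOpen (e.symm.source ∩ e.symm ⁻¹' (𝒜 \ {x})ᶜ) :=
    e.symm.isOpen_inter_preimage hfin.isClosed.isOpen_compl
  have hmem : e x ∈ e.symm.source ∩ e.symm ⁻¹' (𝒜 \ {x})ᶜ := by
    refine ⟨e.map_source hx, ?_⟩
    simp [e.left_inv hx]
  obtain ⟨R, hR, hball⟩ := Metric.isOpen_iff.1 hopen _ hmem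
  have hin : ∀ z ∈ Metric.ball (0 : ℂ) R, e x + z ∈ Metric.ball (e x) R := fun z hz => by
    simpa [Metric.mem_ball, dist_eq_norm] using hz
  refine ⟨⟨fun z => e.symm (e x + z), R, hR, fun z hz => ?_, fun z hz w hw hzw => ?_⟩, ?_, ?_⟩
  · have h1 : ContMDiffAt 𝓘(ℂ) 𝓘(ℂ) ω e.symm (e x + z) :=
      contMDiffAt_symm_of_mem_maximalAtlas (IsManifold.chart_mem_maximalAtlas x)
        (hball (hin z hz)).1
    have h2 : ContMDiffAt 𝓘(ℂ) 𝓘(ℂ) ω (fun z : ℂ => e x + z) z := by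
      rw [contMDiffAt_iff_contDiffAt]
      exact contDiffAt_const.add contDiffAt_id
    exact (h1.comp z h2).contMDiffWithinAt
  · exact add_left_cancel (e.symm.injOn (hball (hin z hz)).1 (hball (hin w hw)).1 hzw)
  · simp [e.left_inv hx]
  · intro z hz hz0 hzA
    have h1 := (hball (hin z hz)).2
    refine h1 ⟨hzA, fun h2 => hz0 ?_⟩
    have h3 : e.symm (e x + z) = x := h2
    have h4 := e.right_inv (hball (hin z hz)).1
    rw [h3] at h4
    exact left_eq_add.1 h4

end Disc

section Orb

variable {S : Type u} [TopologicalSpace S] [ChartedSpace ℂ S] {m : S → ℕ} {d : S → ℤ}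

namespace OrbChart

lemma contMDiffAt (φ : OrbChart S m d) {z : ℂ} (hz : z ∈ Metric.ball (0 : ℂ) φ.radius) :
    ContMDiffAt 𝓘(ℂ) 𝓘(ℂ) ω φ.toFun z :=
  φ.holo.contMDiffAt (Metric.isOpen_ball.mem_nhds hz)

lemma zero_mem (φ : OrbChart S m d) : (0 : ℂ) ∈ Metric.ball (0 : ℂ) φ.radius :=
  Metric.mem_ball_self φ.radius_pos

lemma exists_injOn (φ : OrbChart S m d) {z : ℂ} (hz : z ∈ Metric.ball (0 : ℂ) φ.radius)
    (hm : m (φ.toFun z) = 1) (hpos : 0 < m (φ.toFun 0)) :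
    ∃ U ∈ 𝓝 z, Set.InjOn φ.toFun U := by
  have hd : deriv (fun w : ℂ => w ^ m (φ.toFun 0)) z ≠ 0 := by
    simp only [deriv_pow_field]
    rcases eq_or_ne z 0 with rfl | h0
    · simp [hm]
    · exact mul_ne_zero (by exact_mod_cast hpos.ne') (pow_ne_zero _ h0)
  obtain ⟨U, hU, hinj⟩ := exists_injOn_of_deriv_ne_zero
    (show AnalyticAt ℂ (fun w : ℂ => w ^ m (φ.toFun 0)) z by fun_prop) hd
  refine ⟨_, Filter.inter_mem hU (Metric.isOpen_ball.mem_nhds hz), fun a ha b hb hab => ?_⟩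
  exact hinj ha.1 hb.1 ((φ.fibres a ha.2 b hb.2).1 hab)

variable [IsManifold 𝓘(ℂ) ω S]

lemma jac_ne_zero (φ : OrbChart S m d) {z : ℂ} (hz : z ∈ Metric.ball (0 : ℂ) φ.radius)
    (hm : m (φ.toFun z) = 1) (hpos : 0 < m (φ.toFun 0)) : jac φ.toFun z ≠ 0 := by
  obtain ⟨U, hU, hinj⟩ := φ.exists_injOn hz hm hpos
  exact OrbiRuled.jac_ne_zero (φ.contMDiffAt hz) hU hinj

/-- The coordinate disc of the underlying Riemann surface, with coordinate the `m`-th power of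
the orbifold coordinate. -/
def desing (φ : OrbChart S m d) (hpos : 0 < m (φ.toFun 0)) : Disc S where
  toFun y := φ.toFun (y ^ ((m (φ.toFun 0) : ℂ)⁻¹))
  radius := φ.radius ^ m (φ.toFun 0)
  radius_pos := pow_pos φ.radius_pos _
  holo := by
    set N := m (φ.toFun 0) with hNdef
    have hN : N ≠ 0 := hpos.ne'
    have hin : ∀ y ∈ Metric.ball (0 : ℂ) (φ.radius ^ N), ∀ z : ℂ, z ^ N = y →
        z ∈ Metric.ball (0 : ℂ) φ.radius := by
      intro y hy z hzy
      rw [mem_ball_zero_iff] at hy ⊢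
      rw [← hzy, norm_pow] at hy
      exact lt_of_pow_lt_pow_left₀ _ φ.radius_pos.le hy
    have hfib : ∀ y ∈ Metric.ball (0 : ℂ) (φ.radius ^ N), ∀ z : ℂ, z ^ N = y →
        φ.toFun z = φ.toFun (y ^ ((N : ℂ)⁻¹)) := by
      intro y hy z hzy
      refine (φ.fibres _ (hin y hy z hzy) _ (hin y hy _ (Complex.cpow_nat_inv_pow _ hN))).2 ?_
      rw [hzy, Complex.cpow_nat_inv_pow _ hN]
    intro y hy
    refine ContMDiffAt.contMDiffWithinAt ?_
    have hy' := Metric.isOpen_ball.mem_nhds hy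
    rcases eq_or_ne y 0 with rfl | hy0
    · have h0 : (0 : ℂ) ^ ((N : ℂ)⁻¹) = 0 := Complex.zero_cpow (by simpa using hN)
      have hcont : ContinuousAt (fun y : ℂ => y ^ ((N : ℂ)⁻¹)) 0 := by
        have h1 : (0 : ℝ) < ((N : ℂ)⁻¹).re := by
          rw [← Complex.ofReal_natCast, ← Complex.ofReal_inv, Complex.ofReal_re]
          positivity
        exact Complex.continuousAt_cpow_const_of_re_pos (Or.inl le_rfl) h1
      refine contMDiffAt_of_analyticAt_chart_comp
        (ContinuousAt.comp (g := φ.toFun) (by rw [h0]; exact (φ.contMDiffAt φ.zero_mem).continuousAt)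
          hcont) ?_
      simp only [h0]
      refine analyticAt_comp_root (f := fun z => chartAt ℂ (φ.toFun 0) (φ.toFun z))
        (analyticAt_chart_comp (φ.contMDiffAt φ.zero_mem) (mem_chart_source ℂ _)) hN ?_
      filter_upwards [hy'] with y hy z hz
      simp only [hfib y hy z hz]
    · obtain ⟨k, hk, hky, hkp⟩ := exists_analyticAt_pow_eq (g := fun y => y) (z := y)
        analyticAt_id hy0 hN (c := y ^ ((N : ℂ)⁻¹)) (Complex.cpow_nat_inv_pow _ hN)
      have h1 : ContMDiffAt 𝓘(ℂ) 𝓘(ℂ) ω k y := by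
        rw [contMDiffAt_iff_contDiffAt]
        exact hk.contDiffAt
      have h2 : ContMDiffAt 𝓘(ℂ) 𝓘(ℂ) ω (φ.toFun ∘ k) y :=
        ContMDiffAt.comp (g := φ.toFun) y (φ.contMDiffAt (hin y hy _ (hkp y))) h1
      refine h2.congr_of_eventuallyEq ?_
      filter_upwards [hy'] with y' h3
      exact (hfib y' h3 _ (hkp y')).symm
  inj := by
    intro y hy y' hy' h
    have hN : m (φ.toFun 0) ≠ 0 := hpos.ne'
    have hin : ∀ y ∈ Metric.ball (0 : ℂ) (φ.radius ^ m (φ.toFun 0)),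
        y ^ ((m (φ.toFun 0) : ℂ)⁻¹) ∈ Metric.ball (0 : ℂ) φ.radius := by
      intro y hy
      rw [mem_ball_zero_iff] at hy ⊢
      rw [← Complex.cpow_nat_inv_pow y hN, norm_pow] at hy
      exact lt_of_pow_lt_pow_left₀ _ φ.radius_pos.le hy
    have := (φ.fibres _ (hin y hy) _ (hin y' hy')).1 h
    rwa [Complex.cpow_nat_inv_pow _ hN, Complex.cpow_nat_inv_pow _ hN] at this

lemma desing_radius (φ : OrbChart S m d) (hpos : 0 < m (φ.toFun 0)) :
    (φ.desing hpos).radius = φ.radius ^ m (φ.toFun 0) := rfl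

lemma desing_pow (φ : OrbChart S m d) (hpos : 0 < m (φ.toFun 0)) {z : ℂ}
    (hz : z ∈ Metric.ball (0 : ℂ) φ.radius) :
    (φ.desing hpos).toFun (z ^ m (φ.toFun 0)) = φ.toFun z := by
  have hN : m (φ.toFun 0) ≠ 0 := hpos.ne'
  refine (φ.fibres _ ?_ _ hz).2 (Complex.cpow_nat_inv_pow _ hN)
  have h1 : ((z ^ m (φ.toFun 0)) ^ ((m (φ.toFun 0) : ℂ)⁻¹)) ^ m (φ.toFun 0) =
    z ^ m (φ.toFun 0) := Complex.cpow_nat_inv_pow _ hN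
  have h2 := congrArg norm h1
  rw [norm_pow, norm_pow] at h2
  rw [mem_ball_zero_iff] at hz ⊢
  rwa [(pow_left_inj₀ (norm_nonneg _) (norm_nonneg _) hN).1 h2]

lemma desing_zero (φ : OrbChart S m d) (hpos : 0 < m (φ.toFun 0)) :
    (φ.desing hpos).toFun 0 = φ.toFun 0 := by
  have := φ.desing_pow hpos φ.zero_mem
  rwa [zero_pow hpos.ne'] at this

/-- Two orbifold charts centred at the same point differ by a change of coordinates. -/
lemma exists_transition_zero (φ φ' : OrbChart S m d) (h : φ'.toFun 0 = φ.toFun 0)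
    (hpos : 0 < m (φ.toFun 0)) :
    ∃ k : ℂ → ℂ, AnalyticAt ℂ k 0 ∧ k 0 = 0 ∧ deriv k 0 ≠ 0 ∧
      ∀ᶠ w in 𝓝 0, φ'.toFun (k w) = φ.toFun w := by
  have hpos' : 0 < m (φ'.toFun 0) := by rwa [h]
  have hN : m (φ.toFun 0) ≠ 0 := hpos.ne'
  obtain ⟨k, hk, hk0, hkd, hkw⟩ := (φ.desing hpos).exists_transition (φ'.desing hpos')
    (Disc.zero_mem _) (Disc.zero_mem _) (by rw [desing_zero, desing_zero, h])
  obtain ⟨α, hα, hα0, hkα⟩ := exists_eq_mul_of_map_zero hk hk0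
  rw [← hα0] at hkd
  have hp : Filter.Tendsto (fun z : ℂ => z ^ m (φ.toFun 0)) (𝓝 0) (𝓝 0) := by
    have : ContinuousAt (fun z : ℂ => z ^ m (φ.toFun 0)) 0 := by fun_prop
    simpa [ContinuousAt, zero_pow hN] using this
  have hαN : AnalyticAt ℂ (fun z : ℂ => α (z ^ m (φ.toFun 0))) 0 :=
    AnalyticAt.comp (g := α) (f := fun z : ℂ => z ^ m (φ.toFun 0)) (by simpa [zero_pow hN] using hα)
      (by fun_prop)
  have hα1 : (fun z : ℂ => α (z ^ m (φ.toFun 0))) 0 ≠ 0 := by simpa [zero_pow hN] using hkd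
  obtain ⟨c, hc⟩ := IsAlgClosed.exists_pow_nat_eq (α (0 ^ m (φ.toFun 0))) hpos
  obtain ⟨ρ, hρ, hρ0, hρp⟩ := exists_analyticAt_pow_eq hαN hα1 hN hc
  have hc0 : c ≠ 0 := by
    rintro rfl
    rw [zero_pow hN] at hc
    exact hα1 (by simpa [zero_pow hN] using hc.symm)
  have hz : AnalyticAt ℂ (fun z => z * ρ z) 0 := analyticAt_id.mul hρ
  refine ⟨fun z => z * ρ z, hz, by simp, ?_, ?_⟩
  · have h1 := ((hasDerivAt_id (0 : ℂ)).mul hρ.differentiableAt.hasDerivAt).deriv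
    simp only [id_eq, one_mul, zero_mul, add_zero] at h1
    have h2 : deriv (fun z => z * ρ z) 0 = ρ 0 := h1
    rw [h2, hρ0]
    exact hc0
  · have h1 : ∀ᶠ z in 𝓝 (0 : ℂ), z * ρ z ∈ Metric.ball (0 : ℂ) φ'.radius :=
      hz.continuousAt.eventually (Metric.isOpen_ball.mem_nhds (by simpa using φ'.radius_pos))
    filter_upwards [h1, hp.eventually hkw, hp.eventually hkα,
      Metric.isOpen_ball.mem_nhds φ.zero_mem] with z h2 h3 h4 h5
    rw [← φ'.desing_pow hpos' h2, ← φ.desing_pow hpos h5, ← h3, h4, mul_pow, h, hρp]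

end OrbChart

lemma pow_mem_ball_iff {N : ℕ} (hN : 0 < N) {R : ℝ} (hR : 0 < R) {z : ℂ} :
    z ^ N ∈ Metric.ball (0 : ℂ) R ↔ z ∈ Metric.ball (0 : ℂ) (R ^ ((N : ℝ)⁻¹)) := by
  rw [mem_ball_zero_iff, mem_ball_zero_iff, norm_pow]
  have h1 : (R ^ ((N : ℝ)⁻¹)) ^ N = R := Real.rpow_inv_natCast_pow hR.le hN.ne'
  conv_lhs => rw [← h1]
  exact pow_lt_pow_iff_left₀ (norm_nonneg _) (Real.rpow_pos_of_pos hR _).le hN.ne'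

/-- The orbifold chart at the centre of a coordinate disc. -/
def Disc.orb (φ : Disc S) (m : S → ℕ) (d : S → ℤ) (hpos : 0 < m (φ.toFun 0))
    (hreg : ∀ z ∈ Metric.ball (0 : ℂ) φ.radius, z ≠ 0 → m (φ.toFun z) = 1 ∧ d (φ.toFun z) = 0) :
    OrbChart S m d where
  toFun z := φ.toFun (z ^ m (φ.toFun 0))
  radius := φ.radius ^ ((m (φ.toFun 0) : ℝ)⁻¹)
  radius_pos := Real.rpow_pos_of_pos φ.radius_pos _
  holo := by
    intro z hz
    rw [← pow_mem_ball_iff hpos φ.radius_pos] at hz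
    have h2 : ContMDiffAt 𝓘(ℂ) 𝓘(ℂ) ω (fun z : ℂ => z ^ m (φ.toFun 0)) z := by
      rw [contMDiffAt_iff_contDiffAt]
      exact contDiffAt_id.pow _
    exact (ContMDiffAt.comp z (φ.contMDiffAt hz) h2).contMDiffWithinAt
  fibres := by
    intro z hz w hw
    rw [← pow_mem_ball_iff hpos φ.radius_pos] at hz hw
    rw [zero_pow hpos.ne']
    exact ⟨fun h => φ.inj hz hw h, fun h => by rw [h]⟩
  regular := by
    intro z hz h0
    rw [← pow_mem_ball_iff hpos φ.radius_pos] at hz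
    exact hreg _ hz (pow_ne_zero _ h0)

lemma Disc.orb_zero (φ : Disc S) (m : S → ℕ) (d : S → ℤ) (hpos : 0 < m (φ.toFun 0))
    (hreg : ∀ z ∈ Metric.ball (0 : ℂ) φ.radius, z ≠ 0 → m (φ.toFun z) = 1 ∧ d (φ.toFun z) = 0) :
    (φ.orb m d hpos hreg).toFun 0 = φ.toFun 0 := by
  simp [Disc.orb, zero_pow hpos.ne']

end Orb

/-! ### Changes of orbifold charts -/

section Transition

lemma eventually_nhdsNE_of_near {z : ℂ} {P : ℂ → Prop} (h : ∀ᶠ w in 𝓝[≠] z, P w) :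
    ∀ᶠ w in 𝓝 z, ∀ᶠ w' in 𝓝[≠] w, P w' := by
  have h1 : ∀ᶠ w in 𝓝 z, w ≠ z → P w := eventually_nhdsWithin_iff.1 h
  filter_upwards [h1.eventually_nhds] with w hw
  rcases eq_or_ne w z with rfl | hne
  · exact h
  · filter_upwards [hw.filter_mono nhdsWithin_le_nhds,
      (isOpen_ne.mem_nhds hne : {w | w ≠ z} ∈ 𝓝 w) |> mem_nhdsWithin_of_mem_nhds] with w' h2 h3
    exact h2 h3

lemma eventually_ne_zero_of_deriv_ne_zero {h : ℂ → ℂ} {z : ℂ} (hh : AnalyticAt ℂ h z)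
    (hd : deriv h z ≠ 0) : ∀ᶠ w in 𝓝[≠] z, h w ≠ h z :=
  (hh.differentiableAt.hasDerivAt).eventually_ne hd

/-- The local inverse of a holomorphic germ. -/
lemma exists_local_inverse {h : ℂ → ℂ} {z : ℂ} (hh : AnalyticAt ℂ h z) (hd : deriv h z ≠ 0) :
    ∃ k : ℂ → ℂ, AnalyticAt ℂ k (h z) ∧ k (h z) = z ∧ deriv k (h z) ≠ 0 ∧
      (∀ᶠ w in 𝓝 z, k (h w) = w) ∧ ∀ᶠ w in 𝓝 (h z), h (k w) = w := by
  have hl := hh.hasStrictDerivAt.eventually_left_inverse hd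
  have hr := hh.hasStrictDerivAt.eventually_right_inverse hd
  have hk := hh.analyticAt_localInverse hd
  refine ⟨_, hk, hl.self_of_nhds, ?_, hl, hr⟩
  intro h0
  have h1 := hh.differentiableAt.hasDerivAt.comp_of_eq (h z) hk.differentiableAt.hasDerivAt
    hl.self_of_nhds.symm
  rw [h0, mul_zero] at h1
  have h2 := (hasDerivAt_id (h z)).congr_of_eventuallyEq hr
  exact zero_ne_one (h1.unique h2)

variable {S : Type u} [TopologicalSpace S] [ChartedSpace ℂ S] {m : S → ℕ} {d : S → ℤ} {r : ℕ}

/-- Up to a unit, the frame of the line bundle only depends on the multiplicity of the divisor. -/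
lemma OrbChart.exists_frame (φ : OrbChart S m d) {h : ℂ → ℂ} {z : ℂ} (hh : AnalyticAt ℂ h z)
    (hd : deriv h z ≠ 0) (hz : h z ∈ Metric.ball (0 : ℂ) φ.radius) :
    ∃ β : ℂ → ℂ, AnalyticAt ℂ β z ∧ β z ≠ 0 ∧
      ∀ᶠ w in 𝓝[≠] z, h w ^ d (φ.toFun 0) = (w - z) ^ d (φ.toFun (h z)) * β w := by
  rcases eq_or_ne (h z) 0 with h0 | h0
  · have hs : AnalyticAt ℂ (fun y => h (z + y)) 0 :=
      AnalyticAt.comp (g := h) (f := fun y => z + y) (by simpa using hh) (by fun_prop)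
    obtain ⟨α, hα, hα0, hαe⟩ := exists_eq_mul_of_map_zero hs (by simpa using h0)
    rw [deriv_comp_const_add] at hα0
    simp only [add_zero] at hα0
    have hα' : AnalyticAt ℂ (fun w => α (w - z)) z :=
      AnalyticAt.comp (g := α) (f := fun w => w - z) (by simpa using hα) (by fun_prop)
    have hz0 : (fun w => α (w - z)) z ≠ 0 := by simpa [hα0] using hd
    refine ⟨fun w => α (w - z) ^ d (φ.toFun 0), hα'.zpow hz0, zpow_ne_zero _ hz0, ?_⟩
    have ht : Filter.Tendsto (fun w : ℂ => w - z) (𝓝 z) (𝓝 0) := by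
      have : ContinuousAt (fun w : ℂ => w - z) z := by fun_prop
      simpa [ContinuousAt] using this
    filter_upwards [(ht.eventually hαe).filter_mono nhdsWithin_le_nhds] with w hw
    rw [h0, ← mul_zpow, ← hw]
    simp
  · refine ⟨fun w => h w ^ d (φ.toFun 0), hh.zpow h0, zpow_ne_zero _ h0, ?_⟩
    rw [(φ.regular _ hz h0).2]
    simp

/-- A change of orbifold charts has a holomorphic transition function without zeros. -/
lemma exists_isTransition {φ φ' : OrbChart S m d} {h : ℂ → ℂ} {z : ℂ}
    (hz : z ∈ Metric.ball (0 : ℂ) φ.radius) (hh : AnalyticAt ℂ h z)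
    (hd : deriv h z ≠ 0) (hz' : h z ∈ Metric.ball (0 : ℂ) φ'.radius)
    (hφ : ∀ᶠ w in 𝓝 z, φ'.toFun (h w) = φ.toFun w) :
    ∃ a : ℂ → ℂ, AnalyticAt ℂ a z ∧ ∀ᶠ w in 𝓝 z, a w ≠ 0 ∧ IsTransition r φ φ' w h (a w) := by
  obtain ⟨β, hβ, hβ0, hβe⟩ := φ'.exists_frame hh hd hz'
  obtain ⟨α, hα, hα0, hαe⟩ := φ.exists_frame (h := id) (z := z) analyticAt_id (by simp) hz
  have hg : AnalyticAt ℂ (fun w => α w / β w) z := hα.div hβ hβ0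
  have hge : ∀ᶠ w in 𝓝[≠] z, α w / β w * h w ^ d (φ'.toFun 0) = w ^ d (φ.toFun 0) := by
    filter_upwards [hβe, hαe, (hβ.continuousAt.eventually_ne hβ0).filter_mono nhdsWithin_le_nhds]
      with w h1 h2 h3
    rw [h1, hφ.self_of_nhds]
    simp only [id_eq] at h2
    rw [h2]
    field_simp
  refine ⟨fun w => deriv h w ^ r * (α w / β w), (hh.deriv.pow r).mul hg, ?_⟩
  filter_upwards [hh.eventually_analyticAt, hh.deriv.continuousAt.eventually_ne hd,
    hh.continuousAt.eventually (Metric.isOpen_ball.mem_nhds hz'), hφ.eventually_nhds,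
    hg.eventually_analyticAt, eventually_nhdsNE_of_near hge,
    hα.continuousAt.eventually_ne hα0, hβ.continuousAt.eventually_ne hβ0] with w h1 h2 h3 h4 h5 h6 h7 h8
  exact ⟨mul_ne_zero (pow_ne_zero _ h2) (div_ne_zero h7 h8), h1, h2, h3, h4, _, h5, h6, rfl⟩

lemma IsTransition.unique {φ φ' : OrbChart S m d} {h h' : ℂ → ℂ} {z a a' : ℂ}
    (ht : IsTransition r φ φ' z h a) (ht' : IsTransition r φ φ' z h' a') (hhh : h =ᶠ[𝓝 z] h') :
    a = a' := by
  obtain ⟨hh, hd, hz', -, g, hg, hge, rfl⟩ := ht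
  obtain ⟨-, -, -, -, g', hg', hge', rfl⟩ := ht'
  obtain ⟨β, hβ, hβ0, hβe⟩ := φ'.exists_frame hh hd hz'
  have h1 : ∀ᶠ w in 𝓝[≠] z, g w = g' w := by
    filter_upwards [hge, hge', hβe, hhh.filter_mono nhdsWithin_le_nhds, self_mem_nhdsWithin,
      (hβ.continuousAt.eventually_ne hβ0).filter_mono nhdsWithin_le_nhds] with w h1 h2 h3 h4 h5 h6
    rw [← h4, ← h1] at h2
    refine (mul_right_cancel₀ ?_ h2).symm
    rw [h3]
    exact mul_ne_zero (zpow_ne_zero _ (sub_ne_zero.2 h5)) h6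
  have h2 : g z = g' z := tendsto_nhds_unique
    ((hg.continuousAt.tendsto.mono_left nhdsWithin_le_nhds).congr' h1)
    (hg'.continuousAt.tendsto.mono_left nhdsWithin_le_nhds)
  rw [h2, hhh.deriv_eq]

lemma isTransition_id (φ : OrbChart S m d) {z : ℂ} (hz : z ∈ Metric.ball (0 : ℂ) φ.radius) :
    IsTransition r φ φ z id 1 :=
  ⟨analyticAt_id, by simp, hz, by simp, fun _ => 1, analyticAt_const, by simp, by simp⟩

lemma IsTransition.comp {φ φ' φ'' : OrbChart S m d} {h k : ℂ → ℂ} {z a b : ℂ}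
    (ht : IsTransition r φ φ' z h a) (ht' : IsTransition r φ' φ'' (h z) k b) :
    IsTransition r φ φ'' z (k ∘ h) (a * b) := by
  obtain ⟨hh, hd, hz', hφ, g, hg, hge, rfl⟩ := ht
  obtain ⟨hk, hkd, hz'', hφ', g', hg', hge', rfl⟩ := ht'
  have hder : deriv (k ∘ h) z = deriv k (h z) * deriv h z :=
    deriv_comp z hk.differentiableAt hh.differentiableAt
  have htend : Filter.Tendsto h (𝓝[≠] z) (𝓝[≠] (h z)) :=
    tendsto_nhdsWithin_iff.2 ⟨hh.continuousAt.tendsto.mono_left nhdsWithin_le_nhds,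
      eventually_ne_zero_of_deriv_ne_zero hh hd⟩
  refine ⟨hk.comp hh, ?_, hz'', ?_, fun w => g w * g' (h w), hg.mul (hg'.comp hh), ?_, ?_⟩
  · rw [hder]
    exact mul_ne_zero hkd hd
  · filter_upwards [hφ, hh.continuousAt.eventually hφ'] with w h1 h2
    exact h2.trans h1
  · filter_upwards [hge, htend.eventually hge'] with w h1 h2
    rw [mul_assoc, Function.comp, h2, h1]
  · rw [hder]
    ring

lemma IsTransition.ne_zero {φ φ' : OrbChart S m d} {h : ℂ → ℂ} {z a : ℂ}
    (hz : z ∈ Metric.ball (0 : ℂ) φ.radius) (ht : IsTransition r φ φ' z h a) : a ≠ 0 := by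
  obtain ⟨A, -, hA⟩ := exists_isTransition (r := r) hz ht.1 ht.2.1 ht.2.2.1 ht.2.2.2.1
  rw [ht.unique hA.self_of_nhds.2 (by rfl)]
  exact hA.self_of_nhds.1

lemma IsTransition.exists_symm {φ φ' : OrbChart S m d} {h : ℂ → ℂ} {z a : ℂ}
    (hz : z ∈ Metric.ball (0 : ℂ) φ.radius) (ht : IsTransition r φ φ' z h a) :
    ∃ k, k (h z) = z ∧ IsTransition r φ' φ (h z) k a⁻¹ := by
  obtain ⟨k, hk, hkz, hkd, hkl, hkr⟩ := exists_local_inverse ht.1 ht.2.1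
  have hφ : ∀ᶠ w in 𝓝 (h z), φ.toFun (k w) = φ'.toFun w := by
    have h1 := hk.continuousAt.eventually (p := fun w => φ'.toFun (h w) = φ.toFun w)
      (by rw [hkz]; exact ht.2.2.2.1)
    filter_upwards [h1, hkr] with w h2 h3
    rw [← h2, h3]
  obtain ⟨A, -, hA⟩ := exists_isTransition (r := r) ht.2.2.1 hk hkd (by rwa [hkz]) hφ
  have hA' := hA.self_of_nhds.2
  refine ⟨k, hkz, ?_⟩
  have h1 := (ht.comp hA').unique (isTransition_id φ hz) hkl
  rwa [eq_inv_of_mul_eq_one_right h1] at hA'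

lemma rel_equivalence : Equivalence (Rel (m := m) (d := d) r) where
  refl x := ⟨id, 1, 1, isTransition_id _ x.2.2.1, rfl, one_ne_zero, by simp, by simp⟩
  symm := by
    rintro x x' ⟨h, a, lam, ht, hz, hl, hu, hv⟩
    obtain ⟨k, hkz, hk⟩ := ht.exists_symm x.2.2.1
    have ha := ht.ne_zero x.2.2.1
    refine ⟨k, a⁻¹, lam⁻¹, by rwa [hz], by rw [hz, hkz], inv_ne_zero hl, ?_, ?_⟩
    · rw [hu, inv_mul_cancel_left₀ hl]
    · have h1 : x.2.1.2.2 = lam⁻¹ * (a * x'.2.1.2.2) := by rw [hv, inv_mul_cancel_left₀ hl]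
      rw [h1]
      field_simp
  trans := by
    rintro x x' x'' ⟨h, a, lam, ht, hz, hl, hu, hv⟩ ⟨h', a', lam', ht', hz', hl', hu', hv'⟩
    rw [hz] at ht' hz'
    refine ⟨h' ∘ h, a * a', lam' * lam, ht.comp ht', hz', mul_ne_zero hl' hl, ?_, ?_⟩
    · rw [hu', hu, mul_assoc]
    · rw [mul_assoc, hv', mul_left_comm, hv, mul_assoc]

namespace RuledSurface

lemma mk_eq_mk {x x' : Rep m d} : mk r x = mk r x' ↔ Rel r x x' :=
  ⟨fun h => (rel_equivalence.eqvGen_iff).1 (Quot.eqvGen_exact h), fun h => Quot.sound h⟩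

lemma pt_eq_pt {φ φ' : OrbChart S m d} {z u v z' u' v' : ℂ}
    (hz : z ∈ Metric.ball (0 : ℂ) φ.radius) (huv : (u, v) ≠ (0 : ℂ × ℂ))
    (hz' : z' ∈ Metric.ball (0 : ℂ) φ'.radius) (huv' : (u', v') ≠ (0 : ℂ × ℂ)) :
    pt r φ z u v = pt r φ' z' u' v' ↔ ∃ (h : ℂ → ℂ) (a lam : ℂ), IsTransition r φ φ' z h a ∧
      z' = h z ∧ lam ≠ 0 ∧ u' = lam * u ∧ a * v' = lam * v := by
  rw [pt_eq r φ ⟨hz, huv⟩, pt_eq r φ' ⟨hz', huv'⟩, mk_eq_mk]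
  rfl

lemma prod_div_ne_zero {u v a : ℂ} (huv : (u, v) ≠ (0 : ℂ × ℂ)) (ha : a ≠ 0) :
    (u, v / a) ≠ (0 : ℂ × ℂ) := by
  intro h
  rw [Prod.mk_eq_zero, div_eq_zero_iff, or_iff_left ha] at h
  exact huv (Prod.mk_eq_zero.2 h)

lemma pt_of_isTransition {φ φ' : OrbChart S m d} {h : ℂ → ℂ} {z a u v : ℂ}
    (hz : z ∈ Metric.ball (0 : ℂ) φ.radius) (huv : (u, v) ≠ (0 : ℂ × ℂ))
    (ht : IsTransition r φ φ' z h a) : pt r φ z u v = pt r φ' (h z) u (v / a) := by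
  have ha := ht.ne_zero hz
  refine (pt_eq_pt hz huv ht.2.2.1 (prod_div_ne_zero huv ha)).2 ⟨h, a, 1, ht, rfl, one_ne_zero, ?_, ?_⟩
  · simp
  · field_simp

lemma pt_mul {φ : OrbChart S m d} {z u v c : ℂ} (hz : z ∈ Metric.ball (0 : ℂ) φ.radius)
    (huv : (u, v) ≠ (0 : ℂ × ℂ)) (hc : c ≠ 0) : pt r φ z (c * u) (c * v) = pt r φ z u v := by
  have h : (c * u, c * v) ≠ (0 : ℂ × ℂ) := fun h => by
    rw [Prod.mk_eq_zero, mul_eq_zero, mul_eq_zero, or_iff_right hc, or_iff_right hc] at h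
    exact huv (Prod.mk_eq_zero.2 h)
  exact ((pt_eq_pt hz huv hz h).2 ⟨id, 1, c, isTransition_id φ hz, rfl, hc, rfl, by simp⟩).symm

lemma exists_rep (P : RuledSurface m d r) : ∃ (φ : OrbChart S m d) (z u v : ℂ),
    z ∈ Metric.ball (0 : ℂ) φ.radius ∧ (u, v) ≠ (0 : ℂ × ℂ) ∧ P = pt r φ z u v := by
  induction P using Quot.ind with
  | mk x => exact ⟨x.1, x.2.1.1, x.2.1.2.1, x.2.1.2.2, x.2.2.1, x.2.2.2, (pt_eq r x.1 x.2.2).symm⟩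

lemma proj_pt {φ : OrbChart S m d} {z u v : ℂ} (hz : z ∈ Metric.ball (0 : ℂ) φ.radius)
    (huv : (u, v) ≠ (0 : ℂ × ℂ)) : proj r (pt r φ z u v) = φ.toFun z := by
  rw [pt_eq r φ ⟨hz, huv⟩]
  rfl

lemma isOpen_of_pt {U : Set (RuledSurface m d r)}
    (h : ∀ (φ : OrbChart S m d) (z u v : ℂ), z ∈ Metric.ball (0 : ℂ) φ.radius →
      (u, v) ≠ (0 : ℂ × ℂ) → pt r φ z u v ∈ U →
      ∀ᶠ y in 𝓝 (z, u, v), pt r φ y.1 y.2.1 y.2.2 ∈ U) : IsOpen U := by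
  refine isOpen_coinduced.2 (isOpen_sigma_iff.2 fun φ => isOpen_iff_mem_nhds.2 ?_)
  rintro ⟨⟨z, u, v⟩, hz, huv⟩ hy
  have h1 : pt r φ z u v ∈ U := by
    rw [pt_eq r φ ⟨hz, huv⟩]
    exact hy
  filter_upwards [continuousAt_subtype_val.eventually (h φ z u v hz huv h1)] with y hy'
  rw [pt_eq r φ y.2] at hy'
  exact hy'

lemma continuous_proj : Continuous (proj (m := m) (d := d) r) := by
  refine continuous_quot_lift _ (continuous_sigma fun φ => ?_)
  have h1 := φ.holo.continuousOn
  exact h1.comp_continuous (continuous_fst.comp continuous_subtype_val) fun y => y.2.1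

/-- Two homogeneous coordinates of the same point are related by a holomorphic germ. -/
lemma exists_germ_of_pt_eq {φ φ' : OrbChart S m d} {z u v z' u' v' : ℂ}
    (hz : z ∈ Metric.ball (0 : ℂ) φ.radius) (huv : (u, v) ≠ (0 : ℂ × ℂ))
    (hz' : z' ∈ Metric.ball (0 : ℂ) φ'.radius) (huv' : (u', v') ≠ (0 : ℂ × ℂ))
    (heq : pt r φ z u v = pt r φ' z' u' v') :
    ∃ (h a : ℂ → ℂ) (lam : ℂ), AnalyticAt ℂ h z ∧ AnalyticAt ℂ a z ∧ a z ≠ 0 ∧ h z = z' ∧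
      lam ≠ 0 ∧ u' = lam * u ∧ a z * v' = lam * v ∧
      ∀ᶠ w in 𝓝 z, h w ∈ Metric.ball (0 : ℂ) φ'.radius ∧ a w ≠ 0 ∧ ∀ u v, (u, v) ≠ (0 : ℂ × ℂ) →
        pt r φ w u v = pt r φ' (h w) u (v / a w) := by
  obtain ⟨h, a, lam, ht, rfl, hl, hu, hv⟩ := (pt_eq_pt hz huv hz' huv').1 heq
  obtain ⟨A, hA, hAe⟩ := exists_isTransition (r := r) hz ht.1 ht.2.1 ht.2.2.1 ht.2.2.2.1
  have hAa : a = A z := ht.unique hAe.self_of_nhds.2 (by rfl)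
  refine ⟨h, A, lam, ht.1, hA, hAe.self_of_nhds.1, rfl, hl, hu, by rwa [← hAa], ?_⟩
  filter_upwards [hAe, Metric.isOpen_ball.mem_nhds hz] with w h1 h2
  exact ⟨h1.2.2.2.1, h1.1, fun u v huv => pt_of_isTransition h2 huv h1.2⟩

end RuledSurface

end Transition

/-! ### Affine charts of ruled surfaces -/

namespace RuledSurface

variable {S : Type u} [TopologicalSpace S] [ChartedSpace ℂ S] {m : S → ℕ} {d : S → ℤ} {r : ℕ}

lemma affineChart_false (φ : OrbChart S m d) (y : ℂ × ℂ) :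
    affineChart r φ false y = pt r φ y.1 1 y.2 := rfl

lemma affineChart_true (φ : OrbChart S m d) (y : ℂ × ℂ) :
    affineChart r φ true y = pt r φ y.1 y.2 1 := rfl

lemma one_prod_ne_zero (v : ℂ) : ((1 : ℂ), v) ≠ (0 : ℂ × ℂ) := by simp [Prod.ext_iff]

lemma prod_one_ne_zero (v : ℂ) : (v, (1 : ℂ)) ≠ (0 : ℂ × ℂ) := by simp [Prod.ext_iff]

lemma proj_affineChart {φ : OrbChart S m d} {b : Bool} {y : ℂ × ℂ}
    (hy : y.1 ∈ Metric.ball (0 : ℂ) φ.radius) : proj r (affineChart r φ b y) = φ.toFun y.1 := by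
  cases b
  · exact proj_pt hy (one_prod_ne_zero _)
  · exact proj_pt hy (prod_one_ne_zero _)

lemma pt_eq_affineChart_false {φ : OrbChart S m d} {z u v : ℂ}
    (hz : z ∈ Metric.ball (0 : ℂ) φ.radius) (hu : u ≠ 0) :
    pt r φ z u v = affineChart r φ false (z, v / u) := by
  rw [affineChart_false, ← pt_mul (c := u) hz (one_prod_ne_zero _) hu]
  simp [mul_div_cancel₀ _ hu]

lemma pt_eq_affineChart_true {φ : OrbChart S m d} {z u v : ℂ}
    (hz : z ∈ Metric.ball (0 : ℂ) φ.radius) (hv : v ≠ 0) :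
    pt r φ z u v = affineChart r φ true (z, u / v) := by
  rw [affineChart_true, ← pt_mul (c := v) hz (prod_one_ne_zero _) hv]
  simp [mul_div_cancel₀ _ hv]

lemma affineChart_false_eq_true {φ : OrbChart S m d} {z w : ℂ}
    (hz : z ∈ Metric.ball (0 : ℂ) φ.radius) (hw : w ≠ 0) :
    affineChart r φ false (z, w) = affineChart r φ true (z, w⁻¹) := by
  rw [affineChart_false, pt_eq_affineChart_true hz hw, one_div]

lemma exists_affineChart_eq_pt {φ : OrbChart S m d} {z u v : ℂ}
    (hz : z ∈ Metric.ball (0 : ℂ) φ.radius) (huv : (u, v) ≠ (0 : ℂ × ℂ)) :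
    ∃ b t, pt r φ z u v = affineChart r φ b (z, t) := by
  rcases eq_or_ne u 0 with hu | hu
  · refine ⟨true, _, pt_eq_affineChart_true hz fun hv => huv (Prod.mk_eq_zero.2 ⟨hu, hv⟩)⟩
  · exact ⟨false, _, pt_eq_affineChart_false hz hu⟩

lemma continuousAt_affineChart {φ : OrbChart S m d} {b : Bool} {y : ℂ × ℂ}
    (hy : y.1 ∈ Metric.ball (0 : ℂ) φ.radius) : ContinuousAt (affineChart r φ b) y := by
  cases b
  · have h1 := continuousAt_pt r φ hy (one_prod_ne_zero y.2)
    exact ContinuousAt.comp (f := fun y : ℂ × ℂ => (y.1, (1 : ℂ), y.2)) h1 (by fun_prop)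
  · have h1 := continuousAt_pt r φ hy (prod_one_ne_zero y.2)
    exact ContinuousAt.comp (f := fun y : ℂ × ℂ => (y.1, y.2, (1 : ℂ))) h1 (by fun_prop)

/-- Homogeneous coordinates near a point of an affine chart lift to affine coordinates. -/
lemma exists_affineChart_lift {φ φ' : OrbChart S m d} {z u v : ℂ} {b : Bool} {y : ℂ × ℂ}
    (hz : z ∈ Metric.ball (0 : ℂ) φ'.radius) (huv : (u, v) ≠ (0 : ℂ × ℂ))
    (hy : y.1 ∈ Metric.ball (0 : ℂ) φ.radius) (heq : pt r φ' z u v = affineChart r φ b y) :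
    ∃ G : ℂ × ℂ × ℂ → ℂ × ℂ, AnalyticAt ℂ G (z, u, v) ∧ G (z, u, v) = y ∧
      ∀ᶠ x in 𝓝 (z, u, v), pt r φ' x.1 x.2.1 x.2.2 = affineChart r φ b (G x) := by
  have h1 : AnalyticAt ℂ (fun x : ℂ × ℂ × ℂ => x.1) (z, u, v) := analyticAt_fst
  have h2 : AnalyticAt ℂ (fun x : ℂ × ℂ × ℂ => x.2.1) (z, u, v) :=
    analyticAt_fst.comp analyticAt_snd
  have h3 : AnalyticAt ℂ (fun x : ℂ × ℂ × ℂ => x.2.2) (z, u, v) :=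
    analyticAt_snd.comp analyticAt_snd
  cases b
  · obtain ⟨h, a, lam, hh, ha, ha0, hhz, hl, hu, hv, hev⟩ :=
      exists_germ_of_pt_eq hz huv hy (one_prod_ne_zero _) heq
    have hu0 : u ≠ 0 := right_ne_zero_of_mul (hu ▸ one_ne_zero)
    have h4 : AnalyticAt ℂ (fun x : ℂ × ℂ × ℂ => h x.1) (z, u, v) :=
      AnalyticAt.comp (g := h) (f := fun x : ℂ × ℂ × ℂ => x.1) hh h1
    have h5 : AnalyticAt ℂ (fun x : ℂ × ℂ × ℂ => a x.1) (z, u, v) :=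
      AnalyticAt.comp (g := a) (f := fun x : ℂ × ℂ × ℂ => x.1) ha h1
    refine ⟨fun x => (h x.1, x.2.2 / a x.1 / x.2.1), h4.prod ((h3.div h5 ha0).div h2 hu0), ?_, ?_⟩
    · refine Prod.ext hhz ?_
      simp only
      rw [div_div, div_eq_iff (mul_ne_zero ha0 hu0)]
      have h6 : lam * (a z * u * y.2) = lam * v := by rw [← hv]; linear_combination (a z * y.2) * (-hu)
      linear_combination -(mul_left_cancel₀ hl h6)
    · filter_upwards [h1.continuousAt.eventually hev, h2.continuousAt.eventually_ne hu0] with x h6 h7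
      rw [h6.2.2 _ _ (fun h => h7 (Prod.mk_eq_zero.1 h).1), pt_eq_affineChart_false h6.1 h7]
  · obtain ⟨h, a, lam, hh, ha, ha0, hhz, hl, hu, hv, hev⟩ :=
      exists_germ_of_pt_eq hz huv hy (prod_one_ne_zero _) heq
    rw [mul_one] at hv
    have hv0 : v ≠ 0 := right_ne_zero_of_mul (hv ▸ ha0)
    have h4 : AnalyticAt ℂ (fun x : ℂ × ℂ × ℂ => h x.1) (z, u, v) :=
      AnalyticAt.comp (g := h) (f := fun x : ℂ × ℂ × ℂ => x.1) hh h1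
    have h5 : AnalyticAt ℂ (fun x : ℂ × ℂ × ℂ => a x.1) (z, u, v) :=
      AnalyticAt.comp (g := a) (f := fun x : ℂ × ℂ × ℂ => x.1) ha h1
    refine ⟨fun x => (h x.1, x.2.1 / (x.2.2 / a x.1)),
      h4.prod (h2.div (h3.div h5 ha0) (div_ne_zero hv0 ha0)), ?_, ?_⟩
    · refine Prod.ext hhz ?_
      simp only
      rw [div_eq_iff (div_ne_zero hv0 ha0), hu, hv]
      field_simp
    · filter_upwards [h1.continuousAt.eventually hev, h3.continuousAt.eventually_ne hv0] with x h6 h7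
      rw [h6.2.2 _ _ (fun h => h7 (Prod.mk_eq_zero.1 h).2),
        pt_eq_affineChart_true h6.1 (div_ne_zero h7 h6.2.1)]

/-- The affine charts are open maps. -/
lemma isOpen_image_affineChart (φ : OrbChart S m d) (b : Bool) {W : Set (ℂ × ℂ)} (hW : IsOpen W)
    (hWφ : ∀ y ∈ W, y.1 ∈ Metric.ball (0 : ℂ) φ.radius) : IsOpen (affineChart r φ b '' W) := by
  refine isOpen_of_pt fun φ' z u v hz huv ⟨y, hy, hyz⟩ => ?_
  obtain ⟨G, hG, hGy, hGe⟩ := exists_affineChart_lift hz huv (hWφ y hy) hyz.symm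
  filter_upwards [hGe, hG.continuousAt.eventually (by rw [hGy]; exact hW.mem_nhds hy)] with x h1 h2
  rw [h1]
  exact ⟨_, h2, rfl⟩

/-- Where an affine chart is injective, it is biholomorphic. -/
lemma exists_isBihol_affineChart (φ : OrbChart S m d) (b : Bool) {U : Set (ℂ × ℂ)} (hU : IsOpen U)
    (hUφ : ∀ y ∈ U, y.1 ∈ Metric.ball (0 : ℂ) φ.radius)
    (hinj : Set.InjOn (affineChart r φ b) U) :
    ∃ e : OpenPartialHomeomorph (ℂ × ℂ) (RuledSurface m d r), IsBihol e ∧ e.source = U ∧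
      ⇑e = affineChart r φ b := by
  have hopen : IsOpenMap (U.domRestrict (affineChart r φ b)) := fun W hW => by
    obtain ⟨V, hV, rfl⟩ := isOpen_induced_iff.1 hW
    have h1 : U.domRestrict (affineChart r φ b) '' (Subtype.val ⁻¹' V) =
        affineChart r φ b '' (U ∩ V) := by
      ext x
      constructor
      · rintro ⟨y, hy, rfl⟩
        exact ⟨y, ⟨y.2, hy⟩, rfl⟩
      · rintro ⟨y, ⟨hyU, hyV⟩, rfl⟩
        exact ⟨⟨y, hyU⟩, hyV, rfl⟩
    rw [h1]
    exact isOpen_image_affineChart φ b (hU.inter hV) fun y hy => hUφ y hy.1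
  refine ⟨OpenPartialHomeomorph.ofContinuousOpenRestrict
    (Set.InjOn.toPartialEquiv (affineChart r φ b) U hinj)
    (fun y hy => (continuousAt_affineChart (hUφ y hy)).continuousWithinAt) hopen hU, ?_, rfl, rfl⟩
  intro y hy f
  rw [holAt_iff_analyticAt]
  change HolSpace.HolAt f (affineChart r φ b y) ↔ AnalyticAt ℂ (f ∘ affineChart r φ b) y
  have hyφ := hUφ y hy
  constructor
  · intro hf
    cases b
    · exact AnalyticAt.comp (f := fun y : ℂ × ℂ => (y.1, (1 : ℂ), y.2))
        (hf φ y.1 1 y.2 hyφ (one_prod_ne_zero _) rfl)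
        (analyticAt_fst.prod (analyticAt_const.prod analyticAt_snd))
    · exact AnalyticAt.comp (f := fun y : ℂ × ℂ => (y.1, y.2, (1 : ℂ)))
        (hf φ y.1 y.2 1 hyφ (prod_one_ne_zero _) rfl)
        (analyticAt_fst.prod (analyticAt_snd.prod analyticAt_const))
  · intro hf φ' z u v hz huv heq
    obtain ⟨G, hG, hGy, hGe⟩ := exists_affineChart_lift hz huv hyφ heq
    have h1 : AnalyticAt ℂ ((f ∘ affineChart r φ b) ∘ G) (z, u, v) :=
      AnalyticAt.comp (by rwa [hGy]) hG
    refine h1.congr ?_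
    filter_upwards [hGe] with x hx
    simp only [Function.comp, hx]

end RuledSurface

section Isotropy

variable {S : Type u} [TopologicalSpace S] [ChartedSpace ℂ S] {m : S → ℕ} {d : S → ℤ} {r : ℕ}

lemma norm_eq_one_of_pow {ζ : ℂ} {N : ℕ} (hN : N ≠ 0) (h : ζ ^ N = 1) : ‖ζ‖ = 1 := by
  have h1 := congrArg norm h
  rw [norm_pow, norm_one] at h1
  exact (pow_eq_one_iff_of_nonneg (norm_nonneg _) hN).1 h1

/-- The changes of coordinates of an orbifold chart are the rotations. -/
lemma IsTransition.exists_root {φ : OrbChart S m d} (hpos : 0 < m (φ.toFun 0)) {h : ℂ → ℂ} {z a : ℂ}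
    (hz : z ∈ Metric.ball (0 : ℂ) φ.radius) (ht : IsTransition r φ φ z h a) :
    ∃ ζ : ℂ, ζ ^ m (φ.toFun 0) = 1 ∧ h z = ζ * z ∧ deriv h z = ζ ∧
      a = ζ ^ ((r : ℤ) - d (φ.toFun 0)) := by
  obtain ⟨hh, hd, hz', hφ, g, hg, hge, rfl⟩ := ht
  set N := m (φ.toFun 0) with hN
  have hpow : ∀ᶠ w in 𝓝 z, h w ^ N = w ^ N := by
    filter_upwards [hφ, hh.continuousAt.eventually (Metric.isOpen_ball.mem_nhds hz'),
      Metric.isOpen_ball.mem_nhds hz] with w h1 h2 h3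
    exact (φ.fibres _ h2 _ h3).1 h1
  have hne : ∀ᶠ w in 𝓝[≠] z, w ≠ 0 := by
    rcases eq_or_ne z 0 with rfl | h0
    · exact self_mem_nhdsWithin
    · exact (isOpen_ne.mem_nhds h0 : {w : ℂ | w ≠ 0} ∈ 𝓝 z) |> mem_nhdsWithin_of_mem_nhds
  obtain ⟨α, hα, hαe⟩ : ∃ α : ℂ → ℂ, AnalyticAt ℂ α z ∧ ∀ᶠ w in 𝓝 z, h w = w * α w := by
    rcases eq_or_ne z 0 with rfl | h0
    · have h1 := hpow.self_of_nhds
      rw [zero_pow hpos.ne', pow_eq_zero_iff hpos.ne'] at h1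
      obtain ⟨α, hα, -, hαe⟩ := exists_eq_mul_of_map_zero hh h1
      exact ⟨α, hα, hαe⟩
    · refine ⟨fun w => h w / w, hh.div analyticAt_id h0, ?_⟩
      filter_upwards [isOpen_ne.mem_nhds h0] with w hw
      exact (mul_div_cancel₀ _ hw).symm
  have hαN : ∀ᶠ w in 𝓝[≠] z, α w ^ N = 1 := by
    filter_upwards [hne, hpow.filter_mono nhdsWithin_le_nhds,
      hαe.filter_mono nhdsWithin_le_nhds] with w h1 h2 h3
    rw [h3, mul_pow] at h2
    exact mul_left_cancel₀ (pow_ne_zero N h1) (by rw [h2, mul_one])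
  have hαz : α z ^ N = 1 := tendsto_nhds_unique
    (((hα.pow N).continuousAt.tendsto.mono_left nhdsWithin_le_nhds).congr' hαN) tendsto_const_nhds
  have hα' : deriv α z = 0 := by
    have h1 : (fun w => α w ^ N) =ᶠ[𝓝 z] fun _ => 1 := by
      have h2 := eventually_nhdsWithin_iff.1 hαN
      filter_upwards [h2] with w h3
      rcases eq_or_ne w z with rfl | h4
      · exact hαz
      · exact h3 h4
    have h3 := h1.deriv_eq
    rw [deriv_const, show (fun w => α w ^ N) = α ^ N from rfl,
      (hα.differentiableAt.hasDerivAt.pow N).deriv] at h3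
    have h5 : α z ≠ 0 := fun h0 => by simp [h0, hpos.ne'] at hαz
    have h6 : (N : ℂ) ≠ 0 := by exact_mod_cast hpos.ne'
    simpa [h5, h6] using h3
  have hhd : deriv h z = α z := by
    rw [Filter.EventuallyEq.deriv_eq hαe]
    have h1 : deriv (fun w => w * α w) z = _ :=
      ((hasDerivAt_id z).mul hα.differentiableAt.hasDerivAt).deriv
    rw [h1, hα']
    simp
  have hα0 : α z ≠ 0 := fun h0 => by simp [h0, hpos.ne'] at hαz
  have hgz : g z * α z ^ d (φ.toFun 0) = 1 := by
    have h1 : ∀ᶠ w in 𝓝[≠] z, g w * α w ^ d (φ.toFun 0) = 1 := by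
      filter_upwards [hne, hge, hαe.filter_mono nhdsWithin_le_nhds] with w h1 h2 h3
      rw [h3, mul_zpow] at h2
      exact mul_left_cancel₀ (zpow_ne_zero (d (φ.toFun 0)) h1) (by linear_combination h2)
    exact tendsto_nhds_unique
      (((hg.mul (hα.zpow hα0)).continuousAt.tendsto.mono_left nhdsWithin_le_nhds).congr' h1)
      tendsto_const_nhds
  refine ⟨α z, hαz, by rw [hαe.self_of_nhds, mul_comm], hhd, ?_⟩
  rw [hhd, zpow_sub₀ hα0, zpow_natCast, eq_div_iff (zpow_ne_zero _ hα0), mul_assoc, hgz, mul_one]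

lemma isTransition_mul (φ : OrbChart S m d) (hpos : 0 < m (φ.toFun 0)) {ζ z : ℂ}
    (hζ : ζ ^ m (φ.toFun 0) = 1) (hz : z ∈ Metric.ball (0 : ℂ) φ.radius) :
    IsTransition r φ φ z (fun w => ζ * w) (ζ ^ ((r : ℤ) - d (φ.toFun 0))) := by
  have hn := norm_eq_one_of_pow hpos.ne' hζ
  have hζ0 : ζ ≠ 0 := fun h => by simp [h] at hn
  have hb : ∀ w ∈ Metric.ball (0 : ℂ) φ.radius, ζ * w ∈ Metric.ball (0 : ℂ) φ.radius := by
    intro w hw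
    rwa [mem_ball_zero_iff, norm_mul, hn, one_mul, ← mem_ball_zero_iff]
  have hd : deriv (fun w => ζ * w) z = ζ := by simp
  refine ⟨by fun_prop, by rwa [hd], hb z hz, ?_, fun _ => ζ ^ (-d (φ.toFun 0)), analyticAt_const, ?_, ?_⟩
  · filter_upwards [Metric.isOpen_ball.mem_nhds hz] with w hw
    refine (φ.fibres _ (hb w hw) _ hw).2 ?_
    rw [mul_pow, hζ, one_mul]
  · filter_upwards with w
    rw [mul_zpow, ← mul_assoc, ← zpow_add₀ hζ0, neg_add_cancel, zpow_zero, one_mul]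
  · rw [hd, ← zpow_natCast, ← zpow_add₀ hζ0, sub_eq_add_neg]

namespace RuledSurface

/-- The weight of the action of the isotropy group of an orbifold chart on the affine
coordinate of the fibre. -/
def fibreWeight (r : ℕ) (k : ℤ) (b : Bool) : ℤ := if b then r - k else k - r

lemma affineChart_eq_iff {φ : OrbChart S m d} (hpos : 0 < m (φ.toFun 0)) {b : Bool} {y y' : ℂ × ℂ}
    (hy : y.1 ∈ Metric.ball (0 : ℂ) φ.radius) (hy' : y'.1 ∈ Metric.ball (0 : ℂ) φ.radius) :
    affineChart r φ b y = affineChart r φ b y' ↔ ∃ ζ : ℂ, ζ ^ m (φ.toFun 0) = 1 ∧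
      y' = (ζ * y.1, ζ ^ fibreWeight r (d (φ.toFun 0)) b * y.2) := by
  have h0 : ∀ ζ : ℂ, ζ ^ m (φ.toFun 0) = 1 → ζ ≠ 0 := fun ζ h hζ => by
    simp [hζ, hpos.ne'] at h
  have hw : ∀ ζ : ℂ, ζ ^ fibreWeight r (d (φ.toFun 0)) false =
      (ζ ^ ((r : ℤ) - d (φ.toFun 0)))⁻¹ := fun ζ => by
    rw [← zpow_neg]
    simp [fibreWeight]
  cases b
  · rw [affineChart_false, affineChart_false,
      pt_eq_pt hy (one_prod_ne_zero _) hy' (one_prod_ne_zero _)]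
    constructor
    · rintro ⟨h, a, lam, ht, hz, hl, hu, hv⟩
      obtain ⟨ζ, hζ, hhz, -, rfl⟩ := ht.exists_root hpos hy
      refine ⟨ζ, hζ, Prod.ext (hz.trans hhz) ?_⟩
      simp only
      rw [hw, eq_inv_mul_iff_mul_eq₀ (zpow_ne_zero _ (h0 ζ hζ)), hv, ← mul_one lam, ← hu, one_mul]
    · rintro ⟨ζ, hζ, rfl⟩
      refine ⟨_, _, 1, isTransition_mul φ hpos hζ hy, rfl, one_ne_zero, by simp, ?_⟩
      simp only
      rw [hw, mul_inv_cancel_left₀ (zpow_ne_zero _ (h0 ζ hζ)), one_mul]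
  · rw [affineChart_true, affineChart_true,
      pt_eq_pt hy (prod_one_ne_zero _) hy' (prod_one_ne_zero _)]
    constructor
    · rintro ⟨h, a, lam, ht, hz, hl, hu, hv⟩
      obtain ⟨ζ, hζ, hhz, -, rfl⟩ := ht.exists_root hpos hy
      refine ⟨ζ, hζ, Prod.ext (hz.trans hhz) ?_⟩
      rw [mul_one, mul_one] at hv
      simp only [fibreWeight, if_true]
      rw [hu, hv]
    · rintro ⟨ζ, hζ, rfl⟩
      refine ⟨_, _, _, isTransition_mul φ hpos hζ hy, rfl, zpow_ne_zero _ (h0 ζ hζ), ?_, rfl⟩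
      simp [fibreWeight]

lemma norm_mul_norm_of_affineChart_eq {φ : OrbChart S m d} (hpos : 0 < m (φ.toFun 0))
    {y y' : ℂ × ℂ} (hy : y.1 ∈ Metric.ball (0 : ℂ) φ.radius)
    (hy' : y'.1 ∈ Metric.ball (0 : ℂ) φ.radius)
    (h : affineChart r φ false y = affineChart r φ true y') : ‖y.2‖ * ‖y'.2‖ = 1 := by
  rw [affineChart_false, affineChart_true,
    pt_eq_pt hy (one_prod_ne_zero _) hy' (prod_one_ne_zero _)] at h
  obtain ⟨h, a, lam, ht, hz, hl, hu, hv⟩ := h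
  obtain ⟨ζ, hζ, hhz, -, rfl⟩ := ht.exists_root hpos hy
  have h1 := norm_eq_one_of_pow hpos.ne' hζ
  rw [← norm_mul, hu, mul_one, mul_comm, ← hv, mul_one, norm_zpow, h1, one_zpow]

end RuledSurface

end Isotropy

/-! ### Topology and generic coordinates of ruled surfaces -/

section Ruled

variable {S : Type u} [TopologicalSpace S] [ChartedSpace ℂ S] [IsManifold 𝓘(ℂ) ω S]
  {m : S → ℕ} {d : S → ℤ} {r : ℕ}

/-- Lifts of a point of the base to two orbifold charts are related by a change of charts. -/
lemma OrbChart.exists_transition (hpos : ∀ x, 0 < m x) (φ φ' : OrbChart S m d) {z w : ℂ}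
    (hz : z ∈ Metric.ball (0 : ℂ) φ.radius) (hw : w ∈ Metric.ball (0 : ℂ) φ'.radius)
    (h : φ'.toFun w = φ.toFun z) (h0 : w = 0 ∨ m (φ'.toFun w) = 1) :
    ∃ k : ℂ → ℂ, AnalyticAt ℂ k z ∧ k z = w ∧ deriv k z ≠ 0 ∧
      ∀ᶠ y in 𝓝 z, φ'.toFun (k y) = φ.toFun y := by
  by_cases hm : m (φ'.toFun w) = 1
  · obtain ⟨k, hk, hkz, hkw⟩ := exists_lift (φ.contMDiffAt hz) (φ'.contMDiffAt hw)
      (φ'.jac_ne_zero hw hm (hpos _)) h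
    refine ⟨k, hk, hkz, fun h0 => ?_, hkw⟩
    have := jac_comp hk (by rw [hkz]; exact φ'.contMDiffAt hw) hkw
    rw [h0, mul_zero] at this
    exact φ.jac_ne_zero hz (by rwa [← h]) (hpos _) this
  · obtain rfl := h0.resolve_right hm
    have hz0 : z = 0 := by
      by_contra hne
      exact hm (by rw [h]; exact (φ.regular z hz hne).1)
    subst hz0
    exact φ.exists_transition_zero φ' h (hpos _)

namespace RuledSurface

lemma exists_eq_affineChart (hpos : ∀ x, 0 < m x) (φ : OrbChart S m d) {w : ℂ}
    (hw : w ∈ Metric.ball (0 : ℂ) φ.radius) (h0 : w = 0 ∨ m (φ.toFun w) = 1)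
    {P : RuledSurface m d r} (hP : proj r P = φ.toFun w) :
    ∃ b t, P = affineChart r φ b (w, t) := by
  obtain ⟨φ', z, u, v, hz, huv, rfl⟩ := exists_rep P
  rw [proj_pt hz huv] at hP
  obtain ⟨k, hk, rfl, hkd, hkw⟩ := φ'.exists_transition hpos φ hz hw hP.symm h0
  obtain ⟨a, -, ha⟩ := exists_isTransition (r := r) hz hk hkd hw hkw
  rw [pt_of_isTransition hz huv ha.self_of_nhds.2]
  exact exists_affineChart_eq_pt hw (prod_div_ne_zero huv ha.self_of_nhds.1)

lemma t2Space [T2Space S] (hpos : ∀ x, 0 < m x) (hch : ∀ x, ∃ φ : OrbChart S m d, φ.toFun 0 = x) :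
    T2Space (RuledSurface m d r) := by
  refine ⟨fun P P' hne => ?_⟩
  rcases ne_or_eq (proj r P) (proj r P') with hp | hp
  · obtain ⟨U, V, hU, hV, hPU, hPV, hUV⟩ := t2_separation hp
    exact ⟨_, _, hU.preimage continuous_proj, hV.preimage continuous_proj, hPU, hPV,
      hUV.preimage _⟩
  obtain ⟨φ, hφ⟩ := hch (proj r P)
  -- two points of the same affine chart
  have key : ∀ b t t', affineChart r φ b (0, t) ≠ affineChart r φ b (0, t') →
      ∃ U V : Set (RuledSurface m d r), IsOpen U ∧ IsOpen V ∧ affineChart r φ b (0, t) ∈ U ∧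
        affineChart r φ b (0, t') ∈ V ∧ Disjoint U V := by
    intro b t t' hne
    set k := fibreWeight r (d (φ.toFun 0)) b
    have hfin : {ζ : ℂ | ζ ^ m (φ.toFun 0) = 1}.Finite := by
      refine (Polynomial.nthRoots (m (φ.toFun 0)) (1 : ℂ)).toFinset.finite_toSet.subset fun ζ hζ => ?_
      simpa [Polynomial.mem_nthRoots (hpos _)] using hζ
    have h1 : ∀ᶠ x in 𝓝 (t, t'), ∀ ζ ∈ {ζ : ℂ | ζ ^ m (φ.toFun 0) = 1}, x.2 ≠ ζ ^ k * x.1 := by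
      rw [Filter.eventually_all_finite hfin]
      intro ζ hζ
      have h2 : IsOpen {x : ℂ × ℂ | x.2 ≠ ζ ^ k * x.1} :=
        isOpen_ne_fun continuous_snd (continuous_const.mul continuous_fst)
      refine h2.mem_nhds fun h3 => hne ?_
      refine (affineChart_eq_iff (hpos _) φ.zero_mem φ.zero_mem).2 ⟨ζ, hζ, ?_⟩
      exact Prod.ext (by simp) h3
    obtain ⟨U, hU, V, hV, hUV⟩ := mem_nhds_prod_iff.1 h1
    obtain ⟨U', hU', hUo, htU⟩ := mem_nhds_iff.1 hU
    obtain ⟨V', hV', hVo, htV⟩ := mem_nhds_iff.1 hV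
    refine ⟨_, _, isOpen_image_affineChart φ b (Metric.isOpen_ball.prod hUo) fun y hy => hy.1,
      isOpen_image_affineChart φ b (Metric.isOpen_ball.prod hVo) fun y hy => hy.1,
      ⟨_, ⟨φ.zero_mem, htU⟩, rfl⟩, ⟨_, ⟨φ.zero_mem, htV⟩, rfl⟩, ?_⟩
    rw [Set.disjoint_left]
    rintro _ ⟨y, hy, rfl⟩ ⟨y', hy', h4⟩
    obtain ⟨ζ, hζ, h5⟩ := (affineChart_eq_iff (hpos _) hy.1 hy'.1).1 h4.symm
    have h6 : (y.2, y'.2) ∈ U ×ˢ V := ⟨hU' hy.2, hV' hy'.2⟩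
    exact hUV h6 ζ hζ (congrArg Prod.snd h5)
  -- a point of the zero section chart and a point of the infinity section
  have key' : ∀ t, ∃ U V : Set (RuledSurface m d r), IsOpen U ∧ IsOpen V ∧
      affineChart r φ false (0, t) ∈ U ∧ affineChart r φ true (0, 0) ∈ V ∧ Disjoint U V := by
    intro t
    have hC : 0 < ‖t‖ + 1 := by positivity
    refine ⟨_, _, isOpen_image_affineChart φ false
      (Metric.isOpen_ball.prod (Metric.isOpen_ball (x := (0 : ℂ)) (ε := ‖t‖ + 1))) fun y hy => hy.1,
      isOpen_image_affineChart φ true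
      (Metric.isOpen_ball.prod (Metric.isOpen_ball (x := (0 : ℂ)) (ε := (‖t‖ + 1)⁻¹))) fun y hy => hy.1,
      ⟨_, ⟨φ.zero_mem, by simp⟩, rfl⟩, ⟨_, ⟨φ.zero_mem, by simpa using hC⟩, rfl⟩, ?_⟩
    rw [Set.disjoint_left]
    rintro _ ⟨y, hy, rfl⟩ ⟨y', hy', h4⟩
    have h5 := norm_mul_norm_of_affineChart_eq (hpos _) hy.1 hy'.1 h4.symm
    have h6 := mem_ball_zero_iff.1 hy.2
    have h7 := mem_ball_zero_iff.1 hy'.2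
    have h8 : ‖y.2‖ * ‖y'.2‖ < (‖t‖ + 1) * (‖t‖ + 1)⁻¹ :=
      mul_lt_mul'' h6 h7 (norm_nonneg _) (norm_nonneg _)
    rw [h5, mul_inv_cancel₀ hC.ne'] at h8
    exact lt_irrefl _ h8
  obtain ⟨b, t, rfl⟩ := exists_eq_affineChart hpos φ φ.zero_mem (Or.inl rfl) hφ.symm
  obtain ⟨b', t', rfl⟩ := exists_eq_affineChart hpos φ φ.zero_mem (Or.inl rfl)
    (by rw [hφ, ← hp] : proj r P' = φ.toFun 0)
  have swap : ∀ {Q Q' : RuledSurface m d r}, (∃ U V : Set (RuledSurface m d r), IsOpen U ∧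
      IsOpen V ∧ Q ∈ U ∧ Q' ∈ V ∧ Disjoint U V) → ∃ U V : Set (RuledSurface m d r), IsOpen U ∧
      IsOpen V ∧ Q' ∈ U ∧ Q ∈ V ∧ Disjoint U V :=
    fun ⟨U, V, hU, hV, h1, h2, h3⟩ => ⟨V, U, hV, hU, h2, h1, h3.symm⟩
  have key'' : ∀ t t', affineChart r φ false (0, t) ≠ affineChart r φ true (0, t') →
      ∃ U V : Set (RuledSurface m d r), IsOpen U ∧ IsOpen V ∧ affineChart r φ false (0, t) ∈ U ∧
        affineChart r φ true (0, t') ∈ V ∧ Disjoint U V := by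
    intro t t' hne
    rcases eq_or_ne t' 0 with rfl | ht'
    · exact key' t
    · have h1 := affineChart_false_eq_true (r := r) φ.zero_mem (inv_ne_zero ht')
      rw [inv_inv] at h1
      rw [← h1] at hne ⊢
      exact key _ _ _ hne
  cases b <;> cases b'
  · exact key _ _ _ hne
  · exact key'' _ _ hne
  · exact swap (key'' _ _ hne.symm)
  · exact key _ _ _ hne

/-- The generic coordinates of a point of the ruled surface: its image `x` in the base and, if `x`
is not in the set `𝒜`, the quotient `v / u` of the homogeneous coordinates with respect to the
preferred coordinate of the base at `x`. The second coordinate is `0` over `𝒜`. -/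
def gen (𝒜 : Set S) (h𝒜 : ∀ x ∉ 𝒜, m x = 1 ∧ d x = 0) (hpos : ∀ x, 0 < m x) :
    RuledSurface m d r → S × ℂ :=
  open Classical in
  Quot.lift (fun x : Rep m d => (x.1.toFun x.2.1.1, if x.1.toFun x.2.1.1 ∈ 𝒜 then 0 else
    x.2.1.2.2 / x.2.1.2.1 * (x.2.1.1 ^ (-d (x.1.toFun 0)) * (jac x.1.toFun x.2.1.1)⁻¹ ^ r))) (by
    rintro ⟨φ, ⟨z, u, v⟩, hz, huv⟩ ⟨φ', ⟨z', u', v'⟩, hz', huv'⟩ ⟨h, a, lam, ht, hzz, hl, hu, hv⟩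
    simp only at hz hz' hzz hu hv ht ⊢
    have ha := ht.ne_zero hz
    obtain ⟨hh, hd, -, hφ, g, hg, hge, rfl⟩ := ht
    subst hzz
    have hφz := hφ.self_of_nhds
    refine Prod.ext hφz.symm ?_
    simp only
    rw [hφz]
    split_ifs with hA
    · rfl
    obtain ⟨hm, hd0⟩ := h𝒜 _ hA
    have hz0 : ∀ w : ℂ, ∀ ψ : OrbChart S m d, d (ψ.toFun w) = 0 → w = 0 → d (ψ.toFun 0) = 0 := by
      rintro w ψ h rfl
      exact h
    have hne0 : ∀ {w : ℂ} {ψ : OrbChart S m d}, d (ψ.toFun w) = 0 → w ^ d (ψ.toFun 0) ≠ 0 := by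
      intro w ψ h
      rcases eq_or_ne w 0 with h1 | h1
      · rw [hz0 w ψ h h1, zpow_zero]
        exact one_ne_zero
      · exact zpow_ne_zero _ h1
    have hd0' : d (φ'.toFun (h z)) = 0 := by rw [hφz, hd0]
    have h1 : g z * h z ^ d (φ'.toFun 0) = z ^ d (φ.toFun 0) := by
      have h2 : AnalyticAt ℂ (fun w => g w * h w ^ d (φ'.toFun 0)) z := by
        refine hg.mul ?_
        rcases eq_or_ne (h z) 0 with h1 | h1
        · rw [hz0 _ _ hd0' h1]
          simpa using analyticAt_const
        · exact hh.zpow h1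
      have h3 : AnalyticAt ℂ (fun w : ℂ => w ^ d (φ.toFun 0)) z := by
        rcases eq_or_ne z 0 with h1 | h1
        · rw [hz0 _ _ hd0 h1]
          simpa using analyticAt_const
        · exact analyticAt_id.zpow h1
      exact tendsto_nhds_unique
        ((h2.continuousAt.tendsto.mono_left nhdsWithin_le_nhds).congr' hge)
        (h3.continuousAt.tendsto.mono_left nhdsWithin_le_nhds)
    have hj : jac φ.toFun z = jac φ'.toFun (h z) * deriv h z :=
      jac_comp hh (φ'.contMDiffAt hz') hφ
    have hj0 : jac φ'.toFun (h z) ≠ 0 := φ'.jac_ne_zero hz' (by rw [hφz, hm]) (hpos _)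
    have h4 : v / u = deriv h z ^ r * g z * (v' / u') := by
      have h5 : v = lam⁻¹ * (deriv h z ^ r * g z * v') := by rw [hv, inv_mul_cancel_left₀ hl]
      rw [hu, h5]
      field_simp
    have h6 := hne0 (w := h z) (ψ := φ') hd0'
    have h7 := hne0 (w := z) (ψ := φ) hd0
    have h8 : z ^ (-d (φ.toFun 0)) * g z = h z ^ (-d (φ'.toFun 0)) := by
      rw [zpow_neg, zpow_neg, ← h1]
      rw [← h1] at h7
      have := left_ne_zero_of_mul h7
      field_simp
    rw [h4, hj, ← h8, inv_pow, inv_pow, mul_pow]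
    field_simp)

variable {𝒜 : Set S} {h𝒜 : ∀ x ∉ 𝒜, m x = 1 ∧ d x = 0} {hpos : ∀ x, 0 < m x}

lemma gen_pt {φ : OrbChart S m d} {z u v : ℂ} (hz : z ∈ Metric.ball (0 : ℂ) φ.radius)
    (huv : (u, v) ≠ (0 : ℂ × ℂ)) :
    gen (r := r) 𝒜 h𝒜 hpos (pt r φ z u v) = (φ.toFun z, open Classical in if φ.toFun z ∈ 𝒜 then 0 else
      v / u * (z ^ (-d (φ.toFun 0)) * (jac φ.toFun z)⁻¹ ^ r)) := by
  rw [pt_eq r φ ⟨hz, huv⟩]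
  rfl

lemma gen_fst (P : RuledSurface m d r) : (gen 𝒜 h𝒜 hpos P).1 = proj r P := by
  obtain ⟨φ, z, u, v, hz, huv, rfl⟩ := exists_rep P
  rw [gen_pt hz huv, proj_pt hz huv]

lemma genInj_gen : GenInj (gen (r := r) 𝒜 h𝒜 hpos) := by
  intro P hP P' hP' h
  obtain ⟨φ, z, u, v, hz, huv, rfl⟩ := exists_rep P
  obtain ⟨φ', z', u', v', hz', huv', rfl⟩ := exists_rep P'
  have hx : φ'.toFun z' = φ.toFun z := by
    have := congrArg Prod.fst h
    rw [gen_pt hz huv, gen_pt hz' huv'] at this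
    exact this.symm
  have hA : φ.toFun z ∉ 𝒜 := fun hA => by
    rw [Set.mem_ofPred_eq, gen_pt hz huv] at hP
    simp [hA] at hP
  obtain ⟨k, hk, rfl, hkd, hkw⟩ := φ.exists_transition hpos φ' hz hz' hx
    (Or.inr (by rw [hx]; exact (h𝒜 _ hA).1))
  obtain ⟨a, -, ha⟩ := exists_isTransition (r := r) hz hk hkd hz' hkw
  have ha0 := ha.self_of_nhds.1
  rw [pt_of_isTransition hz huv ha.self_of_nhds.2] at h hP ⊢
  have huv2 := prod_div_ne_zero huv ha0
  rw [gen_pt hz' huv2, gen_pt hz' huv'] at h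
  rw [Set.mem_ofPred_eq, gen_pt hz' huv2] at hP
  have hA' : φ'.toFun (k z) ∉ 𝒜 := by rwa [hx]
  have h1 := congrArg Prod.snd h
  simp only [hA', if_false] at h1 hP
  have h2 := mul_right_cancel₀ (right_ne_zero_of_mul hP) h1
  have h3 := left_ne_zero_of_mul hP
  have hu : u ≠ 0 := fun h0 => h3 (by simp [h0])
  rw [h2] at h3
  have hu' : u' ≠ 0 := fun h0 => h3 (by simp [h0])
  rw [pt_eq_affineChart_false hz' hu, pt_eq_affineChart_false hz' hu', h2]

end RuledSurface

end Ruled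

/-! ### Toric charts -/

section LocMatch

variable {X : Type*} {Y : Type*} {Z : Type*} {S : Type*} [TopologicalSpace X] [HolSpace X]
  [TopologicalSpace Y] [HolSpace Y] [TopologicalSpace Z] [HolSpace Z]
  {f : X → S × ℂ} {g : Y → S × ℂ} {k : Z → S × ℂ}

lemma LocMatch.precomp {e : OpenPartialHomeomorph Z X} (he : IsBihol e) {z : Z} (hz : z ∈ e.source)
    (hk : ∀ z' ∈ e.source, k z' = f (e z')) {y : Y} (h : LocMatch f g (e z) y) :
    LocMatch k g z y := by
  obtain ⟨e', he', hy, hey, hfg, hd⟩ := h.symm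
  refine LocMatch.symm ⟨e'.trans e.symm, he'.trans he.symm, ⟨hy, ?_⟩, ?_, ?_, fun y' hy' => hd y' hy'.1⟩
  · change e' y ∈ e.target
    rw [hey]
    exact e.map_source hz
  · change e.symm (e' y) = z
    rw [hey, e.left_inv hz]
  · rintro y' ⟨h1, h2⟩
    have h3 : e' y' ∈ e.target := h2
    change k (e.symm (e' y')) = g y'
    rw [hk _ (e.map_target h3), e.right_inv h3, hfg y' h1]

lemma LocMatch.of_bihol {e : OpenPartialHomeomorph X Y} (he : IsBihol e) {x : X} (hx : x ∈ e.source)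
    (hfg : ∀ x' ∈ e.source, g (e x') = f x')
    (hd : ∀ᶠ y in 𝓝 (e x), y ∈ closure {y' | (g y').2 ≠ 0}) : LocMatch f g x (e x) := by
  obtain ⟨U, hU, hUo, hxU⟩ := eventually_nhds_iff.1 hd
  refine LocMatch.symm ⟨e.symm.restrOpen U hUo, he.symm.restr hUo, ⟨e.map_source hx, hxU⟩,
    e.left_inv hx, fun y hy => ?_, fun y hy => hU y hy.2⟩
  have h1 : y ∈ e.target := hy.1
  change f (e.symm y) = g y
  rw [← hfg _ (e.map_target h1), e.right_inv h1]

end LocMatch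

/-- A two-dimensional cone of a fan, given by the generators of its rays. -/
abbrev Cone : Type := (ℤ × ℤ) × (ℤ × ℤ)

/-- The map `(s, t) ↦ s ^ v t ^ w` given by the monomials of the cone `(v, w)`. -/
def mon (c : Cone) (y : ℂ × ℂ) : ℂ × ℂ :=
  (y.1 ^ c.1.1 * y.2 ^ c.2.1, y.1 ^ c.1.2 * y.2 ^ c.2.2)

/-- The cone `(v, w)` is unimodular, its rays are in clockwise order, and it lies in the right
half-plane. -/
structure IsCone (c : Cone) : Prop where
  fst_nonneg : 0 ≤ c.1.1
  snd_nonneg : 0 ≤ c.2.1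
  det : c.1.1 * c.2.2 - c.1.2 * c.2.1 = -1

/-- The two halves of a cone: `(v, v + w)` for `true`, and `(v + w, w)` for `false`. -/
def Cone.half (c : Cone) (j : Bool) : Cone := if j then (c.1, c.1 + c.2) else (c.1 + c.2, c.2)

lemma IsCone.half {c : Cone} (hc : IsCone c) (j : Bool) : IsCone (c.half j) := by
  obtain ⟨h1, h2, h3⟩ := hc
  cases j <;> refine ⟨?_, ?_, ?_⟩ <;> simp only [Cone.half, Prod.fst_add, Prod.snd_add, if_true,
    Bool.false_eq_true, if_false] <;> first | omega | linarith

section Toric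

variable {S : Type*}

/-- `R` is a system of generic coordinates `(z, w)` near the fibre `z = 0` over the point `x`. -/
structure IsRef (x : S) (ρ : ℝ) (R : ℂ × ℂ → S × ℂ) : Prop where
  pos : 0 < ρ
  zero : ∀ w, R (0, w) = (x, 0)
  fst_eq : ∀ z w, ‖z‖ < ρ → ((R (z, w)).1 = x ↔ z = 0)
  generic : ∀ z w, (R (z, w)).2 ≠ 0 ↔ z ≠ 0 ∧ ‖z‖ < ρ ∧ w ≠ 0
  inj : GenInj R

/-- The toric chart of the cone `c`. -/
def toric (R : ℂ × ℂ → S × ℂ) (c : Cone) (y : ℂ × ℂ) : S × ℂ := R (mon c y)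

variable {x : S} {ρ : ℝ} {R : ℂ × ℂ → S × ℂ} {c : Cone}

lemma mon_ne_zero {y : ℂ × ℂ} (h1 : y.1 ≠ 0) (h2 : y.2 ≠ 0) :
    (mon c y).1 ≠ 0 ∧ (mon c y).2 ≠ 0 :=
  ⟨mul_ne_zero (zpow_ne_zero _ h1) (zpow_ne_zero _ h2),
    mul_ne_zero (zpow_ne_zero _ h1) (zpow_ne_zero _ h2)⟩

lemma IsCone.ne_zero_of_mon (hc : IsCone c) {y : ℂ × ℂ} (h1 : (mon c y).1 ≠ 0)
    (h2 : (mon c y).2 ≠ 0) : y.1 ≠ 0 ∧ y.2 ≠ 0 := by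
  have hdet := hc.det
  constructor
  · intro h
    have h3 := left_ne_zero_of_mul h1
    have h4 := left_ne_zero_of_mul h2
    rw [h] at h3 h4
    have h5 : c.1.1 = 0 := by_contra fun h => h3 (zero_zpow _ h)
    have h6 : c.1.2 = 0 := by_contra fun h => h4 (zero_zpow _ h)
    simp [h5, h6] at hdet
  · intro h
    have h3 := right_ne_zero_of_mul h1
    have h4 := right_ne_zero_of_mul h2
    rw [h] at h3 h4
    have h5 : c.2.1 = 0 := by_contra fun h => h3 (zero_zpow _ h)
    have h6 : c.2.2 = 0 := by_contra fun h => h4 (zero_zpow _ h)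
    simp [h5, h6] at hdet

lemma IsCone.mon_injective (hc : IsCone c) {y : ℂ × ℂ} (h1 : y.1 ≠ 0) (h2 : y.2 ≠ 0) :
    y.1 = (mon c y).1 ^ (-c.2.2) * (mon c y).2 ^ c.2.1 ∧
      y.2 = (mon c y).1 ^ c.1.2 * (mon c y).2 ^ (-c.1.1) := by
  have hdet := hc.det
  constructor
  · simp only [mon, mul_zpow, ← zpow_mul]
    rw [mul_mul_mul_comm, ← zpow_add₀ h1, ← zpow_add₀ h2,
      show c.1.1 * -c.2.2 + c.1.2 * c.2.1 = 1 by linear_combination -hdet,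
      show c.2.1 * -c.2.2 + c.2.2 * c.2.1 = 0 by ring, zpow_one, zpow_zero, mul_one]
  · simp only [mon, mul_zpow, ← zpow_mul]
    rw [mul_mul_mul_comm, ← zpow_add₀ h1, ← zpow_add₀ h2,
      show c.1.1 * c.1.2 + c.1.2 * -c.1.1 = 0 by ring,
      show c.2.1 * c.1.2 + c.2.2 * -c.1.1 = 1 by linear_combination -hdet, zpow_one, zpow_zero,
      one_mul]

lemma IsCone.continuous_mon_fst (hc : IsCone c) : Continuous fun y => (mon c y).1 := by
  obtain ⟨a, ha⟩ := Int.eq_ofNat_of_zero_le hc.fst_nonneg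
  obtain ⟨b, hb⟩ := Int.eq_ofNat_of_zero_le hc.snd_nonneg
  simp only [mon, ha, hb, zpow_natCast]
  fun_prop

lemma IsRef.eq_zero {y : ℂ × ℂ} (hR : IsRef x ρ R) (h : y.1 = 0) : R y = (x, 0) := by
  rw [← hR.zero y.2, ← h]

lemma IsRef.genInj_toric (hR : IsRef x ρ R) (hc : IsCone c) : GenInj (toric R c) := by
  intro y hy y' hy' h
  have h1 := (hR.generic _ _).1 hy
  have h2 := (hR.generic _ _).1 hy'
  obtain ⟨h3, h4⟩ := hc.ne_zero_of_mon h1.1 h1.2.2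
  obtain ⟨h5, h6⟩ := hc.ne_zero_of_mon h2.1 h2.2.2
  have h7 : mon c y = mon c y' := hR.inj hy hy' h
  obtain ⟨h8, h9⟩ := hc.mon_injective h3 h4
  obtain ⟨h10, h11⟩ := hc.mon_injective h5 h6
  exact Prod.ext (by rw [h8, h10, h7]) (by rw [h9, h11, h7])

lemma eventually_ne_zero_and {y : ℂ × ℂ} : ∃ᶠ y' in 𝓝 y, y'.1 ≠ 0 ∧ y'.2 ≠ 0 := by
  have h : Dense ({z : ℂ | z ≠ 0} ×ˢ {z : ℂ | z ≠ 0}) :=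
    (dense_compl_singleton (0 : ℂ)).prod (dense_compl_singleton (0 : ℂ))
  exact mem_closure_iff_frequently.1 (h y)

lemma IsRef.mem_closure (hR : IsRef x ρ R) (hc : IsCone c) {y : ℂ × ℂ} (hy : ‖(mon c y).1‖ < ρ) :
    y ∈ closure {y' | (toric R c y').2 ≠ 0} := by
  have h1 : ∀ᶠ y' in 𝓝 y, ‖(mon c y').1‖ < ρ :=
    hc.continuous_mon_fst.norm.continuousAt.eventually_lt continuousAt_const hy
  refine mem_closure_iff_frequently.2 ((eventually_ne_zero_and.and_eventually h1).mono ?_)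
  rintro y' ⟨⟨h2, h3⟩, h4⟩
  exact (hR.generic _ _).2 ⟨(mon_ne_zero h2 h3).1, h4, (mon_ne_zero h2 h3).2⟩

lemma IsRef.eventually_mem_closure (hR : IsRef x ρ R) (hc : IsCone c) {y : ℂ × ℂ}
    (hy : (mon c y).1 = 0) : ∀ᶠ y' in 𝓝 y, y' ∈ closure {y' | (toric R c y').2 ≠ 0} := by
  have h1 : ∀ᶠ y' in 𝓝 y, ‖(mon c y').1‖ < ρ :=
    hc.continuous_mon_fst.norm.continuousAt.eventually_lt continuousAt_const
      (by rw [hy, norm_zero]; exact hR.pos)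
  filter_upwards [h1] with y' hy'
  exact hR.mem_closure hc hy'

lemma blowMap_false_ne {y : ℂ × ℂ} (h : y.1 ≠ 0) : mon c (blowMap false y) = mon (c.half false) y := by
  simp only [mon, blowMap_false, Cone.half, Bool.false_eq_true, if_false, Prod.fst_add, Prod.snd_add]
  rw [mul_zpow, mul_zpow, zpow_add₀ h, zpow_add₀ h, mul_assoc, mul_assoc]

lemma blowMap_true_ne {y : ℂ × ℂ} (h : y.2 ≠ 0) : mon c (blowMap true y) = mon (c.half true) y := by
  simp only [mon, blowMap_true, Cone.half, if_true, Prod.fst_add, Prod.snd_add]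
  rw [mul_zpow, mul_zpow, zpow_add₀ h, zpow_add₀ h, mul_assoc, mul_assoc]

lemma IsCone.mon_zero (hc : IsCone c) : (mon c 0).1 = 0 := by
  have hdet := hc.det
  by_contra h
  have h3 := left_ne_zero_of_mul h
  have h4 := right_ne_zero_of_mul h
  have h5 : c.1.1 = 0 := by_contra fun h => h3 (zero_zpow _ h)
  have h6 : c.2.1 = 0 := by_contra fun h => h4 (zero_zpow _ h)
  simp [h5, h6] at hdet

lemma IsCone.add_ne_zero (hc : IsCone c) : c.1.1 + c.2.1 ≠ 0 := by
  obtain ⟨h1, h2, h3⟩ := hc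
  intro h
  have h4 : c.1.1 = 0 := by omega
  have h5 : c.2.1 = 0 := by omega
  simp [h4, h5] at h3

/-- On the exceptional curve the function `z` vanishes, before and after the blow-up. -/
lemma IsCone.mon_half_of_eq_zero (hc : IsCone c) {j : Bool} {y : ℂ × ℂ} (h : blowMap j y = 0) :
    (mon (c.half j) y).1 = 0 := by
  cases j
  · simp only [mon, Cone.half, Bool.false_eq_true, if_false, Prod.fst_add, blowMap_eq_zero.1 h,
      zero_zpow _ hc.add_ne_zero, zero_mul]
  · have h2 : y.2 = 0 := congrArg Prod.snd h
    simp only [mon, Cone.half, if_true, Prod.fst_add, h2, zero_zpow _ hc.add_ne_zero, mul_zero]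

lemma blowMap_ne {j : Bool} {y : ℂ × ℂ} (h : blowMap j y ≠ 0) :
    mon c (blowMap j y) = mon (c.half j) y := by
  cases j
  · exact blowMap_false_ne fun h1 => h (blowMap_eq_zero.2 h1)
  · exact blowMap_true_ne fun h1 => h (by simp [blowMap_true, h1])

lemma IsRef.toric_blowMap (hR : IsRef x ρ R) (hc : IsCone c) (j : Bool) (y : ℂ × ℂ) :
    toric R c (blowMap j y) = toric R (c.half j) y := by
  by_cases h : blowMap j y = 0
  · rw [toric, toric, hR.eq_zero (hc.mon_half_of_eq_zero h), h, hR.eq_zero hc.mon_zero]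
  · rw [toric, toric, blowMap_ne h]

lemma IsRef.locMatch_half (hR : IsRef x ρ R) (hc : IsCone c) {j : Bool} {y : ℂ × ℂ}
    (hy : blowMap j y ≠ 0) (hz : (mon (c.half j) y).1 = 0) :
    LocMatch (toric R (c.half j)) (toric R c) y (blowMap j y) := by
  have hz' : (mon c (blowMap j y)).1 = 0 := by rw [blowMap_ne hy, hz]
  have key : ∀ G : ℂ × ℂ → ℂ × ℂ, AnalyticAt ℂ G (blowMap j y) →
      (∀ᶠ y' in 𝓝 (blowMap j y), blowMap j (G y') = y') →
      LocMatch (toric R (c.half j)) (toric R c) y (blowMap j y) := by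
    intro G hG h
    refine LocMatch.of_germs (hR.genInj_toric (hc.half j)) (hR.genInj_toric hc)
      (analyticAt_blowMap j y) hG (Filter.Eventually.of_forall fun y' => hR.toric_blowMap hc j y') ?_
      (hR.eventually_mem_closure (hc.half j) hz) (hR.eventually_mem_closure hc hz')
    filter_upwards [h] with y' hy'
    rw [← hR.toric_blowMap hc, hy']
  cases j
  · have h1 : y.1 ≠ 0 := fun h1 => hy (blowMap_eq_zero.2 h1)
    have h1' : (blowMap false y).1 ≠ 0 := h1
    refine key (fun y => (y.1, y.2 / y.1)) (analyticAt_fst.prod (analyticAt_snd.div analyticAt_fst h1')) ?_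
    have h2 : ∀ᶠ y' in 𝓝 (blowMap false y), y'.1 ≠ 0 := continuous_fst.continuousAt.eventually_ne h1
    filter_upwards [h2] with y' h3
    rw [blowMap_false]
    exact Prod.ext rfl (mul_div_cancel₀ _ h3)
  · have h1 : y.2 ≠ 0 := fun h1 => hy (by simp [blowMap_true, h1])
    have h1' : (blowMap true y).2 ≠ 0 := h1
    refine key (fun y => (y.1 / y.2, y.2)) ((analyticAt_fst.div analyticAt_snd h1').prod analyticAt_snd) ?_
    have h2 : ∀ᶠ y' in 𝓝 (blowMap true y), y'.2 ≠ 0 := continuous_snd.continuousAt.eventually_ne h1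
    filter_upwards [h2] with y' h3
    rw [blowMap_true]
    exact Prod.ext (div_mul_cancel₀ _ h3) rfl

lemma toric_swap (y : ℂ × ℂ) : toric R c.swap y.swap = toric R c y := by
  simp only [toric, mon, Prod.fst_swap, Prod.snd_swap]
  rw [mul_comm, mul_comm (y.2 ^ _)]

lemma IsRef.locMatch_swap {x : S} {ρ : ℝ} {R : ℂ × ℂ → S × ℂ} (hR : IsRef x ρ R) {c : Cone}
    (hc : IsCone c) {y : ℂ × ℂ} (hy : (mon c y).1 = 0) :
    LocMatch (toric R c.swap) (toric R c) y.swap y := by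
  refine LocMatch.symm ?_
  have h1 : LocMatch (toric R c.swap) (toric R c) y.swap (swapPH y.swap) := by
    refine LocMatch.of_bihol isBihol_swapPH trivial (fun y' _ => ?_) ?_
    · rw [swapPH_apply, ← toric_swap (c := c), Prod.swap_swap]
    · rw [swapPH_apply, Prod.swap_swap]
      exact hR.eventually_mem_closure hc hy
  rw [swapPH_apply, Prod.swap_swap] at h1
  exact h1.symm

/-- Two cones are separated by a line through the origin. -/
def Sep (c c' : Cone) : Prop :=
  ∃ a b : ℤ, 0 ≤ a * c.1.1 + b * c.1.2 ∧ 0 ≤ a * c.2.1 + b * c.2.2 ∧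
    a * c'.1.1 + b * c'.1.2 ≤ 0 ∧ a * c'.2.1 + b * c'.2.2 ≤ 0 ∧ (a ≠ 0 ∨ b ≠ 0)

lemma Sep.symm {c c' : Cone} : Sep c c' → Sep c' c := by
  rintro ⟨a, b, h1, h2, h3, h4, h5⟩
  exact ⟨-a, -b, by linarith, by linarith, by linarith, by linarith, by simpa using h5⟩

lemma Sep.half {c c' : Cone} (h : Sep c c') (j : Bool) : Sep (c.half j) c' := by
  obtain ⟨a, b, h1, h2, h3, h4, h5⟩ := h
  refine ⟨a, b, ?_, ?_, h3, h4, h5⟩ <;> cases j <;>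
    simp only [Cone.half, Bool.false_eq_true, if_false, if_true, Prod.fst_add, Prod.snd_add] <;> linarith

lemma IsCone.sep_half (hc : IsCone c) : Sep (c.half true) (c.half false) := by
  have h := hc.det
  refine ⟨-(c.1.2 + c.2.2), c.1.1 + c.2.1, ?_, ?_, ?_, ?_, Or.inr hc.add_ne_zero⟩ <;>
    simp only [Cone.half, Bool.false_eq_true, if_false, if_true, Prod.fst_add, Prod.snd_add] <;> linarith

/-- The origin of a toric chart is not matched to a point of the chart of a separated cone. -/
lemma IsRef.not_locMatch (hR : IsRef x ρ R) {c' : Cone} (hc : IsCone c) (hc' : IsCone c')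
    (hs : Sep c c') {y : ℂ × ℂ} : ¬ LocMatch (toric R c) (toric R c') 0 y := by
  rintro ⟨e, -, hx, hey, hfg, -⟩
  obtain ⟨a, b, h1, h2, h3, h4, h5⟩ := hs
  -- the character `z ^ a w ^ b` tends to `0` in one chart and is bounded below in the other one
  set χ : ℂ × ℂ → ℂ := fun v => v.1 ^ a * v.2 ^ b with hχ
  have hmon : ∀ (c : Cone) (y : ℂ × ℂ), y.1 ≠ 0 → y.2 ≠ 0 →
      χ (mon c y) = y.1 ^ (a * c.1.1 + b * c.1.2) * y.2 ^ (a * c.2.1 + b * c.2.2) := by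
    intro c y hy1 hy2
    simp only [hχ, mon, mul_zpow, ← zpow_mul]
    rw [zpow_add₀ hy1, zpow_add₀ hy2, mul_comm c.1.1, mul_comm c.1.2, mul_comm c.2.1, mul_comm c.2.2]
    ring
  obtain ⟨m, hm⟩ := Int.eq_ofNat_of_zero_le h1
  obtain ⟨n, hn⟩ := Int.eq_ofNat_of_zero_le h2
  obtain ⟨m', hm'⟩ := Int.eq_ofNat_of_zero_le (neg_nonneg.2 h3)
  obtain ⟨n', hn'⟩ := Int.eq_ofNat_of_zero_le (neg_nonneg.2 h4)
  have hmn : m ≠ 0 ∨ n ≠ 0 := by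
    by_contra! h0
    obtain ⟨rfl, rfl⟩ := h0
    have hdet := hc.det
    simp only [Nat.cast_zero] at hm hn
    rcases h5 with h5 | h5
    · refine h5 ?_
      linear_combination a * hdet - c.2.2 * hm + c.1.2 * hn
    · refine h5 ?_
      linear_combination b * hdet + c.2.1 * hm - c.1.1 * hn
  have hP : Continuous fun y : ℂ × ℂ => y.1 ^ m * y.2 ^ n := by fun_prop
  have hP0 : (0 : ℂ × ℂ).1 ^ m * (0 : ℂ × ℂ).2 ^ n = 0 := by
    rcases hmn with h | h <;> simp [h]
  have hQ : ContinuousAt (fun y' : ℂ × ℂ => (e y').1 ^ m' * (e y').2 ^ n') 0 := by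
    have := e.continuousAt hx
    fun_prop
  have hlim : ContinuousAt (fun y' : ℂ × ℂ => (y'.1 ^ m * y'.2 ^ n) * ((e y').1 ^ m' * (e y').2 ^ n')) 0 :=
    hP.continuousAt.mul hQ
  have hne : ∀ᶠ y' in 𝓝 (0 : ℂ × ℂ), (y'.1 ^ m * y'.2 ^ n) * ((e y').1 ^ m' * (e y').2 ^ n') ≠ 1 :=
    hlim.eventually_ne (by simp only [hP0, zero_mul]; exact zero_ne_one)
  have hsmall : ∀ᶠ y' in 𝓝 (0 : ℂ × ℂ), ‖(mon c y').1‖ < ρ :=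
    hc.continuous_mon_fst.norm.continuousAt.eventually_lt continuousAt_const
      (by rw [hc.mon_zero, norm_zero]; exact hR.pos)
  obtain ⟨y', ⟨hy1, hy2⟩, hy3, hy4, hy5⟩ := (eventually_ne_zero_and.and_eventually
    (hne.and (hsmall.and (e.open_source.mem_nhds hx)))).exists
  have hg : (toric R c y').2 ≠ 0 := (hR.generic _ _).2 ⟨(mon_ne_zero hy1 hy2).1, hy4, (mon_ne_zero hy1 hy2).2⟩
  have hg' : (toric R c' (e y')).2 ≠ 0 := by rwa [hfg y' hy5]
  have h6 := (hR.generic _ _).1 hg'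
  obtain ⟨h7, h8⟩ := hc'.ne_zero_of_mon h6.1 h6.2.2
  have h9 : mon c' (e y') = mon c y' := hR.inj hg' hg (hfg y' hy5)
  have h10 := congrArg χ h9
  rw [hmon _ _ hy1 hy2, hmon _ _ h7 h8, hm, hn, ← neg_neg (a * c'.1.1 + b * c'.1.2),
    ← neg_neg (a * c'.2.1 + b * c'.2.2), hm', hn'] at h10
  simp only [zpow_natCast, zpow_neg] at h10
  apply hy3
  rw [← h10]
  field_simp

end Toric

/-! ### Surfaces with prescribed toric charts -/

section Realizes

variable {S : Type*} {M : Type*} [TopologicalSpace M] [HolSpace M]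

/-- The generic coordinates `f` of a surface `W` over `S` look like the generic coordinates `g` of the
surface `M` over the complement of `𝒜`, and like the toric surface of the fan `Fan x` near the fibre
over the point `x` of `𝒜`. -/
structure Realizes {W : Type*} [TopologicalSpace W] [HolSpace W] (g : M → S × ℂ) (𝒜 : Set S)
    (R : S → ℂ × ℂ → S × ℂ) (f : W → S × ℂ) (Fan : S → Set Cone) : Prop where
  inj : GenInj f
  off_left : ∀ p, (f p).1 ∉ 𝒜 → ∃ P, LocMatch f g p P
  off_right : ∀ P, (g P).1 ∉ 𝒜 → ∃ p, LocMatch f g p P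
  left : ∀ p, (f p).1 ∈ 𝒜 → ∃ c ∈ Fan (f p).1, ∃ y, (mon c y).1 = 0 ∧
    LocMatch f (toric (R (f p).1) c) p y
  right : ∀ x ∈ 𝒜, ∀ c ∈ Fan x, ∀ y, (mon c y).1 = 0 → ∃ p, LocMatch f (toric (R x) c) p y

variable {W W' : Type*} [TopologicalSpace W] [HolSpace W] [TopologicalSpace W'] [HolSpace W']
  {g : M → S × ℂ} {𝒜 : Set S} {R : S → ℂ × ℂ → S × ℂ} {ρ : S → ℝ} {f : W → S × ℂ}
  {f' : W' → S × ℂ} {Fan : S → Set Cone}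

/-- Two surfaces with the same toric charts match everywhere. -/
lemma Realizes.exists_locMatch (h : Realizes g 𝒜 R f Fan) (h' : Realizes g 𝒜 R f' Fan) (p : W) :
    ∃ p', LocMatch f f' p p' := by
  by_cases hp : (f p).1 ∈ 𝒜
  · obtain ⟨c, hc, y, hy, hm⟩ := h.left p hp
    obtain ⟨p', hm'⟩ := h'.right _ hp c hc y hy
    exact ⟨p', hm.trans hm'.symm⟩
  · obtain ⟨P, hm⟩ := h.off_left p hp
    obtain ⟨p', hm'⟩ := h'.off_right P (by rwa [hm.eq])
    exact ⟨p', hm.trans hm'.symm⟩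

lemma LocMatch.fst_eq {x : S} {ρ : ℝ} {R : ℂ × ℂ → S × ℂ} (hR : IsRef x ρ R) {c : Cone} {p : W}
    {y : ℂ × ℂ} (h : LocMatch f (toric R c) p y) (hy : (mon c y).1 = 0) : f p = (x, 0) := by
  rw [← h.eq, toric, hR.eq_zero hy]

lemma IsPointBlowup.locMatch {Y : Type u} {X : Type u} [TopologicalSpace X] [HolSpace X]
    [TopologicalSpace Y] [HolSpace Y] {Z : Type*} [TopologicalSpace Z] [HolSpace Z]
    {b : X → Y} {c : Y} (hb : IsPointBlowup b c) {f : Y → S × ℂ} {g : Z → S × ℂ} {x : X}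
    (hx : b x ≠ c) {z : Z} (h : LocMatch f g (b x) z) : LocMatch (f ∘ b) g x z := by
  obtain ⟨e, he, hxe, heb⟩ := hb.exists_bihol hx
  refine LocMatch.precomp he hxe (fun x' hx' => ?_) (by rwa [heb x hxe])
  rw [Function.comp, heb x' hx']

/-- The charts of the blow-up of the origin of a toric chart are toric. -/
lemma locMatch_blowup_chart {x : S} {ρ : ℝ} {R : ℂ × ℂ → S × ℂ} (hR : IsRef x ρ R) {c : Cone}
    (hc : IsCone c) {κ : OpenPartialHomeomorph W (ℂ × ℂ)}
    (hκf : ∀ p ∈ κ.source, LocMatch f (toric R c) p (κ p)) {b : W' → W} {j : Bool}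
    {κ' : OpenPartialHomeomorph W' (ℂ × ℂ)} (hκ' : IsBihol κ')
    (hb : ∀ p' ∈ κ'.source, b p' ∈ κ.source ∧ κ (b p') = blowMap j (κ' p')) {p : W'}
    (hp : p ∈ κ'.source)
    (hd : ∀ᶠ y in 𝓝 (κ' p), y ∈ closure {y' | (toric R (c.half j) y').2 ≠ 0}) :
    LocMatch (f ∘ b) (toric R (c.half j)) p (κ' p) := by
  refine LocMatch.of_bihol hκ' hp (fun p' hp' => ?_) hd
  obtain ⟨h1, h2⟩ := hb p' hp'
  rw [← hR.toric_blowMap hc, ← h2, (hκf _ h1).eq]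
  rfl

/-- Blowing up the origin of the toric chart of a cone subdivides the cone. -/
lemma Realizes.blowup {W W' : Type u} [TopologicalSpace W] [T2Space W] [HolSpace W]
    [TopologicalSpace W'] [HolSpace W'] {f : W → S × ℂ} (h : Realizes g 𝒜 R f Fan)
    (hR : ∀ x ∈ 𝒜, IsRef x (ρ x) (R x)) (hFan : ∀ x ∈ 𝒜, ∀ c ∈ Fan x, IsCone c)
    {x : S} (hx : x ∈ 𝒜) {c : Cone} {F : Set Cone} (hF : Fan x = insert c F) (hsep : ∀ c' ∈ F, Sep c c')
    {q : W} {κ : OpenPartialHomeomorph W (ℂ × ℂ)} (hκ : IsBihol κ) (hq : q ∈ κ.source)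
    (hq0 : κ q = 0) (hκf : ∀ p ∈ κ.source, LocMatch f (toric (R x) c) p (κ p))
    {b : W' → W} (hb : IsPointBlowup b q) {Fan' : S → Set Cone}
    (hF' : Fan' x = insert (c.half true) (insert (c.half false) F))
    (hne : ∀ x' ≠ x, Fan' x' = Fan x') : Realizes g 𝒜 R (f ∘ b) Fan' := by
  have hc : IsCone c := hFan x hx c (by rw [hF]; exact Set.mem_insert _ _)
  have hRx := hR x hx
  have hqm : LocMatch f (toric (R x) c) q 0 := by
    have := hκf q hq
    rwa [hq0] at this
  have hfq : f q = (x, 0) := hqm.fst_eq hRx hc.mon_zero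
  have hmem : ∀ j, c.half j ∈ Fan' x := by
    rw [hF']
    rintro (_ | _) <;> simp
  obtain ⟨hbA, hbB⟩ := hb.charts hκ hq hq0
  have hchart : ∀ (j : Bool) (κ' : OpenPartialHomeomorph W' (ℂ × ℂ)) (p : W'), IsBihol κ' →
      p ∈ κ'.source → blowMap j (κ' p) = 0 →
      (∀ p' ∈ κ'.source, b p' ∈ κ.source ∧ κ (b p') = blowMap j (κ' p')) →
      LocMatch (f ∘ b) (toric (R x) (c.half j)) p (κ' p) := fun j κ' p hκ' hp h0 hb' =>
    locMatch_blowup_chart hRx hc hκf hκ' hb' hp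
      (hRx.eventually_mem_closure (hc.half j) (hc.mon_half_of_eq_zero h0))
  refine ⟨?_, fun p hp => ?_, fun P hP => ?_, fun p hp => ?_, fun x' hx' c' hc' y hy => ?_⟩
  · intro p hp p' hp' hpp
    refine hb.injOn (fun hbp => ?_) (h.inj hp hp' hpp)
    rw [Set.mem_ofPred_eq, Function.comp, hbp, hfq] at hp
    exact hp rfl
  · have hne : b p ≠ q := fun hbp => by
      rw [Function.comp, hbp, hfq] at hp
      exact hp hx
    obtain ⟨P, hP⟩ := h.off_left (b p) hp
    exact ⟨P, hb.locMatch hne hP⟩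
  · obtain ⟨p, hp⟩ := h.off_right P hP
    have hne : p ≠ q := fun hpq => by
      rw [hp.eq, hpq, hfq] at hP
      exact hP hx
    obtain ⟨p', rfl⟩ := hb.exists_preimage hne
    exact ⟨p', hb.locMatch hne hp⟩
  · by_cases hbp : b p = q
    · have hfp : ((f ∘ b) p).1 = x := by rw [Function.comp, hbp, hfq]
      obtain ⟨j, κ', hκ', hp', h0, hb'⟩ := hbA p hbp
      rw [hfp]
      exact ⟨_, hmem j, κ' p, hc.mon_half_of_eq_zero h0, hchart j κ' p hκ' hp' h0 hb'⟩
    · obtain ⟨c', hc', y, hy, hm⟩ := h.left (b p) hp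
      by_cases hxx : (f (b p)).1 = x
      · rw [hxx] at hm hc'
        change ∃ c ∈ Fan' (f (b p)).1, ∃ y, (mon c y).1 = 0 ∧ LocMatch (f ∘ b) (toric (R (f (b p)).1) c) p y
        rw [hxx]
        rw [hF] at hc'
        rcases hc' with rfl | hc'
        · obtain ⟨j, y', rfl⟩ : ∃ j y', y = blowMap j y' := by
            rcases eq_or_ne y.1 0 with h1 | h1
            · have h2 : y.2 ≠ 0 := fun h2 => by
                obtain rfl : y = 0 := Prod.ext h1 h2
                exact hbp (hm.unique_left h.inj hqm)
              exact ⟨true, (y.1 / y.2, y.2), by rw [blowMap_true]; exact Prod.ext (div_mul_cancel₀ _ h2).symm rfl⟩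
            · exact ⟨false, (y.1, y.2 / y.1), by rw [blowMap_false]; exact Prod.ext rfl (mul_div_cancel₀ _ h1).symm⟩
          have hy0 : blowMap j y' ≠ 0 := fun h0 => by
            rw [h0] at hm
            exact hbp (hm.unique_left h.inj hqm)
          have hy' : (mon (c'.half j) y').1 = 0 := by rw [← blowMap_ne hy0, hy]
          exact ⟨_, hmem j, y', hy', (hb.locMatch hbp hm).trans (hRx.locMatch_half hc hy0 hy').symm⟩
        · exact ⟨c', by rw [hF']; simp [hc'], y, hy, hb.locMatch hbp hm⟩
      · refine ⟨c', ?_, y, hy, hb.locMatch hbp hm⟩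
        change c' ∈ Fan' (f (b p)).1
        rw [hne _ hxx]
        exact hc'
  · -- a point of an old chart which is not the centre of the blow-up
    have hold : ∀ c' ∈ Fan x', ∀ y, (mon c' y).1 = 0 →
        (x' = x → ¬ LocMatch (toric (R x) c) (toric (R x) c') 0 y) →
        ∃ p, LocMatch (f ∘ b) (toric (R x') c') p y := by
      intro c' hc' y hy hno
      obtain ⟨p, hp⟩ := h.right x' hx' c' hc' y hy
      have hpq : p ≠ q := by
        rintro rfl
        have hxx : x' = x := by
          have := hp.fst_eq (hR x' hx') hy
          rw [hfq] at this
          exact (congrArg Prod.fst this).symm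
        subst hxx
        exact hno rfl (hqm.symm.trans hp)
      obtain ⟨p', rfl⟩ := hb.exists_preimage hpq
      exact ⟨p', hb.locMatch hpq hp⟩
    by_cases hxx : x' = x
    · subst hxx
      rw [hF'] at hc'
      have hhalf : ∀ j, ∀ y, (mon (c.half j) y).1 = 0 →
          ∃ p, LocMatch (f ∘ b) (toric (R x') (c.half j)) p y := by
        intro j y hy
        by_cases hy0 : blowMap j y = 0
        · obtain ⟨p, -, κ', hκ', hp, rfl, hb'⟩ := hbB j y hy0
          exact ⟨p, hchart j κ' p hκ' hp hy0 hb'⟩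
        · obtain ⟨p, hp⟩ := hold c (by rw [hF]; exact Set.mem_insert _ _) (blowMap j y)
            (by rw [blowMap_ne hy0, hy])
            (fun _ hm => hy0 ((hqm.trans hm).unique (hRx.genInj_toric hc) hqm))
          exact ⟨p, hp.trans (hRx.locMatch_half hc hy0 hy).symm⟩
      rcases hc' with rfl | rfl | hc'
      · exact hhalf _ y hy
      · exact hhalf _ y hy
      · have hcF : c' ∈ Fan x' := by rw [hF]; exact Set.mem_insert_of_mem _ hc'
        exact hold c' hcF y hy fun _ => hRx.not_locMatch hc (hFan x' hx' c' hcF) (hsep c' hc')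
    · rw [hne _ hxx] at hc'
      exact hold c' hc' y hy fun h => absurd h hxx

/-- The point `q` is the transverse intersection of the curves `C` and `E`, which are the coordinate
axes of the toric chart of the cone `c` near its origin `q`. -/
def IsCorner (R : ℂ × ℂ → S × ℂ) (f : W → S × ℂ) (C E : Set W) (c : Cone) (q : W) : Prop :=
  ∃ κ : OpenPartialHomeomorph W (ℂ × ℂ), IsBihol κ ∧ q ∈ κ.source ∧ κ q = 0 ∧
    (∀ p ∈ κ.source, LocMatch f (toric R c) p (κ p)) ∧
    ∀ p ∈ κ.source, (p ∈ C ↔ (κ p).1 = 0) ∧ (p ∈ E ↔ (κ p).2 = 0)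

lemma mem_properTransform_chart {W W' : Type u} [TopologicalSpace W] [HolSpace W]
    [TopologicalSpace W'] [HolSpace W'] {b : W' → W} {q : W} {κ : OpenPartialHomeomorph W (ℂ × ℂ)}
    (hq : q ∈ κ.source) (hq0 : κ q = 0) {C : Set W} (hC : ∀ p ∈ κ.source, p ∈ C ↔ (κ p).1 = 0)
    {j : Bool} {κ' : OpenPartialHomeomorph W' (ℂ × ℂ)}
    (hb : ∀ p' ∈ κ'.source, b p' ∈ κ.source ∧ κ (b p') = blowMap j (κ' p')) {p : W'}
    (hp : p ∈ κ'.source) : p ∈ properTransform b q C ↔ j = true ∧ (κ' p).1 = 0 := by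
  have hiff : ∀ p' ∈ κ'.source, (b p' ∈ C \ {q} ↔ j = true ∧ (κ' p').1 = 0 ∧ (κ' p').2 ≠ 0) := by
    intro p' hp'
    obtain ⟨h1, h2⟩ := hb p' hp'
    have h3 : b p' = q ↔ blowMap j (κ' p') = 0 := by
      rw [← h2, ← hq0]
      exact ⟨fun h => by rw [h], fun h => κ.injOn h1 hq h⟩
    rw [Set.mem_sdiff, Set.mem_singleton_iff, hC _ h1, h3, h2]
    cases j
    · simp +contextual [blowMap_false, Prod.ext_iff]
    · simp only [blowMap_true, Prod.ext_iff, true_and, Prod.fst_zero, Prod.snd_zero, mul_eq_zero]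
      tauto
  rw [properTransform, mem_closure_iff_frequently]
  constructor
  · intro h
    have h1 := h.and_eventually (κ'.open_source.mem_nhds hp)
    have hj : j = true := by
      obtain ⟨p', h2, h3⟩ := h1.exists
      exact ((hiff p' h3).1 h2).1
    refine ⟨hj, ?_⟩
    by_contra hne
    have h2 : ∀ᶠ p' in 𝓝 p, (κ' p').1 ≠ 0 :=
      ((continuous_fst.continuousAt).comp (κ'.continuousAt hp)).eventually_ne hne
    obtain ⟨p', ⟨h3, h4⟩, h5⟩ := (h1.and_eventually h2).exists
    exact h5 ((hiff p' h4).1 h3).2.1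
  · rintro ⟨hj, h0⟩
    have hline : ∃ᶠ t in 𝓝 (κ' p).2, t ≠ (0 : ℂ) :=
      mem_closure_iff_frequently.1 ((dense_compl_singleton (0 : ℂ)) (κ' p).2)
    have hcont : ContinuousAt (fun t : ℂ => κ'.symm (0, t)) (κ' p).2 := by
      refine ContinuousAt.comp (g := κ'.symm) (f := fun t : ℂ => ((0 : ℂ), t)) ?_ (by fun_prop)
      rw [← h0]
      exact κ'.continuousAt_symm (κ'.map_source hp)
    have hval : κ'.symm (0, (κ' p).2) = p := by
      rw [← h0]
      exact κ'.left_inv hp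
    have htar : ∀ᶠ t : ℂ in 𝓝 (κ' p).2, ((0 : ℂ), t) ∈ κ'.target := by
      have h1 : ContinuousAt (fun t : ℂ => ((0 : ℂ), t)) (κ' p).2 := by fun_prop
      refine h1.eventually_mem (κ'.open_target.mem_nhds ?_)
      rw [← h0]
      exact κ'.map_source hp
    have hfr := hline.and_eventually htar
    have htend := hcont.tendsto
    rw [hval] at htend
    refine htend.frequently (hfr.mono ?_)
    rintro t ⟨h1, h2⟩
    refine (hiff _ (κ'.map_target h2)).2 ⟨hj, ?_, ?_⟩ <;> rw [κ'.right_inv h2]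
    exact h1

lemma exists_isCorner_of_chart {x : S} {ρ : ℝ} {R : ℂ × ℂ → S × ℂ} (hR : IsRef x ρ R) {c : Cone}
    (hc : IsCone c) {κ : OpenPartialHomeomorph W (ℂ × ℂ)}
    (hκf : ∀ p ∈ κ.source, LocMatch f (toric R c) p (κ p)) {b : W' → W} {j : Bool}
    {κ' : OpenPartialHomeomorph W' (ℂ × ℂ)} (hκ' : IsBihol κ')
    (hb : ∀ p' ∈ κ'.source, b p' ∈ κ.source ∧ κ (b p') = blowMap j (κ' p')) {p : W'}
    (hp : p ∈ κ'.source) (hp0 : κ' p = 0) {C E : Set W'}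
    (hCE : ∀ p ∈ κ'.source, (p ∈ C ↔ (κ' p).1 = 0) ∧ (p ∈ E ↔ (κ' p).2 = 0)) :
    IsCorner R (f ∘ b) C E (c.half j) p := by
  have h1 : ∀ᶠ y in 𝓝 (κ' p), ∀ᶠ y' in 𝓝 y, y' ∈ closure {y'' | (toric R (c.half j) y'').2 ≠ 0} :=
    (hR.eventually_mem_closure (hc.half j) (by rw [hp0]; exact (hc.half j).mon_zero)).eventually_nhds
  obtain ⟨U, hU, hUo, hpU⟩ := eventually_nhds_iff.1 ((κ'.continuousAt hp).eventually h1)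
  exact ⟨κ'.restrOpen U hUo, hκ'.restr hUo, ⟨hp, hpU⟩, hp0, fun p' hp' =>
    locMatch_blowup_chart hR hc hκf hκ' hb hp'.1 (hU p' hp'.2), fun p' hp' => hCE p' hp'.1⟩

/-- The exceptional curve meets the proper transforms of the coordinate axes in the two points
which are the origins of the charts of the blow-up. -/
lemma IsCorner.blowup {W W' : Type u} [TopologicalSpace W] [T2Space W] [HolSpace W]
    [TopologicalSpace W'] [HolSpace W'] {f : W → S × ℂ} {x : S} {ρ : ℝ} {R : ℂ × ℂ → S × ℂ}
    (hR : IsRef x ρ R) {C E : Set W} {c : Cone} (hc : IsCone c) {q : W}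
    (hq : IsCorner R f C E c q) {b : W' → W} (hb : IsPointBlowup b q) (hf : GenInj (f ∘ b)) :
    (∃ q', IsCorner R (f ∘ b) (properTransform b q C) (b ⁻¹' {q}) (c.half true) q' ∧
      properTransform b q C ∩ b ⁻¹' {q} = {q'}) ∧
    ∃ q', IsCorner R (f ∘ b) (b ⁻¹' {q}) (properTransform b q E) (c.half false) q' ∧
      properTransform b q E ∩ b ⁻¹' {q} = {q'} := by
  have ht2 : T2Space W' := hb.t2Space
  obtain ⟨κ, hκ, hqs, hq0, hκf, hκC⟩ := hq
  obtain ⟨hbA, hbB⟩ := hb.charts hκ hqs hq0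
  have hκE : ∀ p ∈ (κ.trans swapPH).source, p ∈ E ↔ (κ.trans swapPH p).1 = 0 :=
    fun p hp => (hκC p hp.1).2
  have hqs' : q ∈ (κ.trans swapPH).source := ⟨hqs, trivial⟩
  have hq0' : κ.trans swapPH q = 0 := by simp [swapPH_apply, hq0]
  have hexc : ∀ p ∈ κ.source, p = q ↔ κ p = 0 := fun p hp => by
    rw [← hq0]
    exact ⟨fun h => by rw [h], fun h => κ.injOn hp hqs h⟩
  -- the two proper transforms and the exceptional curve in a chart of the blow-up
  have hcurves : ∀ (j : Bool) (κ' : OpenPartialHomeomorph W' (ℂ × ℂ)),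
      (∀ p' ∈ κ'.source, b p' ∈ κ.source ∧ κ (b p') = blowMap j (κ' p')) → ∀ p ∈ κ'.source,
      (p ∈ properTransform b q C ↔ j = true ∧ (κ' p).1 = 0) ∧
      (p ∈ properTransform b q E ↔ j = false ∧ (κ' p).2 = 0) ∧
      (p ∈ b ⁻¹' {q} ↔ blowMap j (κ' p) = 0) := by
    intro j κ' hb' p hp
    refine ⟨mem_properTransform_chart hqs hq0 (fun p hp => (hκC p hp).1) hb' hp, ?_, ?_⟩
    · have h1 := mem_properTransform_chart (b := b) (j := !j) (κ' := κ'.trans swapPH) (p := p) hqs' hq0'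
        hκE (fun p' hp' => ?_) ⟨hp, trivial⟩
      · rw [h1]
        simp [swapPH_apply]
      · obtain ⟨h1, h2⟩ := hb' p' hp'.1
        refine ⟨⟨h1, trivial⟩, ?_⟩
        simp [swapPH_apply, h2, blowMap_not_swap]
    · obtain ⟨h1, h2⟩ := hb' p hp
      rw [← h2, ← hexc _ h1]
      rfl
  constructor
  · obtain ⟨q', hbq', κ', hκ', hq's, hq'0, hb'⟩ := hbB true 0 (by simp [blowMap_true])
    have hcor : IsCorner R (f ∘ b) (properTransform b q C) (b ⁻¹' {q}) (c.half true) q' := by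
      refine exists_isCorner_of_chart hR hc hκf hκ' hb' hq's hq'0 fun p hp => ?_
      obtain ⟨h1, -, h3⟩ := hcurves true κ' hb' p hp
      refine ⟨by simpa using h1, ?_⟩
      rw [h3, blowMap_true, Prod.mk_eq_zero]
      exact ⟨fun h => h.2, fun h => ⟨by rw [h, mul_zero], h⟩⟩
    refine ⟨q', hcor, Set.eq_singleton_iff_unique_mem.2 ⟨⟨?_, hbq'⟩, ?_⟩⟩
    · exact ((hcurves true κ' hb' q' hq's).1).2 ⟨rfl, by rw [hq'0]; rfl⟩
    · rintro p ⟨hpC, hpq⟩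
      obtain ⟨j, κ₁, hκ₁, hp₁, h0, hb₁⟩ := hbA p hpq
      obtain ⟨rfl, h2⟩ := ((hcurves j κ₁ hb₁ p hp₁).1).1 hpC
      have h3 : κ₁ p = 0 := Prod.ext h2 (by rw [blowMap_true] at h0; exact (Prod.ext_iff.1 h0).2)
      have h4 := locMatch_blowup_chart hR hc hκf hκ₁ hb₁ hp₁
        (hR.eventually_mem_closure (hc.half true) (hc.mon_half_of_eq_zero h0))
      obtain ⟨κ₂, -, h5, h6, h7, -⟩ := hcor
      have h8 := h7 q' h5
      rw [h6] at h8
      rw [h3] at h4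
      exact h4.unique_left hf h8
  · obtain ⟨q', hbq', κ', hκ', hq's, hq'0, hb'⟩ := hbB false 0 (by simp [blowMap_false])
    have hcor : IsCorner R (f ∘ b) (b ⁻¹' {q}) (properTransform b q E) (c.half false) q' := by
      refine exists_isCorner_of_chart hR hc hκf hκ' hb' hq's hq'0 fun p hp => ?_
      obtain ⟨-, h2, h3⟩ := hcurves false κ' hb' p hp
      exact ⟨by rw [h3, blowMap_eq_zero], by simpa using h2⟩
    refine ⟨q', hcor, Set.eq_singleton_iff_unique_mem.2 ⟨⟨?_, hbq'⟩, ?_⟩⟩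
    · exact ((hcurves false κ' hb' q' hq's).2.1).2 ⟨rfl, by rw [hq'0]; rfl⟩
    · rintro p ⟨hpE, hpq⟩
      obtain ⟨j, κ₁, hκ₁, hp₁, h0, hb₁⟩ := hbA p hpq
      obtain ⟨rfl, h2⟩ := ((hcurves j κ₁ hb₁ p hp₁).2.1).1 hpE
      have h3 : κ₁ p = 0 := Prod.ext (blowMap_eq_zero.1 h0) h2
      have h4 := locMatch_blowup_chart hR hc hκf hκ₁ hb₁ hp₁
        (hR.eventually_mem_closure (hc.half false) (hc.mon_half_of_eq_zero h0))
      obtain ⟨κ₂, -, h5, h6, h7, -⟩ := hcor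
      have h8 := h7 q' h5
      rw [h6] at h8
      rw [h3] at h4
      exact h4.unique_left hf h8

end Realizes

/-! ### Chains of curves and subdivisions of fans -/

/-- In a chain of curves with self-intersection numbers `n`, consecutive rays `a`, `b`, `c` of the
fan satisfy `a + c = -n b`. Starting with two consecutive rays, `walk` computes the last two. -/
def walk (a b : ℤ × ℤ) : List ℤ → (ℤ × ℤ) × (ℤ × ℤ)
  | [] => (a, b)
  | n :: l => walk b (-n • b - a) l

/-- The cones spanned by the consecutive rays of a walk. -/
def walkCones (a b : ℤ × ℤ) : List ℤ → List Cone
  | [] => [(b, a)]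
  | n :: l => (b, a) :: walkCones b (-n • b - a) l

/-- The cones of the chain with the rays `vL`, `vE`, `vE - vL` of the last exceptional curve and its
neighbours, and with the given self-intersection numbers on the two sides. -/
def fanList (vE vL : ℤ × ℤ) (l r : List ℤ) : List Cone :=
  walkCones vE vL l ++ (walkCones vE (vE - vL) r).map Prod.swap

/-- The cones are unimodular, and any two of them are separated by a line. -/
structure IsFan (A : List Cone) : Prop where
  isCone : ∀ c ∈ A, IsCone c
  sep : A.Pairwise Sep

lemma IsFan.half {A A' F : List Cone} {c : Cone} (h : IsFan A) (hA : A.Perm (c :: F))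
    (hA' : A'.Perm (c.half true :: c.half false :: F)) : IsFan A' := by
  have h1 := h.isCone
  have h2 := (hA.pairwise_iff fun h => Sep.symm h).1 h.sep
  have hc : IsCone c := h1 c (hA.mem_iff.2 (by simp))
  rw [List.pairwise_cons] at h2
  refine ⟨fun c' hc' => ?_, (hA'.pairwise_iff fun h => Sep.symm h).2 ?_⟩
  · have h3 := hA'.mem_iff.1 hc'
    simp only [List.mem_cons] at h3
    rcases h3 with rfl | rfl | h3
    · exact hc.half true
    · exact hc.half false
    · exact h1 c' (hA.mem_iff.2 (by simp [h3]))
  · rw [List.pairwise_cons, List.pairwise_cons]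
    refine ⟨fun c' hc' => ?_, fun c' hc' => (h2.1 c' hc').half false, h2.2⟩
    rcases List.mem_cons.1 hc' with rfl | hc'
    · exact hc.sep_half
    · exact (h2.1 c' hc').half true

lemma walk_blowup_cons (u v : ℤ × ℤ) (n : ℤ) (l : List ℤ) :
    walk (u + v) v ((n - 1) :: l) = walk u v (n :: l) := by
  simp only [walk]
  congr 1
  module

lemma walk_blowup_new (u v : ℤ × ℤ) (l : List ℤ) : walk (u + v) u (-2 :: l) = walk u (u - v) l := by
  simp only [walk]
  congr 1
  module

lemma walkCones_blowup_cons (u v : ℤ × ℤ) (n : ℤ) (l : List ℤ) :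
    ∃ F, walkCones u v (n :: l) = (v, u) :: F ∧
      walkCones (u + v) v ((n - 1) :: l) = (v, u + v) :: F := by
  refine ⟨walkCones v (-n • v - u) l, rfl, ?_⟩
  simp only [walkCones]
  congr 2
  module

lemma walkCones_blowup_new (u v : ℤ × ℤ) (l : List ℤ) :
    walkCones (u + v) u (-2 :: l) = (u, u + v) :: walkCones u (u - v) l := by
  simp only [walkCones]
  congr 2
  module

lemma fanList_left (vE vL : ℤ × ℤ) (n : ℤ) (l r : List ℤ) : ∃ F,
    (fanList vE vL (n :: l) r).Perm ((vL, vE) :: F) ∧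
    (fanList (vE + vL) vL ((n - 1) :: l) (-2 :: r)).Perm
      (Cone.half (vL, vE) true :: Cone.half (vL, vE) false :: F) := by
  obtain ⟨F, h1, h2⟩ := walkCones_blowup_cons vE vL n l
  refine ⟨F ++ (walkCones vE (vE - vL) r).map Prod.swap, by simp [fanList, h1], ?_⟩
  rw [fanList, h2, show vE + vL - vL = vE by abel, walkCones_blowup_new]
  simp only [Cone.half, if_true, Bool.false_eq_true, if_false, List.map_cons, Prod.swap_prod_mk,
    List.cons_append, add_comm vL vE]
  exact List.Perm.cons _ List.perm_middle

lemma fanList_right (vE vL : ℤ × ℤ) (n : ℤ) (l r : List ℤ) : ∃ F,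
    (fanList vE vL l (n :: r)).Perm ((vE, vE - vL) :: F) ∧
    (fanList (vE + (vE - vL)) vE (-2 :: l) ((n - 1) :: r)).Perm
      (Cone.half (vE, vE - vL) true :: Cone.half (vE, vE - vL) false :: F) := by
  obtain ⟨F, h1, h2⟩ := walkCones_blowup_cons vE (vE - vL) n r
  refine ⟨walkCones vE vL l ++ F.map Prod.swap, ?_, ?_⟩
  · simp only [fanList, h1, List.map_cons, Prod.swap_prod_mk]
    exact List.perm_middle
  · rw [fanList, show vE + (vE - vL) - vE = vE - vL by abel, h2, walkCones_blowup_new,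
      show vE - (vE - vL) = vL by abel]
    simp only [Cone.half, if_true, Bool.false_eq_true, if_false, List.map_cons, Prod.swap_prod_mk,
      List.cons_append]
    exact List.Perm.cons _ List.perm_middle

section Chain

variable {S : Type*} {N : Type*} [TopologicalSpace N] [HolSpace N]

/-- The toric data of a chain of curves obtained by iterated blow-ups over the point `x`: `vE` and `vL`
are the rays of the last exceptional curve `E` and of its neighbour in the list `l`. -/
structure Tracked {M Z : Type u} [TopologicalSpace M] [HolSpace M] [TopologicalSpace Z] [HolSpace Z]
    (g : N → S × ℂ) (𝒜 : Set S) (R : S → ℂ × ℂ → S × ℂ) (x : S) (f₀ : M → S × ℂ) (Fan₀ : S → Set Cone)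
    (Φ : Z → M) (l : List (Set Z × ℤ)) (E : Set Z) (r : List (Set Z × ℤ)) (vE vL : ℤ × ℤ) : Prop where
  t2 : T2Space Z
  realizes : ∀ Fan : S → Set Cone,
    Fan x = {c | c ∈ fanList vE vL (l.map Prod.snd) (r.map Prod.snd)} →
    (∀ x' ≠ x, Fan x' = Fan₀ x') → Realizes g 𝒜 R (f₀ ∘ Φ) Fan
  isFan : IsFan (fanList vE vL (l.map Prod.snd) (r.map Prod.snd))
  walk_left : walk vE vL (l.map Prod.snd) = ((1, 0), (0, 1))
  walk_right : walk vE (vE - vL) (r.map Prod.snd) = ((1, -1), (0, -1))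
  ne_nil : l ≠ []
  left : ∀ C n l', l = (C, n) :: l' → ∃ c, IsCorner (R x) (f₀ ∘ Φ) C E (vL, vE) c ∧ C ∩ E = {c}
  right : ∀ D n r', r = (D, n) :: r' →
    ∃ c, IsCorner (R x) (f₀ ∘ Φ) E D (vE, vE - vL) c ∧ D ∩ E = {c}
  bihol : ∀ p, (f₀ (Φ p)).1 ≠ x → ∃ e : OpenPartialHomeomorph Z M, IsBihol e ∧ p ∈ e.source ∧
    ∀ p' ∈ e.source, e p' = Φ p'

variable {M Z Z' : Type u} [TopologicalSpace M] [HolSpace M] [TopologicalSpace Z] [HolSpace Z]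
  [TopologicalSpace Z'] [HolSpace Z']
  {g : N → S × ℂ} {𝒜 : Set S} {R : S → ℂ × ℂ → S × ℂ} {ρ : S → ℝ} {x : S} {f₀ : M → S × ℂ}
  {Fan₀ : S → Set Cone} {Φ : Z → M}

lemma IsCorner.fst_eq (hR : IsRef x (ρ x) (R x)) {f : Z → S × ℂ} {C E : Set Z} {c : Cone}
    (hc : IsCone c) {q : Z} (h : IsCorner (R x) f C E c q) : (f q).1 = x := by
  obtain ⟨κ, -, hq, hq0, hm, -⟩ := h
  have h1 := hm q hq
  rw [hq0] at h1
  rw [h1.fst_eq hR hc.mon_zero]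

/-- One blow-up of the chain. -/
lemma Realizes.blowup_corner [T2Space Z] (hR : ∀ x ∈ 𝒜, IsRef x (ρ x) (R x)) (hx : x ∈ 𝒜)
    (hFan₀ : ∀ x ∈ 𝒜, ∀ c ∈ Fan₀ x, IsCone c) {A A' F : List Cone} {c : Cone}
    (hre : ∀ Fan : S → Set Cone, Fan x = {c | c ∈ A} → (∀ x' ≠ x, Fan x' = Fan₀ x') →
      Realizes g 𝒜 R (f₀ ∘ Φ) Fan) (hfan : IsFan A) (hA : A.Perm (c :: F))
    (hA' : A'.Perm (c.half true :: c.half false :: F))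
    (hbi : ∀ p, (f₀ (Φ p)).1 ≠ x → ∃ e : OpenPartialHomeomorph Z M, IsBihol e ∧ p ∈ e.source ∧
      ∀ p' ∈ e.source, e p' = Φ p') {C E : Set Z} {q : Z}
    (hq : IsCorner (R x) (f₀ ∘ Φ) C E c q) {b : Z' → Z} (hb : IsPointBlowup b q) :
    T2Space Z' ∧ (∀ Fan : S → Set Cone, Fan x = {c | c ∈ A'} → (∀ x' ≠ x, Fan x' = Fan₀ x') →
      Realizes g 𝒜 R (f₀ ∘ (Φ ∘ b)) Fan) ∧ IsFan A' ∧
    (∀ p, (f₀ ((Φ ∘ b) p)).1 ≠ x → ∃ e : OpenPartialHomeomorph Z' M, IsBihol e ∧ p ∈ e.source ∧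
      ∀ p' ∈ e.source, e p' = (Φ ∘ b) p') ∧
    (∃ q', IsCorner (R x) (f₀ ∘ (Φ ∘ b)) (properTransform b q C) (b ⁻¹' {q}) (c.half true) q' ∧
      properTransform b q C ∩ b ⁻¹' {q} = {q'}) ∧
    ∃ q', IsCorner (R x) (f₀ ∘ (Φ ∘ b)) (b ⁻¹' {q}) (properTransform b q E) (c.half false) q' ∧
      properTransform b q E ∩ b ⁻¹' {q} = {q'} := by
  classical
  have hcA : c ∈ A := hA.mem_iff.2 (by simp)
  have hc : IsCone c := hfan.isCone c hcA
  have hre' : ∀ Fan : S → Set Cone, Fan x = {c | c ∈ A'} → (∀ x' ≠ x, Fan x' = Fan₀ x') →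
      Realizes g 𝒜 R (f₀ ∘ (Φ ∘ b)) Fan := by
    intro Fan h1 h2
    have h3 := hre (Function.update Fan₀ x {c | c ∈ A}) (by simp)
      (fun x' hx' => Function.update_of_ne hx' _ _)
    obtain ⟨κ, hκ, hqs, hq0, hm, -⟩ := hq
    refine h3.blowup hR ?_ hx (c := c) (F := {c | c ∈ F}) ?_ ?_ hκ hqs hq0 hm hb ?_ ?_
    · intro x' hx' c' hc'
      rcases eq_or_ne x' x with rfl | hne
      · rw [Function.update_self] at hc'
        exact hfan.isCone c' hc'
      · rw [Function.update_of_ne hne] at hc'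
        exact hFan₀ x' hx' c' hc'
    · rw [Function.update_self]
      ext c'
      simp [hA.mem_iff]
    · exact (List.pairwise_cons.1 ((hA.pairwise_iff fun h => Sep.symm h).1 hfan.sep)).1
    · rw [h1]
      ext c'
      simp [hA'.mem_iff]
    · intro x' hx'
      rw [h2 x' hx', Function.update_of_ne hx']
  have hinj : GenInj ((f₀ ∘ Φ) ∘ b) :=
    (hre' (Function.update Fan₀ x {c | c ∈ A'}) (by simp)
      (fun x' hx' => Function.update_of_ne hx' _ _)).inj
  obtain ⟨h1, h2⟩ := hq.blowup (hR x hx) hc hb hinj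
  refine ⟨hb.t2Space, hre', hfan.half hA hA', fun p hp => ?_, h1, h2⟩
  have hne : b p ≠ q := fun h => hp (by
    rw [Function.comp, h]
    exact hq.fst_eq (hR x hx) hc)
  obtain ⟨e, he, hpe, heb⟩ := hb.exists_bihol hne
  obtain ⟨e', he', hpe', hee⟩ := hbi (b p) hp
  refine ⟨e.trans e', he.trans he', ⟨hpe, ?_⟩, ?_⟩
  · change e p ∈ e'.source
    rwa [heb p hpe]
  · rintro p' ⟨h3, h4⟩
    have h5 : e p' ∈ e'.source := h4
    change e' (e p') = _
    rw [hee _ h5, heb p' h3]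
    rfl

lemma Tracked.blowup_left (hR : ∀ x ∈ 𝒜, IsRef x (ρ x) (R x)) (hx : x ∈ 𝒜)
    (hFan₀ : ∀ x ∈ 𝒜, ∀ c ∈ Fan₀ x, IsCone c) {C : Set Z} {n : ℤ} {l : List (Set Z × ℤ)} {E : Set Z}
    {r : List (Set Z × ℤ)} {vE vL : ℤ × ℤ}
    (h : Tracked g 𝒜 R x f₀ Fan₀ Φ ((C, n) :: l) E r vE vL) {c : Z} (hc : C ∩ E = {c}) {b : Z' → Z}
    (hb : IsPointBlowup b c) :
    Tracked g 𝒜 R x f₀ Fan₀ (Φ ∘ b)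
      ((properTransform b c C, n - 1) :: l.map (fun D => (properTransform b c D.1, D.2)))
      (b ⁻¹' {c})
      ((properTransform b c E, -2) :: r.map (fun D => (properTransform b c D.1, D.2)))
      (vE + vL) vL := by
  have := h.t2
  obtain ⟨c', hcor, hc'⟩ := h.left C n l rfl
  obtain rfl : c' = c := Set.singleton_injective (hc'.symm.trans hc)
  obtain ⟨F, hA, hA'⟩ := fanList_left vE vL n (l.map Prod.snd) (r.map Prod.snd)
  obtain ⟨h1, h2, h3, h4, ⟨q₁, hq₁, hq₁'⟩, q₂, hq₂, hq₂'⟩ :=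
    Realizes.blowup_corner hR hx hFan₀ h.realizes h.isFan hA hA' h.bihol hcor hb
  have hl : ∀ l : List (Set Z × ℤ),
      (l.map (fun D => (properTransform b c' D.1, D.2))).map Prod.snd = l.map Prod.snd := fun l => by
    rw [List.map_map]
    rfl
  refine ⟨h1, ?_, ?_, ?_, ?_, by simp, ?_, ?_, h4⟩
  · simpa only [List.map_cons, hl] using h2
  · simpa only [List.map_cons, hl] using h3
  · rw [List.map_cons, hl, walk_blowup_cons]
    exact h.walk_left
  · rw [List.map_cons, hl, show vE + vL - vL = vE by abel, walk_blowup_new]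
    exact h.walk_right
  · rintro C' n' l' heq
    simp only [List.cons.injEq, Prod.mk.injEq] at heq
    obtain ⟨⟨rfl, -⟩, -⟩ := heq
    refine ⟨q₁, ?_, hq₁'⟩
    simpa only [Cone.half, if_true, add_comm vL vE] using hq₁
  · rintro C' n' l' heq
    simp only [List.cons.injEq, Prod.mk.injEq] at heq
    obtain ⟨⟨rfl, -⟩, -⟩ := heq
    refine ⟨q₂, ?_, hq₂'⟩
    simpa only [Cone.half, Bool.false_eq_true, if_false, add_comm vL vE, add_sub_cancel_right] using hq₂

lemma Tracked.blowup_right (hR : ∀ x ∈ 𝒜, IsRef x (ρ x) (R x)) (hx : x ∈ 𝒜)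
    (hFan₀ : ∀ x ∈ 𝒜, ∀ c ∈ Fan₀ x, IsCone c) {C : Set Z} {n : ℤ} {l : List (Set Z × ℤ)} {E : Set Z}
    {r : List (Set Z × ℤ)} {vE vL : ℤ × ℤ}
    (h : Tracked g 𝒜 R x f₀ Fan₀ Φ l E ((C, n) :: r) vE vL) {c : Z} (hc : C ∩ E = {c}) {b : Z' → Z}
    (hb : IsPointBlowup b c) :
    Tracked g 𝒜 R x f₀ Fan₀ (Φ ∘ b)
      ((properTransform b c E, -2) :: l.map (fun D => (properTransform b c D.1, D.2)))
      (b ⁻¹' {c})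
      ((properTransform b c C, n - 1) :: r.map (fun D => (properTransform b c D.1, D.2)))
      (vE + (vE - vL)) vE := by
  have := h.t2
  obtain ⟨c', hcor, hc'⟩ := h.right C n r rfl
  obtain rfl : c' = c := Set.singleton_injective (hc'.symm.trans hc)
  obtain ⟨F, hA, hA'⟩ := fanList_right vE vL n (l.map Prod.snd) (r.map Prod.snd)
  obtain ⟨h1, h2, h3, h4, ⟨q₁, hq₁, hq₁'⟩, q₂, hq₂, hq₂'⟩ :=
    Realizes.blowup_corner hR hx hFan₀ h.realizes h.isFan hA hA' h.bihol hcor hb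
  have hl : ∀ l : List (Set Z × ℤ),
      (l.map (fun D => (properTransform b c' D.1, D.2))).map Prod.snd = l.map Prod.snd := fun l => by
    rw [List.map_map]
    rfl
  refine ⟨h1, ?_, ?_, ?_, ?_, by simp, ?_, ?_, h4⟩
  · simpa only [List.map_cons, hl] using h2
  · simpa only [List.map_cons, hl] using h3
  · rw [List.map_cons, hl, walk_blowup_new, show vE - (vE - vL) = vL by abel]
    exact h.walk_left
  · rw [List.map_cons, hl, show vE + (vE - vL) - vE = vE - vL by abel, walk_blowup_cons]
    exact h.walk_right
  · rintro C' n' l' heq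
    simp only [List.cons.injEq, Prod.mk.injEq] at heq
    obtain ⟨⟨rfl, -⟩, -⟩ := heq
    refine ⟨q₁, ?_, hq₁'⟩
    simpa only [Cone.half, if_true] using hq₁
  · rintro C' n' l' heq
    simp only [List.cons.injEq, Prod.mk.injEq] at heq
    obtain ⟨⟨rfl, -⟩, -⟩ := heq
    refine ⟨q₂, ?_, hq₂'⟩
    simpa only [Cone.half, Bool.false_eq_true, if_false,
      show vE + (vE - vL) - vE = vE - vL by abel] using hq₂

/-- The fan of the ruled surface near a fibre: the cones of the two points where the fibre meets the
zero section and the infinity section. -/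
def ruledFan : List Cone := [((0, 1), (1, 0)), ((1, 0), (0, -1))]

lemma isFan_ruledFan : IsFan ruledFan := by
  constructor
  · simp only [ruledFan, List.mem_cons, List.not_mem_nil, or_false]
    rintro c (rfl | rfl) <;> constructor <;> norm_num
  · simp only [ruledFan, List.pairwise_cons, List.mem_cons, List.not_mem_nil, or_false]
    refine ⟨?_, by simp⟩
    rintro c rfl
    exact ⟨0, 1, by norm_num, by norm_num, by norm_num, by norm_num, by norm_num⟩

lemma tracked_first [T2Space M] (hR : ∀ x ∈ 𝒜, IsRef x (ρ x) (R x)) (hx : x ∈ 𝒜)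
    (hFan₀ : ∀ x ∈ 𝒜, ∀ c ∈ Fan₀ x, IsCone c) (h : Realizes g 𝒜 R f₀ Fan₀)
    (hFx : Fan₀ x = {c | c ∈ ruledFan}) {F E : Set M} {B : M}
    (hB : IsCorner (R x) f₀ F E ((1, 0), (0, -1)) B) {b : Z → M} (hb : IsPointBlowup b B) :
    Tracked g 𝒜 R x f₀ Fan₀ b [(properTransform b B F, -1)] (b ⁻¹' {B}) [] (1, -1) (1, 0) := by
  have hA : ruledFan.Perm (((1, 0), (0, -1)) :: [((0, 1), (1, 0))]) := List.Perm.swap _ _ _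
  have hA' : (fanList (1, -1) (1, 0) [-1] []).Perm
      (Cone.half ((1, 0), (0, -1)) true :: Cone.half ((1, 0), (0, -1)) false :: [((0, 1), (1, 0))]) := by
    simp only [fanList, walkCones, Cone.half]
    norm_num
    exact List.Perm.swap _ _ _
  obtain ⟨h1, h2, h3, h4, ⟨q₁, hq₁, hq₁'⟩, q₂, hq₂, hq₂'⟩ :=
    Realizes.blowup_corner (Φ := id) (f₀ := f₀) (Fan₀ := Fan₀) (g := g) hR hx hFan₀ (A := ruledFan) (fun Fan h1 h2 => by
      have : Fan = Fan₀ := by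
        funext x'
        rcases eq_or_ne x' x with rfl | hne
        · rw [h1, hFx]
        · exact h2 x' hne
      rw [this]
      exact h) isFan_ruledFan hA hA' (fun p _ => ⟨OpenPartialHomeomorph.refl M, isBihol_refl, trivial,
        fun _ _ => rfl⟩) hB hb
  refine ⟨h1, h2, h3, ?_, ?_, by simp, ?_, ?_, h4⟩
  · simp [walk]
  · simp [walk]
  · rintro C' n' l' heq
    simp only [List.cons.injEq, Prod.mk.injEq] at heq
    obtain ⟨⟨rfl, -⟩, -⟩ := heq
    refine ⟨q₁, ?_, hq₁'⟩
    simpa only [Cone.half, if_true, Prod.mk_add_mk, add_zero, zero_add, Function.id_comp] using hq₁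
  · simp

/-- Every chain of blow-ups is toric. -/
lemma ChainBlowup.tracked [T2Space M] (hR : ∀ x ∈ 𝒜, IsRef x (ρ x) (R x)) (hx : x ∈ 𝒜)
    (hFan₀ : ∀ x ∈ 𝒜, ∀ c ∈ Fan₀ x, IsCone c) (h : Realizes g 𝒜 R f₀ Fan₀)
    (hFx : Fan₀ x = {c | c ∈ ruledFan}) {F E₀ : Set M} {B : M}
    (hB : IsCorner (R x) f₀ F E₀ ((1, 0), (0, -1)) B) {l r : List (Set Z × ℤ)} {E : Set Z}
    (hch : ChainBlowup F B Z Φ l E r) : ∃ vE vL, Tracked g 𝒜 R x f₀ Fan₀ Φ l E r vE vL := by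
  induction hch with
  | first Z b hb => exact ⟨_, _, tracked_first hR hx hFan₀ h hFx hB hb⟩
  | left Z Z' Φ C n l E r c b _ hc hb ih =>
    obtain ⟨vE, vL, ih⟩ := ih
    exact ⟨_, _, ih.blowup_left hR hx hFan₀ hc hb⟩
  | right Z Z' Φ C n l E r c b _ hc hb ih =>
    obtain ⟨vE, vL, ih⟩ := ih
    exact ⟨_, _, ih.blowup_right hR hx hFan₀ hc hb⟩

end Chain

/-! ### Hirzebruch-Jung continued fractions and their fans -/

section HJ

lemma hjSeq_add_two (e : List ℤ) (a b : ℤ) (i : ℕ) :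
    hjSeq e a b (i + 2) = e.getD i 0 * hjSeq e a b (i + 1) - hjSeq e a b i := rfl

lemma hjSeq_linear (e : List ℤ) (a b c d x y : ℤ) (i : ℕ) :
    hjSeq e (x * a + y * c) (x * b + y * d) i = x * hjSeq e a b i + y * hjSeq e c d i := by
  induction i using Nat.twoStepInduction with
  | zero => rfl
  | one => rfl
  | more i h1 h2 =>
    rw [hjSeq_add_two, hjSeq_add_two, hjSeq_add_two, h1, h2]
    ring

lemma hjSeq_cons (x : ℤ) (e : List ℤ) (a b : ℤ) (i : ℕ) :
    hjSeq (x :: e) a b (i + 1) = hjSeq e b (x * b - a) i := by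
  induction i using Nat.twoStepInduction with
  | zero => rfl
  | one => rfl
  | more i h1 h2 =>
    rw [hjSeq_add_two, h1, h2, hjSeq_add_two, List.getD_cons_succ]

lemma hjSeq_det (e : List ℤ) (a b c d : ℤ) (i : ℕ) :
    hjSeq e a b i * hjSeq e c d (i + 1) - hjSeq e a b (i + 1) * hjSeq e c d i = a * d - b * c := by
  induction i with
  | zero => rfl
  | succ i ih =>
    rw [hjSeq_add_two, hjSeq_add_two]
    linear_combination ih

lemma hjFrac_mem {e : List ℤ} (he : ∀ x ∈ e, 2 ≤ x) : 0 ≤ hjFrac e ∧ hjFrac e < 1 := by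
  induction e with
  | nil => simp [hjFrac]
  | cons x e ih =>
    obtain ⟨h1, h2⟩ := ih fun y hy => he y (List.mem_cons_of_mem _ hy)
    have h3 : (2 : ℚ) ≤ x := by exact_mod_cast he x (by simp)
    have h4 : 1 < (x : ℚ) - hjFrac e := by linarith
    rw [hjFrac]
    exact ⟨by positivity, by rw [div_lt_one (by linarith)]; exact h4⟩

lemma hjSeq_last {e : List ℤ} (he : ∀ x ∈ e, 2 ≤ x) (a b : ℤ) :
    (hjSeq e a b (e.length + 1) : ℚ) = (b - a * hjFrac e) * hjSeq e 0 1 (e.length + 1) := by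
  induction e generalizing a b with
  | nil => simp [hjFrac, hjSeq]
  | cons x e ih =>
    have he' : ∀ y ∈ e, 2 ≤ y := fun y hy => he y (List.mem_cons_of_mem _ hy)
    obtain ⟨h1, h2⟩ := hjFrac_mem he'
    have h3 : (2 : ℚ) ≤ x := by exact_mod_cast he x (by simp)
    have h4 : (x : ℚ) - hjFrac e ≠ 0 := by linarith
    rw [List.length_cons, hjSeq_cons, hjSeq_cons, ih he', ih he' 1, hjFrac]
    push_cast
    field_simp
    ring

lemma hjSeq_last_pos {e : List ℤ} (he : ∀ x ∈ e, 2 ≤ x) : 0 < hjSeq e 0 1 (e.length + 1) := by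
  induction e with
  | nil => simp [hjSeq]
  | cons x e ih =>
    have he' : ∀ y ∈ e, 2 ≤ y := fun y hy => he y (List.mem_cons_of_mem _ hy)
    obtain ⟨h1, h2⟩ := hjFrac_mem he'
    have h3 : (2 : ℚ) ≤ x := by exact_mod_cast he x (by simp)
    have h4 : 0 < (hjSeq e 0 1 (e.length + 1) : ℚ) := by exact_mod_cast ih he'
    have h5 : 0 < (hjSeq (x :: e) 0 1 ((x :: e).length + 1) : ℚ) := by
      rw [List.length_cons, hjSeq_cons, hjSeq_last he']
      push_cast
      exact mul_pos (by linarith) h4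
    exact_mod_cast h5

/-- The last ray of the fan of an expansion of `p / q` is `(q, -p)`. -/
lemma hjSeq_last_eq {e : List ℤ} {p q : ℕ} (hq : 0 < q) (hpq : p.Coprime q)
    (he : IsHJExpansion e (p / q)) :
    hjSeq e 0 1 (e.length + 1) = q ∧ hjSeq e 1 0 (e.length + 1) = -p := by
  have h1 := hjSeq_last he.1 1 0
  have hpos := hjSeq_last_pos he.1
  have hdet := hjSeq_det e 0 1 1 0 e.length
  rw [he.2] at h1
  set N := hjSeq e 0 1 (e.length + 1)
  set B := hjSeq e 1 0 (e.length + 1)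
  have hq' : (q : ℚ) ≠ 0 := by exact_mod_cast hq.ne'
  have h2 : (q : ℤ) * B = -(p * N) := by
    have : (q : ℚ) * B = -(p * N) := by
      rw [h1]
      push_cast
      field_simp
      ring
    exact_mod_cast this
  have hcop : IsCoprime (p : ℤ) q := Nat.isCoprime_iff_coprime.2 hpq
  have h3 : (q : ℤ) ∣ N := by
    have : (q : ℤ) ∣ p * N := ⟨-B, by linarith⟩
    exact hcop.symm.dvd_of_dvd_mul_left this
  have hcop' : IsCoprime N B := ⟨hjSeq e 1 0 e.length, -hjSeq e 0 1 e.length, by linarith⟩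
  have h4 : N ∣ q := by
    have : N ∣ B * q := ⟨-p, by linarith⟩
    exact hcop'.dvd_of_dvd_mul_left this
  have h5 : N = q := Int.dvd_antisymm hpos.le (by positivity) h4 h3
  refine ⟨h5, ?_⟩
  rw [h5] at h2
  have h6 : (q : ℤ) ≠ 0 := by exact_mod_cast hq.ne'
  exact mul_left_cancel₀ h6 (by linarith)

lemma IsHJExpansion.unique {e e' : List ℤ} {α : ℚ} (h : IsHJExpansion e α)
    (h' : IsHJExpansion e' α) : e = e' := by
  induction e generalizing e' α with
  | nil =>
    cases e' with
    | nil => rfl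
    | cons x e' =>
      have h1 := hjFrac_mem (e := e') fun y hy => h'.1 y (List.mem_cons_of_mem _ hy)
      have h2 : (2 : ℚ) ≤ x := by exact_mod_cast h'.1 x (by simp)
      have h3 : hjFrac (x :: e') = 0 := by rw [h'.2, ← h.2, hjFrac]
      rw [hjFrac, div_eq_zero_iff] at h3
      rcases h3 with h3 | h3 <;> linarith
  | cons x e ih =>
    have h1 := hjFrac_mem (e := e) fun y hy => h.1 y (List.mem_cons_of_mem _ hy)
    have h2 : (2 : ℚ) ≤ x := by exact_mod_cast h.1 x (by simp)
    cases e' with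
    | nil =>
      have h3 : hjFrac (x :: e) = 0 := by rw [h.2, ← h'.2, hjFrac]
      rw [hjFrac, div_eq_zero_iff] at h3
      rcases h3 with h3 | h3 <;> linarith
    | cons x' e' =>
      have h3 := hjFrac_mem (e := e') fun y hy => h'.1 y (List.mem_cons_of_mem _ hy)
      have h4 : (2 : ℚ) ≤ x' := by exact_mod_cast h'.1 x' (by simp)
      have h5 : hjFrac (x :: e) = hjFrac (x' :: e') := by rw [h.2, h'.2]
      rw [hjFrac, hjFrac, one_div, one_div, inv_inj] at h5
      have h6 : (x : ℚ) < x' + 1 := by linarith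
      have h7 : (x' : ℚ) < x + 1 := by linarith
      have h8 : x = x' := by
        have h9 : x < x' + 1 := by exact_mod_cast h6
        have h10 : x' < x + 1 := by exact_mod_cast h7
        omega
      subst h8
      rw [ih (α := hjFrac e) ⟨fun y hy => h.1 y (List.mem_cons_of_mem _ hy), rfl⟩
        ⟨fun y hy => h'.1 y (List.mem_cons_of_mem _ hy), by linarith⟩]

/-- The rays of the resolution of the singular point on the zero section. -/
def zeroRay (e : List ℤ) (i : ℕ) : ℤ × ℤ := (hjSeq e 0 1 i, hjSeq e 1 0 i)

/-- The rays of the resolution of the singular point on the infinity section. -/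
def inftyRay (e : List ℤ) (i : ℕ) : ℤ × ℤ := (hjSeq e 0 1 i, -hjSeq e 1 1 i)

lemma zeroRay_add_two (e : List ℤ) (i : ℕ) :
    zeroRay e (i + 2) = e.getD i 0 • zeroRay e (i + 1) - zeroRay e i := by
  simp [zeroRay, hjSeq_add_two]

lemma inftyRay_add_two (e : List ℤ) (i : ℕ) :
    inftyRay e (i + 2) = e.getD i 0 • inftyRay e (i + 1) - inftyRay e i := by
  simp only [inftyRay, hjSeq_add_two, Prod.smul_mk, smul_eq_mul, Prod.mk_sub_mk]
  congr 1
  ring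

/-- The fan of the resolutions of the two singular points in a fibre, where `e` and `e'` are the
expansions of `p / q` and `1 - p / q`. -/
def hjFan (e e' : List ℤ) : Set Cone :=
  {c | (∃ i ≤ e.length, c = (zeroRay e i, zeroRay e (i + 1))) ∨
    ∃ i ≤ e'.length, c = (inftyRay e' (i + 1), inftyRay e' i)}

/-- The self-intersection numbers of a chain determine its rays. -/
lemma walk_eq_iff (x : ℕ → ℤ × ℤ) {e : List ℤ}
    (hx : ∀ i < e.length, x (i + 2) = e.getD i 0 • x (i + 1) - x i) {a b : ℤ × ℤ}
    (h : walk a b (e.map (fun y => -y)).reverse = (x 1, x 0)) :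
    a = x (e.length + 1) ∧ b = x e.length ∧
      ∀ c, c ∈ walkCones a b (e.map (fun y => -y)).reverse ↔ ∃ i ≤ e.length, c = (x i, x (i + 1)) := by
  induction e using List.reverseRecOn generalizing a b with
  | nil =>
    simp only [List.map_nil, List.reverse_nil, walk, Prod.mk.injEq] at h
    obtain ⟨rfl, rfl⟩ := h
    simp [walkCones]
  | append_singleton e m ih =>
    simp only [List.map_append, List.map_cons, List.map_nil, List.reverse_append, List.reverse_cons,
      List.reverse_nil, List.nil_append, List.cons_append, walk, neg_neg] at h
    obtain ⟨h1, h2, h3⟩ := ih (fun i hi => by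
      rw [hx i (by rw [List.length_append]; omega), List.getD_append _ _ _ _ hi]) h
    have h4 := hx e.length (by simp)
    have h5 : (e ++ [m]).getD e.length 0 = m := by simp
    rw [h5] at h4
    have h6 : a = x (e.length + 2) := by
      rw [h4, ← h2, ← h1]
      abel
    simp only [List.length_append, List.length_cons, List.length_nil, zero_add]
    refine ⟨h6, h1, fun c => ?_⟩
    simp only [List.map_append, List.map_cons, List.map_nil, List.reverse_append, List.reverse_cons,
      List.reverse_nil, List.nil_append, List.cons_append, walkCones, neg_neg, List.mem_cons]
    rw [h3, h6, h1]
    constructor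
    · rintro (rfl | ⟨i, hi, rfl⟩)
      · exact ⟨_, le_rfl, rfl⟩
      · exact ⟨i, by omega, rfl⟩
    · rintro ⟨i, hi, rfl⟩
      rcases Nat.le_succ_iff.1 hi with hi | rfl
      · exact Or.inr ⟨i, hi, rfl⟩
      · exact Or.inl rfl

/-- The fan of a chain of curves whose self-intersection numbers are given by `e` and `e'`. -/
lemma fanList_eq_hjFan {e e' : List ℤ} {vE vL : ℤ × ℤ}
    (h : walk vE vL (e.map (fun y => -y)).reverse = ((1, 0), (0, 1)))
    (h' : walk vE (vE - vL) (e'.map (fun y => -y)).reverse = ((1, -1), (0, -1))) :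
    {c | c ∈ fanList vE vL (e.map (fun y => -y)).reverse (e'.map (fun y => -y)).reverse} =
      hjFan e e' ∧ vE = zeroRay e (e.length + 1) ∧ vE = inftyRay e' (e'.length + 1) := by
  obtain ⟨h1, -, h2⟩ := walk_eq_iff (zeroRay e) (fun i _ => zeroRay_add_two e i) h
  obtain ⟨h3, -, h4⟩ := walk_eq_iff (inftyRay e') (fun i _ => inftyRay_add_two e' i) h'
  refine ⟨?_, h1, h3⟩
  ext c
  simp only [Set.mem_ofPred_eq, fanList, List.mem_append, List.mem_map, h2, hjFan]
  refine or_congr Iff.rfl ⟨?_, ?_⟩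
  · rintro ⟨c', hc', rfl⟩
    obtain ⟨i, hi, rfl⟩ := (h4 c').1 hc'
    exact ⟨i, hi, rfl⟩
  · rintro ⟨i, hi, rfl⟩
    exact ⟨_, (h4 _).2 ⟨i, hi, rfl⟩, rfl⟩

/-- The fan of the resolutions of the two singular points of type `A_{p,q}` and `A_{q-p,q}` in
a fibre. -/
def hjFanOf (α : ℚ) : Set Cone :=
  {c | ∃ e e', IsHJExpansion e α ∧ IsHJExpansion e' (1 - α) ∧ c ∈ hjFan e e'}

lemma hjFanOf_eq {α : ℚ} {e e' : List ℤ} (he : IsHJExpansion e α) (he' : IsHJExpansion e' (1 - α)) :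
    hjFanOf α = hjFan e e' := by
  ext c
  constructor
  · rintro ⟨e₁, e₁', h1, h2, h3⟩
    rwa [h1.unique he, h2.unique he'] at h3
  · exact fun h => ⟨e, e', he, he', h⟩

lemma isHJExpansion_of_zeroRay {e : List ℤ} (he : ∀ x ∈ e, 2 ≤ x) {p q : ℕ} (hq : 0 < q)
    (h : ((q : ℤ), -(p : ℤ)) = zeroRay e (e.length + 1)) : IsHJExpansion e (p / q) := by
  refine ⟨he, ?_⟩
  obtain ⟨h1, h2⟩ := Prod.mk.inj h
  have h3 := hjSeq_last he 1 0
  rw [← h1, ← h2] at h3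
  have hq' : (q : ℚ) ≠ 0 := by exact_mod_cast hq.ne'
  push_cast at h3
  rw [eq_div_iff hq']
  linarith

lemma isHJExpansion_of_inftyRay {e : List ℤ} (he : ∀ x ∈ e, 2 ≤ x) {p q : ℕ} (hq : 0 < q)
    (h : ((q : ℤ), -(p : ℤ)) = inftyRay e (e.length + 1)) : IsHJExpansion e (1 - p / q) := by
  refine ⟨he, ?_⟩
  obtain ⟨h1, h2⟩ := Prod.mk.inj h
  have h3 := hjSeq_last he 1 1
  rw [← h1, ← neg_inj.1 h2] at h3
  have hq' : (q : ℚ) ≠ 0 := by exact_mod_cast hq.ne'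
  push_cast at h3
  field_simp
  linarith

end HJ

section Chain

variable {S : Type*} {N : Type*} [TopologicalSpace N] [HolSpace N]
  {M : Type u} [TopologicalSpace M] [HolSpace M]
  {g : N → S × ℂ} {𝒜 : Set S} {R : S → ℂ × ℂ → S × ℂ} {ρ : S → ℝ} {x : S} {f₀ : M → S × ℂ}
  {Fan₀ : S → Set Cone}

/-- A chain of blow-ups can be continued until the last exceptional curve has a prescribed ray in
the cone spanned by the neighbours, by the Euclidean algorithm. -/
lemma Tracked.exists_chain (hR : ∀ x ∈ 𝒜, IsRef x (ρ x) (R x)) (hx : x ∈ 𝒜)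
    (hFan₀ : ∀ x ∈ 𝒜, ∀ c ∈ Fan₀ x, IsCone c) {F : Set M} {B : M} (k : ℕ) :
    ∀ (a b : ℕ), a + b ≤ k → 0 < a → 0 < b → a.Coprime b → ∀ (Z : Type u) (_ : TopologicalSpace Z)
      (_ : HolSpace Z) (Φ : Z → M) (l : List (Set Z × ℤ)) (E : Set Z) (r : List (Set Z × ℤ))
      (vE vL : ℤ × ℤ), ChainBlowup F B Z Φ l E r → Tracked g 𝒜 R x f₀ Fan₀ Φ l E r vE vL →
      r ≠ [] → (∀ n ∈ l.map Prod.snd, n ≤ -2) → (∀ n ∈ r.map Prod.snd, n ≤ -2) →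
      ∃ (Z' : Type u) (_ : TopologicalSpace Z') (_ : HolSpace Z') (Φ' : Z' → M)
        (l' : List (Set Z' × ℤ)) (E' : Set Z') (r' : List (Set Z' × ℤ)) (vL' : ℤ × ℤ),
        ChainBlowup F B Z' Φ' l' E' r' ∧
        Tracked g 𝒜 R x f₀ Fan₀ Φ' l' E' r' ((a : ℤ) • vL + (b : ℤ) • (vE - vL)) vL' ∧
        (∀ n ∈ l'.map Prod.snd, n ≤ -2) ∧ (∀ n ∈ r'.map Prod.snd, n ≤ -2) := by
  induction k with
  | zero => intro a b h ha hb; omega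
  | succ k ih =>
    intro a b hab ha hb hcop Z _ _ Φ l E r vE vL hch ht hr hl2 hr2
    have := ht.t2
    rcases lt_trichotomy a b with h | rfl | h
    · obtain ⟨⟨D, n⟩, r, rfl⟩ := List.exists_cons_of_ne_nil hr
      obtain ⟨c, hcor, hc⟩ := ht.right D n r rfl
      obtain ⟨κ, hκ, hcs, hc0, -⟩ := id hcor
      obtain ⟨Z', _, _, β, hβ⟩ := exists_isPointBlowup hκ hcs hc0
      obtain ⟨Z'', i1, i2, Φ', l', E', r', vL', h1, h2, h3, h4⟩ := ih a (b - a) (by omega) ha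
        (by omega) ((Nat.coprime_sub_self_right h.le).2 hcop) Z' _ _ _ _ _ _ _ _
        (ChainBlowup.right Z Z' Φ D n l E r c β hch hc hβ) (ht.blowup_right hR hx hFan₀ hc hβ)
        (by simp) (by simpa using hl2) (by
          simp only [List.map_cons, List.mem_cons, forall_eq_or_imp] at hr2 ⊢
          refine ⟨by omega, ?_⟩
          simpa using hr2.2)
      refine ⟨Z'', i1, i2, Φ', l', E', r', vL', h1, ?_, h3, h4⟩
      convert h2 using 1
      push_cast [h.le]
      module
    · obtain rfl : a = 1 := by simpa using hcop
      refine ⟨Z, _, _, Φ, l, E, r, vL, hch, ?_, hl2, hr2⟩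
      convert ht using 1
      push_cast
      module
    · obtain ⟨⟨C, n⟩, l, rfl⟩ := List.exists_cons_of_ne_nil ht.ne_nil
      obtain ⟨c, hcor, hc⟩ := ht.left C n l rfl
      obtain ⟨κ, hκ, hcs, hc0, -⟩ := id hcor
      obtain ⟨Z', _, _, β, hβ⟩ := exists_isPointBlowup hκ hcs hc0
      obtain ⟨Z'', i1, i2, Φ', l', E', r', vL', h1, h2, h3, h4⟩ := ih (a - b) b (by omega) (by omega)
        hb ((Nat.coprime_sub_self_left h.le).2 hcop) Z' _ _ _ _ _ _ _ _
        (ChainBlowup.left Z Z' Φ C n l E r c β hch hc hβ) (ht.blowup_left hR hx hFan₀ hc hβ)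
        (by simp) (by
          simp only [List.map_cons, List.mem_cons, forall_eq_or_imp] at hl2 ⊢
          refine ⟨by omega, ?_⟩
          simpa using hl2.2) (by simpa using hr2)
      refine ⟨Z'', i1, i2, Φ', l', E', r', vL', h1, ?_, h3, h4⟩
      convert h2 using 1
      push_cast [h.le]
      module

lemma exists_isWeightedBlowupAt [T2Space M] (hR : ∀ x ∈ 𝒜, IsRef x (ρ x) (R x)) (hx : x ∈ 𝒜)
    (hFan₀ : ∀ x ∈ 𝒜, ∀ c ∈ Fan₀ x, IsCone c) (h : Realizes g 𝒜 R f₀ Fan₀)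
    (hFx : Fan₀ x = {c | c ∈ ruledFan}) {F E₀ : Set M} {B : M}
    (hB : IsCorner (R x) f₀ F E₀ ((1, 0), (0, -1)) B) {p q : ℕ} (hp : 0 < p) (hpq : p < q)
    (hcop : p.Coprime q) :
    ∃ (Z : Type u) (_ : TopologicalSpace Z) (_ : HolSpace Z) (Φ : Z → M),
      IsWeightedBlowupAt F B (p / q) Φ := by
  obtain ⟨κ, hκ, hcs, hc0, -⟩ := id hB
  obtain ⟨Z₁, _, _, b₁, hb₁⟩ := exists_isPointBlowup hκ hcs hc0
  have hch₁ := ChainBlowup.first (F := F) (B := B) Z₁ b₁ hb₁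
  have ht₁ := tracked_first hR hx hFan₀ h hFx hB hb₁
  have := ht₁.t2
  obtain ⟨c, hcor, hc⟩ := ht₁.left _ _ _ rfl
  obtain ⟨κ', hκ', hcs', hc0', -⟩ := id hcor
  obtain ⟨Z₂, _, _, b₂, hb₂⟩ := exists_isPointBlowup hκ' hcs' hc0'
  obtain ⟨Z, i1, i2, Φ, l, E, r, vL, h1, h2, h3, h4⟩ := Tracked.exists_chain hR hx hFan₀ (q - p + p)
    (q - p) p le_rfl (by omega) hp ((Nat.coprime_sub_self_left hpq.le).2 hcop.symm) Z₂ _ _ _ _ _ _ _ _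
    (ChainBlowup.left _ Z₂ _ _ _ _ _ _ c b₂ hch₁ hc hb₂) (ht₁.blowup_left hR hx hFan₀ hc hb₂)
    (by simp) (by simp) (by simp)
  have hvE : (((q - p : ℕ) : ℤ) • ((1, 0) : ℤ × ℤ) +
      (p : ℤ) • (((1, -1) : ℤ × ℤ) + (1, 0) - (1, 0))) = ((q : ℤ), -(p : ℤ)) := by
    push_cast [hpq.le]
    simp
  rw [hvE] at h2
  have hneg : ∀ l : List ℤ, (((l.map (fun y => -y)).reverse).map (fun y => -y)).reverse = l := by
    intro l
    simp [List.map_reverse]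
  have hge : ∀ l : List ℤ, (∀ n ∈ l, n ≤ -2) → ∀ n ∈ (l.map (fun y => -y)).reverse, 2 ≤ n := by
    intro l hl n hn
    simp only [List.mem_reverse, List.mem_map] at hn
    obtain ⟨n', hn', rfl⟩ := hn
    have := hl n' hn'
    omega
  have hwl := h2.walk_left
  have hwr := h2.walk_right
  rw [← hneg (l.map Prod.snd)] at hwl
  rw [← hneg (r.map Prod.snd)] at hwr
  obtain ⟨-, h5, h6⟩ := fanList_eq_hjFan hwl hwr
  exact ⟨Z, i1, i2, Φ, _, _, l, r, E, isHJExpansion_of_zeroRay (hge _ h3) (by omega) h5,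
    isHJExpansion_of_inftyRay (hge _ h4) (by omega) h6, h1, (hneg _).symm, (hneg _).symm⟩

/-- The fan of the blow-up of weight `α`. -/
lemma IsWeightedBlowupAt.realizes [T2Space M] (hR : ∀ x ∈ 𝒜, IsRef x (ρ x) (R x)) (hx : x ∈ 𝒜)
    (hFan₀ : ∀ x ∈ 𝒜, ∀ c ∈ Fan₀ x, IsCone c) (h : Realizes g 𝒜 R f₀ Fan₀)
    (hFx : Fan₀ x = {c | c ∈ ruledFan}) {F E₀ : Set M} {B : M}
    (hB : IsCorner (R x) f₀ F E₀ ((1, 0), (0, -1)) B) {α : ℚ} {Z : Type u} [TopologicalSpace Z]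
    [HolSpace Z] {Φ : Z → M} (hΦ : IsWeightedBlowupAt F B α Φ) :
    T2Space Z ∧ (∀ c ∈ hjFanOf α, IsCone c) ∧ (∀ Fan : S → Set Cone, Fan x = hjFanOf α →
      (∀ x' ≠ x, Fan x' = Fan₀ x') → Realizes g 𝒜 R (f₀ ∘ Φ) Fan) ∧
    ∀ p, (f₀ (Φ p)).1 ≠ x → ∃ e : OpenPartialHomeomorph Z M, IsBihol e ∧ p ∈ e.source ∧
      ∀ p' ∈ e.source, e p' = Φ p' := by
  obtain ⟨e, e', l, r, E, he, he', hch, hl, hr⟩ := hΦ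
  obtain ⟨vE, vL, ht⟩ := hch.tracked hR hx hFan₀ h hFx hB
  have hwl := ht.walk_left
  have hwr := ht.walk_right
  have hre := ht.realizes
  have hfan := ht.isFan
  rw [hl] at hwl
  rw [hr] at hwr
  rw [hl, hr] at hre hfan
  obtain ⟨h1, -⟩ := fanList_eq_hjFan hwl hwr
  rw [h1, ← hjFanOf_eq he he'] at hre
  rw [hjFanOf_eq he he', ← h1]
  exact ⟨ht.t2, hfan.isCone, by rw [h1, ← hjFanOf_eq he he']; exact hre, ht.bihol⟩

end Chain

/-! ### Generic coordinates in charts of ruled surfaces -/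

section Tau

variable {S : Type u} [TopologicalSpace S] [ChartedSpace ℂ S]

/-- The generic coordinates in the affine chart around the zero section given by a coordinate disc,
where `k` is the multiplicity of the divisor at the centre of the disc. -/
def tau (φ : Disc S) (k : ℤ) (r : ℕ) (𝒜 : Set S) (y : ℂ × ℂ) : S × ℂ :=
  open Classical in
  (φ.toFun y.1, if y.1 ∈ Metric.ball (0 : ℂ) φ.radius ∧ φ.toFun y.1 ∉ 𝒜 then
    y.2 * (y.1 ^ (-k) * (jac φ.toFun y.1)⁻¹ ^ r) else 0)

/-- The generic coordinates in the affine chart around the zero section (`b = false`) or the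
infinity section (`b = true`). -/
def affTau (φ : Disc S) (k : ℤ) (r : ℕ) (𝒜 : Set S) (b : Bool) (y : ℂ × ℂ) : S × ℂ :=
  tau φ k r 𝒜 (y.1, if b then y.2⁻¹ else y.2)

lemma affTau_eq_toric (φ : Disc S) (k : ℤ) (r : ℕ) (𝒜 : Set S) (b : Bool) :
    affTau φ k r 𝒜 b = toric (tau φ k r 𝒜) (if b then ((1, 0), (0, -1)) else ((1, 0), (0, 1))) := by
  funext y
  cases b <;> simp [affTau, toric, mon]

variable [IsManifold 𝓘(ℂ) ω S] {φ : Disc S} {k : ℤ} {r : ℕ} {𝒜 : Set S}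

lemma tau_snd_ne_zero (hav : φ.Avoids 𝒜) {y : ℂ × ℂ} (hy : y.1 ∈ Metric.ball (0 : ℂ) φ.radius)
    (h1 : y.1 ≠ 0) (h2 : y.2 ≠ 0) : (tau φ k r 𝒜 y).2 ≠ 0 := by
  rw [tau]
  simp only [hy, hav _ hy h1, not_false_eq_true, and_self, if_true]
  exact mul_ne_zero h2 (mul_ne_zero (zpow_ne_zero _ h1) (pow_ne_zero _ (inv_ne_zero (φ.jac_ne_zero hy))))

lemma affTau_dense (hav : φ.Avoids 𝒜) {b : Bool} {y : ℂ × ℂ}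
    (hy : y.1 ∈ Metric.ball (0 : ℂ) φ.radius) :
    ∀ᶠ y' in 𝓝 y, y' ∈ closure {y'' | (affTau φ k r 𝒜 b y'').2 ≠ 0} := by
  have h1 : ∀ᶠ y' in 𝓝 y, y'.1 ∈ Metric.ball (0 : ℂ) φ.radius :=
    continuous_fst.continuousAt.eventually_mem (Metric.isOpen_ball.mem_nhds hy)
  filter_upwards [h1.eventually_nhds] with y' h2
  refine mem_closure_iff_frequently.2 ((eventually_ne_zero_and.and_eventually h2).mono ?_)
  rintro y'' ⟨⟨h3, h4⟩, h5⟩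
  refine tau_snd_ne_zero hav h5 h3 ?_
  cases b
  · exact h4
  · exact inv_ne_zero h4

/-- The generic coordinates near the fibre over a marked point. -/
lemma isRef_tau (hav : φ.Avoids 𝒜) (h0 : φ.toFun 0 ∈ 𝒜) :
    IsRef (φ.toFun 0) φ.radius (tau φ k r 𝒜) where
  pos := φ.radius_pos
  zero w := by simp [tau, h0]
  fst_eq z w hz := by
    rw [← mem_ball_zero_iff] at hz
    exact ⟨fun h => φ.inj hz φ.zero_mem h, fun h => by rw [h]; rfl⟩
  generic z w := by
    rw [← mem_ball_zero_iff]
    constructor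
    · intro h
      rw [tau] at h
      simp only [ne_eq, ite_eq_right_iff, not_forall] at h
      obtain ⟨⟨h1, h2⟩, h3⟩ := h
      exact ⟨fun hz => h2 (by rw [hz]; exact h0), h1, left_ne_zero_of_mul h3⟩
    · rintro ⟨h1, h2, h3⟩
      exact tau_snd_ne_zero hav h2 h1 h3
  inj y hy y' hy' h := by
    have key : ∀ y : ℂ × ℂ, (tau φ k r 𝒜 y).2 ≠ 0 → y.1 ∈ Metric.ball (0 : ℂ) φ.radius ∧
        φ.toFun y.1 ∉ 𝒜 ∧ y.1 ^ (-k) * (jac φ.toFun y.1)⁻¹ ^ r ≠ 0 := by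
      intro y h
      rw [tau] at h
      simp only [ne_eq, ite_eq_right_iff, not_forall] at h
      obtain ⟨⟨h1, h2⟩, h3⟩ := h
      exact ⟨h1, h2, right_ne_zero_of_mul h3⟩
    obtain ⟨h1, h2, h3⟩ := key y hy
    obtain ⟨h4, h5, h6⟩ := key y' hy'
    have h7 : y.1 = y'.1 := φ.inj h1 h4 (congrArg Prod.fst h)
    refine Prod.ext h7 ?_
    have h8 := congrArg Prod.snd h
    simp only [tau, h1, h2, h4, h5, not_false_eq_true, and_self, if_true] at h8
    rw [← h7] at h8 h6
    exact mul_right_cancel₀ h6 h8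

end Tau

section RuledCharts

variable {S : Type u} [TopologicalSpace S] [ChartedSpace ℂ S]
  {m : S → ℕ} {d : S → ℤ} {r : ℕ} {𝒜 : Set S} {h𝒜 : ∀ x ∉ 𝒜, m x = 1 ∧ d x = 0}
  {hpos : ∀ x, 0 < m x}

/-- The orbifold chart with the same centre as a coordinate disc. -/
def Disc.orbAt (φ : Disc S) (hav : φ.Avoids 𝒜) (h𝒜 : ∀ x ∉ 𝒜, m x = 1 ∧ d x = 0)
    (hpos : ∀ x, 0 < m x) : OrbChart S m d :=
  φ.orb m d (hpos _) fun z hz h0 => h𝒜 _ (hav z hz h0)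

lemma Disc.orbAt_zero {φ : Disc S} {hav : φ.Avoids 𝒜} :
    (φ.orbAt hav h𝒜 hpos).toFun 0 = φ.toFun 0 :=
  Disc.orb_zero _ _ _ _ _

lemma Disc.orbAt_toFun {φ : Disc S} {hav : φ.Avoids 𝒜} (hm : m (φ.toFun 0) = 1) :
    (φ.orbAt hav h𝒜 hpos).toFun = φ.toFun := by
  funext z
  change φ.toFun (z ^ m (φ.toFun 0)) = _
  rw [hm, pow_one]

lemma Disc.orbAt_mem {φ : Disc S} {hav : φ.Avoids 𝒜} (hm : m (φ.toFun 0) = 1) {z : ℂ} :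
    z ∈ Metric.ball (0 : ℂ) (φ.orbAt hav h𝒜 hpos).radius ↔ z ∈ Metric.ball (0 : ℂ) φ.radius := by
  change z ∈ Metric.ball (0 : ℂ) (φ.radius ^ ((m (φ.toFun 0) : ℝ)⁻¹)) ↔ _
  simp [hm]

namespace RuledSurface

variable [IsManifold 𝓘(ℂ) ω S]

lemma gen_affineChart {φ : OrbChart S m d} {b : Bool} {y : ℂ × ℂ}
    (hy : y.1 ∈ Metric.ball (0 : ℂ) φ.radius) :
    gen (r := r) 𝒜 h𝒜 hpos (affineChart r φ b y) = (φ.toFun y.1, open Classical in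
      if φ.toFun y.1 ∈ 𝒜 then 0 else
        (if b then y.2⁻¹ else y.2) * (y.1 ^ (-d (φ.toFun 0)) * (jac φ.toFun y.1)⁻¹ ^ r)) := by
  cases b
  · rw [affineChart_false, gen_pt hy (one_prod_ne_zero _)]
    simp
  · rw [affineChart_true, gen_pt hy (prod_one_ne_zero _)]
    simp

/-- Generic coordinates and local injectivity determine the germ of the surface. -/
lemma locMatch_affineChart {φ : OrbChart S m d} {b : Bool} {U : Set (ℂ × ℂ)} (hU : IsOpen U)
    (hUφ : ∀ y ∈ U, y.1 ∈ Metric.ball (0 : ℂ) φ.radius)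
    (hinj : Set.InjOn (affineChart r φ b) U) {y : ℂ × ℂ} (hy : y ∈ U) {μ : ℂ × ℂ → S × ℂ}
    (hμ : ∀ y' ∈ U, gen (r := r) 𝒜 h𝒜 hpos (affineChart r φ b y') = μ y')
    (hd : ∀ᶠ y' in 𝓝 y, y' ∈ closure {y'' | (μ y'').2 ≠ 0}) :
    LocMatch (gen (r := r) 𝒜 h𝒜 hpos) μ (affineChart r φ b y) y := by
  obtain ⟨e, he, hes, heb⟩ := exists_isBihol_affineChart φ b hU hUφ hinj
  have hye : y ∈ e.source := by rwa [hes]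
  have hinv : e.symm (affineChart r φ b y) = y := by
    rw [← heb]
    exact e.left_inv hye
  have h1 := LocMatch.of_bihol (f := gen (r := r) 𝒜 h𝒜 hpos) (g := μ) (x := affineChart r φ b y)
    he.symm (by rw [← heb]; exact e.map_source hye) ?_ (by rw [hinv]; exact hd)
  · rwa [hinv] at h1
  · intro P hP
    have h2 : P ∈ e.target := hP
    have h3 := e.map_target h2
    rw [hes] at h3
    rw [← hμ _ h3, ← heb, e.right_inv h2]

lemma locMatch_affTau {φ : Disc S} (hav : φ.Avoids 𝒜) (hm : m (φ.toFun 0) = 1) (b : Bool) (t : ℂ) :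
    LocMatch (gen (r := r) 𝒜 h𝒜 hpos) (affTau φ (d (φ.toFun 0)) r 𝒜 b)
      (affineChart r (φ.orbAt hav h𝒜 hpos) b (0, t)) (0, t) := by
  have hz : ∀ z, z ∈ Metric.ball (0 : ℂ) (φ.orbAt hav h𝒜 hpos).radius ↔
      z ∈ Metric.ball (0 : ℂ) φ.radius := fun z => Disc.orbAt_mem hm
  refine locMatch_affineChart (U := Metric.ball (0 : ℂ) φ.radius ×ˢ Set.univ)
    (Metric.isOpen_ball.prod isOpen_univ) (fun y hy => (hz _).2 hy.1) ?_ ⟨φ.zero_mem, trivial⟩ ?_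
    (affTau_dense hav φ.zero_mem)
  · intro y hy y' hy' h
    rw [affineChart_eq_iff (hpos _) ((hz _).2 hy.1) ((hz _).2 hy'.1)] at h
    obtain ⟨ζ, hζ, h⟩ := h
    rw [Disc.orbAt_zero, hm, pow_one] at hζ
    rw [h, hζ]
    simp
  · intro y hy
    rw [gen_affineChart ((hz _).2 hy.1), Disc.orbAt_toFun hm, affTau, tau]
    have h1 : y.1 ∈ Metric.ball (0 : ℂ) φ.radius := hy.1
    by_cases hA : φ.toFun y.1 ∈ 𝒜 <;> simp [h1, hA]

end RuledSurface

end RuledCharts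

/-! ### The iterated blow-up of a ruled surface -/

section Match

variable {S : Type u} [TopologicalSpace S] [ChartedSpace ℂ S] [IsManifold 𝓘(ℂ) ω S]
  {r : ℕ} {𝒜 : Set S} {δ : S → Disc S}

namespace RuledSurface

section

variable {m : S → ℕ} {d : S → ℤ} {h𝒜 : ∀ x ∉ 𝒜, m x = 1 ∧ d x = 0} {hpos : ∀ x, 0 < m x}

/-- The points of a fibre without isotropy. -/
lemma exists_locMatch_affTau (hδ : ∀ x, (δ x).toFun 0 = x) (hav : ∀ x, (δ x).Avoids 𝒜)
    (P : RuledSurface m d r) (hm : m (proj r P) = 1) :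
    ∃ b t, LocMatch (gen 𝒜 h𝒜 hpos) (affTau (δ (proj r P)) (d (proj r P)) r 𝒜 b) P (0, t) := by
  obtain ⟨b, t, h⟩ := exists_eq_affineChart hpos ((δ (proj r P)).orbAt (hav _) h𝒜 hpos)
    (OrbChart.zero_mem _) (Or.inl rfl) (P := P) (by rw [Disc.orbAt_zero, hδ])
  have h1 := locMatch_affTau (r := r) (h𝒜 := h𝒜) (hpos := hpos) (hav (proj r P))
    (by rwa [hδ]) b t
  rw [← h, hδ] at h1
  exact ⟨b, t, h1⟩

lemma exists_locMatch_affTau' (hδ : ∀ x, (δ x).toFun 0 = x) (hav : ∀ x, (δ x).Avoids 𝒜)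
    (x : S) (hm : m x = 1) (b : Bool) (t : ℂ) :
    ∃ P, LocMatch (gen (r := r) 𝒜 h𝒜 hpos) (affTau (δ x) (d x) r 𝒜 b) P (0, t) := by
  have h1 := locMatch_affTau (r := r) (h𝒜 := h𝒜) (hpos := hpos) (hav x) (by rwa [hδ]) b t
  rw [hδ] at h1
  exact ⟨_, h1⟩

/-- Two ruled surfaces agree away from the marked fibres. -/
lemma exists_locMatch_gen {m' : S → ℕ} {d' : S → ℤ} {h𝒜' : ∀ x ∉ 𝒜, m' x = 1 ∧ d' x = 0}
    {hpos' : ∀ x, 0 < m' x} (hδ : ∀ x, (δ x).toFun 0 = x) (hav : ∀ x, (δ x).Avoids 𝒜)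
    (P : RuledSurface m d r) (hP : proj r P ∉ 𝒜) :
    ∃ P' : RuledSurface m' d' r, LocMatch (gen 𝒜 h𝒜 hpos) (gen 𝒜 h𝒜' hpos') P P' := by
  obtain ⟨b, t, h⟩ := exists_locMatch_affTau (h𝒜 := h𝒜) (hpos := hpos) hδ hav P (h𝒜 _ hP).1
  obtain ⟨P', h'⟩ := exists_locMatch_affTau' (r := r) (h𝒜 := h𝒜') (hpos := hpos') hδ hav
    (proj r P) (h𝒜' _ hP).1 b t
  rw [(h𝒜 _ hP).2] at h
  rw [(h𝒜' _ hP).2] at h'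
  exact ⟨P', h.trans h'.symm⟩

end

section

variable {D : S → ℤ} {h𝒜 : ∀ x ∉ 𝒜, (1 : ℕ) = 1 ∧ D x = 0}

/-- The ruled surface `ℙ(O ⊕ K^r ⊗ [D])`, without orbifold points. -/
local notation "genD" => gen (m := fun _ : S => 1) (d := D) (r := r) 𝒜 h𝒜 fun _ => one_pos

lemma isRef_fibre (hδ : ∀ x, (δ x).toFun 0 = x) (hav : ∀ x, (δ x).Avoids 𝒜) (x : S) (hx : x ∈ 𝒜) :
    IsRef x (δ x).radius (tau (δ x) (D x) r 𝒜) := by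
  have := isRef_tau (k := D x) (r := r) (hav x) (by rwa [hδ])
  rwa [hδ] at this

lemma locMatch_gen_self (hδ : ∀ x, (δ x).toFun 0 = x) (hav : ∀ x, (δ x).Avoids 𝒜)
    (P : RuledSurface (fun _ : S => 1) D r) : LocMatch genD genD P P := by
  obtain ⟨b, t, h⟩ := exists_locMatch_affTau (h𝒜 := h𝒜) (hpos := fun _ => one_pos) hδ hav P rfl
  exact h.trans h.symm

lemma realizes_gen (hδ : ∀ x, (δ x).toFun 0 = x) (hav : ∀ x, (δ x).Avoids 𝒜) :
    Realizes genD 𝒜 (fun x => tau (δ x) (D x) r 𝒜) genD (fun _ => {c | c ∈ ruledFan}) where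
  inj := genInj_gen
  off_left P _ := ⟨P, locMatch_gen_self hδ hav P⟩
  off_right P _ := ⟨P, locMatch_gen_self hδ hav P⟩
  left P hP := by
    obtain ⟨b, t, h⟩ := exists_locMatch_affTau (h𝒜 := h𝒜) (hpos := fun _ => one_pos) hδ hav P rfl
    rw [gen_fst] at hP ⊢
    rw [affTau_eq_toric] at h
    cases b
    · have hc : IsCone ((0, 1), (1, 0)) := isFan_ruledFan.isCone _ (by simp [ruledFan])
      refine ⟨((0, 1), (1, 0)), by simp [ruledFan], (t, 0), by simp [mon], h.trans ?_⟩
      exact (isRef_fibre hδ hav _ hP).locMatch_swap hc (y := (t, 0)) (by simp [mon])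
    · exact ⟨((1, 0), (0, -1)), by simp [ruledFan], (0, t), by simp [mon], h⟩
  right x hx c hc y hy := by
    simp only [ruledFan, List.mem_cons, List.not_mem_nil, or_false, Set.mem_ofPred_eq] at hc
    rcases hc with rfl | rfl
    · have hy2 : y.2 = 0 := by simpa [mon] using hy
      obtain ⟨P, h⟩ := exists_locMatch_affTau' (m := fun _ : S => 1) (d := D) (r := r) (h𝒜 := h𝒜)
        (hpos := fun _ => one_pos) hδ hav x rfl false y.1
      rw [affTau_eq_toric] at h
      have hc : IsCone ((0, 1), (1, 0)) := isFan_ruledFan.isCone _ (by simp [ruledFan])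
      have h2 := (isRef_fibre (D := D) (r := r) hδ hav x hx).locMatch_swap hc (y := y) hy
      refine ⟨P, LocMatch.trans h ?_⟩
      rwa [show y.swap = (0, y.1) from Prod.ext hy2 rfl] at h2
    · have hy1 : y.1 = 0 := by simpa [mon] using hy
      obtain ⟨P, h⟩ := exists_locMatch_affTau' (m := fun _ : S => 1) (d := D) (r := r) (h𝒜 := h𝒜)
        (hpos := fun _ => one_pos) hδ hav x rfl true y.2
      rw [affTau_eq_toric, show ((0 : ℂ), y.2) = y from Prod.ext hy1.symm rfl] at h
      exact ⟨P, h⟩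

/-- The points of the infinity section are the origins of their toric charts. -/
lemma locMatch_infinitySection (hδ : ∀ x, (δ x).toFun 0 = x) (hav : ∀ x, (δ x).Avoids 𝒜)
    {P : RuledSurface (fun _ : S => 1) D r} (hP : P ∈ infinitySection r) :
    LocMatch genD (toric (tau (δ (proj r P)) (D (proj r P)) r 𝒜) ((1, 0), (0, -1))) P 0 := by
  obtain ⟨φ, z, v, hz, hv, rfl⟩ := hP
  have huv : ((0 : ℂ), v) ≠ (0 : ℂ × ℂ) := fun h => hv (Prod.mk_eq_zero.1 h).2
  rw [proj_pt hz huv]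
  have hm : (fun _ : S => 1) ((δ (φ.toFun z)).toFun 0) = 1 := rfl
  have h0 := Disc.orbAt_zero (h𝒜 := h𝒜) (hpos := fun _ => one_pos) (hav := hav (φ.toFun z))
  set φ' : OrbChart S (fun _ => 1) D := (δ (φ.toFun z)).orbAt (hav (φ.toFun z)) h𝒜 fun _ => one_pos
    with hφ'
  rw [hδ] at h0
  obtain ⟨k, hk, hkz, hkd, hkw⟩ := φ.exists_transition (fun _ => one_pos) φ' hz φ'.zero_mem h0
    (Or.inl rfl)
  obtain ⟨a, -, ha⟩ := exists_isTransition (r := r) hz hk hkd (by rw [hkz]; exact φ'.zero_mem) hkw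
  have ha0 := ha.self_of_nhds.1
  have h1 := locMatch_affTau (r := r) (h𝒜 := h𝒜) (hpos := fun _ => one_pos) (hav (φ.toFun z)) hm
    true 0
  rw [pt_of_isTransition hz huv ha.self_of_nhds.2, hkz,
    pt_eq_affineChart_true φ'.zero_mem (div_ne_zero hv ha0), zero_div]
  rw [affTau_eq_toric, hδ] at h1
  exact h1

end

end RuledSurface

end Match

section Iterated

variable {S : Type*} {M : Type u} [TopologicalSpace M] [HolSpace M]
  {g : M → S × ℂ} {𝒜 : Set S} {R : S → ℂ × ℂ → S × ℂ} {ρ : S → ℝ}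

lemma LocMatch.isCorner {Z : Type*} [TopologicalSpace Z] [HolSpace Z] {x : S} {ρ : ℝ}
    {R : ℂ × ℂ → S × ℂ} (hR : IsRef x ρ R) {f : Z → S × ℂ} {q : Z}
    (h : LocMatch f (toric R ((1, 0), (0, -1))) q 0) :
    ∃ E, IsCorner R f {p | (f p).1 = x} E ((1, 0), (0, -1)) q := by
  obtain ⟨κ, hκ, hq, hq0, -, hm⟩ := h.exists_chart Filter.univ_mem
  have h1 : ∀ᶠ p in 𝓝 q, ‖(κ p).1‖ < ρ := by
    have h2 : ContinuousAt (fun p => ‖(κ p).1‖) q :=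
      (continuous_fst.norm.continuousAt).comp (κ.continuousAt hq)
    refine h2.eventually_lt continuousAt_const ?_
    rw [hq0]
    simpa using hR.pos
  obtain ⟨U, hU, hUo, hqU⟩ := eventually_nhds_iff.1 h1
  refine ⟨{p | (κ p).2 = 0}, κ.restrOpen U hUo, hκ.restr hUo, ⟨hq, hqU⟩, hq0,
    fun p hp => (hm p hp.1).1, fun p hp => ⟨?_, Iff.rfl⟩⟩
  change (f p).1 = x ↔ (κ p).1 = 0
  rw [← (hm p hp.1).2, ← hR.fst_eq _ ((κ p).1 ^ (0 : ℤ) * (κ p).2 ^ (-1 : ℤ)) (hU p hp.2)]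
  simp [toric, mon]

lemma IsBiholOver.locMatch {X Y : Type u} [TopologicalSpace X] [HolSpace X] [TopologicalSpace Y]
    [HolSpace Y] {f : X → Y} {V : Set Y} (h : IsBiholOver f V) {Z : Type*} [TopologicalSpace Z]
    [HolSpace Z] {μ : Y → S × ℂ} {ν : Z → S × ℂ} {x : X} (hx : f x ∈ V) {z : Z}
    (hm : LocMatch μ ν (f x) z) : LocMatch (μ ∘ f) ν x z := by
  obtain ⟨e, hes, -, heq, he⟩ := h
  have hx' : x ∈ e.source := by rwa [hes]
  refine LocMatch.precomp (e := e) he hx' (fun x' h' => ?_) (by rwa [← heq hx'])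
  rw [Function.comp, heq h']

/-- The fan of the iterated blow-up at the points with indices in `J`. -/
def blowupFan {s : ℕ} (A : Fin s → S) (α : Fin s → ℚ) (J : List (Fin s)) (x : S) : Set Cone :=
  {c | (∃ j ∈ J, A j = x ∧ c ∈ hjFanOf (α j)) ∨ (∀ j ∈ J, A j ≠ x) ∧ c ∈ ruledFan}

lemma blowupFan_cons_self {s : ℕ} {A : Fin s → S} (hA : Function.Injective A) (α : Fin s → ℚ)
    {J : List (Fin s)} {j : Fin s} (hj : j ∉ J) :
    blowupFan A α (j :: J) (A j) = hjFanOf (α j) ∧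
      blowupFan A α J (A j) = {c | c ∈ ruledFan} := by
  have h1 : ∀ j' ∈ J, A j' ≠ A j := fun j' hj' h => hj (hA h ▸ hj')
  constructor
  · ext c
    simp only [blowupFan, List.mem_cons, Set.mem_ofPred_eq]
    constructor
    · rintro (⟨j', rfl | hj', h2, h3⟩ | ⟨h2, -⟩)
      · exact h3
      · exact absurd h2 (h1 j' hj')
      · exact absurd rfl (h2 j (Or.inl rfl))
    · exact fun h => Or.inl ⟨j, Or.inl rfl, rfl, h⟩
  · ext c
    simp only [blowupFan, Set.mem_ofPred_eq]
    constructor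
    · rintro (⟨j', hj', h2, h3⟩ | ⟨-, h2⟩)
      · exact absurd h2 (h1 j' hj')
      · exact h2
    · exact fun h => Or.inr ⟨h1, h⟩

lemma blowupFan_cons_of_ne {s : ℕ} {A : Fin s → S} (α : Fin s → ℚ) {J : List (Fin s)} {j : Fin s}
    {x : S} (hx : x ≠ A j) : blowupFan A α (j :: J) x = blowupFan A α J x := by
  ext c
  simp [blowupFan, hx.symm]

/-- The properties of the iterated blow-up at the points with indices in `J`. -/
structure IsBlowupModel {Y : Type u} [TopologicalSpace Y] [HolSpace Y] (g : M → S × ℂ) (𝒜 : Set S)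
    (R : S → ℂ × ℂ → S × ℂ) {s : ℕ} (A : Fin s → S) (α : Fin s → ℚ) (J : List (Fin s)) (Φ : Y → M) :
    Prop where
  t2 : T2Space Y
  isCone : ∀ x ∈ 𝒜, ∀ c ∈ blowupFan A α J x, IsCone c
  realizes : Realizes g 𝒜 R (g ∘ Φ) (blowupFan A α J)
  off : ∀ p, (∀ j ∈ J, A j ≠ (g (Φ p)).1) → LocMatch (g ∘ Φ) g p (Φ p)

variable {s : ℕ} {A : Fin s → S} {α : Fin s → ℚ} {B : Fin s → M}

lemma isBlowupModel_nil [T2Space M] (hg : Realizes g 𝒜 R g (fun _ => {c | c ∈ ruledFan}))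
    (hself : ∀ P, LocMatch g g P P) {Y : Type u} [TopologicalSpace Y] [HolSpace Y] {Φ : Y → M}
    (hΦ : IsBiholOver Φ Set.univ) : IsBlowupModel g 𝒜 R A α [] Φ := by
  have hfan : blowupFan A α [] = fun _ => {c | c ∈ ruledFan} := by
    funext x
    ext c
    simp [blowupFan]
  obtain ⟨e, hes, het, heq, he⟩ := id hΦ
  rw [Set.preimage_univ] at hes
  have heΦ : ∀ p, e p = Φ p := fun p => (heq (by rw [hes]; trivial)).symm
  have hinj : Function.Injective Φ := fun p p' h =>
    e.injOn (by rw [hes]; trivial) (by rw [hes]; trivial) (by rw [heΦ, heΦ, h])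
  have hsurj : Function.Surjective Φ := fun P => ⟨e.symm P, by
    rw [← heΦ]
    exact e.right_inv (by rw [het]; trivial)⟩
  have hcont : Continuous Φ := by
    rw [← funext heΦ]
    have := e.continuousOn
    rwa [hes, continuousOn_univ] at this
  refine ⟨T2Space.of_injective_continuous hinj hcont, ?_, ?_, fun p _ => hΦ.locMatch trivial (hself _)⟩
  · rw [hfan]
    exact fun _ _ => isFan_ruledFan.isCone
  · rw [hfan]
    refine ⟨fun p hp p' hp' h => hinj (hg.inj hp hp' h),
      fun p _ => ⟨Φ p, hΦ.locMatch trivial (hself _)⟩, fun P _ => ?_, fun p hp => ?_,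
      fun x hx c hc y hy => ?_⟩
    · obtain ⟨p, rfl⟩ := hsurj P
      exact ⟨p, hΦ.locMatch trivial (hself _)⟩
    · obtain ⟨c, hc, y, hy, h⟩ := hg.left (Φ p) hp
      exact ⟨c, hc, y, hy, hΦ.locMatch trivial h⟩
    · obtain ⟨P, h⟩ := hg.right x hx c hc y hy
      obtain ⟨p, rfl⟩ := hsurj P
      exact ⟨p, hΦ.locMatch trivial h⟩

lemma IsBlowupModel.exists_isCorner (hR : ∀ x ∈ 𝒜, IsRef x (ρ x) (R x)) (hA : ∀ j, A j ∈ 𝒜)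
    (hAi : Function.Injective A)
    (hB : ∀ j, LocMatch g (toric (R (A j)) ((1, 0), (0, -1))) (B j) 0)
    {J : List (Fin s)} {j : Fin s} (hj : j ∉ J) {Z : Type u} [TopologicalSpace Z] [HolSpace Z]
    {Φ : Z → M} (h : IsBlowupModel g 𝒜 R A α J Φ) {B' : Z} (hB' : Φ B' = B j) :
    ∃ E, IsCorner (R (A j)) (g ∘ Φ) {p | (g (Φ p)).1 = A j} E ((1, 0), (0, -1)) B' := by
  have hc : IsCone ((1, 0), (0, -1)) := isFan_ruledFan.isCone _ (by simp [ruledFan])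
  have hgB : g (B j) = (A j, 0) := (hB j).fst_eq (hR _ (hA j)) hc.mon_zero
  have h1 := h.off B' (fun j' hj' h' => hj (by
    rw [hB', hgB] at h'
    rwa [← hAi h']))
  rw [hB'] at h1
  exact (h1.trans (hB j)).isCorner (hR _ (hA j))

lemma IsBlowupModel.cons (hR : ∀ x ∈ 𝒜, IsRef x (ρ x) (R x)) (hA : ∀ j, A j ∈ 𝒜)
    (hAi : Function.Injective A)
    (hB : ∀ j, LocMatch g (toric (R (A j)) ((1, 0), (0, -1))) (B j) 0)
    {J : List (Fin s)} {j : Fin s} (hj : j ∉ J) {Y Z : Type u} [TopologicalSpace Z] [HolSpace Z]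
    [TopologicalSpace Y] [HolSpace Y] {Φ : Z → M} (h : IsBlowupModel g 𝒜 R A α J Φ) {B' : Z}
    (hB' : Φ B' = B j) {b : Y → Z}
    (hb : IsWeightedBlowupAt {p | (g (Φ p)).1 = A j} B' (α j) b) :
    IsBlowupModel g 𝒜 R A α (j :: J) (Φ ∘ b) := by
  have := h.t2
  obtain ⟨E, hE⟩ := h.exists_isCorner hR hA hAi hB hj hB'
  obtain ⟨h1, h2⟩ := blowupFan_cons_self hAi α hj
  obtain ⟨h3, h4, h5, h6⟩ := hb.realizes hR (hA j) h.isCone h.realizes h2 hE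
  refine ⟨h3, fun x hx => ?_, h5 _ h1 fun x hx => blowupFan_cons_of_ne α hx, fun p hp => ?_⟩
  · rcases eq_or_ne x (A j) with rfl | hne
    · rw [h1]
      exact h4
    · rw [blowupFan_cons_of_ne α hne]
      exact h.isCone x hx
  · simp only [List.mem_cons, forall_eq_or_imp] at hp
    obtain ⟨e, he, hpe, heb⟩ := h6 p fun h => hp.1 h.symm
    refine LocMatch.precomp he hpe (fun p' hp' => ?_) (f := g ∘ Φ) ?_
    · rw [heb p' hp']
      rfl
    · rw [heb p hpe]
      exact h.off (b p) hp.2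

/-- All iterated blow-ups have the same toric charts. -/
lemma IsIteratedBlowup.isBlowupModel [T2Space M]
    (hg : Realizes g 𝒜 R g (fun _ => {c | c ∈ ruledFan})) (hself : ∀ P, LocMatch g g P P)
    (hR : ∀ x ∈ 𝒜, IsRef x (ρ x) (R x)) (hA : ∀ j, A j ∈ 𝒜) (hAi : Function.Injective A)
    (hB : ∀ j, LocMatch g (toric (R (A j)) ((1, 0), (0, -1))) (B j) 0) (J : List (Fin s))
    (hJ : J.Nodup) {Y : Type u} [TopologicalSpace Y] [HolSpace Y] {Φ : Y → M}
    (h : IsIteratedBlowup (J.map fun j => ({P | (g P).1 = A j}, B j, α j)) Y Φ) :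
    IsBlowupModel g 𝒜 R A α J Φ := by
  induction J generalizing Y with
  | nil =>
    cases h with
    | nil _ _ h => exact isBlowupModel_nil hg hself h
  | cons j J ih =>
    rw [List.nodup_cons] at hJ
    cases h with
    | cons Z _ F _ _ _ Φ B' b h hB' hb => exact (ih hJ.2 h).cons hR hA hAi hB hJ.1 hB' hb

lemma exists_isIteratedBlowup [T2Space M]
    (hg : Realizes g 𝒜 R g (fun _ => {c | c ∈ ruledFan})) (hself : ∀ P, LocMatch g g P P)
    (hR : ∀ x ∈ 𝒜, IsRef x (ρ x) (R x)) (hA : ∀ j, A j ∈ 𝒜) (hAi : Function.Injective A)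
    (hB : ∀ j, LocMatch g (toric (R (A j)) ((1, 0), (0, -1))) (B j) 0) {p q : Fin s → ℕ}
    (hp : ∀ j, 0 < p j ∧ p j < q j) (hpq : ∀ j, (p j).Coprime (q j)) (hα : ∀ j, α j = p j / q j)
    (J : List (Fin s)) (hJ : J.Nodup) :
    ∃ (Y : Type u) (_ : TopologicalSpace Y) (_ : HolSpace Y) (Φ : Y → M),
      IsIteratedBlowup (J.map fun j => ({P | (g P).1 = A j}, B j, α j)) Y Φ := by
  induction J with
  | nil =>
    refine ⟨M, inferInstance, inferInstance, id, IsIteratedBlowup.nil M id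
      ⟨OpenPartialHomeomorph.refl M, by simp, by simp, fun _ _ => rfl, isBihol_refl⟩⟩
  | cons j J ih =>
    rw [List.nodup_cons] at hJ
    obtain ⟨Z, _, _, Φ, hΦ⟩ := ih hJ.2
    have hm := hΦ.isBlowupModel hg hself hR hA hAi hB J hJ.2
    have := hm.t2
    have hc : IsCone ((1, 0), (0, -1)) := isFan_ruledFan.isCone _ (by simp [ruledFan])
    obtain ⟨h1, h2⟩ := blowupFan_cons_self hAi α hJ.1
    obtain ⟨B', hB'⟩ := hm.realizes.right (A j) (hA j) ((1, 0), (0, -1))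
      (by rw [h2]; simp [ruledFan]) 0 hc.mon_zero
    have hgB := hB'.fst_eq (hR _ (hA j)) hc.mon_zero
    have hΦB : Φ B' = B j := by
      have h3 := hm.off B' (fun j' hj' h' => hJ.1 (by
        have h4 := congrArg Prod.fst hgB
        rw [Function.comp] at h4
        rw [h4] at h'
        rwa [← hAi h']))
      exact h3.unique hg.inj (hB'.trans (hB j).symm)
    obtain ⟨E, hE⟩ := hm.exists_isCorner hR hA hAi hB hJ.1 hΦB
    obtain ⟨Y, i1, i2, b, hb⟩ := exists_isWeightedBlowupAt hR (hA j) hm.isCone hm.realizes h2 hE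
      (hp j).1 (hp j).2 (hpq j)
    refine ⟨Y, i1, i2, Φ ∘ b, IsIteratedBlowup.cons Z Y _ _ _ _ Φ B' b hΦ hΦB ?_⟩
    rw [hα j]
    exact hb

end Iterated

/-! ### The toric charts of Hirzebruch-Jung strings -/

section HJCharts

lemma exists_isHJExpansion {p q : ℕ} (h : p < q) : ∃ e, IsHJExpansion e (p / q) := by
  induction p using Nat.strong_induction_on generalizing q with
  | _ p ih =>
    rcases Nat.eq_zero_or_pos p with rfl | hp
    · exact ⟨[], by simp [IsHJExpansion, hjFrac]⟩
    -- `p / q = 1 / (x - p' / p)`, where `x` is the least integer above `q / p`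
    have h1 : q + (p - 1) = p * ((q + (p - 1)) / p) + (q + (p - 1)) % p := (Nat.div_add_mod _ _).symm
    have h2 : (q + (p - 1)) % p < p := Nat.mod_lt _ hp
    set x := (q + (p - 1)) / p
    set p' := p - 1 - (q + (p - 1)) % p
    have h3 : q + p' = p * x := by omega
    have h4 : 2 ≤ x := by
      by_contra hx
      have : p * x ≤ p * 1 := Nat.mul_le_mul_left _ (by omega)
      omega
    have h5 : p' < p := by omega
    obtain ⟨e, he, hf⟩ := ih p' h5 h5
    refine ⟨(x : ℤ) :: e, ?_, ?_⟩
    · intro y hy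
      rcases List.mem_cons.1 hy with rfl | hy
      · exact_mod_cast h4
      · exact he y hy
    · have hp0 : (p : ℚ) ≠ 0 := by exact_mod_cast hp.ne'
      have hq0 : (q : ℚ) ≠ 0 := by exact_mod_cast (show q ≠ 0 by omega)
      have h6 : (q : ℚ) = p * x - p' := by
        have : (q : ℚ) + p' = p * x := by exact_mod_cast h3
        linarith
      rw [hjFrac, hf, Int.cast_natCast, show (x : ℚ) - p' / p = q / p by rw [h6]; field_simp,
        one_div_div]

lemma hjSeq_mono {e : List ℤ} (he : ∀ x ∈ e, 2 ≤ x) {a b : ℤ} (ha : 0 ≤ a) (hab : a ≤ b) {i : ℕ}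
    (hi : i ≤ e.length) : 0 ≤ hjSeq e a b i ∧ hjSeq e a b i ≤ hjSeq e a b (i + 1) := by
  induction i with
  | zero => exact ⟨ha, hab⟩
  | succ i ih =>
    obtain ⟨h1, h2⟩ := ih (by omega)
    have h3 : 2 ≤ e.getD i 0 := by
      rw [List.getD_eq_getElem _ _ (by omega)]
      exact he _ (List.getElem_mem _)
    refine ⟨by omega, ?_⟩
    rw [hjSeq_add_two]
    nlinarith

lemma hjSeq_zero_one_nonneg {e : List ℤ} (he : ∀ x ∈ e, 2 ≤ x) {i : ℕ} (hi : i ≤ e.length + 1) :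
    0 ≤ hjSeq e 0 1 i := by
  rcases i with _ | i
  · exact le_rfl
  · have := hjSeq_mono he le_rfl zero_le_one (i := i) (by omega)
    omega

lemma hjSeq_zero_one_pos {e : List ℤ} (he : ∀ x ∈ e, 2 ≤ x) {i : ℕ} (hi : i ≤ e.length) :
    0 < hjSeq e 0 1 (i + 1) := by
  induction i with
  | zero => exact one_pos
  | succ i ih => exact (ih (by omega)).trans_le (hjSeq_mono he le_rfl zero_le_one hi).2

lemma hjSeq_one_one_pos {e : List ℤ} (he : ∀ x ∈ e, 2 ≤ x) {i : ℕ} (hi : i ≤ e.length + 1) :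
    0 < hjSeq e 1 1 i := by
  induction i with
  | zero => exact one_pos
  | succ i ih =>
    exact (ih (by omega)).trans_le (hjSeq_mono he zero_le_one le_rfl (i := i) (by omega)).2

lemma hjSeq_one_one (e : List ℤ) (i : ℕ) : hjSeq e 1 1 i = hjSeq e 1 0 i + hjSeq e 0 1 i := by
  have := hjSeq_linear e 1 0 0 1 1 1 i
  simpa using this

lemma hjSeq_q_p (e : List ℤ) (p q : ℤ) (i : ℕ) :
    hjSeq e q p i = q * hjSeq e 1 0 i + p * hjSeq e 0 1 i := by
  have := hjSeq_linear e 1 0 0 1 q p i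
  simpa using this

lemma hjSeq_q_p_last {e : List ℤ} {p q : ℕ} (hq : 0 < q) (hpq : p.Coprime q)
    (he : IsHJExpansion e (p / q)) :
    hjSeq e q p (e.length + 1) = 0 ∧ hjSeq e q p e.length = 1 := by
  obtain ⟨h1, h2⟩ := hjSeq_last_eq hq hpq he
  have h3 : hjSeq e q p (e.length + 1) = 0 := by
    rw [hjSeq_q_p, h1, h2]
    ring
  refine ⟨h3, ?_⟩
  have h4 := hjSeq_det e 0 1 q p e.length
  rw [h3, h1] at h4
  have h5 : (q : ℤ) * hjSeq e q p e.length = q * 1 := by linarith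
  exact mul_left_cancel₀ (by exact_mod_cast hq.ne') h5

lemma hjSeq_q_p_pos {e : List ℤ} {p q : ℕ} (hq : 0 < q) (hpq : p.Coprime q)
    (he : IsHJExpansion e (p / q)) {i : ℕ} (hi : i ≤ e.length) : 0 < hjSeq e q p i := by
  obtain ⟨h1, h2⟩ := hjSeq_q_p_last hq hpq he
  have key : ∀ j i, i + j = e.length → hjSeq e q p (i + 1) < hjSeq e q p i ∧ 0 < hjSeq e q p i := by
    intro j
    induction j with
    | zero =>
      rintro i rfl
      rw [h1, h2]
      exact ⟨one_pos, one_pos⟩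
    | succ j ih =>
      intro i hij
      obtain ⟨h3, h4⟩ := ih (i + 1) (by omega)
      rw [hjSeq_add_two] at h3
      have h5 : 2 ≤ e.getD i 0 := by
        rw [List.getD_eq_getElem _ _ (by omega)]
        exact he.1 _ (List.getElem_mem _)
      constructor <;> nlinarith
  exact (key (e.length - i) i (by omega)).2

/-- The cones of the resolution of the singular point on the zero section (`b = false`) or the
infinity section (`b = true`). -/
def sideCone (b : Bool) (e : List ℤ) (i : ℕ) : Cone :=
  if b then (inftyRay e (i + 1), inftyRay e i) else (zeroRay e i, zeroRay e (i + 1))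

/-- The cones at the infinity section run through their string in the opposite direction. -/
def flip (b : Bool) : OpenPartialHomeomorph (ℂ × ℂ) (ℂ × ℂ) :=
  if b then swapPH else OpenPartialHomeomorph.refl _

lemma flip_apply (b : Bool) (y : ℂ × ℂ) : flip b y = if b then y.swap else y := by
  cases b
  · rfl
  · exact swapPH_apply y

lemma flip_source (b : Bool) : (flip b).source = Set.univ := by
  cases b <;> rfl

lemma flip_flip (b : Bool) (y : ℂ × ℂ) : flip b (flip b y) = y := by
  cases b
  · rfl
  · simp [flip_apply]

lemma isBihol_flip (b : Bool) : IsBihol (flip b) := by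
  cases b
  · exact isBihol_refl
  · exact isBihol_swapPH

lemma isCone_sideCone (b : Bool) {e : List ℤ} (he : ∀ x ∈ e, 2 ≤ x) {i : ℕ} (hi : i ≤ e.length) :
    IsCone (sideCone b e i) := by
  have h1 := hjSeq_zero_one_nonneg he (i := i) (by omega)
  have h2 := hjSeq_zero_one_pos he hi
  cases b
  · exact ⟨h1, h2.le, by have := hjSeq_det e 0 1 1 0 i; simp [sideCone, zeroRay]; linarith⟩
  · exact ⟨h2.le, h1, by have := hjSeq_det e 0 1 1 1 i; simp [sideCone, inftyRay]; linarith⟩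

lemma mon_sideCone (b : Bool) (e : List ℤ) (i : ℕ) (y : ℂ × ℂ) :
    mon (sideCone b e i) (flip b y) = (y.1 ^ hjSeq e 0 1 i * y.2 ^ hjSeq e 0 1 (i + 1),
      if b then (y.1 ^ hjSeq e 1 1 i * y.2 ^ hjSeq e 1 1 (i + 1))⁻¹
      else y.1 ^ hjSeq e 1 0 i * y.2 ^ hjSeq e 1 0 (i + 1)) := by
  cases b
  · rfl
  · simp only [flip_apply, mon, sideCone, inftyRay, if_true, Prod.fst_swap, Prod.snd_swap, zpow_neg,
      mul_inv]
    rw [mul_comm, mul_comm (y.2 ^ _)⁻¹]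

/-- The Hirzebruch-Jung charts are toric. -/
lemma toric_sideCone {S : Type*} {x : S} {ρ : ℝ} {R : ℂ × ℂ → S × ℂ} (hR : IsRef x ρ R) {b : Bool}
    {e : List ℤ} {p q : ℕ} (hq : 0 < q) (hpq : p ≤ q) {i : ℕ} {y v : ℂ × ℂ}
    (h : HJOver e (if b then q - p else p) q i y v) :
    toric R (sideCone b e i) (flip b y) =
      R (v.1 ^ q, (if b then v.2⁻¹ else v.2) * v.1 ^ (-(p : ℤ))) := by
  obtain ⟨h1, -, h3⟩ := h
  rw [toric, mon_sideCone, ← h1]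
  rcases eq_or_ne v.1 0 with h0 | h0
  · rw [h0, zero_pow hq.ne', hR.zero, hR.zero]
  have h4 : (y.1 ^ hjSeq e 0 1 i * y.2 ^ hjSeq e 0 1 (i + 1)) ≠ 0 := by
    rw [← h1]
    exact pow_ne_zero _ h0
  congr 2
  cases b
  · simp only [Bool.false_eq_true, if_false] at h3 ⊢
    have h5 : ∀ z : ℂ, ∀ j, z ^ hjSeq e 0 1 j ≠ 0 →
        z ^ hjSeq e 1 1 j = z ^ hjSeq e 1 0 j * z ^ hjSeq e 0 1 j := by
      intro z j hz
      rw [hjSeq_one_one]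
      rcases eq_or_ne z 0 with rfl | hz0
      · have : hjSeq e 0 1 j = 0 := by
          by_contra h
          exact hz (zero_zpow _ h)
        rw [this]
        simp
      · exact zpow_add₀ hz0 _ _
    rw [h5 _ _ (left_ne_zero_of_mul h4), h5 _ _ (right_ne_zero_of_mul h4), mul_mul_mul_comm,
      ← h1] at h3
    have h6 : v.1 ^ q ≠ 0 := pow_ne_zero _ h0
    have h7 : v.1 ^ q = v.1 ^ (q - p) * v.1 ^ p := by rw [← pow_add, Nat.sub_add_cancel hpq]
    rw [zpow_neg, zpow_natCast]
    have h8 : v.1 ^ (q - p) ≠ 0 := pow_ne_zero _ h0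
    have h9 : v.1 ^ p ≠ 0 := pow_ne_zero _ h0
    rw [h7] at h3
    field_simp
    refine mul_left_cancel₀ h8 ?_
    linear_combination -h3
  · simp only [if_true, Nat.sub_sub_self hpq] at h3 ⊢
    rw [← h3, mul_inv, zpow_neg, zpow_natCast, mul_comm]

end HJCharts

section RefChange

variable {S : Type*}

/-- The generic coordinates `R` and `R'` near a fibre differ by a change of the coordinate of the
base and of the frame. -/
def RefChange (R R' : ℂ × ℂ → S × ℂ) : Prop :=
  ∃ α β : ℂ → ℂ, AnalyticAt ℂ α 0 ∧ AnalyticAt ℂ β 0 ∧ α 0 ≠ 0 ∧ β 0 ≠ 0 ∧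
    ∀ᶠ z in 𝓝 (0 : ℂ), ∀ w, R' (z * α z, w * β z) = R (z, w)

variable {x : S} {ρ ρ' : ℝ} {R R' : ℂ × ℂ → S × ℂ} {c : Cone}

/-- A change of the generic coordinates lifts to an analytic germ in each toric chart. -/
lemma RefChange.exists_germ (h : RefChange R R') (hc : IsCone c) {y : ℂ × ℂ}
    (hy : (mon c y).1 = 0) : ∃ F : ℂ × ℂ → ℂ × ℂ, AnalyticAt ℂ F y ∧ (mon c (F y)).1 = 0 ∧
      ∀ᶠ y' in 𝓝 y, toric R' c (F y') = toric R c y' := by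
  obtain ⟨α, β, hα, hβ, hα0, hβ0, he⟩ := h
  have hdet := hc.det
  have hZ : AnalyticAt ℂ (fun y : ℂ × ℂ => (mon c y).1) y := by
    obtain ⟨a, ha⟩ := Int.eq_ofNat_of_zero_le hc.fst_nonneg
    obtain ⟨b, hb⟩ := Int.eq_ofNat_of_zero_le hc.snd_nonneg
    simp only [mon, ha, hb, zpow_natCast]
    exact (analyticAt_fst.pow _).mul (analyticAt_snd.pow _)
  have hmul : ∀ (i j : ℤ), AnalyticAt ℂ (fun z => α z ^ i * β z ^ j) 0 := fun i j =>
    (hα.zpow hα0).mul (hβ.zpow hβ0)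
  have hcomp : ∀ (i j : ℤ), AnalyticAt ℂ (fun y => α (mon c y).1 ^ i * β (mon c y).1 ^ j) y :=
    fun i j => AnalyticAt.comp (g := fun z => α z ^ i * β z ^ j) (f := fun y : ℂ × ℂ => (mon c y).1)
      (by rw [hy]; exact hmul i j) hZ
  have hZc : ContinuousAt (fun y : ℂ × ℂ => (mon c y).1) y := hZ.continuousAt
  have hmon : ∀ y : ℂ × ℂ, α (mon c y).1 ≠ 0 → β (mon c y).1 ≠ 0 →
      mon c (α (mon c y).1 ^ (-c.2.2) * β (mon c y).1 ^ c.2.1 * y.1,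
        α (mon c y).1 ^ c.1.2 * β (mon c y).1 ^ (-c.1.1) * y.2) =
      ((mon c y).1 * α (mon c y).1, (mon c y).2 * β (mon c y).1) := by
    intro y h1 h2
    generalize α (mon c y).1 = A at h1 ⊢
    generalize β (mon c y).1 = B at h2 ⊢
    have key : ∀ i j : ℤ, (A ^ (-c.2.2) * B ^ c.2.1 * y.1) ^ i * (A ^ c.1.2 * B ^ (-c.1.1) * y.2) ^ j =
        A ^ (-c.2.2 * i + c.1.2 * j) * B ^ (c.2.1 * i + -c.1.1 * j) * (y.1 ^ i * y.2 ^ j) := by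
      intro i j
      rw [mul_zpow, mul_zpow, mul_zpow, mul_zpow, ← zpow_mul, ← zpow_mul, ← zpow_mul, ← zpow_mul,
        zpow_add₀ h1, zpow_add₀ h2]
      ring
    simp only [mon, key]
    rw [show -c.2.2 * c.1.1 + c.1.2 * c.2.1 = 1 by linear_combination -hdet,
      show c.2.1 * c.1.1 + -c.1.1 * c.2.1 = 0 by ring,
      show -c.2.2 * c.1.2 + c.1.2 * c.2.2 = 0 by ring,
      show c.2.1 * c.1.2 + -c.1.1 * c.2.2 = 1 by linear_combination -hdet]
    simp [mul_comm]
  refine ⟨fun y => (α (mon c y).1 ^ (-c.2.2) * β (mon c y).1 ^ c.2.1 * y.1,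
    α (mon c y).1 ^ c.1.2 * β (mon c y).1 ^ (-c.1.1) * y.2),
    ((hcomp _ _).mul analyticAt_fst).prod ((hcomp _ _).mul analyticAt_snd), ?_, ?_⟩
  · rw [hmon y (by rwa [hy]) (by rwa [hy]), hy, zero_mul]
  · have h0 : Filter.Tendsto (fun y : ℂ × ℂ => (mon c y).1) (𝓝 y) (𝓝 0) := by
      have := hZc.tendsto
      rwa [hy] at this
    filter_upwards [h0.eventually he, h0.eventually (hα.continuousAt.eventually_ne hα0),
      h0.eventually (hβ.continuousAt.eventually_ne hβ0)] with y' h1 h2 h3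
    rw [toric, hmon y' h2 h3, h1]
    rfl

lemma RefChange.exists_locMatch (hR : IsRef x ρ R) (hR' : IsRef x ρ' R') (h : RefChange R R')
    (h' : RefChange R' R) (hc : IsCone c) {y : ℂ × ℂ} (hy : (mon c y).1 = 0) :
    ∃ y', (mon c y').1 = 0 ∧ LocMatch (toric R c) (toric R' c) y y' := by
  obtain ⟨F, hF, hy', hFR⟩ := h.exists_germ hc hy
  obtain ⟨G, hG, -, hGR⟩ := h'.exists_germ hc hy'
  exact ⟨F y, hy', LocMatch.of_germs (hR.genInj_toric hc) (hR'.genInj_toric hc) hF hG hFR hGR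
    (hR.eventually_mem_closure hc hy) (hR'.eventually_mem_closure hc hy')⟩

end RefChange

/-! ### The fibres over the orbifold points -/

section OrbFibre

variable {S : Type u}

/-- The numerical data: `m` is the order of the orbifold points, which are the points of `𝒜`, the
weights are `p / m`, and `k` is the divisor of the ruled surface without orbifold points. -/
structure OrbWeights (𝒜 : Set S) (m : S → ℕ) (k : S → ℤ) (p : S → ℕ) (r : ℕ) : Prop where
  off : ∀ x ∉ 𝒜, m x = 1
  pos : ∀ x ∈ 𝒜, 0 < p x
  lt : ∀ x ∈ 𝒜, p x < m x
  coprime : ∀ x ∈ 𝒜, (m x).Coprime r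
  mul : ∀ x ∈ 𝒜, (m x : ℤ) * k x = r * m x - p x - r

variable {𝒜 : Set S} {m : S → ℕ} {k : S → ℤ} {p : S → ℕ} {r : ℕ}

namespace OrbWeights

lemma order_pos (h : OrbWeights 𝒜 m k p r) (x : S) : 0 < m x := by
  by_cases hx : x ∈ 𝒜
  · exact (Nat.zero_le _).trans_lt (h.lt x hx)
  · rw [h.off x hx]
    exact one_pos

lemma off_zero (h : OrbWeights 𝒜 m k p r) : ∀ x ∉ 𝒜, m x = 1 ∧ (0 : S → ℤ) x = 0 :=
  fun x hx => ⟨h.off x hx, rfl⟩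

lemma order_ne_one (h : OrbWeights 𝒜 m k p r) {x : S} (hx : x ∈ 𝒜) : m x ≠ 1 := by
  have := h.pos x hx
  have := h.lt x hx
  omega

lemma coprime_weight (h : OrbWeights 𝒜 m k p r) {x : S} (hx : x ∈ 𝒜) : (p x).Coprime (m x) := by
  have h1 : IsCoprime (m x : ℤ) (r : ℤ) := Nat.isCoprime_iff_coprime.2 (h.coprime x hx)
  refine Nat.isCoprime_iff_coprime.1 ?_
  have h2 : (p x : ℤ) = -r + m x * (r - k x) := by linear_combination h.mul x hx
  rw [h2]
  exact IsCoprime.add_mul_left_left h1.symm.neg_left _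

end OrbWeights

/-- The weight `p` at the zero section, and `m - p` at the infinity section. -/
def sideWeight (m p : ℕ) (b : Bool) : ℕ := if b then m - p else p

lemma OrbWeights.sideWeight_pos (h : OrbWeights 𝒜 m k p r) {x : S} (hx : x ∈ 𝒜) (b : Bool) :
    0 < sideWeight (m x) (p x) b := by
  have := h.pos x hx
  have := h.lt x hx
  cases b <;> simp [sideWeight] <;> omega

lemma OrbWeights.sideWeight_lt (h : OrbWeights 𝒜 m k p r) {x : S} (hx : x ∈ 𝒜) (b : Bool) :
    sideWeight (m x) (p x) b < m x := by
  have := h.pos x hx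
  have := h.lt x hx
  cases b <;> simp [sideWeight] <;> omega

lemma OrbWeights.sideWeight_coprime (h : OrbWeights 𝒜 m k p r) {x : S} (hx : x ∈ 𝒜) (b : Bool) :
    (sideWeight (m x) (p x) b).Coprime (m x) := by
  have h1 := h.coprime_weight hx
  cases b
  · exact h1
  · exact (Nat.coprime_self_sub_left (h.lt x hx).le).2 h1

/-- The weights determine the action of the isotropy group on the fibre. -/
lemma OrbWeights.zpow_fibreWeight (h : OrbWeights 𝒜 m k p r) {x : S} (hx : x ∈ 𝒜) (b : Bool) {ζ : ℂ}
    (hζ : ζ ^ m x = 1) :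
    ζ ^ RuledSurface.fibreWeight r 0 b = ζ ^ sideWeight (m x) (p x) b := by
  have h0 : ζ ≠ 0 := fun h0 => by simp [h0, (h.order_pos x).ne'] at hζ
  have h1 : ∀ j : ℤ, ζ ^ ((m x : ℤ) * j) = 1 := fun j => by
    rw [zpow_mul, zpow_natCast, hζ, one_zpow]
  rw [← zpow_natCast ζ (sideWeight _ _ _)]
  have h2 := h.mul x hx
  cases b
  · rw [show ((sideWeight (m x) (p x) false : ℕ) : ℤ) =
      RuledSurface.fibreWeight r 0 false + m x * (r - k x) by
        simp [sideWeight, RuledSurface.fibreWeight]; linarith, zpow_add₀ h0, h1, mul_one]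
  · rw [show ((sideWeight (m x) (p x) true : ℕ) : ℤ) =
      RuledSurface.fibreWeight r 0 true + m x * (1 - r + k x) by
        simp [sideWeight, RuledSurface.fibreWeight, Nat.cast_sub (h.lt x hx).le]; linarith,
      zpow_add₀ h0, h1, mul_one]

/-- A rotation which acts trivially on the fibre is trivial. -/
lemma OrbWeights.eq_one (h : OrbWeights 𝒜 m k p r) {x : S} (hx : x ∈ 𝒜) {ζ : ℂ}
    (hζ : ζ ^ m x = 1) (hζ' : ζ ^ r = 1) : ζ = 1 := by
  have h1 := orderOf_dvd_of_pow_eq_one hζ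
  have h2 := orderOf_dvd_of_pow_eq_one hζ'
  have h3 := Nat.dvd_gcd h1 h2
  rw [(h.coprime x hx : Nat.gcd _ _ = 1), Nat.dvd_one, orderOf_eq_one_iff] at h3
  exact h3

lemma IsRef.scale {x : S} {ρ : ℝ} {R : ℂ × ℂ → S × ℂ} (hR : IsRef x ρ R) {κ : ℂ} (hκ : κ ≠ 0) :
    IsRef x ρ (fun y => R (y.1, κ * y.2)) where
  pos := hR.pos
  zero w := hR.zero _
  fst_eq z w := hR.fst_eq z _
  generic z w := by rw [hR.generic]; simp [hκ]
  inj y hy y' hy' h := by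
    have := hR.inj hy hy' h
    rw [Prod.mk.injEq] at this
    exact Prod.ext this.1 (mul_left_cancel₀ hκ this.2)

lemma eventually_eq_one_of_pow {N : ℕ} (hN : 0 < N) {α : ℂ → ℂ} {z : ℂ} (hα : ContinuousAt α z)
    (h1 : α z = 1) : ∀ᶠ w in 𝓝 z, α w ^ N = 1 → α w = 1 := by
  have hfin : ({ζ : ℂ | ζ ^ N = 1} \ {1}).Finite := by
    refine Set.Finite.subset (Polynomial.nthRootsFinset N (1 : ℂ)).finite_toSet fun ζ hζ => ?_
    simpa [Polynomial.mem_nthRootsFinset hN] using hζ.1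
  have hmem : α z ∈ ({ζ : ℂ | ζ ^ N = 1} \ {1})ᶜ := fun h => h.2 h1
  filter_upwards [hα.eventually (hfin.isClosed.isOpen_compl.mem_nhds hmem)] with w hw h2
  by_contra h3
  exact hw ⟨h2, h3⟩

variable [TopologicalSpace S] [ChartedSpace ℂ S]

namespace RuledSurface

lemma false_ne_true_of_affineChart_zero {φ φ' : OrbChart S m 0} :
    affineChart r φ false 0 ≠ affineChart r φ' true 0 := by
  rw [affineChart_false, affineChart_true]
  intro h
  obtain ⟨h, a, lam, -, -, hl, hu, -⟩ :=
    (pt_eq_pt φ.zero_mem (one_prod_ne_zero _) φ'.zero_mem (prod_one_ne_zero _)).1 h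
  simp only [mul_one] at hu
  exact hl hu.symm

lemma eq_of_affineChart_zero {φ φ' : OrbChart S m 0} {b b' : Bool}
    (h : affineChart r φ b 0 = affineChart r φ' b' 0) : b = b' := by
  cases b <;> cases b'
  · rfl
  · exact absurd h false_ne_true_of_affineChart_zero
  · exact absurd h.symm false_ne_true_of_affineChart_zero
  · rfl

lemma affineChart_ne_zero (hw : OrbWeights 𝒜 m k p r) {φ : OrbChart S m 0} {b b' : Bool} {t : ℂ}
    (ht : t ≠ 0) : affineChart r φ b (0, t) ≠ affineChart r φ b' 0 := by
  intro h
  cases b <;> cases b'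
  · obtain ⟨ζ, hζ, h⟩ := (affineChart_eq_iff (hw.order_pos _) φ.zero_mem φ.zero_mem).1 h.symm
    exact ht (by simpa using congrArg Prod.snd h)
  · have := norm_mul_norm_of_affineChart_eq (hw.order_pos _) φ.zero_mem φ.zero_mem h
    simp at this
  · have := norm_mul_norm_of_affineChart_eq (hw.order_pos _) φ.zero_mem φ.zero_mem h.symm
    simp at this
  · obtain ⟨ζ, hζ, h⟩ := (affineChart_eq_iff (hw.order_pos _) φ.zero_mem φ.zero_mem).1 h.symm
    exact ht (by simpa using congrArg Prod.snd h)

lemma affineChart_zero_mem_singularSet (hw : OrbWeights 𝒜 m k p r) (φ : OrbChart S m 0)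
    (hφ : φ.toFun 0 ∈ 𝒜) (b : Bool) : affineChart r φ b 0 ∈ singularSet (m := m) (d := 0) r := by
  have hpos := hw.order_pos (φ.toFun 0)
  have hprim := Complex.isPrimitiveRoot_exp (m (φ.toFun 0)) hpos.ne'
  set ζ := Complex.exp (2 * Real.pi * Complex.I / m (φ.toFun 0))
  have hζ := hprim.pow_eq_one
  have hζ1 : ζ ≠ 1 := fun h => hw.order_ne_one hφ (by
    rw [h] at hprim
    exact hprim.unique IsPrimitiveRoot.one)
  have hζ0 : ζ ≠ 0 := hprim.ne_zero hpos.ne'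
  have hnid : ¬ (fun w : ℂ => ζ * w) =ᶠ[𝓝 0] id := by
    intro h
    have := h.deriv_eq
    simp only [deriv_const_mul_id', deriv_id] at this
    exact hζ1 (by simpa using this)
  have ht := isTransition_mul (r := r) φ hpos hζ φ.zero_mem
  cases b
  · exact ⟨φ, 0, 1, 0, _, _, 1, φ.zero_mem, one_prod_ne_zero _, affineChart_false .., ht, by simp,
      one_ne_zero, by simp, by simp, hnid⟩
  · exact ⟨φ, 0, 0, 1, _, _, _, φ.zero_mem, prod_one_ne_zero _, affineChart_true .., ht, by simp,
      zpow_ne_zero _ hζ0, by simp, rfl, hnid⟩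

variable [IsManifold 𝓘(ℂ) ω S]

/-- The singular points are the points of the zero and the infinity section over `𝒜`. -/
lemma exists_eq_affineChart_zero (hw : OrbWeights 𝒜 m k p r) {P : RuledSurface m 0 r}
    (hP : P ∈ singularSet (m := m) (d := 0) r) : proj r P ∈ 𝒜 ∧
      ∀ φ : OrbChart S m 0, φ.toFun 0 = proj r P → ∃ b, P = affineChart r φ b 0 := by
  obtain ⟨φ, z, u, v, h, a, lam, hz, huv, rfl, ht, hhz, hl, hu, hv, hnid⟩ := hP
  rw [proj_pt hz huv]
  have hA : φ.toFun z ∈ 𝒜 := by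
    by_contra hA
    obtain ⟨U, hU, hinj⟩ := φ.exists_injOn hz (hw.off _ hA) (hw.order_pos _)
    have h1 : ∀ᶠ w in 𝓝 z, h w ∈ U := ht.1.continuousAt.eventually (by rw [hhz]; exact hU)
    refine hnid ?_
    filter_upwards [h1, hU, ht.2.2.2.1] with w h2 h3 h4
    exact hinj h2 h3 h4
  have hz0 : z = 0 := by
    by_contra h0
    exact hw.order_ne_one hA (φ.regular z hz h0).1
  subst hz0
  refine ⟨hA, fun φ' hφ' => ?_⟩
  have huv0 : u = 0 ∨ v = 0 := by
    by_contra! h0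
    have hl1 : lam = 1 := mul_right_cancel₀ h0.1 (by rw [← hu, one_mul])
    have ha1 : a = 1 := mul_right_cancel₀ h0.2 (by rw [hv, hl1])
    have hpos := hw.order_pos (φ.toFun 0)
    obtain ⟨ζ, hζ, -, hd, ha⟩ := ht.exists_root hpos hz
    rw [ha1, Pi.zero_apply, sub_zero, zpow_natCast] at ha
    rw [hw.eq_one hA hζ ha.symm] at hd
    obtain ⟨α, hα, hα0, hαe⟩ := exists_eq_mul_of_map_zero ht.1 hhz
    refine hnid ?_
    filter_upwards [hαe, ht.2.2.2.1, eventually_eq_one_of_pow hpos hα.continuousAt (hα0.trans hd),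
      ht.1.continuousAt.eventually (Metric.isOpen_ball.mem_nhds ht.2.2.1),
      Metric.isOpen_ball.mem_nhds hz] with w h1 h2 h3 h4 h5
    rcases eq_or_ne w 0 with rfl | hw0
    · exact hhz
    · have h6 := (φ.fibres _ h4 _ h5).1 h2
      rw [h1, mul_pow] at h6
      have h7 := h3 (mul_left_cancel₀ (pow_ne_zero _ hw0) (by rw [h6, mul_one]))
      rw [h1, h7, mul_one]
      rfl
  obtain ⟨κ, hκ, hκ0, hκd, hκe⟩ := φ.exists_transition hw.order_pos φ' hz φ'.zero_mem hφ' (Or.inl rfl)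
  obtain ⟨c, -, hc⟩ := exists_isTransition (r := r) hz hκ hκd (by rw [hκ0]; exact φ'.zero_mem) hκe
  have hc0 := hc.self_of_nhds.1
  rw [pt_of_isTransition hz huv hc.self_of_nhds.2, hκ0]
  rcases huv0 with rfl | rfl
  · have hv0 : v ≠ 0 := fun h => huv (by rw [h]; rfl)
    exact ⟨true, by rw [pt_eq_affineChart_true φ'.zero_mem (div_ne_zero hv0 hc0), zero_div]; rfl⟩
  · have hu0 : u ≠ 0 := fun h => huv (by rw [h]; rfl)
    exact ⟨false, by rw [pt_eq_affineChart_false φ'.zero_mem hu0, zero_div, zero_div]; rfl⟩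

lemma affineChart_notMem_singularSet (hw : OrbWeights 𝒜 m k p r) {φ : OrbChart S m 0} {b : Bool}
    {t : ℂ} (ht : t ≠ 0) : affineChart r φ b (0, t) ∉ singularSet (m := m) (d := 0) r := by
  intro h
  obtain ⟨-, h1⟩ := exists_eq_affineChart_zero hw h
  obtain ⟨b', h2⟩ := h1 φ (by rw [proj_affineChart φ.zero_mem])
  exact affineChart_ne_zero hw ht h2

end RuledSurface

/-- The generic coordinates near a fibre, rescaled by a constant. -/
def scaledTau (φ : Disc S) (κ : ℂ) (k : ℤ) (r : ℕ) (𝒜 : Set S) (y : ℂ × ℂ) : S × ℂ :=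
  tau φ k r 𝒜 (y.1, κ * y.2)

lemma scaledTau_one (φ : Disc S) (k : ℤ) (r : ℕ) (𝒜 : Set S) :
    scaledTau φ 1 k r 𝒜 = tau φ k r 𝒜 := by
  funext y
  rw [scaledTau, one_mul]

/-- The type of the quotient singularity is determined by the chart. -/
lemma eq_of_isQuotientChart (hw : OrbWeights 𝒜 m k p r) {φ : OrbChart S m 0} (h0 : φ.toFun 0 ∈ 𝒜)
    {b : Bool} {ρ : ℝ} (hρ : 0 < ρ) (hρφ : ρ ≤ φ.radius) {p' q' : ℕ}
    (h : IsQuotientChart (RuledSurface.affineChart r φ b) ρ p' q') :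
    q' = m (φ.toFun 0) ∧ p' = sideWeight (m (φ.toFun 0)) (p (φ.toFun 0)) b := by
  obtain ⟨hp', hlt', hcop', hch⟩ := h
  set x := φ.toFun 0
  have hq := hw.order_pos x
  set ε : ℂ := ((ρ / 2 : ℝ) : ℂ) with hε
  have hεn : ‖ε‖ = ρ / 2 := by rw [hε, Complex.norm_real, Real.norm_of_nonneg (by positivity)]
  have hε0 : ε ≠ 0 := norm_ne_zero_iff.1 (by rw [hεn]; positivity)
  have hmem : ∀ ζ ξ : ℂ, ‖ζ‖ = 1 → ‖ξ‖ = 1 → (ζ * ε, ξ * ε) ∈ polydisc ρ := by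
    intro ζ ξ h1 h2
    simp only [polydisc, Set.mem_ofPred_eq, norm_mul, h1, h2, hεn, one_mul]
    constructor <;> linarith
  have hball : ∀ v ∈ polydisc ρ, v.1 ∈ Metric.ball (0 : ℂ) φ.radius := fun v hv =>
    mem_ball_zero_iff.2 (hv.1.trans_le hρφ)
  have hεm : (ε, ε) ∈ polydisc ρ := by simpa using hmem 1 1 (by simp) (by simp)
  have key : ∀ ζ : ℂ, ζ ^ m x = 1 → ζ ^ q' = 1 ∧ ζ ^ sideWeight (m x) (p x) b = ζ ^ p' := by
    intro ζ hζ
    have hn := norm_eq_one_of_pow hq.ne' hζ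
    have h1 := hmem ζ (ζ ^ sideWeight (m x) (p x) b) hn (by rw [norm_pow, hn, one_pow])
    obtain ⟨ξ, hξ, h2⟩ := (hch _ hεm _ h1).1 ((RuledSurface.affineChart_eq_iff hq (hball _ hεm)
      (hball _ h1)).2 ⟨ζ, hζ, by rw [Pi.zero_apply, hw.zpow_fibreWeight h0 b hζ]⟩)
    obtain ⟨h3, h4⟩ := Prod.mk.inj h2
    have h5 := mul_right_cancel₀ hε0 h3
    subst h5
    exact ⟨hξ, mul_right_cancel₀ hε0 h4⟩
  have key' : ∀ ζ : ℂ, ζ ^ q' = 1 → ζ ^ m x = 1 := by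
    intro ζ hζ
    have hn := norm_eq_one_of_pow (by omega) hζ
    have h1 := hmem ζ (ζ ^ p') hn (by rw [norm_pow, hn, one_pow])
    obtain ⟨ξ, hξ, h2⟩ := (RuledSurface.affineChart_eq_iff hq (hball _ hεm) (hball _ h1)).1
      ((hch _ hεm _ h1).2 ⟨ζ, hζ, rfl⟩)
    rw [mul_right_cancel₀ hε0 (Prod.mk.inj h2).1]
    exact hξ
  have hprim := Complex.isPrimitiveRoot_exp (m x) hq.ne'
  have hprim' := Complex.isPrimitiveRoot_exp q' (by omega)
  obtain ⟨h1, h2⟩ := key _ hprim.pow_eq_one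
  have h3 : q' = m x := Nat.dvd_antisymm (hprim'.dvd_of_pow_eq_one _ (key' _ hprim'.pow_eq_one))
    (hprim.dvd_of_pow_eq_one _ h1)
  exact ⟨h3, (hprim.pow_inj (hw.sideWeight_lt h0 b) (by omega) h2).symm⟩

lemma isQuotientChart_affineChart (hw : OrbWeights 𝒜 m k p r) {φ : OrbChart S m 0}
    (h0 : φ.toFun 0 ∈ 𝒜) {b : Bool} : IsQuotientChart (RuledSurface.affineChart r φ b) φ.radius
      (sideWeight (m (φ.toFun 0)) (p (φ.toFun 0)) b) (m (φ.toFun 0)) := by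
  refine ⟨hw.sideWeight_pos h0 b, hw.sideWeight_lt h0 b, hw.sideWeight_coprime h0 b,
    fun v hv v' hv' => ?_⟩
  rw [RuledSurface.affineChart_eq_iff (hw.order_pos _) (mem_ball_zero_iff.2 hv.1)
    (mem_ball_zero_iff.2 hv'.1)]
  refine exists_congr fun ζ => and_congr_right fun hζ => ?_
  rw [Pi.zero_apply, hw.zpow_fibreWeight h0 b hζ]

variable [IsManifold 𝓘(ℂ) ω S]

lemma isRef_scaledTau {φ : Disc S} {κ : ℂ} (hκ : κ ≠ 0) {k : ℤ} (hav : φ.Avoids 𝒜)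
    (h0 : φ.toFun 0 ∈ 𝒜) : IsRef (φ.toFun 0) φ.radius (scaledTau φ κ k r 𝒜) :=
  (isRef_tau hav h0).scale hκ

lemma refChange_scaledTau {φ φ' : Disc S} {κ κ' : ℂ} (hκ : κ ≠ 0) (hκ' : κ' ≠ 0) {k : ℤ}
    (h0 : φ.toFun 0 ∈ 𝒜) (h : φ'.toFun 0 = φ.toFun 0) :
    RefChange (scaledTau φ κ k r 𝒜) (scaledTau φ' κ' k r 𝒜) := by
  obtain ⟨f, hf, hf0, hfd, hfe⟩ := φ.exists_transition φ' φ.zero_mem φ'.zero_mem h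
  obtain ⟨α, hα, hα0, hαe⟩ := exists_eq_mul_of_map_zero hf hf0
  have hα1 : α 0 ≠ 0 := by rwa [hα0]
  have hfd' : AnalyticAt ℂ (deriv f) 0 := hf.deriv
  refine ⟨α, fun z => κ'⁻¹ * κ * (α z ^ k * (deriv f z ^ r)⁻¹), hα,
    analyticAt_const.mul ((hα.zpow hα1).mul ((hfd'.pow r).inv (pow_ne_zero _ hfd))), hα1,
    mul_ne_zero (mul_ne_zero (inv_ne_zero hκ') hκ)
      (mul_ne_zero (zpow_ne_zero _ hα1) (inv_ne_zero (pow_ne_zero _ hfd))), ?_⟩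
  have hball : ∀ᶠ z in 𝓝 (0 : ℂ), f z ∈ Metric.ball (0 : ℂ) φ'.radius :=
    hf.continuousAt.eventually (Metric.isOpen_ball.mem_nhds (by rw [hf0]; exact φ'.zero_mem))
  filter_upwards [hfe.eventually_nhds, hball, Metric.isOpen_ball.mem_nhds φ.zero_mem, hαe,
    hα.continuousAt.eventually_ne hα1, hfd'.continuousAt.eventually_ne hfd,
    hf.eventually_analyticAt] with z h1 h2 h3 h4 h5 h6 h7 w
  have h8 := h1.self_of_nhds
  rw [← h4, scaledTau, scaledTau, tau, tau]
  refine Prod.ext h8 ?_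
  simp only
  by_cases hA : φ.toFun z ∈ 𝒜
  · simp [hA, h8]
  have hz0 : z ≠ 0 := fun h => hA (by rw [h]; exact h0)
  have h9 : jac φ.toFun z = jac φ'.toFun (f z) * deriv f z := jac_comp h7 (φ'.contMDiffAt h2) h1
  have h10 := φ'.jac_ne_zero h2
  rw [if_pos ⟨h2, by rwa [h8]⟩, if_pos ⟨h3, hA⟩, h9]
  have h12 : f z ^ (-k) = z ^ (-k) * (α z ^ k)⁻¹ := by rw [h4, mul_zpow, zpow_neg (α z)]
  rw [h12, inv_pow, inv_pow, mul_pow]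
  have h11 := zpow_ne_zero k h5
  field_simp

end OrbFibre

/-! ### Orbifold charts in toric coordinates -/

section OrbRef

variable {S : Type u} [TopologicalSpace S] [ChartedSpace ℂ S] [IsManifold 𝓘(ℂ) ω S]
  {𝒜 : Set S} {m : S → ℕ} {k : S → ℤ} {p : S → ℕ} {r : ℕ}

/-- The generic coordinates of the points of the orbifold ruled surface. -/
def orbGen (hw : OrbWeights 𝒜 m k p r) : RuledSurface m 0 r → S × ℂ :=
  RuledSurface.gen 𝒜 hw.off_zero hw.order_pos

lemma genInj_orbGen (hw : OrbWeights 𝒜 m k p r) : GenInj (orbGen hw) := RuledSurface.genInj_gen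

lemma orbGen_fst (hw : OrbWeights 𝒜 m k p r) (P : RuledSurface m 0 r) :
    (orbGen hw P).1 = RuledSurface.proj r P :=
  RuledSurface.gen_fst P

lemma proj_notMem_of_orbGen (hw : OrbWeights 𝒜 m k p r) {P : RuledSurface m 0 r}
    (hP : (orbGen hw P).2 ≠ 0) : RuledSurface.proj r P ∉ 𝒜 := by
  intro hA
  obtain ⟨φ, z, u, v, hz, huv, rfl⟩ := RuledSurface.exists_rep P
  rw [RuledSurface.proj_pt hz huv] at hA
  rw [orbGen, RuledSurface.gen_pt hz huv] at hP
  simp [hA] at hP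

lemma notMem_singularSet_of_proj (hw : OrbWeights 𝒜 m k p r) {P : RuledSurface m 0 r}
    (hP : RuledSurface.proj r P ∉ 𝒜) : P ∉ RuledSurface.singularSet (m := m) (d := 0) r :=
  fun h => hP (RuledSurface.exists_eq_affineChart_zero hw h).1

/-- In terms of the generic coordinates `R`, the affine charts over the orbifold chart `φ` are
`(z, w) ↦ (z ^ m, w z ^ (-p))` and `(z, w) ↦ (z ^ m, w⁻¹ z ^ (-p))`. -/
structure IsOrbRef (hw : OrbWeights 𝒜 m k p r) (φ : OrbChart S m 0) (R : ℂ × ℂ → S × ℂ) : Prop where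
  isRef : IsRef (φ.toFun 0) (φ.radius ^ m (φ.toFun 0)) R
  gen_eq : ∀ (b : Bool) (y : ℂ × ℂ), y.1 ∈ Metric.ball (0 : ℂ) φ.radius →
    orbGen hw (RuledSurface.affineChart r φ b y) = R (y.1 ^ m (φ.toFun 0),
      (if b then y.2⁻¹ else y.2) * y.1 ^ (-(p (φ.toFun 0) : ℤ)))

variable {hw : OrbWeights 𝒜 m k p r}

lemma isOrbRef_scaledTau {φ : OrbChart S m 0} (h0 : φ.toFun 0 ∈ 𝒜) {ψ : Disc S}
    (hψ : ψ.radius = φ.radius ^ m (φ.toFun 0))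
    (hφψ : ∀ z ∈ Metric.ball (0 : ℂ) φ.radius, ψ.toFun (z ^ m (φ.toFun 0)) = φ.toFun z) :
    ψ.toFun 0 = φ.toFun 0 ∧ ψ.Avoids 𝒜 ∧
      IsOrbRef hw φ (scaledTau ψ ((m (φ.toFun 0) : ℂ) ^ r)⁻¹ (k (φ.toFun 0)) r 𝒜) := by
  have hpos := hw.order_pos (φ.toFun 0)
  have hz0 : ψ.toFun 0 = φ.toFun 0 := by
    have := hφψ 0 φ.zero_mem
    rwa [zero_pow hpos.ne'] at this
  have hball : ∀ z : ℂ, z ^ m (φ.toFun 0) ∈ Metric.ball (0 : ℂ) ψ.radius ↔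
      z ∈ Metric.ball (0 : ℂ) φ.radius := by
    intro z
    rw [mem_ball_zero_iff, mem_ball_zero_iff, norm_pow, hψ]
    exact pow_lt_pow_iff_left₀ (norm_nonneg _) φ.radius_pos.le hpos.ne'
  have hoff : ∀ z ∈ Metric.ball (0 : ℂ) φ.radius, z ≠ 0 → φ.toFun z ∉ 𝒜 := fun z hz hz0 hA =>
    hw.order_ne_one hA (φ.regular z hz hz0).1
  have hav : ψ.Avoids 𝒜 := by
    intro y hy hy0
    obtain ⟨z, rfl⟩ := IsAlgClosed.exists_pow_nat_eq y hpos
    rw [hball] at hy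
    rw [hφψ z hy]
    exact hoff z hy fun h => hy0 (by rw [h, zero_pow hpos.ne'])
  have hm0 : (m (φ.toFun 0) : ℂ) ≠ 0 := by exact_mod_cast hpos.ne'
  refine ⟨hz0, hav, ?_, fun b y hy => ?_⟩
  · rw [← hψ, ← hz0]
    exact isRef_scaledTau (inv_ne_zero (pow_ne_zero _ (by rwa [hz0]))) hav (by rwa [hz0])
  · rw [orbGen, RuledSurface.gen_affineChart hy, scaledTau, tau]
    have hψy := hφψ _ hy
    refine Prod.ext hψy.symm ?_
    simp only
    by_cases hA : φ.toFun y.1 ∈ 𝒜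
    · simp [hA, hψy]
    have hy0 : y.1 ≠ 0 := fun h => hA (by rwa [h])
    have hjac : jac φ.toFun y.1 = jac ψ.toFun (y.1 ^ m (φ.toFun 0)) *
        (m (φ.toFun 0) * y.1 ^ (m (φ.toFun 0) - 1)) := by
      rw [jac_comp (g' := ψ.toFun) (h := fun z => z ^ m (φ.toFun 0)) (by fun_prop)
        (ψ.contMDiffAt ((hball _).2 hy)), deriv_pow_field]
      filter_upwards [Metric.isOpen_ball.mem_nhds hy] with z hz
      exact hφψ z hz
    have hj := ψ.jac_ne_zero ((hball _).2 hy)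
    have hexp : (y.1 ^ m (φ.toFun 0)) ^ (-k (φ.toFun 0)) =
        y.1 ^ (p (φ.toFun 0) : ℤ) * (((y.1 ^ (m (φ.toFun 0) - 1)) ^ r)⁻¹) := by
      rw [← zpow_natCast, ← zpow_mul, ← zpow_natCast, ← zpow_natCast, ← zpow_mul, ← zpow_neg,
        ← zpow_add₀ hy0, Nat.cast_sub hpos]
      congr 1
      have := hw.mul _ h0
      push_cast
      linarith
    have hc : y.1 ^ m (φ.toFun 0) ∈ Metric.ball (0 : ℂ) ψ.radius ∧
        ψ.toFun (y.1 ^ m (φ.toFun 0)) ∉ 𝒜 := ⟨(hball _).2 hy, by rwa [hψy]⟩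
    rw [if_neg hA, if_pos hc, hjac, hexp, Pi.zero_apply, neg_zero, zpow_zero, zpow_neg, inv_pow,
      inv_pow, mul_pow, mul_pow]
    have h1 := zpow_ne_zero (p (φ.toFun 0) : ℤ) hy0
    field_simp

lemma exists_isOrbRef (hw : OrbWeights 𝒜 m k p r) (φ : OrbChart S m 0) (h0 : φ.toFun 0 ∈ 𝒜)
    {δ : Disc S} (hδ : δ.toFun 0 = φ.toFun 0) :
    ∃ R, IsOrbRef hw φ R ∧ RefChange R (tau δ (k (φ.toFun 0)) r 𝒜) ∧
      RefChange (tau δ (k (φ.toFun 0)) r 𝒜) R := by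
  rw [← scaledTau_one]
  obtain ⟨h1, h2, h3⟩ := isOrbRef_scaledTau (hw := hw) h0 (φ.desing_radius (hw.order_pos _))
    fun z hz => φ.desing_pow (hw.order_pos _) hz
  have hκ' : ((m (φ.toFun 0) : ℂ) ^ r)⁻¹ ≠ 0 :=
    inv_ne_zero (pow_ne_zero _ (by exact_mod_cast (hw.order_pos _).ne'))
  exact ⟨_, h3, refChange_scaledTau hκ' one_ne_zero (by rwa [h1]) (by rw [h1, hδ]),
    refChange_scaledTau one_ne_zero hκ' (by rwa [hδ]) (by rw [h1, hδ])⟩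

/-- The points `(0, w)` with `w ≠ 0` of an orbifold chart lie on the outermost curve of the
Hirzebruch-Jung string. -/
lemma hjOver_last {e : List ℤ} {p q : ℕ} (hq : 0 < q) (hpq : p.Coprime q) (hlt : p < q)
    (he : IsHJExpansion e (p / q)) {z w : ℂ} (hw : w ≠ 0) :
    HJOver e p q e.length (w ^ q, z * w ^ (-hjSeq e 0 1 e.length)) (z, w) := by
  obtain ⟨h1, h2⟩ := hjSeq_q_p_last hq hpq he
  obtain ⟨h3, h4⟩ := hjSeq_last_eq hq hpq he
  have h5 : hjSeq e 1 1 (e.length + 1) = ((q - p : ℕ) : ℤ) := by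
    rw [hjSeq_one_one, h3, h4, Nat.cast_sub hlt.le]
    ring
  have h6 := hjSeq_det e 0 1 1 1 e.length
  rw [h3, h5] at h6
  set a := hjSeq e 0 1 e.length
  refine ⟨?_, ?_, ?_⟩
  · simp only [h3]
    rw [mul_zpow, ← zpow_natCast, ← zpow_natCast, ← zpow_mul, ← zpow_mul, mul_left_comm,
      ← zpow_add₀ hw, show (q : ℤ) * a + -a * q = 0 by ring, zpow_zero, mul_one]
  · simp only [h1, h2, zpow_one, zpow_zero, mul_one]
  · simp only [h5]
    rw [mul_zpow, ← zpow_natCast z, ← zpow_natCast w, ← zpow_mul, ← zpow_mul, mul_left_comm,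
      ← zpow_add₀ hw, show (q : ℤ) * hjSeq e 1 1 e.length + -a * ((q - p : ℕ) : ℤ) = 1 by linarith,
      zpow_one]

lemma mon_sideCone_last (b : Bool) {e : List ℤ} (he : ∀ x ∈ e, 2 ≤ x) (s : ℂ) :
    (mon (sideCone b e e.length) (flip b (s, 0))).1 = 0 := by
  rw [mon_sideCone]
  simp only
  rw [zero_zpow _ (hjSeq_zero_one_pos he le_rfl).ne', mul_zero]

namespace RuledSurface

/-- An orbifold chart and a toric chart match at points that correspond to each other by analytic
germs. -/
lemma locMatch_affineChart_of_germs {φ : OrbChart S m 0} (h0 : φ.toFun 0 ∈ 𝒜)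
    {R : ℂ × ℂ → S × ℂ} (hR : IsOrbRef hw φ R) {b : Bool} {e : List ℤ} (he : ∀ x ∈ e, 2 ≤ x) {i : ℕ}
    (hi : i ≤ e.length) {v : ℂ × ℂ} {F G : ℂ × ℂ → ℂ × ℂ} (hF : AnalyticAt ℂ F v)
    (hG : AnalyticAt ℂ G (F v)) (hGv : G (F v) = v)
    (hFH : ∀ᶠ v' in 𝓝 v, HJOver e (sideWeight (m (φ.toFun 0)) (p (φ.toFun 0)) b)
      (m (φ.toFun 0)) i (F v') v')
    (hGH : ∀ᶠ y in 𝓝 (F v), HJOver e (sideWeight (m (φ.toFun 0)) (p (φ.toFun 0)) b)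
      (m (φ.toFun 0)) i y (G y)) {U : Set (ℂ × ℂ)} (hUo : IsOpen U) (hvU : v ∈ U)
    (hU : ∀ y ∈ U, y.1 ∈ Metric.ball (0 : ℂ) φ.radius) (hUinj : Set.InjOn (affineChart r φ b) U) :
    LocMatch (orbGen hw) (toric R (sideCone b e i)) (affineChart r φ b v) (flip b (F v)) := by
  have hq := hw.order_pos (φ.toFun 0)
  have hp := (hw.lt _ h0).le
  have hc := isCone_sideCone b he hi
  obtain ⟨e₂, he₂, he₂s, he₂b⟩ := exists_isBihol_affineChart φ b hUo hU hUinj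
  have hve : v ∈ e₂.source := by rwa [he₂s]
  -- the generic coordinates of the chart, extended by non-generic values
  set μ : ℂ × ℂ → S × ℂ := fun y =>
    open Classical in if y ∈ U then orbGen hw (affineChart r φ b y) else (φ.toFun 0, 0) with hμ
  have hμU : ∀ y ∈ U, μ y = orbGen hw (affineChart r φ b y) := fun y hy => if_pos hy
  have hμU' : ∀ y, (μ y).2 ≠ 0 → y ∈ U := fun y hy => by
    by_contra h
    simp [hμ, h] at hy
  have hμR : ∀ y ∈ U, ∀ y', HJOver e (sideWeight (m (φ.toFun 0)) (p (φ.toFun 0)) b)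
      (m (φ.toFun 0)) i y' y → toric R (sideCone b e i) (flip b y') = μ y := fun y hy y' h => by
    rw [hμU y hy, hR.gen_eq b y (hU y hy)]
    exact toric_sideCone hR.isRef hq hp h
  have hflip : Continuous (flip b) := by
    have := (flip b).continuousOn
    rwa [flip_source, continuousOn_univ] at this
  have key : LocMatch μ (toric R (sideCone b e i)) v (flip b (F v)) := by
    refine LocMatch.of_germs (F := fun y => flip b (F y)) (G := fun y => G (flip b y))
      (fun y hy y' hy' h => ?_) (hR.isRef.genInj_toric hc) ?_ ?_ ?_ ?_ ?_ ?_
    · have h1 := hμU' y hy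
      have h2 := hμU' y' hy'
      rw [Set.mem_ofPred_eq, hμU y h1] at hy
      rw [Set.mem_ofPred_eq, hμU y' h2] at hy'
      rw [hμU y h1, hμU y' h2] at h
      exact hUinj h1 h2 (genInj_orbGen hw hy hy' h)
    · exact ((isBihol_flip b).analyticAt (by rw [flip_source]; trivial)).comp hF
    · refine AnalyticAt.comp (by rwa [flip_flip])
        ((isBihol_flip b).analyticAt (by rw [flip_source]; trivial))
    · filter_upwards [hFH, hUo.mem_nhds hvU] with y h1 h2
      exact hμR y h2 _ h1
    · have h1 : Filter.Tendsto (flip b) (𝓝 (flip b (F v))) (𝓝 (F v)) := by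
        have := hflip.tendsto (flip b (F v))
        rwa [flip_flip] at this
      filter_upwards [h1.eventually hGH, h1.eventually (hG.continuousAt.eventually
        (by rw [hGv]; exact hUo.mem_nhds hvU))] with y h2 h3
      rw [← hμR _ h3 _ h2, flip_flip]
    · filter_upwards [hUo.mem_nhds hvU] with y hy
      refine mem_closure_iff_frequently.2 ((eventually_ne_zero_and.and_eventually
        (hUo.mem_nhds hy)).mono ?_)
      rintro y' ⟨⟨h2, h3⟩, h4⟩
      refine Set.mem_ofPred_eq ▸ ?_
      rw [hμU _ h4, hR.gen_eq b _ (hU _ h4), hR.isRef.generic]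
      refine ⟨pow_ne_zero _ h2, ?_, mul_ne_zero ?_ (zpow_ne_zero _ h2)⟩
      · rw [norm_pow]
        exact pow_lt_pow_left₀ (mem_ball_zero_iff.1 (hU _ h4)) (norm_nonneg _) hq.ne'
      · split_ifs
        · exact inv_ne_zero h3
        · exact h3
    · refine (hc.continuous_mon_fst.norm.continuousAt.eventually_lt continuousAt_const ?_).mono
        fun y hy => hR.isRef.mem_closure hc hy
      rw [mon_sideCone, ← hFH.self_of_nhds.1, norm_pow]
      exact pow_lt_pow_left₀ (mem_ball_zero_iff.1 (hU _ hvU)) (norm_nonneg _) hq.ne'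
  have hPt : affineChart r φ b v ∈ e₂.target := by
    rw [← he₂b]
    exact e₂.map_source hve
  refine LocMatch.precomp (f := μ) he₂.symm hPt (fun P hP => ?_) ?_
  · have h1 := e₂.map_target hP
    rw [he₂s] at h1
    rw [hμU _ h1, ← he₂b, e₂.right_inv hP]
  · rwa [← he₂b, e₂.left_inv hve]

/-- The powers are injective near a point away from the origin. -/
lemma exists_injOn_pow {n : ℕ} (hn : 0 < n) {w : ℂ} (hw : w ≠ 0) :
    ∃ U ∈ 𝓝 w, Set.InjOn (fun z : ℂ => z ^ n) U := by
  refine exists_injOn_of_deriv_ne_zero (by fun_prop) ?_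
  rw [deriv_pow_field]
  exact mul_ne_zero (by exact_mod_cast hn.ne') (pow_ne_zero _ hw)

/-- A smooth point of a fibre over an orbifold point. -/
lemma locMatch_affineChart_middle {φ : OrbChart S m 0} (h0 : φ.toFun 0 ∈ 𝒜) {R : ℂ × ℂ → S × ℂ}
    (hR : IsOrbRef hw φ R) {b : Bool} {e : List ℤ}
    (he : IsHJExpansion e ((sideWeight (m (φ.toFun 0)) (p (φ.toFun 0)) b : ℕ) / m (φ.toFun 0)))
    {w : ℂ} (hw0 : w ≠ 0) :
    LocMatch (orbGen hw) (toric R (sideCone b e e.length)) (affineChart r φ b (0, w))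
      (flip b (w ^ m (φ.toFun 0), 0)) := by
  have hq := hw.order_pos (φ.toFun 0)
  have hlt := hw.sideWeight_lt h0 b
  have hcop := hw.sideWeight_coprime h0 b
  set a := hjSeq e 0 1 e.length
  obtain ⟨root, hroot, hroot0, hrootp⟩ := exists_analyticAt_pow_eq (g := fun y : ℂ × ℂ => y.1)
    (z := (w ^ m (φ.toFun 0), 0)) analyticAt_fst (pow_ne_zero _ hw0) hq.ne' rfl
  have hF0 : ((w ^ m (φ.toFun 0), 0 * w ^ (-a)) : ℂ × ℂ) = (w ^ m (φ.toFun 0), 0) := by simp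
  have hrootw : root (w ^ m (φ.toFun 0), 0) ≠ 0 := by rwa [hroot0]
  -- the isotropy group moves `w` away from itself
  obtain ⟨V, hV, hVinj⟩ := exists_injOn_pow hq hw0
  obtain ⟨U, hU, hUo, hwU⟩ : ∃ U : Set (ℂ × ℂ), (∀ y ∈ U, y.1 ∈ Metric.ball (0 : ℂ) φ.radius ∧
      y.2 ∈ V ∧ y.2 ≠ 0) ∧ IsOpen U ∧ ((0 : ℂ), w) ∈ U := by
    refine eventually_nhds_iff.1 ?_
    filter_upwards [continuous_fst.continuousAt.eventually (Metric.isOpen_ball.mem_nhds φ.zero_mem),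
      continuous_snd.continuousAt.eventually hV, continuous_snd.continuousAt.eventually_ne hw0]
      with y h1 h2 h3
    exact ⟨h1, h2, h3⟩
  have hUinj : Set.InjOn (affineChart r φ b) U := by
    intro y hy y' hy' h
    obtain ⟨h1, h2, h3⟩ := hU y hy
    obtain ⟨h4, h5, h6⟩ := hU y' hy'
    obtain ⟨ζ, hζ, rfl⟩ := (affineChart_eq_iff hq h1 h4).1 h
    have h7 : ζ ^ fibreWeight r 0 b * y.2 = y.2 := by
      refine hVinj h5 h2 ?_
      simp only [Pi.zero_apply, mul_pow]
      rw [← zpow_natCast (ζ ^ fibreWeight r 0 b), ← zpow_mul, mul_comm (fibreWeight r 0 b), zpow_mul,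
        zpow_natCast, hζ, one_zpow, one_mul]
    have h8 : ζ ^ fibreWeight r 0 b = 1 := mul_right_cancel₀ h3 (by rw [h7, one_mul])
    have h9 : ζ ^ r = 1 := by
      cases b <;> simpa [fibreWeight] using h8
    simp [hw.eq_one h0 hζ h9]
  have h := locMatch_affineChart_of_germs h0 hR he.1 le_rfl (v := (0, w))
    (F := fun y => (y.2 ^ m (φ.toFun 0), y.1 * y.2 ^ (-a))) (G := fun y => (y.2 * root y ^ a, root y))
    ((analyticAt_snd.pow _).prod (analyticAt_fst.mul (analyticAt_snd.zpow hw0)))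
    (by simp only [hF0]; exact (analyticAt_snd.mul (hroot.zpow hrootw)).prod hroot)
    (by simp [hroot0])
    ((continuous_snd.continuousAt.eventually_ne hw0).mono fun y hy =>
      hjOver_last hq hcop hlt he hy) ?_ hUo hwU (fun y hy => (hU y hy).1) hUinj
  · simpa using h
  · simp only [hF0]
    filter_upwards [hroot.continuousAt.eventually_ne hrootw] with y hy
    have h1 := hjOver_last hq hcop hlt he (z := y.2 * root y ^ a) hy
    rwa [hrootp y, mul_assoc, ← zpow_add₀ hy, add_neg_cancel, zpow_zero, mul_one] at h1

end RuledSurface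

end OrbRef

/-! ### The toric charts of the Hirzebruch-Jung resolution -/

section Resolution

lemma hjOver_zero {e : List ℤ} {p q : ℕ} (hp : 0 < p) (hpq : p.Coprime q) (hlt : p < q)
    (he : IsHJExpansion e (p / q)) {i : ℕ} (hi : i ≤ e.length) {y : ℂ × ℂ}
    (hy : y.1 ^ hjSeq e 0 1 i * y.2 ^ hjSeq e 0 1 (i + 1) = 0) (hlast : i = e.length → y.1 = 0) :
    HJOver e p q i y 0 := by
  have hq : 0 < q := by omega
  have h1 : ∀ z : ℂ, ∀ j : ℤ, z ^ j = 0 → z = 0 ∧ j ≠ 0 := fun z j h => by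
    have hz : z = 0 := by
      by_contra hz
      exact zpow_ne_zero j hz h
    refine ⟨hz, fun hj => ?_⟩
    rw [hj, zpow_zero] at h
    exact one_ne_zero h
  have h2 := hjSeq_one_one_pos he.1 (i := i) (by omega)
  have h3 := hjSeq_one_one_pos he.1 (i := i + 1) (by omega)
  have h4 := hjSeq_q_p_pos hq hpq he hi
  have hzero : ∀ a : ℤ, ∀ b : ℤ, a ≠ 0 → b ≠ 0 → y.1 ^ a * y.2 ^ b = 0 := by
    intro a b ha hb
    rcases mul_eq_zero.1 hy with h | h
    · rw [(h1 _ _ h).1, zero_zpow _ ha, zero_mul]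
    · rw [(h1 _ _ h).1, zero_zpow _ hb, mul_zero]
  refine ⟨?_, ?_, ?_⟩
  · rw [hy]
    exact zero_pow hq.ne'
  · rw [Prod.snd_zero, zero_pow hq.ne']
    rcases hi.lt_or_eq with hi' | hi'
    · exact (hzero _ _ h4.ne' (hjSeq_q_p_pos hq hpq he (i := i + 1) hi').ne').symm
    · rw [hlast hi', zero_zpow _ h4.ne', zero_mul]
  · rw [Prod.snd_zero, mul_zero]
    exact (hzero _ _ h2.ne' h3.ne').symm

lemma flip_eq_of_mon_eq_zero {b : Bool} {e : List ℤ} {y : ℂ × ℂ}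
    (hy : (mon (sideCone b e e.length) y).1 = 0) (h1 : (flip b y).1 ≠ 0) :
    y = flip b ((flip b y).1, 0) := by
  rw [← flip_flip b y, mon_sideCone] at hy
  have h2 := (mul_eq_zero.1 hy).resolve_left (zpow_ne_zero _ h1)
  have h3 : (flip b y).2 = 0 := by
    by_contra h
    exact zpow_ne_zero _ h h2
  rw [← h3, flip_flip]

lemma mem_hjFanOf {S : Type u} {𝒜 : Set S} {m : S → ℕ} {k : S → ℤ} {p : S → ℕ} {r : ℕ}
    (hw : OrbWeights 𝒜 m k p r) {x : S} (hx : x ∈ 𝒜) {E : Bool → List ℤ}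
    (hE : ∀ b, IsHJExpansion (E b) ((sideWeight (m x) (p x) b : ℕ) / (m x : ℕ))) {c : Cone} :
    c ∈ hjFanOf ((p x : ℚ) / m x) ↔ ∃ b, ∃ i ≤ (E b).length, c = sideCone b (E b) i := by
  have h1 : IsHJExpansion (E true) (1 - (p x : ℚ) / m x) := by
    have h2 := hE true
    have h3 : (m x : ℚ) ≠ 0 := by exact_mod_cast (hw.order_pos x).ne'
    rwa [sideWeight, if_pos rfl, Nat.cast_sub (hw.lt x hx).le, sub_div, div_self h3] at h2
  have h4 : IsHJExpansion (E false) ((p x : ℚ) / m x) := hE false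
  rw [hjFanOf_eq h4 h1, Bool.exists_bool]
  rfl

variable {S : Type u} [TopologicalSpace S] [ChartedSpace ℂ S] [IsManifold 𝓘(ℂ) ω S]
  {𝒜 : Set S} {m : S → ℕ} {k : S → ℤ} {p : S → ℕ} {r : ℕ} {hw : OrbWeights 𝒜 m k p r}

/-- The points of the resolution over a singular point. -/
lemma IsHJModel.locMatch {X : Type u} [TopologicalSpace X] [HolSpace X]
    {π : X → RuledSurface m 0 r} {φ : OrbChart S m 0} (h0 : φ.toFun 0 ∈ 𝒜) {R : ℂ × ℂ → S × ℂ}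
    (hR : IsOrbRef hw φ R) {b : Bool} {ρ : ℝ} (hρ : ρ ≤ φ.radius) {e : List ℤ}
    {c : OpenPartialHomeomorph X (ℂ × ℂ)} {i : ℕ} (hi : i ≤ e.length) (he : ∀ x ∈ e, 2 ≤ x)
    (hc : IsHolChart c) (ht : c.target = {y | ∃ v ∈ polydisc ρ, HJOver e
      (sideWeight (m (φ.toFun 0)) (p (φ.toFun 0)) b) (m (φ.toFun 0)) i y v})
    (hπ : ∀ y ∈ c.target, ∀ v ∈ polydisc ρ, HJOver e
      (sideWeight (m (φ.toFun 0)) (p (φ.toFun 0)) b) (m (φ.toFun 0)) i y v →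
        π (c.symm y) = RuledSurface.affineChart r φ b v)
    {P : X} (hP : P ∈ c.source) (hz : (mon (sideCone b e i) (flip b (c P))).1 = 0) :
    LocMatch (orbGen hw ∘ π) (toric R (sideCone b e i)) P (flip b (c P)) := by
  set T := c.trans (flip b) with hT
  have hTP : flip b (c P) = T P := rfl
  rw [hTP] at hz ⊢
  refine LocMatch.of_bihol ((isBihol_iff_isHolChart.2 hc).trans (isBihol_flip b))
    ⟨hP, by rw [flip_source]; trivial⟩ ?_
    (hR.isRef.eventually_mem_closure (isCone_sideCone b he hi) hz)
  rintro P' ⟨hP', -⟩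
  have hy := c.map_source hP'
  have hy' := hy
  rw [ht] at hy'
  obtain ⟨v, hv, hHJ⟩ := hy'
  have h1 := hπ _ hy v hv hHJ
  rw [c.left_inv hP'] at h1
  rw [Function.comp, h1, hR.gen_eq b v (mem_ball_zero_iff.2 (hv.1.trans_le hρ))]
  exact toric_sideCone hR.isRef (hw.order_pos _) (hw.lt _ h0).le hHJ

/-- The Hirzebruch-Jung resolution has the same toric charts as the iterated blow-up. -/
lemma IsHJResolution.realizes (hk : ∀ x ∉ 𝒜, (1 : ℕ) = 1 ∧ k x = 0) {δ : S → Disc S}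
    (hδ : ∀ x, (δ x).toFun 0 = x) (hav : ∀ x, (δ x).Avoids 𝒜) {Fan : S → Set Cone}
    (hFan : ∀ x ∈ 𝒜, Fan x = hjFanOf ((p x : ℚ) / m x)) {X : Type u} [TopologicalSpace X]
    [HolSpace X] {π : X → RuledSurface m 0 r} (hπ : IsHJResolution π) :
    Realizes (RuledSurface.gen (m := fun _ : S => 1) (d := k) (r := r) 𝒜 hk fun _ => one_pos) 𝒜
      (fun x => tau (δ x) (k x) r 𝒜) (orbGen hw ∘ π) Fan := by
  obtain ⟨-, hbi, hsing⟩ := hπ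
  obtain ⟨e₀, he₀s, he₀t, he₀, he₀b⟩ := id hbi
  have hoff : ∀ P : RuledSurface m 0 r, RuledSurface.proj r P ∉ 𝒜 →
      P ∈ (RuledSurface.singularSet (m := m) (d := 0) r)ᶜ :=
    fun P hP => notMem_singularSet_of_proj hw hP
  have hfst : ∀ q : X, ((orbGen hw ∘ π) q).1 = RuledSurface.proj r (π q) :=
    fun q => orbGen_fst hw _
  have hgen : ∀ q : X, ((orbGen hw ∘ π) q).2 ≠ 0 →
      π q ∈ (RuledSurface.singularSet (m := m) (d := 0) r)ᶜ :=
    fun q hq => hoff _ (proj_notMem_of_orbGen hw hq)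
  have hsurj : ∀ P ∈ (RuledSurface.singularSet (m := m) (d := 0) r)ᶜ, ∃ q, π q = P := by
    intro P hP
    rw [← he₀t] at hP
    have h1 := e₀.map_target hP
    exact ⟨e₀.symm P, by rw [he₀ h1, e₀.right_inv hP]⟩
  -- the data of the resolution at a singular point
  have hdata : ∀ x ∈ 𝒜, ∀ b, ∃ (φ : OrbChart S m 0) (ρ : ℝ) (R : ℂ × ℂ → S × ℂ) (e : List ℤ)
      (c : ℕ → OpenPartialHomeomorph X (ℂ × ℂ)), φ.toFun 0 = x ∧ 0 < ρ ∧ IsOrbRef hw φ R ∧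
      RefChange R (tau (δ x) (k x) r 𝒜) ∧ RefChange (tau (δ x) (k x) r 𝒜) R ∧
      IsHJExpansion e ((sideWeight (m x) (p x) b : ℕ) / (m x : ℕ)) ∧
      (∀ q, π q = RuledSurface.affineChart r ((δ x).orbAt (hav x) hw.off_zero hw.order_pos) b 0 →
        ∃ i ≤ e.length, q ∈ (c i).source ∧ (mon (sideCone b e i) (flip b (c i q))).1 = 0) ∧
      (∀ i ≤ e.length, (c i).target = {y | ∃ v ∈ polydisc ρ, HJOver e
        (sideWeight (m x) (p x) b) (m x) i y v}) ∧
      ∀ i ≤ e.length, ∀ q ∈ (c i).source, (mon (sideCone b e i) (flip b (c i q))).1 = 0 →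
        LocMatch (orbGen hw ∘ π) (toric R (sideCone b e i)) q (flip b (c i q)) := by
    intro x hx b
    set φ₀ : OrbChart S m 0 := (δ x).orbAt (hav x) hw.off_zero hw.order_pos
    have hφ₀ : φ₀.toFun 0 = x := by rw [Disc.orbAt_zero, hδ]
    obtain ⟨φ, b', ρ, p', q', hρ, hρφ, hpt, hquot, hM⟩ := hsing _
      (RuledSurface.affineChart_zero_mem_singularSet hw φ₀ (by rwa [hφ₀]) b)
    obtain rfl := RuledSurface.eq_of_affineChart_zero hpt
    have hφ : φ.toFun 0 = x := by
      have h1 := congrArg (RuledSurface.proj r) hpt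
      rwa [RuledSurface.proj_affineChart (y := 0) φ.zero_mem,
        RuledSurface.proj_affineChart (y := 0) φ₀.zero_mem, Prod.fst_zero, hφ₀] at h1
    subst hφ
    obtain ⟨rfl, rfl⟩ := eq_of_isQuotientChart hw hx hρ hρφ hquot
    obtain ⟨R, hR, hR1, hR2⟩ := exists_isOrbRef hw φ hx (hδ _)
    obtain ⟨e, c, he, hch, hpre, htar, hov, -⟩ := hM
    refine ⟨φ, ρ, R, e, c, rfl, hρ, hR, hR1, hR2, he, fun q hq => ?_, htar, fun i hi q hq hz => ?_⟩
    · have h1 : q ∈ π ⁻¹' (RuledSurface.affineChart r φ b' '' polydisc ρ) :=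
        ⟨0, by simp [polydisc, hρ], by rw [hpt, hq]⟩
      rw [hpre] at h1
      simp only [Set.mem_iUnion] at h1
      obtain ⟨i, hi, hqi⟩ := h1
      refine ⟨i, hi, hqi, ?_⟩
      have hy := (c i).map_source hqi
      have hy' := hy
      rw [htar i hi] at hy'
      obtain ⟨v, hv, hHJ⟩ := hy'
      have hvb := mem_ball_zero_iff.2 (hv.1.trans_le hρφ)
      have h2 := hov i hi _ hy v hv hHJ
      rw [(c i).left_inv hqi, hq, ← hpt] at h2
      have h3 := congrArg (RuledSurface.proj r) h2
      rw [RuledSurface.proj_affineChart (y := 0) φ.zero_mem, RuledSurface.proj_affineChart hvb,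
        Prod.fst_zero] at h3
      have h4 : v.1 = 0 := by
        by_contra h4
        exact hw.order_ne_one hx (by rw [h3]; exact (φ.regular _ hvb h4).1)
      rw [mon_sideCone, ← hHJ.1, h4, zero_pow (hw.order_pos _).ne']
    · exact IsHJModel.locMatch hx hR hρφ hi he.1 (hch i hi) (htar i hi) (hov i hi) hq hz
  refine ⟨fun q hq q' hq' h => ?_, fun q hq => ?_, fun P hP => ?_, fun q hq => ?_,
    fun x hx c hc y hy => ?_⟩
  · have h1 : π q = π q' := genInj_orbGen hw hq hq' h
    have h2 : q ∈ e₀.source := by rw [he₀s]; exact hgen q hq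
    have h3 : q' ∈ e₀.source := by rw [he₀s]; exact hgen q' hq'
    exact e₀.injOn h2 h3 (by rw [← he₀ h2, ← he₀ h3, h1])
  · rw [hfst] at hq
    obtain ⟨P, hP⟩ := RuledSurface.exists_locMatch_gen (m' := fun _ : S => 1) (d' := k)
      (h𝒜 := hw.off_zero) (hpos := hw.order_pos) (h𝒜' := hk) (hpos' := fun _ => one_pos) hδ hav _ hq
    exact ⟨P, hbi.locMatch (hoff _ hq) hP⟩
  · rw [RuledSurface.gen_fst] at hP
    obtain ⟨P', hP'⟩ := RuledSurface.exists_locMatch_gen (m' := m) (d' := 0)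
      (h𝒜 := hk) (hpos := fun _ => one_pos) (h𝒜' := hw.off_zero) (hpos' := hw.order_pos) hδ hav _ hP
    have h1 : P' ∈ (RuledSurface.singularSet (m := m) (d := 0) r)ᶜ := by
      refine hoff _ ?_
      have h2 := congrArg Prod.fst hP'.eq
      rw [RuledSurface.gen_fst, RuledSurface.gen_fst] at h2
      rwa [h2]
    obtain ⟨q, rfl⟩ := hsurj P' h1
    exact ⟨q, hbi.locMatch h1 hP'.symm⟩
  · rw [hfst] at hq ⊢
    set x := RuledSurface.proj r (π q) with hx
    have hRx := RuledSurface.isRef_fibre (D := k) (r := r) hδ hav x hq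
    have hE := fun b => exists_isHJExpansion (hw.sideWeight_lt hq b)
    choose E hE using hE
    set φ₀ : OrbChart S m 0 := (δ x).orbAt (hav x) hw.off_zero hw.order_pos with hφ₀def
    have hφ₀ : φ₀.toFun 0 = x := by rw [Disc.orbAt_zero, hδ]
    obtain ⟨b, t, hbt⟩ := RuledSurface.exists_eq_affineChart hw.order_pos φ₀ φ₀.zero_mem
      (Or.inl rfl) (P := π q) (by rw [hφ₀])
    have hfin : ∀ (R : ℂ × ℂ → S × ℂ) (ρ : ℝ), IsRef x ρ R → RefChange R (tau (δ x) (k x) r 𝒜) →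
        RefChange (tau (δ x) (k x) r 𝒜) R → ∀ i ≤ (E b).length, ∀ y,
        (mon (sideCone b (E b) i) y).1 = 0 →
        LocMatch (orbGen hw ∘ π) (toric R (sideCone b (E b) i)) q y → ∃ c ∈ Fan x, ∃ y,
        (mon c y).1 = 0 ∧ LocMatch (orbGen hw ∘ π) (toric (tau (δ x) (k x) r 𝒜) c) q y := by
      intro R ρ hR hR1 hR2 i hi y hy hm
      obtain ⟨y', hy', hm'⟩ := hR1.exists_locMatch hR hRx hR2 (isCone_sideCone b (hE b).1 hi) hy
      exact ⟨_, by rw [hFan x hq, mem_hjFanOf hw hq hE]; exact ⟨b, i, hi, rfl⟩, y', hy', hm.trans hm'⟩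
    rcases eq_or_ne t 0 with rfl | ht
    · obtain ⟨φ, ρ, R, e, c, hφ, hρ, hR, hR1, hR2, he, hcov, htar, hm⟩ := hdata x hq b
      obtain rfl := he.unique (hE b)
      obtain ⟨i, hi, hqi, hz⟩ := hcov q hbt
      exact hfin R _ (hφ ▸ hR.isRef) hR1 hR2 i hi _ hz (hm i hi q hqi hz)
    · have hq' : φ₀.toFun 0 ∈ 𝒜 := by rwa [hφ₀]
      obtain ⟨R, hR, hR1, hR2⟩ := exists_isOrbRef hw φ₀ hq' (δ := δ x) (by rw [hφ₀, hδ])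
      have h1 := RuledSurface.locMatch_affineChart_middle hq' hR (b := b) (e := E b)
        (by rw [hφ₀]; exact hE b) ht
      rw [← hbt] at h1
      have h2 : π q ∈ (RuledSurface.singularSet (m := m) (d := 0) r)ᶜ := by
        rw [hbt]
        exact RuledSurface.affineChart_notMem_singularSet hw ht
      rw [hφ₀] at hR1 hR2
      exact hfin R _ (hφ₀ ▸ hR.isRef) hR1 hR2 _ le_rfl _ (mon_sideCone_last b (hE b).1 _)
        (hbi.locMatch h2 h1)
  · have hRx := RuledSurface.isRef_fibre (D := k) (r := r) hδ hav x hx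
    have hE := fun b => exists_isHJExpansion (hw.sideWeight_lt hx b)
    choose E hE using hE
    rw [hFan x hx, mem_hjFanOf hw hx hE] at hc
    obtain ⟨b, i, hi, rfl⟩ := hc
    have hcone := isCone_sideCone b (hE b).1 hi
    obtain ⟨φ, ρ, R, e, c, hφ, hρ, hR, hR1, hR2, he, -, htar, hm⟩ := hdata x hx b
    obtain rfl := he.unique (hE b)
    subst hφ
    obtain ⟨y', hy', hm'⟩ := hR2.exists_locMatch hRx hR.isRef hR1 hcone hy
    suffices h : ∃ q, LocMatch (orbGen hw ∘ π) (toric R (sideCone b (E b) i)) q y' by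
      obtain ⟨q, hq⟩ := h
      exact ⟨q, hq.trans hm'.symm⟩
    by_cases hmid : i = (E b).length ∧ (flip b y').1 ≠ 0
    · obtain ⟨rfl, hne⟩ := hmid
      obtain ⟨w, hw1⟩ := IsAlgClosed.exists_pow_nat_eq (flip b y').1 (hw.order_pos (φ.toFun 0))
      have hw0 : w ≠ 0 := by
        rintro rfl
        rw [zero_pow (hw.order_pos _).ne'] at hw1
        exact hne hw1.symm
      have h1 := RuledSurface.locMatch_affineChart_middle hx hR (b := b) (hE b) hw0
      rw [hw1, ← flip_eq_of_mon_eq_zero hy' hne] at h1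
      have h2 := RuledSurface.affineChart_notMem_singularSet (b := b) (φ := φ) hw hw0
      obtain ⟨q, hq⟩ := hsurj _ h2
      rw [← hq] at h1 h2
      exact ⟨q, hbi.locMatch h2 h1⟩
    · have h1 : flip b y' ∈ (c i).target := by
        rw [htar i hi]
        refine ⟨0, by simp [polydisc, hρ], hjOver_zero (hw.sideWeight_pos hx b)
          (hw.sideWeight_coprime hx b) (hw.sideWeight_lt hx b) (hE b) hi ?_ fun h => ?_⟩
        · rw [← flip_flip b y', mon_sideCone] at hy'
          exact hy'
        · by_contra h2
          exact hmid ⟨h, h2⟩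
      have h2 := hm i hi _ ((c i).map_target h1)
      rw [(c i).right_inv h1, flip_flip] at h2
      exact ⟨_, h2 hy'⟩

end Resolution

/-! ### The points of the Hirzebruch-Jung charts -/

section HJPoints

variable {e : List ℤ} {p q : ℕ} {i : ℕ} {y v : ℂ × ℂ}

/-- The relation between the three invariant monomials of the cyclic group. -/
lemma hjMonomial_rel (hlt : p < q) (he : IsHJExpansion e (p / q))
    (hi : i ≤ e.length) (y : ℂ × ℂ) :
    (y.1 ^ hjSeq e 1 1 i * y.2 ^ hjSeq e 1 1 (i + 1)) ^ q =
      (y.1 ^ hjSeq e 0 1 i * y.2 ^ hjSeq e 0 1 (i + 1)) ^ (q - p) *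
        (y.1 ^ hjSeq e q p i * y.2 ^ hjSeq e q p (i + 1)) := by
  have hq : 0 < q := by omega
  have key : ∀ j ≤ e.length + 1, ∀ z : ℂ, (z ^ hjSeq e 1 1 j) ^ q =
      (z ^ hjSeq e 0 1 j) ^ (q - p) * z ^ hjSeq e q p j := by
    intro j hj z
    have h1 : hjSeq e 1 1 j * q = hjSeq e 0 1 j * (q - p : ℕ) + hjSeq e q p j := by
      rw [hjSeq_one_one, hjSeq_q_p e p q, Nat.cast_sub hlt.le]
      ring
    have h2 := hjSeq_one_one_pos he.1 hj
    rw [← zpow_natCast, ← zpow_natCast, ← zpow_mul, ← zpow_mul, h1]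
    rcases eq_or_ne z 0 with rfl | hz
    · have h3 : hjSeq e 0 1 j * ((q - p : ℕ) : ℤ) + hjSeq e q p j ≠ 0 := by
        rw [← h1]
        exact mul_ne_zero h2.ne' (by exact_mod_cast hq.ne')
      rw [zero_zpow _ h3]
      rcases eq_or_ne (hjSeq e q p j) 0 with h4 | h4
      · rw [h4, add_zero] at h3
        rw [zero_zpow _ h3, zero_mul]
      · rw [zero_zpow _ h4, mul_zero]
    · exact zpow_add₀ hz _ _
  rw [mul_pow, mul_pow, key i (by omega), key (i + 1) (by omega), mul_mul_mul_comm]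

lemma HJOver.of_eq (hlt : p < q) (he : IsHJExpansion e (p / q))
    (hi : i ≤ e.length) (hv : v.1 ≠ 0)
    (h1 : v.1 ^ q = y.1 ^ hjSeq e 0 1 i * y.2 ^ hjSeq e 0 1 (i + 1))
    (h3 : v.1 ^ (q - p) * v.2 = y.1 ^ hjSeq e 1 1 i * y.2 ^ hjSeq e 1 1 (i + 1)) :
    HJOver e p q i y v := by
  refine ⟨h1, ?_, h3⟩
  have h4 := hjMonomial_rel hlt he hi y
  rw [← h1, ← h3, mul_pow, ← pow_mul, ← pow_mul, mul_comm q] at h4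
  exact mul_left_cancel₀ (pow_ne_zero _ hv) h4

lemma exists_hjOver (hlt : p < q) (he : IsHJExpansion e (p / q))
    (hi : i ≤ e.length) (y : ℂ × ℂ) : ∃ v, HJOver e p q i y v := by
  have hq : 0 < q := by omega
  obtain ⟨z, hz⟩ := IsAlgClosed.exists_pow_nat_eq
    (y.1 ^ hjSeq e 0 1 i * y.2 ^ hjSeq e 0 1 (i + 1)) hq
  rcases eq_or_ne z 0 with rfl | hz0
  · obtain ⟨w, hw⟩ := IsAlgClosed.exists_pow_nat_eq
      (y.1 ^ hjSeq e q p i * y.2 ^ hjSeq e q p (i + 1)) hq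
    refine ⟨(0, w), hz, hw, ?_⟩
    have h4 := hjMonomial_rel hlt he hi y
    have h5 : q - p ≠ 0 := by omega
    rw [← hz, zero_pow hq.ne', zero_pow h5, zero_mul] at h4
    rw [eq_zero_of_pow_eq_zero h4, zero_pow h5, zero_mul]
  · refine ⟨(z, (y.1 ^ hjSeq e 1 1 i * y.2 ^ hjSeq e 1 1 (i + 1)) / z ^ (q - p)),
      HJOver.of_eq hlt he hi hz0 hz ?_⟩
    have := pow_ne_zero (q - p) hz0
    field_simp

lemma hjSeq_q_p_nonneg (hpq : p.Coprime q) (hlt : p < q) (he : IsHJExpansion e (p / q))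
    (hi : i ≤ e.length + 1) : 0 ≤ hjSeq e q p i := by
  have hq : 0 < q := by omega
  rcases hi.lt_or_eq with h | rfl
  · exact (hjSeq_q_p_pos hq hpq he (by omega)).le
  · exact (hjSeq_q_p_last hq hpq he).1.ge

lemma analyticAt_monomial {a b : ℤ} (ha : 0 ≤ a) (hb : 0 ≤ b) (y : ℂ × ℂ) :
    AnalyticAt ℂ (fun y : ℂ × ℂ => y.1 ^ a * y.2 ^ b) y := by
  lift a to ℕ using ha
  lift b to ℕ using hb
  simp only [zpow_natCast]
  exact (analyticAt_fst.pow _).mul (analyticAt_snd.pow _)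

lemma continuous_monomial {a b : ℤ} (ha : 0 ≤ a) (hb : 0 ≤ b) :
    Continuous (fun y : ℂ × ℂ => y.1 ^ a * y.2 ^ b) :=
  continuous_iff_continuousAt.2 fun y => (analyticAt_monomial ha hb y).continuousAt

/-- Near the origin of a chart, the points of the orbifold chart below it are near the origin. -/
lemma eventually_hjOver_mem_polydisc (hpq : p.Coprime q) (hlt : p < q)
    (he : IsHJExpansion e (p / q)) (hi : i ≤ e.length) {y₀ v₀ : ℂ × ℂ} {ρ : ℝ}
    (hv : v₀ ∈ polydisc ρ) (h : HJOver e p q i y₀ v₀) :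
    ∀ᶠ y in 𝓝 y₀, ∀ v, HJOver e p q i y v → v ∈ polydisc ρ := by
  have hq : q ≠ 0 := by omega
  have key : ∀ a b : ℤ, 0 ≤ a → 0 ≤ b → ∀ w : ℂ, ‖w‖ < ρ → w ^ q = y₀.1 ^ a * y₀.2 ^ b →
      ∀ᶠ y in 𝓝 y₀, ∀ w : ℂ, w ^ q = y.1 ^ a * y.2 ^ b → ‖w‖ < ρ := by
    intro a b ha hb w hw hwe
    have hρ := (norm_nonneg w).trans_lt hw
    filter_upwards [(continuous_monomial ha hb).norm.continuousAt.eventually_lt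
      (continuousAt_const (y := ρ ^ q)) (by
        rw [← hwe, norm_pow]
        exact pow_lt_pow_left₀ hw (norm_nonneg _) hq)] with y hy w' hw'
    rw [← hw', norm_pow] at hy
    exact lt_of_pow_lt_pow_left₀ q hρ.le hy
  filter_upwards [key _ _ (hjSeq_zero_one_nonneg he.1 (by omega))
      (hjSeq_zero_one_nonneg he.1 (by omega)) _ hv.1 h.1,
    key _ _ (hjSeq_q_p_nonneg hpq hlt he (by omega)) (hjSeq_q_p_nonneg hpq hlt he (by omega))
      _ hv.2 h.2.1] with y h1 h2 v hv
  exact ⟨h1 _ hv.1, h2 _ hv.2.1⟩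

lemma isOpen_hjOver (hpq : p.Coprime q) (hlt : p < q) (he : IsHJExpansion e (p / q))
    (hi : i ≤ e.length) (ρ : ℝ) : IsOpen {y | ∃ v ∈ polydisc ρ, HJOver e p q i y v} := by
  refine isOpen_iff_mem_nhds.2 fun y₀ ⟨v₀, hv₀, h₀⟩ => ?_
  filter_upwards [eventually_hjOver_mem_polydisc hpq hlt he hi hv₀ h₀] with y hy
  obtain ⟨v, hv⟩ := exists_hjOver hlt he hi y
  exact ⟨v, hy v hv, hv⟩

/-- Away from the fibre, the point of a Hirzebruch-Jung chart is an analytic function of the point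
of the orbifold chart. -/
lemma HJOver.exists_germ (hlt : p < q) (he : IsHJExpansion e (p / q))
    (hi : i ≤ e.length) (h : HJOver e p q i y v) (hv : v.1 ≠ 0) :
    ∃ F : ℂ × ℂ → ℂ × ℂ, AnalyticAt ℂ F v ∧ F v = y ∧ ∀ᶠ v' in 𝓝 v, HJOver e p q i (F v') v' := by
  have hq : 0 < q := by omega
  obtain ⟨h1, -, h3⟩ := h
  have hv' := continuous_fst.continuousAt.eventually_ne hv
  have hN : v.1 ^ q ≠ 0 := pow_ne_zero _ hv
  have hZa : AnalyticAt ℂ (fun v : ℂ × ℂ => v.1 ^ q) v := analyticAt_fst.pow _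
  have hWa : AnalyticAt ℂ (fun v : ℂ × ℂ => v.1 ^ (q - p) * v.2) v :=
    (analyticAt_fst.pow _).mul analyticAt_snd
  rcases Nat.eq_zero_or_pos i with rfl | hi0
  · simp only [hjSeq, zpow_zero, zpow_one, one_mul] at h1 h3
    refine ⟨fun v => (v.1 ^ (q - p) * v.2 / v.1 ^ q, v.1 ^ q), (hWa.div hZa hN).prod hZa, ?_, ?_⟩
    · have : y.2 ≠ 0 := h1 ▸ hN
      refine Prod.ext ?_ h1
      simp only [h1, h3]
      field_simp
    · filter_upwards [hv'] with v' hv'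
      have h4 := pow_ne_zero q hv'
      refine HJOver.of_eq hlt he hi hv' ?_ ?_ <;> simp only [hjSeq, zpow_zero, zpow_one, one_mul]
      field_simp
  · have ha : 0 < hjSeq e 0 1 i := by
      have := hjSeq_zero_one_pos he.1 (i := i - 1) (by omega)
      rwa [Nat.sub_add_cancel hi0] at this
    have ha' := hjSeq_zero_one_pos he.1 hi
    have hy1 : y.1 ≠ 0 := fun h0 => hN (by rw [h1, h0, zero_zpow _ ha.ne', zero_mul])
    have hy2 : y.2 ≠ 0 := fun h0 => hN (by rw [h1, h0, zero_zpow _ ha'.ne', mul_zero])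
    have hW : v.1 ^ (q - p) * v.2 ≠ 0 := by
      rw [h3]
      exact mul_ne_zero (zpow_ne_zero _ hy1) (zpow_ne_zero _ hy2)
    have hdet := hjSeq_det e 0 1 1 1 i
    set c : Cone := ((hjSeq e 0 1 i, hjSeq e 1 1 i), (hjSeq e 0 1 (i + 1), hjSeq e 1 1 (i + 1)))
    have hc : IsCone c := ⟨ha.le, ha'.le, by simp only [c]; linarith⟩
    have hm : mon c y = (v.1 ^ q, v.1 ^ (q - p) * v.2) := Prod.ext h1.symm h3.symm
    refine ⟨fun v => ((v.1 ^ q) ^ (-c.2.2) * (v.1 ^ (q - p) * v.2) ^ c.2.1,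
      (v.1 ^ q) ^ c.1.2 * (v.1 ^ (q - p) * v.2) ^ (-c.1.1)),
      ((hZa.zpow hN).mul (hWa.zpow hW)).prod ((hZa.zpow hN).mul (hWa.zpow hW)), ?_, ?_⟩
    · obtain ⟨h4, h5⟩ := hc.mon_injective hy1 hy2
      rw [hm] at h4 h5
      exact (Prod.ext h4 h5).symm
    · filter_upwards [hv', hWa.continuousAt.eventually_ne hW] with v' hv' hW'
      have hZ' := pow_ne_zero q hv'
      have key : ∀ Z W : ℂ, Z ≠ 0 → W ≠ 0 → ∀ i j : ℤ,
          (Z ^ (-c.2.2) * W ^ c.2.1) ^ i * (Z ^ c.1.2 * W ^ (-c.1.1)) ^ j =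
          Z ^ (-c.2.2 * i + c.1.2 * j) * W ^ (c.2.1 * i + -c.1.1 * j) := by
        intro Z W hZ hW i j
        rw [mul_zpow, mul_zpow, ← zpow_mul, ← zpow_mul, ← zpow_mul, ← zpow_mul, zpow_add₀ hZ,
          zpow_add₀ hW, mul_mul_mul_comm]
      have hd := hc.det
      refine HJOver.of_eq hlt he hi hv' ?_ ?_
      · refine Eq.symm ((key _ _ hZ' hW' c.1.1 c.2.1).trans ?_)
        rw [show -c.2.2 * c.1.1 + c.1.2 * c.2.1 = 1 by linarith,
          show c.2.1 * c.1.1 + -c.1.1 * c.2.1 = 0 by ring, zpow_one, zpow_zero, mul_one]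
      · refine Eq.symm ((key _ _ hZ' hW' c.1.2 c.2.2).trans ?_)
        rw [show -c.2.2 * c.1.2 + c.1.2 * c.2.2 = 0 by ring,
          show c.2.1 * c.1.2 + -c.1.1 * c.2.2 = 1 by linarith, zpow_one, zpow_zero, one_mul]

/-- Away from the fibre, the point of the orbifold chart is an analytic function of the point of a
Hirzebruch-Jung chart, for each choice of a root. -/
lemma HJOver.exists_germ_symm (hlt : p < q) (he : IsHJExpansion e (p / q))
    (hi : i ≤ e.length) (h : HJOver e p q i y v) (hv : v.1 ≠ 0) :
    ∃ G : ℂ × ℂ → ℂ × ℂ, AnalyticAt ℂ G y ∧ G y = v ∧ ∀ᶠ y' in 𝓝 y, HJOver e p q i y' (G y') := by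
  have hq : 0 < q := by omega
  obtain ⟨h1, -, h3⟩ := h
  have hN := analyticAt_monomial (hjSeq_zero_one_nonneg he.1 (i := i) (by omega))
    (hjSeq_zero_one_nonneg he.1 (i := i + 1) (by omega)) y
  have hN' := analyticAt_monomial (hjSeq_one_one_pos he.1 (i := i) (by omega)).le
    (hjSeq_one_one_pos he.1 (i := i + 1) (by omega)).le y
  obtain ⟨root, hroot, hroot0, hrootp⟩ := exists_analyticAt_pow_eq hN
    (by rw [← h1]; exact pow_ne_zero _ hv) hq.ne' h1
  have h0 : root y ≠ 0 := by rwa [hroot0]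
  refine ⟨fun y => (root y, (y.1 ^ hjSeq e 1 1 i * y.2 ^ hjSeq e 1 1 (i + 1)) / root y ^ (q - p)),
    hroot.prod (hN'.div (hroot.pow _) (pow_ne_zero _ h0)), ?_, ?_⟩
  · refine Prod.ext hroot0 ?_
    have := pow_ne_zero (q - p) hv
    simp only [hroot0, ← h3]
    field_simp
  · filter_upwards [hroot.continuousAt.eventually_ne h0] with y' hy'
    refine HJOver.of_eq hlt he hi hy' (hrootp y') ?_
    have := pow_ne_zero (q - p) hy'
    field_simp

end HJPoints

/-- The points of the resolution off the exceptional curves and the fibre. -/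
lemma RuledSurface.locMatch_affineChart_off {S : Type u} [TopologicalSpace S] [ChartedSpace ℂ S]
    [IsManifold 𝓘(ℂ) ω S] {𝒜 : Set S} {m : S → ℕ} {k : S → ℤ} {p : S → ℕ} {r : ℕ}
    {hw : OrbWeights 𝒜 m k p r} {φ : OrbChart S m 0} (h0 : φ.toFun 0 ∈ 𝒜)
    {R : ℂ × ℂ → S × ℂ} (hR : IsOrbRef hw φ R) {b : Bool} {e : List ℤ}
    (he : IsHJExpansion e ((sideWeight (m (φ.toFun 0)) (p (φ.toFun 0)) b : ℕ) / m (φ.toFun 0)))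
    {i : ℕ} (hi : i ≤ e.length) {y v : ℂ × ℂ} (hv : v.1 ∈ Metric.ball (0 : ℂ) φ.radius)
    (hv0 : v.1 ≠ 0)
    (h : HJOver e (sideWeight (m (φ.toFun 0)) (p (φ.toFun 0)) b) (m (φ.toFun 0)) i y v) :
    LocMatch (orbGen hw) (toric R (sideCone b e i)) (affineChart r φ b v) (flip b y) := by
  have hq := hw.order_pos (φ.toFun 0)
  have hlt := hw.sideWeight_lt h0 b
  obtain ⟨F, hF, rfl, hFH⟩ := h.exists_germ hlt he hi hv0
  obtain ⟨G, hG, hGv, hGH⟩ := h.exists_germ_symm hlt he hi hv0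
  obtain ⟨V, hV, hVinj⟩ := exists_injOn_pow hq hv0
  obtain ⟨U, hU, hUo, hvU⟩ : ∃ U : Set (ℂ × ℂ), (∀ y ∈ U, y.1 ∈ Metric.ball (0 : ℂ) φ.radius ∧
      y.1 ∈ V ∧ y.1 ≠ 0) ∧ IsOpen U ∧ v ∈ U := by
    refine eventually_nhds_iff.1 ?_
    filter_upwards [continuous_fst.continuousAt.eventually (Metric.isOpen_ball.mem_nhds hv),
      continuous_fst.continuousAt.eventually hV, continuous_fst.continuousAt.eventually_ne hv0]
      with y h1 h2 h3
    exact ⟨h1, h2, h3⟩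
  refine locMatch_affineChart_of_germs h0 hR he.1 hi hF hG hGv hFH hGH hUo hvU
    (fun y hy => (hU y hy).1) fun y hy y' hy' h => ?_
  obtain ⟨h1, h2, h3⟩ := hU y hy
  obtain ⟨h4, h5, h6⟩ := hU y' hy'
  obtain ⟨ζ, hζ, rfl⟩ := (affineChart_eq_iff hq h1 h4).1 h
  have h7 : ζ * y.1 = y.1 := hVinj h5 h2 (by simp only [mul_pow, hζ, one_mul])
  have h8 : ζ = 1 := mul_right_cancel₀ h3 (by rw [h7, one_mul])
  simp [h8]

/-! ### The map from a toric model to the orbifold ruled surface -/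

lemma HJOver.eq_last {e : List ℤ} {p q : ℕ} (hpq : p.Coprime q) (hlt : p < q)
    (he : IsHJExpansion e (p / q)) {i : ℕ} (hi : i ≤ e.length) {y : ℂ × ℂ} {w : ℂ} (hw : w ≠ 0)
    (h : HJOver e p q i y (0, w)) : i = e.length ∧ y = (w ^ q, 0) := by
  have hq : 0 < q := by omega
  obtain ⟨h1, h2, -⟩ := h
  have hw' : w ^ q ≠ 0 := pow_ne_zero _ hw
  simp only [zero_pow hq.ne'] at h1
  rcases hi.lt_or_eq with hi' | rfl
  · exfalso
    have h3 := (hjSeq_q_p_pos hq hpq he hi).ne'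
    have h4 := (hjSeq_q_p_pos hq hpq he (i := i + 1) hi').ne'
    have h5 : y.1 ≠ 0 := fun h0 => hw' (by rw [h2, h0, zero_zpow _ h3, zero_mul])
    have h6 : y.2 ≠ 0 := fun h0 => hw' (by rw [h2, h0, zero_zpow _ h4, mul_zero])
    exact mul_ne_zero (zpow_ne_zero _ h5) (zpow_ne_zero _ h6) h1.symm
  · obtain ⟨h3, h4⟩ := hjSeq_q_p_last hq hpq he
    simp only [h3, h4, zpow_one, zpow_zero, mul_one] at h2
    refine ⟨rfl, Prod.ext h2.symm ?_⟩
    by_contra h5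
    exact mul_ne_zero (zpow_ne_zero _ (h2 ▸ hw')) (zpow_ne_zero _ h5) h1.symm

section Limit

variable {S : Type*} {X Y : Type*} [TopologicalSpace X] [TopologicalSpace Y] {f : X → S × ℂ}
  {g : Y → S × ℂ} {x : X} {y y' : Y}

/-- The generic points near `x` have generic coordinates which belong to points near `y`. -/
def IsGenLimit (f : X → S × ℂ) (g : Y → S × ℂ) (x : X) (y : Y) : Prop :=
  ∀ V ∈ 𝓝 y, ∀ᶠ x' in 𝓝 x, (f x').2 ≠ 0 → ∃ y' ∈ V, g y' = f x'

lemma IsGenLimit.unique [T2Space Y] (hg : GenInj g) (hx : ∃ᶠ x' in 𝓝 x, (f x').2 ≠ 0)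
    (h : IsGenLimit f g x y) (h' : IsGenLimit f g x y') : y = y' := by
  by_contra hne
  obtain ⟨U, V, hU, hV, hyU, hyV, hUV⟩ := t2_separation hne
  obtain ⟨x', h1, h2, h3⟩ := (hx.and_eventually ((h U (hU.mem_nhds hyU)).and
    (h' V (hV.mem_nhds hyV)))).exists
  obtain ⟨y₁, h4, h5⟩ := h2 h1
  obtain ⟨y₂, h6, h7⟩ := h3 h1
  have h8 : y₁ = y₂ := hg (by rw [Set.mem_ofPred_eq, h5]; exact h1)
    (by rw [Set.mem_ofPred_eq, h7]; exact h1) (h5.trans h7.symm)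
  exact Set.disjoint_left.1 hUV h4 (h8 ▸ h6)

lemma LocMatch.isGenLimit [HolSpace X] [HolSpace Y] (h : LocMatch f g x y) :
    IsGenLimit f g x y := by
  intro V hV
  obtain ⟨e, -, hx, rfl, -, hm⟩ := h.exists_chart Filter.univ_mem
  filter_upwards [e.open_source.mem_nhds hx, (e.continuousAt hx).eventually hV] with x' h1 h2 _
  exact ⟨e x', h2, (hm x' h1).2⟩

end Limit

section ToricModel

variable {S : Type u} [TopologicalSpace S] [ChartedSpace ℂ S] {𝒜 : Set S} {m : S → ℕ}
  {k : S → ℤ} {p : S → ℕ} {r : ℕ}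

/-- The chart `i` of the Hirzebruch-Jung string at the centre of the orbifold chart `φ` maps `y` to
the class of `v`. -/
abbrev ChartOver (p : S → ℕ) (φ : OrbChart S m 0) (e : Bool → List ℤ) (b : Bool) (i : ℕ)
    (y v : ℂ × ℂ) : Prop :=
  HJOver (e b) (sideWeight (m (φ.toFun 0)) (p (φ.toFun 0)) b) (m (φ.toFun 0)) i y v

lemma proj_affineChart_notMem (hw : OrbWeights 𝒜 m k p r) {φ : OrbChart S m 0}
    {b : Bool} {v : ℂ × ℂ}     (hv : v ∈ polydisc φ.radius) (hv0 : v.1 ≠ 0) :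
    RuledSurface.proj r (RuledSurface.affineChart r φ b v) ∉ 𝒜 := by
  have hvb := mem_ball_zero_iff.2 hv.1
  rw [RuledSurface.proj_affineChart hvb]
  exact fun hA => hw.order_ne_one hA (φ.regular _ hvb hv0).1

variable [IsManifold 𝓘(ℂ) ω S]

/-- A surface with generic coordinates `f`, which look like those of the orbifold ruled surface
off the fibres over `𝒜`, and which has the charts of the Hirzebruch-Jung strings at these fibres. -/
structure IsToricModel {Y : Type u} [TopologicalSpace Y] [HolSpace Y] (hw : OrbWeights 𝒜 m k p r)
    (φ : S → OrbChart S m 0) (R : S → ℂ × ℂ → S × ℂ) (E : S → Bool → List ℤ) (f : Y → S × ℂ) :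
    Prop where
  inj : GenInj f
  center : ∀ x, (φ x).toFun 0 = x
  ref : ∀ x ∈ 𝒜, IsOrbRef hw (φ x) (R x)
  exp : ∀ x ∈ 𝒜, ∀ b, IsHJExpansion (E x b)
    ((sideWeight (m ((φ x).toFun 0)) (p ((φ x).toFun 0)) b : ℕ) / m ((φ x).toFun 0))
  off_left : ∀ q, (f q).1 ∉ 𝒜 → ∃ P, LocMatch f (orbGen hw) q P
  off_right : ∀ P, RuledSurface.proj r P ∉ 𝒜 → ∃ q, LocMatch f (orbGen hw) q P
  left : ∀ q, (f q).1 ∈ 𝒜 → ∃ b, ∃ i ≤ (E (f q).1 b).length, ∃ y,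
    (mon (sideCone b (E (f q).1 b) i) (flip b y)).1 = 0 ∧
      LocMatch f (toric (R (f q).1) (sideCone b (E (f q).1 b) i)) q (flip b y)
  right : ∀ x ∈ 𝒜, ∀ b, ∀ i ≤ (E x b).length, ∀ y,
    (mon (sideCone b (E x b) i) (flip b y)).1 = 0 →
      ∃ q, LocMatch f (toric (R x) (sideCone b (E x b) i)) q (flip b y)

variable {hw : OrbWeights 𝒜 m k p r} {Y : Type u} [TopologicalSpace Y]
  [HolSpace Y] {φ : S → OrbChart S m 0} {R : S → ℂ × ℂ → S × ℂ} {E : S → Bool → List ℤ}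
  {f : Y → S × ℂ} {π : Y → RuledSurface m 0 r} {x : S} {b : Bool} {i : ℕ} {y v : ℂ × ℂ} {q : Y}

lemma IsToricModel.center_mem (h : IsToricModel hw φ R E f) (hx : x ∈ 𝒜) : (φ x).toFun 0 ∈ 𝒜 := by
  rwa [h.center]

lemma IsToricModel.isOpen_over (h : IsToricModel hw φ R E f) (hx : x ∈ 𝒜)
    (hi : i ≤ (E x b).length) (ρ : ℝ) :
    IsOpen {y | ∃ v ∈ polydisc ρ, ChartOver p (φ x) (E x) b i y v} :=
  isOpen_hjOver (hw.sideWeight_coprime (h.center_mem hx) b) (hw.sideWeight_lt (h.center_mem hx) b)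
    (h.exp x hx b) hi ρ

/-- A point of a Hirzebruch-Jung chart over a point other than the origin matches that point. -/
lemma IsToricModel.locMatch_affineChart (h : IsToricModel hw φ R E f) (hx : x ∈ 𝒜)
    (hi : i ≤ (E x b).length) (hv : v ∈ polydisc (φ x).radius) (hv0 : v ≠ 0)
    (hy : ChartOver p (φ x) (E x) b i y v) :
    LocMatch (orbGen hw) (toric (R x) (sideCone b (E x b) i)) (RuledSurface.affineChart r (φ x) b v)
      (flip b y) := by
  have h0 := h.center_mem hx
  by_cases hv1 : v.1 = 0
  · obtain ⟨_, w⟩ := v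
    obtain rfl : _ = (0 : ℂ) := hv1
    have hw0 : w ≠ 0 := by
      rintro rfl
      exact hv0 rfl
    obtain ⟨rfl, rfl⟩ := hy.eq_last (hw.sideWeight_coprime h0 b) (hw.sideWeight_lt h0 b)
      (h.exp x hx b) hi hw0
    exact RuledSurface.locMatch_affineChart_middle h0 (h.ref x hx) (h.exp x hx b) hw0
  · exact RuledSurface.locMatch_affineChart_off h0 (h.ref x hx) (h.exp x hx b) hi
      (mem_ball_zero_iff.2 hv.1) hv1 hy

lemma IsToricModel.exists_locMatch (h : IsToricModel hw φ R E f) (hx : x ∈ 𝒜)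
    (hi : i ≤ (E x b).length) (hv : v ∈ polydisc (φ x).radius)
    (hy : ChartOver p (φ x) (E x) b i y v) :
    ∃ q, LocMatch f (toric (R x) (sideCone b (E x b) i)) q (flip b y) := by
  by_cases hv1 : v.1 = 0
  · refine h.right x hx b i hi y ?_
    rw [mon_sideCone, ← hy.1, hv1, zero_pow (hw.order_pos _).ne']
  · obtain ⟨q, hq⟩ := h.off_right _ (proj_affineChart_notMem (b := b) hw hv hv1)
    exact ⟨q, hq.trans (h.locMatch_affineChart hx hi hv (fun h0 => hv1 (by rw [h0]; rfl)) hy)⟩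

/-- A point of a toric model matches a smooth point of the orbifold ruled surface, or it lies in a
Hirzebruch-Jung chart over the origin. -/
lemma IsToricModel.exists_or (h : IsToricModel hw φ R E f) (q : Y) :
    (∃ P ∉ RuledSurface.singularSet (m := m) (d := 0) r, LocMatch f (orbGen hw) q P) ∨ ((f q).1 ∈ 𝒜 ∧ ∃ b, ∃ i ≤ (E (f q).1 b).length, ∃ y,
      ChartOver p (φ (f q).1) (E (f q).1) b i y 0 ∧
        LocMatch f (toric (R (f q).1) (sideCone b (E (f q).1 b) i)) q (flip b y)) := by
  by_cases hx : (f q).1 ∈ 𝒜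
  · have h0 := h.center_mem hx
    obtain ⟨b, i, hi, y, hy, hm⟩ := h.left q hx
    by_cases hmid : i = (E (f q).1 b).length ∧ y.1 ≠ 0
    · obtain ⟨rfl, hne⟩ := hmid
      obtain ⟨w, hw1⟩ := IsAlgClosed.exists_pow_nat_eq y.1 (hw.order_pos ((φ (f q).1).toFun 0))
      have hw0 : w ≠ 0 := by
        rintro rfl
        rw [zero_pow (hw.order_pos _).ne'] at hw1
        exact hne hw1.symm
      have h1 := flip_eq_of_mon_eq_zero hy (by rwa [flip_flip])
      rw [flip_flip] at h1
      rw [h1, ← hw1] at hm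
      exact Or.inl ⟨_, RuledSurface.affineChart_notMem_singularSet hw hw0, hm.trans (RuledSurface.locMatch_affineChart_middle h0 (h.ref _ hx)
        (h.exp _ hx b) hw0).symm⟩
    · rw [mon_sideCone] at hy
      refine Or.inr ⟨hx, b, i, hi, y, hjOver_zero (hw.sideWeight_pos h0 b)
        (hw.sideWeight_coprime h0 b) (hw.sideWeight_lt h0 b) (h.exp _ hx b) hi hy fun h => ?_, hm⟩
      by_contra h2
      exact hmid ⟨h, h2⟩
  · obtain ⟨P, hP⟩ := h.off_left q hx
    rw [← hP.eq, orbGen_fst] at hx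
    exact Or.inl ⟨P, notMem_singularSet_of_proj hw hx, hP⟩

/-- The points near a point over the origin lie in the same chart, over points near the origin. -/
lemma IsToricModel.eventually_near (h : IsToricModel hw φ R E f) (hx : x ∈ 𝒜)
    (hi : i ≤ (E x b).length) (hy : ChartOver p (φ x) (E x) b i y 0)
    (hm : LocMatch f (toric (R x) (sideCone b (E x b) i)) q (flip b y))
    {V : Set (RuledSurface m 0 r)} (hV : V ∈ 𝓝 (RuledSurface.affineChart r (φ x) b 0)) :
    ∀ᶠ q' in 𝓝 q, ∃ y' v', v' ∈ polydisc (φ x).radius ∧ RuledSurface.affineChart r (φ x) b v' ∈ V ∧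
      ChartOver p (φ x) (E x) b i y' v' ∧
      LocMatch f (toric (R x) (sideCone b (E x b) i)) q' (flip b y') := by
  have h0 := h.center_mem hx
  have hc : ContinuousAt (RuledSurface.affineChart r (φ x) b) 0 :=
    RuledSurface.continuousAt_affineChart (φ x).zero_mem
  obtain ⟨ε, hε, hεV⟩ := Metric.mem_nhds_iff.1 (hc.preimage_mem_nhds hV)
  have hρ : 0 < min ε (φ x).radius := lt_min hε (φ x).radius_pos
  have h1 := eventually_hjOver_mem_polydisc (hw.sideWeight_coprime h0 b) (hw.sideWeight_lt h0 b)
    (h.exp x hx b) hi (v₀ := 0) (ρ := min ε (φ x).radius) (by simp [polydisc, hε, (φ x).radius_pos]) hy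
  obtain ⟨e, -, hqe, heq, -, he⟩ := hm.exists_chart Filter.univ_mem
  have h2 : Filter.Tendsto (fun q' => flip b (e q')) (𝓝 q) (𝓝 y) := by
    have h3 := ((isBihol_flip b).analyticAt (x := flip b y)
      (by rw [flip_source]; trivial)).continuousAt
    rw [← heq] at h3
    have h4 := h3.tendsto.comp (e.continuousAt hqe)
    rwa [heq, flip_flip] at h4
  filter_upwards [h2.eventually h1, e.open_source.mem_nhds hqe] with q' h3 h4
  obtain ⟨v, hv⟩ := exists_hjOver (hw.sideWeight_lt h0 b)
    (h.exp x hx b) hi (flip b (e q'))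
  obtain ⟨h5, h6⟩ := h3 v hv
  refine ⟨flip b (e q'), v, ⟨h5.trans_le (min_le_right _ _), h6.trans_le (min_le_right _ _)⟩,
    hεV ?_, hv, ?_⟩
  · rw [mem_ball_zero_iff]
    exact max_lt (h5.trans_le (min_le_left _ _)) (h6.trans_le (min_le_left _ _))
  · rw [flip_flip]
    exact (he q' h4).1

lemma IsToricModel.isGenLimit_zero (h : IsToricModel hw φ R E f) (hx : x ∈ 𝒜)
    (hi : i ≤ (E x b).length) (hy : ChartOver p (φ x) (E x) b i y 0)
    (hm : LocMatch f (toric (R x) (sideCone b (E x b) i)) q (flip b y)) :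
    IsGenLimit f (orbGen hw) q (RuledSurface.affineChart r (φ x) b 0) := by
  intro V hV
  filter_upwards [h.eventually_near hx hi hy hm hV]
  rintro q' ⟨y', v', hv', hV', hy', hm'⟩ -
  refine ⟨_, hV', ?_⟩
  rw [← hm'.eq, (h.ref x hx).gen_eq b _ (mem_ball_zero_iff.2 hv'.1)]
  exact (toric_sideCone (h.ref x hx).isRef (hw.order_pos _) (hw.lt _ (h.center_mem hx)).le hy').symm

lemma IsToricModel.exists_isGenLimit (h : IsToricModel hw φ R E f) (q : Y) :
    ∃ P, IsGenLimit f (orbGen hw) q P := by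
  rcases h.exists_or q with ⟨P, -, hP⟩ | ⟨hx, b, i, hi, y, hy, hm⟩
  · exact ⟨P, hP.isGenLimit⟩
  · exact ⟨_, h.isGenLimit_zero hx hi hy hm⟩

lemma IsToricModel.eq_of_isGenLimit [T2Space (RuledSurface m 0 r)] (h : IsToricModel hw φ R E f)
    {P P' : RuledSurface m 0 r} (hP : IsGenLimit f (orbGen hw) q P)
    (hP' : IsGenLimit f (orbGen hw) q P') : P = P' := by
  refine hP.unique (genInj_orbGen hw) ?_ hP'
  rcases h.exists_or q with ⟨P, -, hP⟩ | ⟨hx, b, i, hi, y, hy, hm⟩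
  · exact hP.frequently_generic
  · exact hm.frequently_generic

variable [T2Space (RuledSurface m 0 r)]

lemma IsToricModel.map_eq (h : IsToricModel hw φ R E f)
    (hπ : ∀ q, IsGenLimit f (orbGen hw) q (π q)) (hx : x ∈ 𝒜) (hi : i ≤ (E x b).length)
    (hv : v ∈ polydisc (φ x).radius) (hy : ChartOver p (φ x) (E x) b i y v)
    (hm : LocMatch f (toric (R x) (sideCone b (E x b) i)) q (flip b y)) :
    π q = RuledSurface.affineChart r (φ x) b v := by
  refine h.eq_of_isGenLimit (hπ q) ?_
  rcases eq_or_ne v 0 with rfl | hv0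
  · exact h.isGenLimit_zero hx hi hy hm
  · exact (hm.trans (h.locMatch_affineChart hx hi hv hv0 hy).symm).isGenLimit

lemma IsToricModel.continuous (h : IsToricModel hw φ R E f)
    (hπ : ∀ q, IsGenLimit f (orbGen hw) q (π q)) : Continuous π := by
  refine continuous_iff_continuousAt.2 fun q => ?_
  rcases h.exists_or q with ⟨P, -, hP⟩ | ⟨hx, b, i, hi, y, hy, hm⟩
  · obtain ⟨e, -, hqe, -, -, he⟩ := hP.exists_chart Filter.univ_mem
    refine (e.continuousAt hqe).congr ?_
    filter_upwards [e.open_source.mem_nhds hqe] with q' hq'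
    exact h.eq_of_isGenLimit (he q' hq').1.isGenLimit (hπ q')
  · intro V hV
    rw [h.eq_of_isGenLimit (hπ q) (h.isGenLimit_zero hx hi hy hm)] at hV
    rw [Filter.mem_map]
    filter_upwards [h.eventually_near hx hi hy hm hV]
    rintro q' ⟨y', v', hv', hV', hy', hm'⟩
    rwa [Set.mem_preimage, h.map_eq hπ hx hi hv' hy' hm']

/-- Over the smooth points of the orbifold ruled surface, the surfaces match. -/
lemma IsToricModel.locMatch_of_notMem (h : IsToricModel hw φ R E f)
    (hπ : ∀ q, IsGenLimit f (orbGen hw) q (π q))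
    (hq : π q ∉ RuledSurface.singularSet (m := m) (d := 0) r) :
    LocMatch f (orbGen hw) q (π q) := by
  rcases h.exists_or q with ⟨P, -, hP⟩ | ⟨hx, b, i, hi, y, hy, hm⟩
  · rwa [← h.eq_of_isGenLimit hP.isGenLimit (hπ q)]
  · rw [h.eq_of_isGenLimit (hπ q) (h.isGenLimit_zero hx hi hy hm)] at hq
    exact absurd (RuledSurface.affineChart_zero_mem_singularSet hw _ (h.center_mem hx) b) hq

lemma IsToricModel.isClosed_singularSet (h : IsToricModel hw φ R E f) (h𝒜 : 𝒜.Finite) :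
    IsClosed (RuledSurface.singularSet (m := m) (d := 0) r) := by
  refine Set.Finite.isClosed (((h𝒜.prod (Set.finite_univ (α := Bool))).image fun xb =>
    RuledSurface.affineChart r (φ xb.1) xb.2 0).subset fun P hP => ?_)
  obtain ⟨h1, h2⟩ := RuledSurface.exists_eq_affineChart_zero hw hP
  obtain ⟨b, hb⟩ := h2 (φ _) (h.center _)
  exact ⟨(_, b), ⟨h1, trivial⟩, hb.symm⟩

lemma IsToricModel.exists_map_eq (h : IsToricModel hw φ R E f)
    (hπ : ∀ q, IsGenLimit f (orbGen hw) q (π q)) {P : RuledSurface m 0 r}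
    (hP : P ∉ RuledSurface.singularSet (m := m) (d := 0) r) : ∃ q, π q = P := by
  suffices h1 : ∃ q, LocMatch f (orbGen hw) q P by
    obtain ⟨q, hq⟩ := h1
    exact ⟨q, h.eq_of_isGenLimit (hπ q) hq.isGenLimit⟩
  by_cases hx : RuledSurface.proj r P ∈ 𝒜
  · obtain ⟨b, t, ht⟩ := RuledSurface.exists_eq_affineChart hw.order_pos
      (φ (RuledSurface.proj r P)) (φ _).zero_mem (Or.inl rfl) (P := P) (h.center _).symm
    have h0 := h.center_mem hx
    have ht0 : t ≠ 0 := by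
      rintro rfl
      refine hP ?_
      rw [ht]
      exact RuledSurface.affineChart_zero_mem_singularSet hw _ h0 b
    have h1 := RuledSurface.locMatch_affineChart_middle h0 (h.ref _ hx) (h.exp _ hx b) ht0
    obtain ⟨q, hq⟩ := h.right _ hx b _ le_rfl _ (mon_sideCone_last b (h.exp _ hx b).1 _)
    rw [← ht] at h1
    exact ⟨q, hq.trans h1.symm⟩
  · exact h.off_right P hx

lemma IsToricModel.isBiholOver (h : IsToricModel hw φ R E f)
    (hπ : ∀ q, IsGenLimit f (orbGen hw) q (π q)) [T2Space Y] [Nonempty S] (h𝒜 : 𝒜.Finite) :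
    IsBiholOver π (RuledSurface.singularSet (m := m) (d := 0) r)ᶜ := by
  have hne : (π ⁻¹' (RuledSurface.singularSet (m := m) (d := 0) r)ᶜ).Nonempty := by
    obtain ⟨x⟩ := ‹Nonempty S›
    obtain ⟨q, hq⟩ := h.exists_map_eq hπ (RuledSurface.affineChart_notMem_singularSet (φ := φ x)
      (b := false) hw one_ne_zero)
    refine ⟨q, ?_⟩
    rw [Set.mem_preimage, hq]
    exact RuledSurface.affineChart_notMem_singularSet hw one_ne_zero
  obtain ⟨e, he, hes, hem⟩ := exists_openPartialHomeomorph_of_locMatch h.inj (genInj_orbGen hw)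
    ((h.isClosed_singularSet h𝒜).isOpen_compl.preimage (h.continuous hπ)) hne
    fun q hq => ⟨π q, h.locMatch_of_notMem hπ hq⟩
  have heq : Set.EqOn π e e.source := fun q hq =>
    h.eq_of_isGenLimit (hπ q) (hem q (hes ▸ hq)).isGenLimit
  refine ⟨e, hes, ?_, heq, he⟩
  rw [← e.image_source_eq_target, ← heq.image_eq, hes, Set.image_preimage_eq_iff]
  intro P hP
  exact h.exists_map_eq hπ hP

end ToricModel

/-! ### Toric models are Hirzebruch-Jung resolutions -/

section Gluing

/-- The gluing of two consecutive Hirzebruch-Jung charts. -/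
def hjGlue (n : ℤ) (y : ℂ × ℂ) : ℂ × ℂ := (y.2 * y.1 ^ n, y.1⁻¹)

variable {S : Type u} {x : S} {ρ : ℝ} {R : ℂ × ℂ → S × ℂ} {b : Bool} {e : List ℤ} {i : ℕ}
  {y y' : ℂ × ℂ}

lemma mon_hjGlue (b : Bool) (e : List ℤ) (i : ℕ) (hy : y.1 ≠ 0) :
    mon (sideCone b e (i + 1)) (flip b (hjGlue (e.getD i 0) y)) =
      mon (sideCone b e i) (flip b y) := by
  have key : ∀ a c : ℤ, (y.2 * y.1 ^ e.getD i 0) ^ hjSeq e a c (i + 1) *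
      y.1⁻¹ ^ hjSeq e a c (i + 1 + 1) = y.1 ^ hjSeq e a c i * y.2 ^ hjSeq e a c (i + 1) := by
    intro a c
    rw [mul_zpow, ← zpow_mul, inv_zpow', mul_assoc, ← zpow_add₀ hy, mul_comm, hjSeq_add_two]
    congr 2
    ring
  rw [mon_sideCone, mon_sideCone]
  simp only [hjGlue, key]

lemma IsRef.locMatch_hjGlue (hR : IsRef x ρ R) (he : ∀ x ∈ e, 2 ≤ x) (hi : i < e.length)
    (hy : y.1 ≠ 0) (hρ : ‖(mon (sideCone b e i) (flip b y)).1‖ < ρ) :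
    LocMatch (toric R (sideCone b e i)) (toric R (sideCone b e (i + 1))) (flip b y)
      (flip b (hjGlue (e.getD i 0) y)) := by
  set n := e.getD i 0 with hn
  have hc := isCone_sideCone b he hi.le
  have hc' := isCone_sideCone b he (i := i + 1) hi
  have hfa : ∀ z, AnalyticAt ℂ (flip b) z := fun z =>
    (isBihol_flip b).analyticAt (by rw [flip_source]; trivial)
  have hfc : ∀ z, Filter.Tendsto (flip b) (𝓝 (flip b z)) (𝓝 z) := fun z => by
    have := (hfa (flip b z)).continuousAt.tendsto
    rwa [flip_flip] at this
  have hg : AnalyticAt ℂ (hjGlue n) y :=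
    (analyticAt_snd.mul (analyticAt_fst.zpow hy)).prod (analyticAt_fst.inv hy)
  have hy2 : (hjGlue n y).2 ≠ 0 := inv_ne_zero hy
  have hg' : AnalyticAt ℂ (fun z : ℂ × ℂ => (z.2⁻¹, z.1 * z.2 ^ n)) (hjGlue n y) :=
    (analyticAt_snd.inv hy2).prod (analyticAt_fst.mul (analyticAt_snd.zpow hy2))
  have hρ' : ‖(mon (sideCone b e (i + 1)) (flip b (hjGlue n y))).1‖ < ρ := by
    rwa [hn, mon_hjGlue b e i hy]
  have h := LocMatch.of_germs (F := fun z => flip b (hjGlue n (flip b z)))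
    (G := fun z => flip b (((flip b z).2⁻¹, (flip b z).1 * (flip b z).2 ^ n)))
    (y := flip b y) (hR.genInj_toric hc) (hR.genInj_toric hc') ?_ ?_ ?_ ?_ ?_ ?_
  · simpa only [flip_flip] using h
  · exact (hfa _).comp (AnalyticAt.comp (g := hjGlue n) (by rwa [flip_flip]) (hfa _))
  · refine (hfa _).comp (AnalyticAt.comp (g := fun z : ℂ × ℂ => (z.2⁻¹, z.1 * z.2 ^ n)) ?_ (hfa _))
    simpa only [flip_flip] using hg'
  · filter_upwards [(hfc y).eventually (continuous_fst.continuousAt.eventually_ne hy)] with z hz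
    rw [toric, hn, mon_hjGlue b e i hz, flip_flip]
    rfl
  · simp only [flip_flip]
    filter_upwards [(hfc _).eventually (continuous_snd.continuousAt.eventually_ne hy2)] with z hz
    have h1 : hjGlue n ((flip b z).2⁻¹, (flip b z).1 * (flip b z).2 ^ n) = flip b z := by
      refine Prod.ext ?_ (inv_inv _)
      simp only [hjGlue]
      rw [mul_assoc, ← mul_zpow, mul_inv_cancel₀ hz, one_zpow, mul_one]
    rw [toric, ← mon_hjGlue b e i (inv_ne_zero hz), ← hn, h1, flip_flip]
    rfl
  · exact (hc.continuous_mon_fst.norm.continuousAt.eventually_lt continuousAt_const hρ).mono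
      fun z hz => hR.mem_closure hc hz
  · simp only [flip_flip]
    exact (hc'.continuous_mon_fst.norm.continuousAt.eventually_lt continuousAt_const hρ').mono
      fun z hz => hR.mem_closure hc' hz

/-- Points of consecutive charts that match correspond to each other under the gluing. -/
lemma IsRef.eq_hjGlue (hR : IsRef x ρ R) (he : ∀ x ∈ e, 2 ≤ x) (hi : i < e.length)
    (hρ : ‖(mon (sideCone b e i) (flip b y)).1‖ < ρ)
    (h : LocMatch (toric R (sideCone b e i)) (toric R (sideCone b e (i + 1))) (flip b y)
      (flip b y')) : y.1 ≠ 0 ∧ y' = hjGlue (e.getD i 0) y := by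
  have hc := isCone_sideCone b he hi.le
  have hc' := isCone_sideCone b he (i := i + 1) hi
  have hf : Continuous (flip b) := by
    have := (flip b).continuousOn
    rwa [flip_source, continuousOn_univ] at this
  -- `s t' = 1` holds at the generic points, hence at all points
  have h1 : y.1 * y'.2 = 1 := by
    by_contra hne
    have hfr := h.frequently_generic
    obtain ⟨ε, -, hyε, hεy, -, hε⟩ := h.exists_chart Filter.univ_mem
    have h2 : ContinuousAt (fun z => (flip b z).1 * (flip b (ε z)).2) (flip b y) :=
      (continuous_fst.comp hf).continuousAt.mul
        ((continuous_snd.comp hf).continuousAt.comp (ε.continuousAt hyε))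
    obtain ⟨z, hz, hzne, hzε⟩ := (hfr.and_eventually ((h2.eventually_ne (y := (1 : ℂ))
      (by rwa [hεy, flip_flip, flip_flip])).and (ε.open_source.mem_nhds hyε))).exists
    have h3 := (hR.generic _ _).1 hz
    have h4 : (flip b z).1 ≠ 0 := by
      obtain ⟨h5, h6⟩ := hc.ne_zero_of_mon h3.1 h3.2.2
      rw [flip_apply]
      split_ifs
      exacts [h6, h5]
    have h5 : toric R (sideCone b e (i + 1)) (flip b (hjGlue (e.getD i 0) (flip b z))) =
        toric R (sideCone b e i) z := by
      rw [toric, mon_hjGlue b e i h4, flip_flip]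
      rfl
    have h6 := hR.genInj_toric hc' (by rw [Set.mem_ofPred_eq, h5]; exact hz)
      (by rw [Set.mem_ofPred_eq, (hε z hzε).2]; exact hz) (h5.trans (hε z hzε).2.symm)
    refine hzne ?_
    rw [← h6, flip_flip]
    exact mul_inv_cancel₀ h4
  have hy : y.1 ≠ 0 := left_ne_zero_of_mul (h1 ▸ one_ne_zero)
  refine ⟨hy, ?_⟩
  have h2 := h.unique (hR.genInj_toric hc') (hR.locMatch_hjGlue he hi hy hρ)
  rw [← flip_flip b y', h2, flip_flip]

end Gluing

section ToricModel

variable {S : Type u} [TopologicalSpace S] [ChartedSpace ℂ S] [IsManifold 𝓘(ℂ) ω S] {𝒜 : Set S}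
  {m : S → ℕ} {k : S → ℤ} {p : S → ℕ} {r : ℕ} {hw : OrbWeights 𝒜 m k p r} {Y : Type u}
  [TopologicalSpace Y] [T2Space Y] [HolSpace Y] {φ : S → OrbChart S m 0} {R : S → ℂ × ℂ → S × ℂ}
  {E : S → Bool → List ℤ} {f : Y → S × ℂ} {π : Y → RuledSurface m 0 r} {x : S} {b : Bool} {i : ℕ}

lemma IsToricModel.exists_chart (h : IsToricModel hw φ R E f) (hx : x ∈ 𝒜)
    (hi : i ≤ (E x b).length) : ∃ c : OpenPartialHomeomorph Y (ℂ × ℂ), IsHolChart c ∧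
      c.target = {y | ∃ v ∈ polydisc (φ x).radius, ChartOver p (φ x) (E x) b i y v} ∧
      ∀ y ∈ c.target, LocMatch f (toric (R x) (sideCone b (E x b) i)) (c.symm y) (flip b y) := by
  have h0 := h.center_mem hx
  have hcone := isCone_sideCone b (h.exp x hx b).1 hi
  have hf : Continuous (flip b) := by
    have := (flip b).continuousOn
    rwa [flip_source, continuousOn_univ] at this
  have hne : (flip b ⁻¹' {y | ∃ v ∈ polydisc (φ x).radius,
      ChartOver p (φ x) (E x) b i y v}).Nonempty := by
    refine ⟨flip b 0, 0, by simp [polydisc, (φ x).radius_pos], hjOver_zero (hw.sideWeight_pos h0 b)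
      (hw.sideWeight_coprime h0 b) (hw.sideWeight_lt h0 b) (h.exp x hx b) hi ?_ fun _ => ?_⟩
    · have h1 := hcone.mon_zero
      rw [← flip_flip b 0, mon_sideCone] at h1
      rwa [flip_flip, show (0 : ℂ × ℂ) = flip b 0 by cases b <;> simp [flip_apply]]
    · rw [flip_flip]
      rfl
  obtain ⟨e, he, hes, hem⟩ := exists_openPartialHomeomorph_of_locMatch
    ((h.ref x hx).isRef.genInj_toric hcone) h.inj
    ((h.isOpen_over hx hi (φ x).radius).preimage hf) hne fun z ⟨v, hv, hz⟩ => by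
      obtain ⟨q, hq⟩ := h.exists_locMatch hx hi hv hz
      rw [flip_flip] at hq
      exact ⟨q, hq.symm⟩
  have ht : ((flip b).trans e).source = {y | ∃ v ∈ polydisc (φ x).radius,
      ChartOver p (φ x) (E x) b i y v} := by
    ext y
    rw [OpenPartialHomeomorph.trans_source, flip_source, hes, Set.univ_inter, Set.mem_preimage,
      Set.mem_preimage, flip_flip]
  refine ⟨((flip b).trans e).symm, isBihol_iff_isHolChart.1 ((isBihol_flip b).trans he).symm, ht,
    fun y hy => ?_⟩
  have hy' : y ∈ ((flip b).trans e).source := hy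
  rw [ht] at hy'
  exact (hem (flip b y) (by rwa [Set.mem_preimage, flip_flip])).symm

lemma IsToricModel.isHJModel [T2Space (RuledSurface m 0 r)] (h : IsToricModel hw φ R E f)
    (hπ : ∀ q, IsGenLimit f (orbGen hw) q (π q)) (hx : x ∈ 𝒜) (b : Bool) :
    IsHJModel π (RuledSurface.affineChart r (φ x) b) (φ x).radius
      (sideWeight (m ((φ x).toFun 0)) (p ((φ x).toFun 0)) b) (m ((φ x).toFun 0)) := by
  have h0 := h.center_mem hx
  have hq := hw.order_pos ((φ x).toFun 0)
  have hlt := hw.sideWeight_lt h0 b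
  have hex := h.exp x hx b
  have hch : ∀ i, ∃ c : OpenPartialHomeomorph Y (ℂ × ℂ), i ≤ (E x b).length → IsHolChart c ∧
      c.target = {y | ∃ v ∈ polydisc (φ x).radius, ChartOver p (φ x) (E x) b i y v} ∧
      ∀ y ∈ c.target, LocMatch f (toric (R x) (sideCone b (E x b) i)) (c.symm y) (flip b y) := by
    intro i
    by_cases hi : i ≤ (E x b).length
    · obtain ⟨c, hc⟩ := h.exists_chart hx hi
      exact ⟨c, fun _ => hc⟩
    · obtain ⟨c, -⟩ := h.exists_chart (b := b) hx (Nat.zero_le _)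
      exact ⟨c, fun h => absurd h hi⟩
  choose c hc using hch
  have hover : ∀ i ≤ (E x b).length, ∀ y ∈ (c i).target, ∀ v ∈ polydisc (φ x).radius,
      ChartOver p (φ x) (E x) b i y v →
      π ((c i).symm y) = RuledSurface.affineChart r (φ x) b v :=
    fun i hi y hy v hv hyv => h.map_eq hπ hx hi hv hyv ((hc i hi).2.2 y hy)
  have hnorm : ∀ i ≤ (E x b).length, ∀ y ∈ (c i).target,
      ‖(mon (sideCone b (E x b) i) (flip b y)).1‖ < (φ x).radius ^ m ((φ x).toFun 0) := by
    intro i hi y hy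
    rw [(hc i hi).2.1] at hy
    obtain ⟨v, hv, hyv⟩ := hy
    rw [mon_sideCone, ← hyv.1, norm_pow]
    exact pow_lt_pow_left₀ hv.1 (norm_nonneg _) hq.ne'
  refine ⟨E x b, c, hex, fun i hi => (hc i hi).1, ?_, fun i hi => (hc i hi).2.1, hover, ?_⟩
  · ext q
    simp only [Set.mem_iUnion]
    constructor
    · rintro ⟨v, hv, hvq⟩
      suffices hm : ∃ i ≤ (E x b).length, ∃ y, ∃ v ∈ polydisc (φ x).radius,
          ChartOver p (φ x) (E x) b i y v ∧
          LocMatch f (toric (R x) (sideCone b (E x b) i)) q (flip b y) by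
        obtain ⟨i, hi, y, v, hv, hyv, hm⟩ := hm
        obtain ⟨-, h2, h3⟩ := hc i hi
        have h4 : y ∈ (c i).target := by
          rw [h2]
          exact ⟨v, hv, hyv⟩
        rw [hm.unique_left h.inj (h3 y h4)]
        exact ⟨i, hi, (c i).map_target h4⟩
      rcases eq_or_ne v 0 with rfl | hv0
      · have hsing : π q ∈ RuledSurface.singularSet (m := m) (d := 0) r := by
          rw [← hvq]
          exact RuledSurface.affineChart_zero_mem_singularSet hw _ h0 b
        rcases h.exists_or q with ⟨P, hPs, hP⟩ | ⟨hx', b', i, hi, y, hy, hm⟩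
        · rw [h.eq_of_isGenLimit (hπ q) hP.isGenLimit] at hsing
          exact absurd hsing hPs
        · have h1 := hvq.trans (h.eq_of_isGenLimit (hπ q) (h.isGenLimit_zero hx' hi hy hm))
          obtain rfl := RuledSurface.eq_of_affineChart_zero h1
          have h2 := congrArg (RuledSurface.proj r) h1
          rw [RuledSurface.proj_affineChart (y := 0) (φ _).zero_mem,
            RuledSurface.proj_affineChart (y := 0) (φ _).zero_mem, Prod.fst_zero, h.center,
            h.center] at h2
          subst h2
          exact ⟨i, hi, y, 0, hv, hy, hm⟩
      · suffices hi : ∃ i ≤ (E x b).length, ∃ y, ChartOver p (φ x) (E x) b i y v by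
          obtain ⟨i, hi, y, hyv⟩ := hi
          have h1 := h.locMatch_affineChart hx hi hv hv0 hyv
          have h2 : LocMatch f (orbGen hw) q (π q) := by
            refine h.locMatch_of_notMem hπ ?_
            rw [← hvq]
            by_cases hv1 : v.1 = 0
            · obtain ⟨_, w⟩ := v
              obtain rfl : _ = (0 : ℂ) := hv1
              refine RuledSurface.affineChart_notMem_singularSet hw ?_
              rintro rfl
              exact hv0 rfl
            · exact notMem_singularSet_of_proj hw (proj_affineChart_notMem hw hv hv1)
          rw [← hvq] at h2
          exact ⟨i, hi, y, v, hv, hyv, h2.trans h1⟩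
        by_cases hv1 : v.1 = 0
        · obtain ⟨z, w⟩ := v
          have hw0 : w ≠ 0 := by
            rintro rfl
            exact hv0 (Prod.ext hv1 rfl)
          exact ⟨_, le_rfl, _, hjOver_last hq (hw.sideWeight_coprime h0 b) hlt hex hw0⟩
        · have h1 := pow_ne_zero (m ((φ x).toFun 0)) hv1
          refine ⟨0, Nat.zero_le _, (v.1 ^ (m ((φ x).toFun 0) - sideWeight (m ((φ x).toFun 0))
            (p ((φ x).toFun 0)) b) * v.2 / v.1 ^ m ((φ x).toFun 0), v.1 ^ m ((φ x).toFun 0)),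
            HJOver.of_eq hlt hex (Nat.zero_le _) hv1 ?_ ?_⟩ <;>
            simp only [hjSeq, zpow_zero, zpow_one, one_mul]
          field_simp
    · rintro ⟨i, hi, hqi⟩
      have h1 := (c i).map_source hqi
      have h2 := h1
      rw [(hc i hi).2.1] at h2
      obtain ⟨v, hv, hyv⟩ := h2
      refine ⟨v, hv, ?_⟩
      rw [← hover i hi _ h1 v hv hyv, (c i).left_inv hqi]
  · intro i hi y hy y' hy'
    have hm := (hc i hi.le).2.2 y hy
    have hm' := (hc (i + 1) hi).2.2 y' hy'
    constructor
    · intro heq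
      rw [← heq] at hm'
      exact (h.ref x hx).isRef.eq_hjGlue hex.1 hi (hnorm i hi.le y hy) (hm.symm.trans hm')
    · rintro ⟨hy1, hyy⟩
      have h1 := (h.ref x hx).isRef.locMatch_hjGlue hex.1 hi hy1 (hnorm i hi.le y hy)
      rw [show hjGlue ((E x b).getD i 0) y = y' from hyy.symm] at h1
      exact (hm.trans h1).unique_left h.inj hm'

end ToricModel

section Realizes

variable {S : Type u} [TopologicalSpace S] [ChartedSpace ℂ S] [IsManifold 𝓘(ℂ) ω S]
  {𝒜 : Set S} {m : S → ℕ} {k : S → ℤ} {p : S → ℕ} {r : ℕ} {hw : OrbWeights 𝒜 m k p r}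
  {hk : ∀ x ∉ 𝒜, (1 : ℕ) = 1 ∧ k x = 0} {δ : S → Disc S} {Fan : S → Set Cone} {Y : Type u}
  [TopologicalSpace Y] [HolSpace Y] {f : Y → S × ℂ}

/-- A surface with the toric charts of the iterated blow-up is a toric model of the orbifold ruled
surface: its charts on the two sides of the `-1`-curve are those of the Hirzebruch-Jung strings. -/
lemma Realizes.exists_isToricModel (hδ : ∀ x, (δ x).toFun 0 = x) (hav : ∀ x, (δ x).Avoids 𝒜)
    (hFan : ∀ x ∈ 𝒜, Fan x = hjFanOf ((p x : ℚ) / m x))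
    (h : Realizes (RuledSurface.gen (m := fun _ : S => 1) (d := k) (r := r) 𝒜 hk fun _ => one_pos) 𝒜
      (fun x => tau (δ x) (k x) r 𝒜) f Fan) : ∃ φ R E, IsToricModel hw φ R E f := by
  set φ : S → OrbChart S m 0 := fun x => (δ x).orbAt (hav x) hw.off_zero hw.order_pos
  have hφ : ∀ x, (φ x).toFun 0 = x := fun x => by rw [Disc.orbAt_zero, hδ]
  have hR : ∀ x, ∃ R, x ∈ 𝒜 → IsOrbRef hw (φ x) R ∧ RefChange R (tau (δ x) (k x) r 𝒜) ∧
      RefChange (tau (δ x) (k x) r 𝒜) R := by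
    intro x
    by_cases hx : x ∈ 𝒜
    · obtain ⟨R, hR⟩ := exists_isOrbRef hw (φ x) (by rwa [hφ]) (δ := δ x) (by rw [hφ, hδ])
      rw [hφ] at hR
      exact ⟨R, fun _ => hR⟩
    · exact ⟨fun _ => (x, 0), fun h => absurd h hx⟩
  have hE : ∀ x b, ∃ e, x ∈ 𝒜 → IsHJExpansion e ((sideWeight (m x) (p x) b : ℕ) / (m x : ℕ)) := by
    intro x b
    by_cases hx : x ∈ 𝒜
    · obtain ⟨e, he⟩ := exists_isHJExpansion (hw.sideWeight_lt hx b)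
      exact ⟨e, fun _ => he⟩
    · exact ⟨[], fun h => absurd h hx⟩
  choose R hR using hR
  choose E hE using hE
  have href : ∀ x ∈ 𝒜, IsRef x ((φ x).radius ^ m ((φ x).toFun 0)) (R x) := fun x hx => by
    have h1 := (hR x hx).1.isRef
    rwa [hφ x] at h1 ⊢
  refine ⟨φ, R, E, h.inj, hφ, fun x hx => (hR x hx).1, fun x hx b => by rw [hφ]; exact hE x b hx,
    fun q hq => ?_, fun P hP => ?_, fun q hq => ?_, fun x hx b i hi y hy => ?_⟩
  · obtain ⟨P, hP⟩ := h.off_left q hq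
    rw [← hP.eq, RuledSurface.gen_fst] at hq
    obtain ⟨P', hP'⟩ := RuledSurface.exists_locMatch_gen (m' := m) (d' := 0)
      (h𝒜 := hk) (hpos := fun _ => one_pos) (h𝒜' := hw.off_zero) (hpos' := hw.order_pos) hδ hav _ hq
    exact ⟨P', hP.trans hP'⟩
  · obtain ⟨P', hP'⟩ := RuledSurface.exists_locMatch_gen (m' := fun _ : S => 1) (d' := k)
      (h𝒜 := hw.off_zero) (hpos := hw.order_pos) (h𝒜' := hk) (hpos' := fun _ => one_pos) hδ hav _ hP
    obtain ⟨q, hq⟩ := h.off_right P' (by rw [hP'.eq, RuledSurface.gen_fst]; exact hP)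
    exact ⟨q, hq.trans hP'.symm⟩
  · obtain ⟨c, hc, y, hy, hm⟩ := h.left q hq
    rw [hFan _ hq, mem_hjFanOf hw hq fun b => hE _ b hq] at hc
    obtain ⟨b, i, hi, rfl⟩ := hc
    obtain ⟨y', hy', hm'⟩ := (hR _ hq).2.2.exists_locMatch
      (RuledSurface.isRef_fibre (D := k) (r := r) hδ hav _ hq) (href _ hq) (hR _ hq).2.1
      (isCone_sideCone b (hE _ b hq).1 hi) hy
    exact ⟨b, i, hi, flip b y', by rwa [flip_flip], by rw [flip_flip]; exact hm.trans hm'⟩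
  · obtain ⟨y', hy', hm'⟩ := (hR x hx).2.1.exists_locMatch (href x hx)
      (RuledSurface.isRef_fibre (D := k) (r := r) hδ hav x hx) (hR x hx).2.2
      (isCone_sideCone b (hE x b hx).1 hi) hy
    obtain ⟨q, hq⟩ := h.right x hx _ (by
      rw [hFan x hx, mem_hjFanOf hw hx fun b => hE x b hx]
      exact ⟨b, i, hi, rfl⟩) y' hy'
    exact ⟨q, hq.trans hm'.symm⟩

/-- A toric model resolves the orbifold ruled surface by the map which takes each point to the limit
of the generic points near it. -/
lemma IsToricModel.exists_isHJResolution [T2Space Y] [T2Space (RuledSurface m 0 r)] [Nonempty S]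
    (h𝒜 : 𝒜.Finite) {φ : S → OrbChart S m 0} {R : S → ℂ × ℂ → S × ℂ} {E : S → Bool → List ℤ}
    (h : IsToricModel hw φ R E f) : ∃ π : Y → RuledSurface m 0 r, IsHJResolution π := by
  choose π hπ using h.exists_isGenLimit
  refine ⟨π, h.continuous hπ, h.isBiholOver hπ h𝒜, fun P hP => ?_⟩
  obtain ⟨hx, hb⟩ := RuledSurface.exists_eq_affineChart_zero hw hP
  obtain ⟨b, hb⟩ := hb (φ _) (h.center _)
  exact ⟨φ _, b, _, _, _, (φ _).radius_pos, le_rfl, hb.symm,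
    isQuotientChart_affineChart hw (h.center_mem hx), h.isHJModel hπ hx b⟩

/-- A surface with prescribed toric charts is a complex manifold. -/
lemma Realizes.exists_isHolChart (hδ : ∀ x, (δ x).toFun 0 = x) (hav : ∀ x, (δ x).Avoids 𝒜)
    (h : Realizes (RuledSurface.gen (m := fun _ : S => 1) (d := k) (r := r) 𝒜 hk fun _ => one_pos) 𝒜
      (fun x => tau (δ x) (k x) r 𝒜) f Fan) (q : Y) :
    ∃ c : OpenPartialHomeomorph Y (ℂ × ℂ), IsHolChart c ∧ q ∈ c.source := by
  have key : ∀ (μ : ℂ × ℂ → S × ℂ) (y : ℂ × ℂ), LocMatch f μ q y →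
      ∃ c : OpenPartialHomeomorph Y (ℂ × ℂ), IsHolChart c ∧ q ∈ c.source := by
    rintro μ y ⟨c, hc, hq, -⟩
    exact ⟨c, isBihol_iff_isHolChart.1 hc, hq⟩
  by_cases hq : (f q).1 ∈ 𝒜
  · obtain ⟨c, -, y, -, hm⟩ := h.left q hq
    exact key _ _ hm
  · obtain ⟨P, hP⟩ := h.off_left q hq
    obtain ⟨b, t, hm⟩ := RuledSurface.exists_locMatch_affTau (h𝒜 := hk) (hpos := fun _ => one_pos)
      hδ hav P rfl
    exact key _ _ (hP.trans hm)

end Realizes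

/-! ### Complex manifolds -/

section Manifold

/-- A space with holomorphic functions which is covered by holomorphic charts is a manifold. -/
lemma exists_chartedSpace {X : Type u} [TopologicalSpace X] [inst : HolSpace X]
    (h : ∀ x : X, ∃ c : OpenPartialHomeomorph X (ℂ × ℂ), IsHolChart c ∧ x ∈ c.source) :
    ∃ (_ : ChartedSpace (ℂ × ℂ) X) (_ : IsManifold 𝓘(ℂ, ℂ × ℂ) ω X),
      instHolSpaceManifold X = inst := by
  choose c hc hx using h
  let C : ChartedSpace (ℂ × ℂ) X :=
    { atlas := {e | IsHolChart e}
      chartAt := c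
      mem_chart_source := hx
      chart_mem_atlas := hc }
  have hM : IsManifold 𝓘(ℂ, ℂ × ℂ) ω X := by
    refine isManifold_of_contDiffOn _ _ _ fun e e' he he' => ?_
    have h1 : IsBihol (e.symm.trans e') :=
      (isBihol_iff_isHolChart.2 he).symm.trans (isBihol_iff_isHolChart.2 he')
    simp only [modelWithCornersSelf_coe, modelWithCornersSelf_coe_symm, Function.id_comp,
      Function.comp_id, Set.preimage_id, Set.range_id, Set.inter_univ]
    exact AnalyticOnNhd.contDiffOn (fun y hy => h1.analyticAt hy)
      (e.symm.trans e').open_source.uniqueDiffOn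
  refine ⟨C, hM, ?_⟩
  have key : ∀ (f : X → ℂ) (x : X), (instHolSpaceManifold X).HolAt f x ↔ inst.HolAt f x := by
    intro f x
    have h1 := hc x x (hx x) f
    refine Iff.trans ?_ h1.symm
    rw [← holAt_iff_analyticAt]
    change ContMDiffAt 𝓘(ℂ, ℂ × ℂ) 𝓘(ℂ) ω f x ↔ ContMDiffAt 𝓘(ℂ, ℂ × ℂ) 𝓘(ℂ) ω (f ∘ (c x).symm) _
    rw [contMDiffAt_iff_source_of_mem_source (x := x) (mem_chart_source (ℂ × ℂ) x)]
    simp only [modelWithCornersSelf_coe, Set.range_id, contMDiffWithinAt_univ]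
    rfl
  cases inst
  unfold instHolSpaceManifold
  congr 1
  funext f x
  exact propext (key f x)

variable {X Y : Type u} [TopologicalSpace X] [ChartedSpace (ℂ × ℂ) X] [TopologicalSpace Y]
  [ChartedSpace (ℂ × ℂ) Y]

lemma IsBihol.contMDiffAt [IsManifold 𝓘(ℂ, ℂ × ℂ) ω Y] {e : OpenPartialHomeomorph X Y}
    (he : IsBihol e) {x : X} (hx : x ∈ e.source) :
    ContMDiffAt 𝓘(ℂ, ℂ × ℂ) 𝓘(ℂ, ℂ × ℂ) ω e x := by
  rw [contMDiffAt_iff_target]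
  refine ⟨e.continuousAt hx, ?_⟩
  have h1 : ∀ L : ℂ × ℂ →L[ℂ] ℂ, ContMDiffAt 𝓘(ℂ, ℂ × ℂ) 𝓘(ℂ) ω
      ((L ∘ extChartAt 𝓘(ℂ, ℂ × ℂ) (e x)) ∘ e) x := fun L =>
    (he x hx _).1 (L.contMDiff.contMDiffAt.comp (e x) contMDiffAt_extChartAt)
  exact (h1 (ContinuousLinearMap.fst ℂ ℂ ℂ)).prodMk_space (h1 (ContinuousLinearMap.snd ℂ ℂ ℂ))

/-- Surfaces with the same toric charts are biholomorphic. -/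
lemma Realizes.nonempty_diffeomorph {S M : Type*} [TopologicalSpace M] [HolSpace M] {g : M → S × ℂ}
    {𝒜 : Set S} {R : S → ℂ × ℂ → S × ℂ} {f : X → S × ℂ} {f' : Y → S × ℂ} {Fan : S → Set Cone}
    [T2Space X] [T2Space Y] [IsManifold 𝓘(ℂ, ℂ × ℂ) ω X] [IsManifold 𝓘(ℂ, ℂ × ℂ) ω Y]
    (h : Realizes g 𝒜 R f Fan) (h' : Realizes g 𝒜 R f' Fan) :
    Nonempty (Diffeomorph 𝓘(ℂ, ℂ × ℂ) 𝓘(ℂ, ℂ × ℂ) X Y ω) := by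
  rcases isEmpty_or_nonempty X with hX | ⟨⟨x₀⟩⟩
  · have hY : IsEmpty Y := ⟨fun y => hX.elim (h'.exists_locMatch h y).choose⟩
    exact ⟨⟨Equiv.equivOfIsEmpty X Y, fun x => hX.elim x, fun y => hY.elim y⟩⟩
  obtain ⟨e, he, hes, hem⟩ := exists_openPartialHomeomorph_of_locMatch h.inj h'.inj isOpen_univ
    ⟨x₀, trivial⟩ fun x _ => h.exists_locMatch h' x
  have hx : ∀ x, x ∈ e.source := fun x => by rw [hes]; trivial
  have hy : ∀ y, y ∈ e.target := fun y => by
    obtain ⟨x, hm⟩ := h'.exists_locMatch h y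
    rw [← (hem x trivial).unique h'.inj hm.symm]
    exact e.map_source (hx x)
  exact ⟨⟨⟨e, e.symm, fun x => e.left_inv (hx x), fun y => e.right_inv (hy y)⟩,
    fun x => he.contMDiffAt (hx x), fun y => he.symm.contMDiffAt (hy y)⟩⟩

end Manifold

/-! ### Marked points -/

section Marked

variable {S : Type u} {s : ℕ} {A : Fin s → S} {q p n : Fin s → ℕ} {r : ℕ}

lemma orbOrder_apply (hA : Function.Injective A) (q : Fin s → ℕ) (j : Fin s) :
    orbOrder A q (A j) = q j := by
  classical
  simp [orbOrder, hA.eq_iff]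

lemma divisorOf_apply (hA : Function.Injective A) (k : Fin s → ℤ) (j : Fin s) :
    divisorOf A k (A j) = k j := by
  classical
  simp [divisorOf, hA.eq_iff]

lemma orbOrder_of_notMem (q : Fin s → ℕ) {x : S} (hx : x ∉ Set.range A) : orbOrder A q x = 1 := by
  classical
  exact Finset.prod_eq_one fun j _ => if_neg fun h => hx ⟨j, h⟩

lemma divisorOf_of_notMem (k : Fin s → ℤ) {x : S} (hx : x ∉ Set.range A) : divisorOf A k x = 0 := by
  classical
  exact Finset.sum_eq_zero fun j _ => if_neg fun h => hx ⟨j, h⟩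

lemma orbWeights_of_marked (hA : Function.Injective A) (hqr : ∀ j, (q j).Coprime r)
    (hp : ∀ j, 0 < p j ∧ p j < q j) (hn : ∀ j, n j * q j = p j + r) :
    OrbWeights (Set.range A) (orbOrder A q) (divisorOf A fun j => (r : ℤ) - (n j : ℤ))
      (Function.extend A p 0) r := by
  refine ⟨fun x hx => orbOrder_of_notMem q hx, ?_, ?_, ?_, ?_⟩ <;> rintro _ ⟨j, rfl⟩
  · rw [hA.extend_apply]
    exact (hp j).1
  · rw [hA.extend_apply, orbOrder_apply hA]
    exact (hp j).2
  · rw [orbOrder_apply hA]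
    exact hqr j
  · rw [hA.extend_apply, orbOrder_apply hA, divisorOf_apply hA]
    have h1 : (n j : ℤ) * q j = p j + r := by exact_mod_cast hn j
    linear_combination -h1

end Marked

/-! ### Resolutions and iterated blow-ups -/

/-- The existence of the two surfaces and the biholomorphism, in terms of the orders `m`, the divisor
`k` and the numerators `p` of the weights as functions on `S`. -/
theorem resolution_biholomorphic_blowup {S : Type u} [TopologicalSpace S] [T2Space S] [Nonempty S]
    [ChartedSpace ℂ S] [IsManifold 𝓘(ℂ) ω S] {s r : ℕ} {A : Fin s → S} (hA : Function.Injective A)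
    {m : S → ℕ} {k : S → ℤ} {p : S → ℕ} (hw : OrbWeights (Set.range A) m k p r)
    (hk0 : ∀ x ∉ Set.range A, k x = 0)
    (P : ParabolicStructure (RuledSurface.proj (m := fun _ : S => 1) (d := k) r) s) (hPA : P.A = A)
    (hPB : ∀ j, P.B j ∈ RuledSurface.infinitySection r)
    (hPw : ∀ j, P.weight j = (p (A j) : ℚ) / (m (A j) : ℚ)) :
    (∃ (X : Type u) (_ : TopologicalSpace X) (_ : T2Space X) (_ : ChartedSpace (ℂ × ℂ) X)
      (_ : IsManifold 𝓘(ℂ, ℂ × ℂ) ω X) (π : X → RuledSurface m 0 r),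
      IsHJResolution π) ∧
    (∃ (Y : Type u) (_ : TopologicalSpace Y) (_ : T2Space Y) (_ : ChartedSpace (ℂ × ℂ) Y)
      (_ : IsManifold 𝓘(ℂ, ℂ × ℂ) ω Y)
      (β : Y → RuledSurface (fun _ : S => 1) k r),
      IsParabolicBlowup P β) ∧
    ∀ (X : Type u) [TopologicalSpace X] [T2Space X] [ChartedSpace (ℂ × ℂ) X]
      [IsManifold 𝓘(ℂ, ℂ × ℂ) ω X] (π : X → RuledSurface m 0 r)
      (Y : Type u) [TopologicalSpace Y] [T2Space Y] [ChartedSpace (ℂ × ℂ) Y]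
      [IsManifold 𝓘(ℂ, ℂ × ℂ) ω Y]
      (β : Y → RuledSurface (fun _ : S => 1) k r),
      IsHJResolution π → IsParabolicBlowup P β →
      Nonempty (Diffeomorph 𝓘(ℂ, ℂ × ℂ) 𝓘(ℂ, ℂ × ℂ) X Y ω) := by
  have h𝒜f : (Set.range A).Finite := Set.finite_range A
  have hk : ∀ x ∉ Set.range A, (1 : ℕ) = 1 ∧ k x = 0 := fun x hx => ⟨rfl, hk0 x hx⟩
  choose δ hδ hav using fun x : S => exists_disc x h𝒜f
  have hM : T2Space (RuledSurface (fun _ : S => 1) k r) := RuledSurface.t2Space (fun _ => one_pos)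
    fun x => ⟨(δ x).orbAt (hav x) hk fun _ => one_pos, by rw [Disc.orbAt_zero, hδ]⟩
  have hMorb : T2Space (RuledSurface m 0 r) := RuledSurface.t2Space hw.order_pos
    fun x => ⟨(δ x).orbAt (hav x) hw.off_zero hw.order_pos, by rw [Disc.orbAt_zero, hδ]⟩
  have hself := RuledSurface.locMatch_gen_self (r := r) (h𝒜 := hk) hδ hav
  have hreal := RuledSurface.realizes_gen (r := r) (h𝒜 := hk) hδ hav
  have hR := RuledSurface.isRef_fibre (D := k) (r := r) hδ hav
  have hAm : ∀ j, A j ∈ Set.range A := fun j => ⟨j, rfl⟩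
  have hB : ∀ j, LocMatch (RuledSurface.gen (r := r) (Set.range A) hk fun _ => one_pos)
      (toric (tau (δ (A j)) (k (A j)) r (Set.range A)) ((1, 0), (0, -1))) (P.B j) 0 := by
    intro j
    have h1 := RuledSurface.locMatch_infinitySection (h𝒜 := hk) hδ hav (hPB j)
    rwa [P.pr_B j, hPA] at h1
  have hFan : ∀ x ∈ Set.range A, blowupFan A P.weight (List.finRange s) x =
      hjFanOf ((p x : ℚ) / m x) := by
    rintro _ ⟨j, rfl⟩
    rw [← hPw j]
    ext c
    constructor
    · rintro (⟨j', -, hj', hc⟩ | ⟨hc, -⟩)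
      · rwa [← hA hj']
      · exact absurd rfl (hc j (List.mem_finRange j))
    · exact fun hc => Or.inl ⟨j, List.mem_finRange j, rfl, hc⟩
  have hlist : (List.ofFn fun j => (RuledSurface.proj (m := fun _ : S => 1) (d := k) r ⁻¹' {P.A j},
      P.B j, P.weight j)) = (List.finRange s).map fun j => ({P' | (RuledSurface.gen (r := r)
        (Set.range A) hk (fun _ => one_pos) P').1 = A j}, P.B j, P.weight j) := by
    rw [List.ofFn_eq_map]
    refine List.map_congr_left fun j _ => ?_
    congr 1
    ext P'
    rw [Set.mem_ofPred_eq, RuledSurface.gen_fst, hPA]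
    rfl
  have hblow : ∀ {Y : Type u} [TopologicalSpace Y] [HolSpace Y]
      {β : Y → RuledSurface (fun _ : S => 1) k r}, IsParabolicBlowup P β →
      IsBlowupModel (RuledSurface.gen (r := r) (Set.range A) hk fun _ => one_pos) (Set.range A)
        (fun x => tau (δ x) (k x) r (Set.range A)) A P.weight (List.finRange s) β := by
    intro Y _ _ β hβ
    rw [IsParabolicBlowup, hlist] at hβ
    exact hβ.isBlowupModel hreal hself hR hAm hA hB _ (List.nodup_finRange s)
  obtain ⟨Y, iT, iH, β, hβ⟩ := exists_isIteratedBlowup hreal hself hR hAm hA hB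
    (fun j => ⟨hw.pos _ (hAm j), hw.lt _ (hAm j)⟩) (fun j => hw.coprime_weight (hAm j)) hPw _
    (List.nodup_finRange s)
  rw [← hlist] at hβ
  have hY := hblow hβ
  have hT2 := hY.t2
  obtain ⟨iC, iM, rfl⟩ := exists_chartedSpace (hY.realizes.exists_isHolChart hδ hav)
  refine ⟨?_, ⟨Y, iT, hT2, iC, iM, β, hβ⟩, ?_⟩
  · obtain ⟨φ, R, E, h⟩ := hY.realizes.exists_isToricModel (hw := hw) hδ hav hFan
    obtain ⟨π, hπ⟩ := h.exists_isHJResolution h𝒜f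
    exact ⟨Y, iT, hT2, iC, iM, π, hπ⟩
  · intro X _ _ _ _ π Z _ _ _ _ β' hπ hβ'
    exact (hπ.realizes (hw := hw) hk hδ hav hFan).nonempty_diffeomorph (hblow hβ').realizes

end OrbiRuled

end

theorem mainTheorem6 {S : Type u} [TopologicalSpace S] [T2Space S] [CompactSpace S]
    [ConnectedSpace S] [ChartedSpace ℂ S] [IsManifold 𝓘(ℂ) ω S]
    (r : ℕ) (hr : 0 < r) (s : ℕ) (A : Fin s → S) (hA : Function.Injective A)
    (q p n : Fin s → ℕ) (hqr : ∀ j, (q j).Coprime r)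
    (hp : ∀ j, 0 < p j ∧ p j < q j) (hpr : ∀ j, (p j : ℤ) ≡ -(r : ℤ) [ZMOD (q j : ℤ)])
    (hn : ∀ j, n j * q j = p j + r)
    (P : ParabolicStructure
      (RuledSurface.proj (m := fun _ : S => 1)
        (d := divisorOf A fun j => (r : ℤ) - (n j : ℤ)) r) s)
    (hPA : P.A = A) (hPB : ∀ j, P.B j ∈ RuledSurface.infinitySection r)
    (hPw : ∀ j, P.weight j = (p j : ℚ) / (q j : ℚ)) :
    (∃ (X : Type u) (_ : TopologicalSpace X) (_ : T2Space X) (_ : ChartedSpace (ℂ × ℂ) X)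
      (_ : IsManifold 𝓘(ℂ, ℂ × ℂ) ω X) (π : X → RuledSurface (orbOrder A q) 0 r),
      IsHJResolution π) ∧
    (∃ (Y : Type u) (_ : TopologicalSpace Y) (_ : T2Space Y) (_ : ChartedSpace (ℂ × ℂ) Y)
      (_ : IsManifold 𝓘(ℂ, ℂ × ℂ) ω Y)
      (β : Y → RuledSurface (fun _ : S => 1) (divisorOf A fun j => (r : ℤ) - (n j : ℤ)) r),
      IsParabolicBlowup P β) ∧
    ∀ (X : Type u) [TopologicalSpace X] [T2Space X] [ChartedSpace (ℂ × ℂ) X]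
      [IsManifold 𝓘(ℂ, ℂ × ℂ) ω X] (π : X → RuledSurface (orbOrder A q) 0 r)
      (Y : Type u) [TopologicalSpace Y] [T2Space Y] [ChartedSpace (ℂ × ℂ) Y]
      [IsManifold 𝓘(ℂ, ℂ × ℂ) ω Y]
      (β : Y → RuledSurface (fun _ : S => 1) (divisorOf A fun j => (r : ℤ) - (n j : ℤ)) r),
      IsHJResolution π → IsParabolicBlowup P β →
      Nonempty (Diffeomorph 𝓘(ℂ, ℂ × ℂ) 𝓘(ℂ, ℂ × ℂ) X Y ω) := by
  refine resolution_biholomorphic_blowup hA (orbWeights_of_marked hA hqr hp hn)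
    (fun x hx => divisorOf_of_notMem _ hx) P hPA hPB fun j => ?_
  rw [hPw, hA.extend_apply, orbOrder_apply hA]
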